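/- Let $k$ be an algebraically closed field of characteristic $p\ge 0$, let $m\ge 1$ be invertible in $k$, let $\xi\in k$ be a primitive $m$-th root of unity, let $n\ge 0$, and assume that $p=0$ or $p>n$. Let $\delta=(\delta_r)_{r\in\mathbb Z/m\mathbb Z}\in k^m$. **Notation.** Let $B_n^m=B_n^m(\delta)$ be the cyclotomic Brauer algebra. Its basis consists of the loop-free Brauer diagrams on $n+n$ nodes whose strands are oriented and labelled by $\mathbb Z/m\mathbb Z$, where reversing a strand negates its label. Diagrams are multiplied by concatenation, adding labels, and a closed loop that has label $r$ when it is oriented downwards at its leftmost node is replaced by $\delta_r$ (this product is associative if $\delta_r=\delta_{-r}$ for all $r$ or if $n\le 1$; the statement below holds for every $\delta$). Diagrams without arcs span the group algebra $H_n^m=k((\mathbb Z/m\mathbb Z)\wr\Sigma_n)$ inside $B_n^m$; let $t_x$ be the generator of the $x$-th copy of $\mathbb Z/m\mathbb Z$. An $m$-partition of $N$ is a tuple $\lambda=(\lambda^i)_{i\in\mathbb Z/m\mathbb Z}$ of partitions with $\sum_i|\lambda^i|=N$; put $|\lambda|=(|\lambda^i|)_i$. Write $S(\nu)^{(i)}$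 for the Specht module $S(\nu)$ of $k\Sigma_{|\nu|}$ on which every $t_x$ acts as $\xi^i$. The Specht module of $H_N^m$ is $\mathbf S(\lambda)=\bigl(\bigotimes_i S(\lambda^i)^{(i)}\bigr)\!\uparrow_{H^m_{|\lambda|}}^{H^m_N}$, where $H^m_{|\lambda|}=\bigotimes_iH^m_{|\lambda^i|}$. For an $m$-partition $\lambda$ of $n-2l$ (where $0\le 2l\le n$), the standard module is $\Delta_n(\lambda)=V(m,n,l)\otimes\mathbf S(\lambda)$. Here $V(m,n,l)$ has as basis the $(m,n,l)$-dangles: the choices of $l$ disjoint arcs on $n$ nodes, each oriented and labelled by $\mathbb Z/m\mathbb Z$ (up to reversal as before), the other $n-2l$ nodes being free. A diagram $X$ acts by $X(d\otimes x)=(Xd)\otimes\sigma x$, where $X$ is placed above $d$ and concatenated, closed loops are replaced by scalars as above, $\sigma\in(\mathbb Z/m\mathbb Z)\wr\Sigma_{n-2l}$ is given by the strands that start at the free nodes of $d$, and the result is $0$ if $Xd$ has more than $l$ arcs. For $m$-compositions $\omega,\omega'$ (tuples of non-negative integers indexed by $\mathbb Z/m\mathbb Z$), $\omega\preceq\omega'$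 means that $\omega_r\le\omega'_r$ for all $r$, that $\omega_r-\omega'_r=\omega_{-r}-\omega'_{-r}$ if $r\ne -r$, and that $\omega_r-\omega_r'$ is even if $r=-r$ (that is, $r=0$ or $r=m/2$). In this case put $a_r=\omega'_r-\omega_r$ if $r\neq -r$ and $a_r=(\omega'_r-\omega_r)/2$ if $r=-r$, and write $\omega\preceq_{\sum a_r\xi^r}\omega'$. Write $\lambda\le\mu$ if $\lambda^i\subseteq\mu^i$ for all $i$ and $|\lambda|\preceq|\mu|$. Finally, $c^{\nu}_{\lambda,\mu}$ denotes the Littlewood-Richardson coefficient, that is, in characteristic zero, the multiplicity of $S(\nu)$ in $(S(\lambda)\otimes S(\mu))\!\uparrow_{\Sigma_{|\lambda|}\times\Sigma_{|\mu|}}^{\Sigma_{|\lambda|+|\mu|}}$ (zero if $|\nu|\ne|\lambda|+|\mu|$), and a partition is even if all its parts are even. **Theorem.** Let $0\le 2l\le n$, let $\lambda$ be an $m$-partition of $n-2l$, and let $\mu$ be an $m$-partition of $n$. Let $[\Delta_n(\lambda)\!\downarrow_{H_n^m}:\mathbf S(\mu)]$ be the composition multiplicity of $\mathbf S(\mu)$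 in the restriction of $\Delta_n(\lambda)$ to $H_n^m$. If $\lambda\not\le\mu$, then $$[\Delta_n(\lambda)\!\downarrow_{H_n^m}:\mathbf S(\mu)]=0 .$$ Otherwise $|\lambda|\preceq_{\sum a_r\xi^r}|\mu|$ with $a_r$ as above, and $$[\Delta_n(\lambda)\!\downarrow_{H_n^m}:\mathbf S(\mu)]=\prod_{0<i<m/2}\Bigl(\sum_{\tau\vdash a_i}c^{\mu^i}_{\lambda^i,\tau}\,c^{\mu^{m-i}}_{\lambda^{m-i},\tau}\Bigr)\ \prod_{j=0,\,m/2}\Bigl(\sum_{\substack{\eta\vdash 2a_j\\ \eta\ \text{even}}}c^{\mu^j}_{\lambda^j,\eta}\Bigr),$$ where $j=m/2$ occurs only if $m$ is even. -/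

import Mathlib

open scoped TensorProduct

namespace CyclotomicBrauer

section Walk

variable {Z : Type*} (F G : Z → Z)

/-- One step of a walk along glued strands: jump across the glue `G`, then traverse a strand `F`. -/
def step (z : Z) : Z := F (G z)

variable {F G}

theorem step_inv (hF : ∀ z, F (F z) = z) (hG : ∀ z, G (G z) = z) (i j : ℕ) (z : Z)
    (hw : G ((step F G)^[j] z) = (step F G)^[j] z) (hij : i ≤ j) :
    (step F G)^[i] ((step F G)^[j] z) = G ((step F G)^[j - i] z) := by
  induction i with
  | zero => simp [hw]
  | succ i ih =>
    rw [Function.iterate_succ_apply', ih (by omega)]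
    have h1 : j - i = (j - (i + 1)) + 1 := by omega
    rw [h1, Function.iterate_succ_apply']
    simp [step, hF, hG]

theorem exists_exit [Finite Z] (hF : ∀ z, F (F z) = z) (hG : ∀ z, G (G z) = z)
    (z : Z) (hz : G z = z) :
    ∃ j, 0 < j ∧ G ((step F G)^[j] z) = (step F G)^[j] z := by
  have hinj : Function.Injective (step F G) := fun a b h => by
    have := congrArg F h
    simp only [step, hF] at this
    simpa [hG] using congrArg G this
  obtain ⟨j, hj, h⟩ := (Function.Injective.mem_periodicPts hinj z)
  have h' : (step F G)^[j] z = z := h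
  exact ⟨j, hj, by rw [h', hz]⟩

/-- The endpoint of a walk that exits is not its starting point. -/
theorem exit_ne (hF : ∀ z, F (F z) = z) (hG : ∀ z, G (G z) = z) (hne : ∀ z, F z ≠ z)
    (z : Z) (hz : G z = z) (j : ℕ) (hj : 0 < j)
    (hmin : ∀ i, 0 < i → i < j → G ((step F G)^[i] z) ≠ (step F G)^[i] z) :
    (step F G)^[j] z ≠ z := by
  intro h
  have hw : G ((step F G)^[j] z) = (step F G)^[j] z := by rw [h, hz]
  rcases Nat.even_or_odd' j with ⟨i, rfl | rfl⟩
  · have := step_inv hF hG i (2 * i) z hw (by omega)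
    rw [h, show 2 * i - i = i by omega] at this
    exact hmin i (by omega) (by omega) this.symm
  · have := step_inv hF hG (i + 1) (2 * i + 1) z hw (by omega)
    rw [h, show 2 * i + 1 - (i + 1) = i by omega, Function.iterate_succ_apply'] at this
    exact hne _ this

end Walk

/-- A labelled perfect matching of the nodes `X`: every node `x` is joined by a strand to `inv x`,
and `lab x` is the label of this strand when it is oriented from `x` to `inv x`. Reversing the
orientation negates the label. -/
@[ext] structure LMatching (m : ℕ) (X : Type) where
  inv : X → X
  inv_inv : ∀ x, inv (inv x) = x
  inv_ne : ∀ x, inv x ≠ x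
  lab : X → ZMod m
  lab_inv : ∀ x, lab (inv x) = - lab x

section Concatenation

variable {m : ℕ} {A C S : Type}

/-- Ends of strands when a diagram with nodes `A` (north), `C` (south) is put above a diagram with
nodes `C` (north), `S` (south). -/
abbrev Ends (A C S : Type) : Type := (A ⊕ C) ⊕ (C ⊕ S)

/-- The identification of the central nodes; outer nodes are fixed. -/
def glue : Ends A C S → Ends A C S
  | .inl (.inl a) => .inl (.inl a)
  | .inl (.inr c) => .inr (.inl c)
  | .inr (.inl c) => .inl (.inr c)
  | .inr (.inr s) => .inr (.inr s)

theorem glue_glue (z : Ends A C S) : glue (glue z) = z := by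
  rcases z with (a | c) | (c | s) <;> rfl

/-- The outer nodes. -/
def outer : A ⊕ S → Ends A C S
  | .inl a => .inl (.inl a)
  | .inr s => .inr (.inr s)

theorem glue_outer (o : A ⊕ S) : glue (outer (C := C) o) = outer o := by
  rcases o with a | s <;> rfl

/-- The outer node at `z`, for `z` not a central node. -/
def toOuter : (z : Ends A C S) → glue z = z → A ⊕ S
  | .inl (.inl a), _ => .inl a
  | .inl (.inr _), h => nomatch h
  | .inr (.inl _), h => nomatch h
  | .inr (.inr s), _ => .inr s

theorem outer_toOuter (z : Ends A C S) (h : glue z = z) : outer (toOuter z h) = z := by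
  rcases z with (a | c) | (c | s)
  · rfl
  · exact nomatch h
  · exact nomatch h
  · rfl

theorem outer_injective : Function.Injective (outer : A ⊕ S → Ends A C S) := by
  rintro (a | s) (b | t) h <;> simp_all [outer]

variable (x : LMatching m (A ⊕ C)) (y : LMatching m (C ⊕ S))

/-- Traverse a strand of `x` or of `y`. -/
def strand : Ends A C S → Ends A C S := Sum.map x.inv y.inv

/-- The label of the strand starting at a given end. -/
def strandLab : Ends A C S → ZMod m := Sum.elim x.lab y.lab

theorem strand_strand (z : Ends A C S) : strand x y (strand x y z) = z := by
  rcases z with z | z <;> simp [strand, x.inv_inv, y.inv_inv]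

theorem strand_ne (z : Ends A C S) : strand x y z ≠ z := by
  rcases z with z | z <;> simp [strand, x.inv_ne, y.inv_ne]

theorem strandLab_strand (z : Ends A C S) :
    strandLab x y (strand x y z) = - strandLab x y z := by
  rcases z with z | z <;> simp [strand, strandLab, x.lab_inv, y.lab_inv]

/-- The position after `j` strands of the walk that starts at `z` by jumping across the glue. -/
def walk (z : Ends A C S) (j : ℕ) : Ends A C S := (step (strand x y) glue)^[j] z

/-- The sum of the labels of the first `j` strands of this walk, oriented along the walk. -/
def walkLab (z : Ends A C S) (j : ℕ) : ZMod m :=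
  ∑ i ∈ Finset.range j, strandLab x y (glue (walk x y z i))

variable [Finite A] [Finite C] [Finite S]

open Classical in
/-- The number of strands of `x` and `y` that make up the strand of the concatenation which
starts at the outer node `o`. -/
noncomputable def exitTime (o : A ⊕ S) : ℕ :=
  Nat.find (exists_exit (strand_strand x y) glue_glue (outer o) (glue_outer o))

theorem exitTime_pos (o : A ⊕ S) : 0 < exitTime x y o := by
  classical
  exact (Nat.find_spec (exists_exit (strand_strand x y) glue_glue (outer o) (glue_outer o))).1

theorem glue_exit (o : A ⊕ S) :
    glue (walk x y (outer o) (exitTime x y o)) = walk x y (outer o) (exitTime x y o) := by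
  classical
  exact (Nat.find_spec (exists_exit (strand_strand x y) glue_glue (outer o) (glue_outer o))).2

theorem exitTime_eq (o : A ⊕ S) (j : ℕ) (hj : 0 < j)
    (hex : glue (walk x y (outer o) j) = walk x y (outer o) j)
    (hmin : ∀ i, 0 < i → i < j → glue (walk x y (outer o) i) ≠ walk x y (outer o) i) :
    exitTime x y o = j := by
  classical
  refine (Nat.find_eq_iff _).2 ⟨⟨hj, hex⟩, fun i hi h => hmin i h.1 hi h.2⟩

theorem exitTime_min (o : A ⊕ S) (i : ℕ) (h0 : 0 < i) (hi : i < exitTime x y o) :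
    glue (walk x y (outer o) i) ≠ walk x y (outer o) i := by
  classical
  exact fun h => Nat.find_min
    (exists_exit (strand_strand x y) glue_glue (outer o) (glue_outer o)) hi ⟨h0, h⟩

/-- The other endpoint of the strand of the concatenation starting at `o`. -/
noncomputable def exit (o : A ⊕ S) : A ⊕ S :=
  toOuter (walk x y (outer o) (exitTime x y o)) (glue_exit x y o)

theorem outer_exit (o : A ⊕ S) :
    outer (exit x y o) = walk x y (outer o) (exitTime x y o) := outer_toOuter _ _

theorem walk_back (o : A ⊕ S) (i : ℕ) (hi : i ≤ exitTime x y o) :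
    walk x y (outer (exit x y o)) i = glue (walk x y (outer o) (exitTime x y o - i)) := by
  rw [outer_exit]
  exact step_inv (strand_strand x y) glue_glue i _ _ (glue_exit x y o) hi

theorem exitTime_exit (o : A ⊕ S) : exitTime x y (exit x y o) = exitTime x y o := by
  refine exitTime_eq x y _ _ (exitTime_pos x y o) ?_ ?_
  · rw [walk_back x y o _ le_rfl, glue_glue, Nat.sub_self]
    exact (glue_outer o).symm
  · intro i h0 hi h
    rw [walk_back x y o i hi.le, glue_glue] at h
    exact exitTime_min x y o _ (by omega) (by omega) h.symm

/-- The concatenation of `x` above `y`, with the closed loops removed. -/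
noncomputable def concat : LMatching m (A ⊕ S) where
  inv := exit x y
  inv_inv o := by
    apply outer_injective (C := C)
    rw [outer_exit, exitTime_exit, walk_back x y o _ le_rfl, Nat.sub_self]
    exact glue_outer o
  inv_ne o h := by
    have h' := outer_exit x y o
    rw [h] at h'
    exact exit_ne (strand_strand x y) glue_glue (strand_ne x y) (outer o) (glue_outer o)
      (exitTime x y o) (exitTime_pos x y o) (exitTime_min x y o) h'.symm
  lab o := walkLab x y (outer o) (exitTime x y o)
  lab_inv o := by
    rw [exitTime_exit, walkLab, walkLab, ← Finset.sum_neg_distrib, ← Finset.sum_range_reflect]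
    refine Finset.sum_congr rfl fun i hi => ?_
    have hi' : i < exitTime x y o := Finset.mem_range.1 hi
    rw [walk_back x y o _ (by omega), glue_glue,
      show exitTime x y o - (exitTime x y o - 1 - i) = i + 1 by omega, ← strandLab_strand]
    simp only [walk, Function.iterate_succ_apply', step]

theorem concat_eq_of_walk (z : LMatching m (A ⊕ S))
    (h : ∀ o, ∃ j, 0 < j ∧ walk x y (outer o) j = outer (z.inv o) ∧
      walkLab x y (outer o) j = z.lab o ∧
      ∀ i, 0 < i → i < j → glue (walk x y (outer o) i) ≠ walk x y (outer o) i) :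
    concat x y = z := by
  have ht : ∀ o, ∃ j, exitTime x y o = j ∧ walk x y (outer o) j = outer (z.inv o) ∧
      walkLab x y (outer o) j = z.lab o := by
    intro o
    obtain ⟨j, hj, hw, hl, hmin⟩ := h o
    exact ⟨j, exitTime_eq x y o j hj (by rw [hw, glue_outer]) hmin, hw, hl⟩
  ext o
  · obtain ⟨j, rfl, hw, -⟩ := ht o
    apply outer_injective (C := C)
    exact (outer_exit x y o).trans hw
  · obtain ⟨j, rfl, -, hl⟩ := ht o
    exact hl

end Concatenation

section Loops

variable {m : ℕ} {k : Type*} [CommRing k] {A S : Type} {c : ℕ}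

/-- The central node `i` lies on a closed loop and is the leftmost central node of that loop.
The walk starting at `.inl (.inr i)` first passes through the node `i` downwards. -/
def IsLoopStart (x : LMatching m (A ⊕ Fin c)) (y : LMatching m (Fin c ⊕ S)) (i : Fin c) : Prop :=
  ∀ j, ∃ i', i ≤ i' ∧ (walk x y (.inl (.inr i)) j = .inl (.inr i') ∨
    walk x y (.inl (.inr i)) j = .inr (.inl i'))

open Classical in
/-- The scalar by which the removal of the closed loops multiplies: a factor `δ r` for every closed
loop which has label `r` when it passes downwards through its leftmost central node. -/
noncomputable def loopScalar (δ : ZMod m → k)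
    (x : LMatching m (A ⊕ Fin c)) (y : LMatching m (Fin c ⊕ S)) : k :=
  ∏ i : Fin c with IsLoopStart x y i,
    δ (walkLab x y (.inl (.inr i))
      (Function.minimalPeriod (step (strand x y) glue) (.inl (.inr i))))

end Loops


section WreathProduct

/-- The wreath product of `ℤ/m` with the symmetric group on `X`: pairs `(f, σ)` with
`(f, σ) (g, τ) = (f · g ∘ σ⁻¹, σ τ)`. -/
abbrev Wreath (m : ℕ) (X : Type) : Type :=
  (X → Multiplicative (ZMod m)) ⋊[mulAutArrow] Equiv.Perm X

variable {m : ℕ} {X : Type}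

/-- The label `f x` of `(f, σ)`. -/
def Wreath.lab (g : Wreath m X) (x : X) : ZMod m := (g.left x).toAdd

@[simp] theorem Wreath.lab_mul (g h : Wreath m X) (x : X) :
    Wreath.lab (g * h) x = Wreath.lab g x + Wreath.lab h (g.right.symm x) := rfl

@[simp] theorem Wreath.lab_one (x : X) : Wreath.lab (1 : Wreath m X) x = 0 := rfl

theorem Wreath.ext' {g h : Wreath m X} (hl : ∀ x, Wreath.lab g x = Wreath.lab h x)
    (hr : g.right = h.right) : g = h :=
  SemidirectProduct.ext (funext hl) hr

/-- The diagram of `(f, σ)`: the node `σ j` in the north is joined to the node `j` in the south, and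
the strand from the northern node `i`, oriented downwards, has label `f i`. -/
def Wreath.diagram (g : Wreath m X) : LMatching m (X ⊕ X) where
  inv := Sum.elim (fun i => .inr (g.right.symm i)) (fun j => .inl (g.right j))
  inv_inv := by rintro (i | j) <;> simp
  inv_ne := by rintro (i | j) <;> simp
  lab := Sum.elim (fun i => Wreath.lab g i) (fun j => - Wreath.lab g (g.right j))
  lab_inv := by rintro (i | j) <;> simp

/-- The effect of putting the diagram of `g` above a diagram. -/
def Wreath.act {S : Type} (g : Wreath m X) (D : LMatching m (X ⊕ S)) : LMatching m (X ⊕ S) where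
  inv o := Sum.map g.right id (D.inv (Sum.map g.right.symm id o))
  inv_inv o := by
    have h : ∀ o : X ⊕ S, Sum.map g.right.symm id (Sum.map g.right id o) = o := by
      rintro (_ | _) <;> simp
    rw [h, D.inv_inv]; rcases o with _ | _ <;> simp
  inv_ne o h := by
    have h2 : ∀ o : X ⊕ S, Sum.map g.right.symm id (Sum.map g.right id o) = o := by
      rintro (_ | _) <;> simp
    have := congrArg (Sum.map g.right.symm id) h
    rw [h2] at this
    exact D.inv_ne _ this
  lab o := Sum.elim (Wreath.lab g) 0 o + D.lab (Sum.map g.right.symm id o)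
    - Sum.elim (Wreath.lab g) 0 (Sum.map g.right id (D.inv (Sum.map g.right.symm id o)))
  lab_inv o := by
    have h : ∀ o : X ⊕ S, Sum.map g.right.symm id (Sum.map g.right id o) = o := by
      rintro (_ | _) <;> simp
    have h' : ∀ o : X ⊕ S, Sum.map g.right id (Sum.map g.right.symm id o) = o := by
      rintro (_ | _) <;> simp
    rw [h, D.inv_inv, h', D.lab_inv]; ring

theorem Wreath.act_mul {S : Type} (g h : Wreath m X) (D : LMatching m (X ⊕ S)) :
    Wreath.act (g * h) D = Wreath.act g (Wreath.act h D) := by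
  have h1 : ∀ o : X ⊕ S, Sum.map (g * h).right.symm id o
      = Sum.map h.right.symm id (Sum.map g.right.symm id o) := by
    rintro (_ | _) <;> simp [Equiv.Perm.mul_def]
  have h2 : ∀ o : X ⊕ S, Sum.map (g * h).right id o
      = Sum.map g.right id (Sum.map h.right id o) := by
    rintro (_ | _) <;> simp
  have h3 : ∀ o : X ⊕ S, Sum.elim (Wreath.lab (g * h)) 0 o
      = Sum.elim (Wreath.lab g) 0 o
        + Sum.elim (Wreath.lab h) 0 (Sum.map g.right.symm id o) := by
    rintro (_ | _) <;> simp
  have h4 : ∀ o : X ⊕ S, Sum.map g.right.symm id (Sum.map g.right id o) = o := by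
    rintro (_ | _) <;> simp
  ext o
  · simp only [Wreath.act, h1, h2]
  · simp only [Wreath.act, h1, h2, h3, h4]; ring

theorem Wreath.act_one {S : Type} (D : LMatching m (X ⊕ S)) :
    Wreath.act (1 : Wreath m X) D = D := by
  have h1 : ∀ o : X ⊕ S, Sum.map (1 : Wreath m X).right.symm id o = o := by
    rintro (_ | _) <;> simp [Equiv.Perm.one_def]
  have h2 : ∀ o : X ⊕ S, Sum.map (1 : Wreath m X).right id o = o := by
    rintro (_ | _) <;> simp
  have h3 : ∀ o : X ⊕ S, Sum.elim (Wreath.lab (1 : Wreath m X)) 0 o = 0 := by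
    rintro (_ | _) <;> simp
  ext o
  · simp only [Wreath.act, h1, h2]
  · simp only [Wreath.act, h1, h2, h3]; ring

theorem Wreath.act_diagram (g h : Wreath m X) :
    Wreath.act g (Wreath.diagram h) = Wreath.diagram (g * h) := by
  ext o
  · rcases o with i | j <;> simp [Wreath.act, Wreath.diagram, Equiv.Perm.mul_def]
  · rcases o with i | j <;> simp [Wreath.act, Wreath.diagram, sub_eq_add_neg, add_comm]

theorem Wreath.concat_diagram {S : Type} [Finite X] [Finite S] (g : Wreath m X)
    (D : LMatching m (X ⊕ S)) : concat (Wreath.diagram g) D = Wreath.act g D := by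
  apply concat_eq_of_walk
  rintro (a | s)
  · rcases hD : D.inv (.inl (g.right.symm a)) with a' | s'
    · refine ⟨3, by omega, ?_, ?_, ?_⟩
      · simp [walk, step, outer, glue, strand, Wreath.diagram, Wreath.act, hD]
      · simp [walk, walkLab, Finset.sum_range_succ, step, outer, glue, strand, strandLab,
          Wreath.diagram, Wreath.act, hD, sub_eq_add_neg]
      · intro i h0 h3
        interval_cases i <;> simp [walk, step, outer, glue, strand, Wreath.diagram, hD]
    · refine ⟨2, by omega, ?_, ?_, ?_⟩
      · simp [walk, step, outer, glue, strand, Wreath.diagram, Wreath.act, hD]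
      · simp [walk, walkLab, Finset.sum_range_succ, step, outer, glue, strand, strandLab,
          Wreath.diagram, Wreath.act, hD]
      · intro i h0 h3
        interval_cases i; simp [walk, step, outer, glue, strand, Wreath.diagram]
  · rcases hD : D.inv (.inr s) with a' | s'
    · refine ⟨2, by omega, ?_, ?_, ?_⟩
      · simp [walk, step, outer, glue, strand, Wreath.diagram, Wreath.act, hD]
      · simp [walk, walkLab, Finset.sum_range_succ, step, outer, glue, strand, strandLab,
          Wreath.diagram, Wreath.act, hD, sub_eq_add_neg]
      · intro i h0 h3
        interval_cases i; simp [walk, step, outer, glue, strand, hD]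
    · refine ⟨1, by omega, ?_, ?_, ?_⟩
      · simp [walk, step, outer, glue, strand, Wreath.act, hD]
      · simp [walk, walkLab, outer, glue, strandLab, Wreath.act, hD]
      · intro i h0 h3
        omega

theorem Wreath.loopScalar_diagram {k : Type*} [CommRing k] {S : Type} {n : ℕ} (δ : ZMod m → k)
    (g : Wreath m (Fin n)) (D : LMatching m (Fin n ⊕ S)) :
    loopScalar δ (Wreath.diagram g) D = 1 := by
  classical
  rw [loopScalar, Finset.filter_false_of_mem, Finset.prod_empty]
  intro i _ h
  rcases hD : D.inv (.inl i) with a' | s'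
  · obtain ⟨i', -, h | h⟩ := h 2 <;>
      simp [walk, step, glue, strand, Wreath.diagram, hD] at h
  · obtain ⟨i', -, h | h⟩ := h 1 <;>
      simp [walk, step, glue, strand, hD] at h

end WreathProduct

section Brauer

/-- An `(m,n)`-diagram without closed loops; `.inl i` are the northern, `.inr i` the southern
nodes. -/
abbrev Diagram (m n : ℕ) : Type := LMatching m (Fin n ⊕ Fin n)

/-- The cyclotomic Brauer algebra `B_n^m(δ)`: the vector space on the `(m,n)`-diagrams, with the
product given below. -/
def CycBrauer {m : ℕ} (n : ℕ) {k : Type*} [CommRing k] (_δ : ZMod m → k) : Type _ :=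
  Diagram m n →₀ k

variable {m n : ℕ} {k : Type*} [CommRing k] (δ : ZMod m → k)

noncomputable instance : AddCommGroup (CycBrauer n δ) :=
  inferInstanceAs (AddCommGroup (Diagram m n →₀ k))

noncomputable instance : Module k (CycBrauer n δ) :=
  inferInstanceAs (Module k (Diagram m n →₀ k))

/-- The basis vector of a diagram. -/
noncomputable def CycBrauer.of (X : Diagram m n) : CycBrauer n δ := Finsupp.single X (1 : k)

/-- The linear map on `B_n^m(δ)` with given values on the diagrams. -/
noncomputable def CycBrauer.lift {M : Type*} [AddCommMonoid M] [Module k M] (f : Diagram m n → M) :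
    CycBrauer n δ →ₗ[k] M :=
  Finsupp.linearCombination k f

@[simp] theorem CycBrauer.lift_of {M : Type*} [AddCommMonoid M] [Module k M] (f : Diagram m n → M)
    (X : Diagram m n) : CycBrauer.lift δ f (CycBrauer.of δ X) = f X := by
  exact (Finsupp.linearCombination_single k 1 X).trans (one_smul k _)

/-- The product of `B_n^m(δ)`: concatenate and remove the closed loops. -/
noncomputable instance : Mul (CycBrauer n δ) where
  mul a b := CycBrauer.lift δ (fun X => CycBrauer.lift δ
    (fun Y => loopScalar δ X Y • CycBrauer.of δ (concat X Y)) b) a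

theorem CycBrauer.of_mul_of (X Y : Diagram m n) :
    CycBrauer.of δ X * CycBrauer.of δ Y = loopScalar δ X Y • CycBrauer.of δ (concat X Y) := by
  change CycBrauer.lift δ _ _ = _
  simp

/-- The inclusion of the basis of `H_n^m = k((ℤ/m) ≀ Σ_n)` in `B_n^m(δ)`. -/
noncomputable def CycBrauer.ofWreath (g : Wreath m (Fin n)) : CycBrauer n δ :=
  CycBrauer.of δ (Wreath.diagram g)

theorem CycBrauer.ofWreath_mul (g h : Wreath m (Fin n)) :
    CycBrauer.ofWreath δ (g * h) = CycBrauer.ofWreath δ g * CycBrauer.ofWreath δ h := by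
  simp only [CycBrauer.ofWreath, CycBrauer.of_mul_of, Wreath.loopScalar_diagram,
    Wreath.concat_diagram, Wreath.act_diagram, one_smul]

end Brauer

section Dangles

/-- An `(m,n,l)`-dangle, `f = n - 2l`: a partition of `n` nodes into arcs `{i, inv i}` and `f` free
nodes (`inv i = i`), where `lab i` is the label of the arc at `i`, oriented from `i` to `inv i`. -/
@[ext] structure Dangle (m n f : ℕ) where
  inv : Fin n → Fin n
  inv_inv : ∀ i, inv (inv i) = i
  lab : Fin n → ZMod m
  lab_inv : ∀ i, lab (inv i) = - lab i
  lab_free : ∀ i, inv i = i → lab i = 0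
  card_free : (Finset.univ.filter fun i => inv i = i).card = f

variable {m n f : ℕ}

/-- The free nodes of a dangle, in increasing order. -/
def Dangle.free (d : Dangle m n f) (s : Fin f) : Fin n :=
  (Finset.univ.filter fun i => d.inv i = i).orderEmbOfFin d.card_free s

theorem Dangle.free_injective (d : Dangle m n f) : Function.Injective d.free :=
  by
  intro s t h
  exact (Finset.orderEmbOfFin _ d.card_free).injective h

theorem Dangle.inv_free (d : Dangle m n f) (s : Fin f) : d.inv (d.free s) = d.free s :=
  (Finset.mem_filter.1 (Finset.orderEmbOfFin_mem _ d.card_free s)).2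

theorem Dangle.exists_free (d : Dangle m n f) (i : Fin n) (h : d.inv i = i) :
    ∃ s, d.free s = i := by
  have : i ∈ Set.range (Finset.orderEmbOfFin _ d.card_free) := by
    rw [Finset.range_orderEmbOfFin]; simpa using h
  exact this

/-- The free nodes of a dangle, numbered from left to right. -/
noncomputable def Dangle.freeEquiv (d : Dangle m n f) : Fin f ≃ {i // d.inv i = i} :=
  Equiv.ofBijective (fun s => ⟨d.free s, d.inv_free s⟩)
    ⟨fun _ _ h => d.free_injective (Subtype.mk.inj h),
      fun i => (d.exists_free i.1 i.2).imp fun _ h => Subtype.ext h⟩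

open Classical in
/-- The dangle as a diagram from `n` to `f` nodes: the `s`-th free node is joined by a strand with
label `0` to the `s`-th southern node. -/
noncomputable def Dangle.toMatching (d : Dangle m n f) : LMatching m (Fin n ⊕ Fin f) where
  inv := Sum.elim
    (fun i => if h : d.inv i = i then .inr (d.freeEquiv.symm ⟨i, h⟩) else .inl (d.inv i))
    (fun s => .inl (d.free s))
  inv_inv := by
    rintro (i | s)
    · by_cases h : d.inv i = i
      · have : d.free (d.freeEquiv.symm ⟨i, h⟩) = i :=
          congrArg Subtype.val (d.freeEquiv.apply_symm_apply ⟨i, h⟩)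
        simp only [Sum.elim_inl, dif_pos h, Sum.elim_inr, this]
      · simp [h, d.inv_inv, Ne.symm h]
    · have : d.freeEquiv.symm ⟨d.free s, d.inv_free s⟩ = s := d.freeEquiv.symm_apply_apply s
      simp [d.inv_free, this]
  inv_ne := by
    rintro (i | s)
    · by_cases h : d.inv i = i <;> simp [h]
    · simp
  lab := Sum.elim d.lab 0
  lab_inv := by
    rintro (i | s)
    · by_cases h : d.inv i = i
      · simp [h, d.lab_free i h]
      · simp [h, d.lab_inv]
    · simp [d.lab_free _ (d.inv_free s)]

/-- All southern nodes lie on through strands. -/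
def IsThrough (D : LMatching m (Fin n ⊕ Fin f)) : Prop :=
  ∀ s, (D.inv (.inr s)).isLeft

/-- The northern end of the through strand at the southern node `s`. -/
def throughTop (D : LMatching m (Fin n ⊕ Fin f)) (h : IsThrough D) (s : Fin f) : Fin n :=
  (D.inv (.inr s)).getLeft (h s)

theorem inl_throughTop (D : LMatching m (Fin n ⊕ Fin f)) (h : IsThrough D) (s : Fin f) :
    .inl (throughTop D h s) = D.inv (.inr s) := Sum.inl_getLeft _ _

theorem throughTop_injective (D : LMatching m (Fin n ⊕ Fin f)) (h : IsThrough D) :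
    Function.Injective (throughTop D h) := fun s t hst => by
  have := congrArg (Sum.inl (β := Fin f)) hst
  rw [inl_throughTop, inl_throughTop] at this
  simpa [D.inv_inv] using congrArg D.inv this

/-- The other end of the arc at `i`, or `i` itself if `i` is on a through strand. -/
def northInv (D : LMatching m (Fin n ⊕ Fin f)) (i : Fin n) : Fin n :=
  Sum.elim id (fun _ => i) (D.inv (.inl i))

theorem northInv_eq_self_iff (D : LMatching m (Fin n ⊕ Fin f)) (i : Fin n) :
    northInv D i = i ↔ ∃ s, D.inv (.inl i) = .inr s := by
  rcases h : D.inv (.inl i) with j | s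
  · have : j ≠ i := fun e => D.inv_ne (.inl i) (by rw [h, e])
    simp [northInv, h, this]
  · simp [northInv, h]

/-- The dangle at the top of a diagram all of whose southern nodes lie on through strands. -/
def topDangle (D : LMatching m (Fin n ⊕ Fin f)) (h : IsThrough D) : Dangle m n f where
  inv := northInv D
  inv_inv i := by
    rcases hD : D.inv (.inl i) with j | s
    · have : D.inv (.inl j) = .inl i := by rw [← hD, D.inv_inv]
      simp [northInv, hD, this]
    · simp [northInv, hD]
  lab i := Sum.elim (fun _ => D.lab (.inl i)) (fun _ => 0) (D.inv (.inl i))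
  lab_inv i := by
    rcases hD : D.inv (.inl i) with j | s
    · have : D.inv (.inl j) = .inl i := by rw [← hD, D.inv_inv]
      have hl := D.lab_inv (.inl i)
      rw [hD] at hl
      simp [northInv, hD, this, hl]
    · simp [northInv, hD]
  lab_free i hi := by
    obtain ⟨s, hs⟩ := (northInv_eq_self_iff D i).1 hi
    simp [hs]
  card_free := by
    have : (Finset.univ.filter fun i => northInv D i = i)
        = Finset.univ.map ⟨throughTop D h, throughTop_injective D h⟩ := by
      ext i
      simp only [Finset.mem_filter, Finset.mem_univ, true_and, Finset.mem_map,
        Function.Embedding.coeFn_mk, northInv_eq_self_iff]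
      constructor
      · rintro ⟨s, hs⟩
        refine ⟨s, Sum.inl_injective (β := Fin f) ?_⟩
        rw [inl_throughTop, ← hs, D.inv_inv]
      · rintro ⟨s, rfl⟩
        exact ⟨s, by rw [inl_throughTop, D.inv_inv]⟩
    rw [this]; simp

theorem topDangle_inv (D : LMatching m (Fin n ⊕ Fin f)) (h : IsThrough D) (i : Fin n) :
    (topDangle D h).inv i = Sum.elim id (fun _ => i) (D.inv (.inl i)) := rfl

theorem topDangle_lab (D : LMatching m (Fin n ⊕ Fin f)) (h : IsThrough D) (i : Fin n) :
    (topDangle D h).lab i =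
      Sum.elim (fun _ => D.lab (.inl i)) (fun _ => 0) (D.inv (.inl i)) := rfl

theorem topDangle_inv_throughTop (D : LMatching m (Fin n ⊕ Fin f)) (h : IsThrough D) (s : Fin f) :
    (topDangle D h).inv (throughTop D h s) = throughTop D h s :=
  (northInv_eq_self_iff D _).2 ⟨s, by rw [inl_throughTop, D.inv_inv]⟩

/-- The permutation and the labels of the through strands: the through strand at the southern node
`s` starts at the `σ s`-th of the northern nodes that lie on through strands. -/
noncomputable def throughWreath (D : LMatching m (Fin n ⊕ Fin f)) (h : IsThrough D) :
    Wreath m (Fin f) :=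
  ⟨fun q => Multiplicative.ofAdd (D.lab (.inl ((topDangle D h).free q))),
    Equiv.ofBijective (fun s => (topDangle D h).freeEquiv.symm
        ⟨throughTop D h s, topDangle_inv_throughTop D h s⟩)
      (Finite.injective_iff_bijective.1 fun s t hst => by
        simpa [(throughTop_injective D h).eq_iff] using hst)⟩

theorem free_throughWreath (D : LMatching m (Fin n ⊕ Fin f)) (h : IsThrough D) (s : Fin f) :
    (topDangle D h).free ((throughWreath D h).right s) = throughTop D h s :=
  congrArg Subtype.val ((topDangle D h).freeEquiv.apply_symm_apply
    ⟨throughTop D h s, topDangle_inv_throughTop D h s⟩)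

theorem lab_throughWreath (D : LMatching m (Fin n ⊕ Fin f)) (h : IsThrough D) (q : Fin f) :
    Wreath.lab (throughWreath D h) q = D.lab (.inl ((topDangle D h).free q)) := rfl

theorem isThrough_toMatching (d : Dangle m n f) : IsThrough d.toMatching := fun _ => rfl

theorem topDangle_toMatching (d : Dangle m n f) :
    topDangle d.toMatching (isThrough_toMatching d) = d := by
  ext i
  · by_cases h : d.inv i = i <;> simp [topDangle, northInv, Dangle.toMatching, h]
  · by_cases h : d.inv i = i <;> simp [topDangle, Dangle.toMatching, h, d.lab_free]

theorem throughWreath_toMatching (d : Dangle m n f) :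
    throughWreath d.toMatching (isThrough_toMatching d) = 1 := by
  refine Wreath.ext' (fun q => ?_) (Equiv.ext fun s => ?_)
  · rw [lab_throughWreath, topDangle_toMatching]
    exact d.lab_free _ (d.inv_free q)
  · apply d.free_injective
    have := free_throughWreath d.toMatching (isThrough_toMatching d) s
    rw [topDangle_toMatching] at this
    exact this

theorem isThrough_act (g : Wreath m (Fin n)) (D : LMatching m (Fin n ⊕ Fin f))
    (h : IsThrough D) : IsThrough (Wreath.act g D) := fun s => by
  have := h s
  simpa [Wreath.act] using this

theorem throughTop_act (g : Wreath m (Fin n)) (D : LMatching m (Fin n ⊕ Fin f))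
    (h : IsThrough D) (s : Fin f) :
    throughTop (Wreath.act g D) (isThrough_act g D h) s = g.right (throughTop D h s) := by
  apply Sum.inl_injective (β := Fin f)
  rw [inl_throughTop]
  simp [Wreath.act, ← inl_throughTop D h]

theorem throughTop_toMatching (d : Dangle m n f) (s : Fin f) :
    throughTop d.toMatching (isThrough_toMatching d) s = d.free s := rfl

theorem topDangle_act (g : Wreath m (Fin n)) (D : LMatching m (Fin n ⊕ Fin f))
    (h : IsThrough D) :
    topDangle (Wreath.act g (topDangle D h).toMatching)
      (isThrough_act g _ (isThrough_toMatching _)) =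
    topDangle (Wreath.act g D) (isThrough_act g D h) := by
  have key : ∀ i j, D.inv (.inl i) = .inl j → (topDangle D h).toMatching.inv (.inl i) = .inl j ∧
      (topDangle D h).toMatching.lab (.inl i) = D.lab (.inl i) := by
    intro i j hij
    have hji : j ≠ i := fun e => D.inv_ne (.inl i) (by rw [hij, e])
    simp [Dangle.toMatching, topDangle, northInv, hij, hji]
  have key2 : ∀ i s, D.inv (.inl i) = .inr s →
      ∃ t, (topDangle D h).toMatching.inv (.inl i) = .inr t := by
    intro i s his
    simp [Dangle.toMatching, topDangle, northInv, his]
  have main : ∀ (E : LMatching m (Fin n ⊕ Fin f)) (hT : IsThrough E),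
      (∀ i j, D.inv (.inl i) = .inl j → E.inv (.inl i) = .inl j ∧
        E.lab (.inl i) = D.lab (.inl i)) →
      (∀ i s, D.inv (.inl i) = .inr s → ∃ t, E.inv (.inl i) = .inr t) →
      topDangle (Wreath.act g E) (isThrough_act g _ hT) =
        topDangle (Wreath.act g D) (isThrough_act g D h) := by
    intro E hT key key2
    refine Dangle.ext (funext fun i => ?_) (funext fun i => ?_)
    · rcases hD : D.inv (.inl (g.right.symm i)) with j | s
      · simp [topDangle_inv, Wreath.act, hD, (key _ _ hD).1]
      · obtain ⟨t, ht⟩ := key2 _ _ hD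
        simp [topDangle_inv, Wreath.act, hD, ht]
    · rcases hD : D.inv (.inl (g.right.symm i)) with j | s
      · simp [topDangle_lab, Wreath.act, hD, (key _ _ hD).1, (key _ _ hD).2]
      · obtain ⟨t, ht⟩ := key2 _ _ hD
        simp [topDangle_lab, Wreath.act, hD, ht]
  exact main _ (isThrough_toMatching _) key key2

theorem throughWreath_act (g : Wreath m (Fin n)) (D : LMatching m (Fin n ⊕ Fin f))
    (h : IsThrough D) :
    throughWreath (Wreath.act g D) (isThrough_act g D h) =
      throughWreath (Wreath.act g (topDangle D h).toMatching)
        (isThrough_act g _ (isThrough_toMatching _)) * throughWreath D h := by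
  set E := (topDangle D h).toMatching with hE
  have hT : IsThrough E := isThrough_toMatching _
  have hr : ∀ s, (throughWreath (Wreath.act g E) (isThrough_act g _ hT)).right
      ((throughWreath D h).right s) =
      (throughWreath (Wreath.act g D) (isThrough_act g D h)).right s := by
    intro s
    apply (topDangle (Wreath.act g D) (isThrough_act g D h)).free_injective
    have h1 := free_throughWreath (Wreath.act g E) (isThrough_act g _ hT)
      ((throughWreath D h).right s)
    rw [topDangle_act, throughTop_act g E hT, throughTop_toMatching, free_throughWreath] at h1
    rw [free_throughWreath, throughTop_act g D h]
    exact h1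
  have hr' : (throughWreath (Wreath.act g D) (isThrough_act g D h)).right =
      (throughWreath (Wreath.act g E) (isThrough_act g _ hT)).right *
        (throughWreath D h).right := Equiv.ext fun s => (hr s).symm
  refine Wreath.ext' (fun q => ?_) hr'
  obtain ⟨s, rfl⟩ := (throughWreath (Wreath.act g D) (isThrough_act g D h)).right.surjective q
  rw [Wreath.lab_mul, ← hr s, Equiv.symm_apply_apply, lab_throughWreath, lab_throughWreath,
    lab_throughWreath, hr s, topDangle_act, free_throughWreath, free_throughWreath,
    throughTop_act g D h]
  have hD : D.inv (.inl (throughTop D h s)) = .inr s := by rw [inl_throughTop, D.inv_inv]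
  have hE1 : E.inv (.inl (throughTop D h s)) = .inr ((throughWreath D h).right s) := by
    rw [← free_throughWreath D h s, ← throughTop_toMatching, inl_throughTop, E.inv_inv]
  have hE2 : E.lab (.inl (throughTop D h s)) = 0 :=
    (topDangle D h).lab_free _ (topDangle_inv_throughTop D h s)
  simp [Wreath.act, hD, ← hE, hE1, hE2]

end Dangles

section CellModules

variable {m n f : ℕ} {k : Type*} [CommRing k] (δ : ZMod m → k)

/-- The vector space `V(m,n,l)` on the `(m,n,l)`-dangles, with `f = n - 2l`. -/
def DangleSpace (m n f : ℕ) (k : Type*) [CommRing k] : Type _ := Dangle m n f →₀ k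

noncomputable instance : AddCommGroup (DangleSpace m n f k) :=
  inferInstanceAs (AddCommGroup (Dangle m n f →₀ k))

noncomputable instance : Module k (DangleSpace m n f k) :=
  inferInstanceAs (Module k (Dangle m n f →₀ k))

variable (k) in
/-- The basis vector of a dangle. -/
noncomputable def DangleSpace.of (d : Dangle m n f) : DangleSpace m n f k :=
  Finsupp.single d (1 : k)

/-- The linear map on `V(m,n,l)` with given values on the dangles. -/
noncomputable def DangleSpace.lift {M : Type*} [AddCommMonoid M] [Module k M]
    (g : Dangle m n f → M) : DangleSpace m n f k →ₗ[k] M :=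
  Finsupp.linearCombination k g

@[simp] theorem DangleSpace.lift_of {M : Type*} [AddCommMonoid M] [Module k M]
    (g : Dangle m n f → M) (d : Dangle m n f) :
    DangleSpace.lift g (DangleSpace.of k d) = g d :=
  (Finsupp.linearCombination_single k 1 d).trans (one_smul k _)

theorem DangleSpace.tensor_hom_ext {M N : Type*} [AddCommMonoid M] [Module k M] [AddCommMonoid N]
    [Module k N] {F G : DangleSpace m n f k ⊗[k] M →ₗ[k] N}
    (h : ∀ d v, F (DangleSpace.of k d ⊗ₜ v) = G (DangleSpace.of k d ⊗ₜ v)) : F = G :=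
  TensorProduct.ext (Finsupp.lhom_ext' fun d => LinearMap.ext_ring (LinearMap.ext (h d)))

variable {M : Type*} [AddCommGroup M] [Module k M] (ρ : Representation k (Wreath m (Fin f)) M)

open Classical in
/-- The map `x ↦ X (d ⊗ x)`, for a diagram `X` and a dangle `d`: put `X` above `d`. If this does not
have `f` through strands, the result is `0`; otherwise it is `(Xd) ⊗ σ x`, times the scalar for the
closed loops. -/
noncomputable def dangleAction (X : Diagram m n) (d : Dangle m n f) :
    M →ₗ[k] DangleSpace m n f k ⊗[k] M :=
  if h : IsThrough (concat X d.toMatching) then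
    loopScalar δ X d.toMatching •
      (TensorProduct.mk k (DangleSpace m n f k) M (DangleSpace.of k (topDangle _ h)) ∘ₗ
        ρ (throughWreath _ h))
  else 0

/-- The linear operator `d ⊗ x ↦ X (d ⊗ x)`. -/
noncomputable def dangleOperator (X : Diagram m n) : Module.End k (DangleSpace m n f k ⊗[k] M) :=
  TensorProduct.lift (DangleSpace.lift (dangleAction δ ρ X))

/-- The action of `B_n^m(δ)` on `V(m,n,l) ⊗ M`, for a representation `M` of
`(ℤ/m) ≀ Σ_{n-2l}`. -/
noncomputable def cellAction : CycBrauer n δ →ₗ[k]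
    Module.End k (DangleSpace m n f k ⊗[k] M) :=
  CycBrauer.lift δ (dangleOperator δ ρ)

theorem cellAction_ofWreath (g : Wreath m (Fin n)) (d : Dangle m n f) (v : M) :
    cellAction δ ρ (CycBrauer.ofWreath δ g) (DangleSpace.of k d ⊗ₜ v) =
      DangleSpace.of k (topDangle (Wreath.act g d.toMatching)
        (isThrough_act g _ (isThrough_toMatching d))) ⊗ₜ
      ρ (throughWreath (Wreath.act g d.toMatching)
        (isThrough_act g _ (isThrough_toMatching d))) v := by
  have h := isThrough_act g _ (isThrough_toMatching d)
  have h' : IsThrough (concat (Wreath.diagram g) d.toMatching) := by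
    rw [Wreath.concat_diagram]; exact h
  simp only [cellAction, CycBrauer.ofWreath, CycBrauer.lift_of, dangleOperator, TensorProduct.lift.tmul,
    DangleSpace.lift_of, dangleAction, dif_pos h',
    Wreath.loopScalar_diagram]
  simp only [Wreath.concat_diagram]
  rw [one_smul]
  rfl

/-- The restriction of `V(m,n,l) ⊗ M` from `B_n^m(δ)` to `H_n^m`. -/
noncomputable def cellRestriction :
    Representation k (Wreath m (Fin n)) (DangleSpace m n f k ⊗[k] M) where
  toFun g := cellAction δ ρ (CycBrauer.ofWreath δ g)
  map_one' := by
    refine DangleSpace.tensor_hom_ext fun d v => ?_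
    change cellAction δ ρ (CycBrauer.ofWreath δ 1) (DangleSpace.of k d ⊗ₜ v) = _
    rw [cellAction_ofWreath]
    simp only [Wreath.act_one, topDangle_toMatching, throughWreath_toMatching, map_one]
    rfl
  map_mul' g h := by
    refine DangleSpace.tensor_hom_ext fun d v => ?_
    change cellAction δ ρ (CycBrauer.ofWreath δ (g * h)) (DangleSpace.of k d ⊗ₜ v) =
      cellAction δ ρ (CycBrauer.ofWreath δ g) (cellAction δ ρ (CycBrauer.ofWreath δ h)
        (DangleSpace.of k d ⊗ₜ v))
    rw [cellAction_ofWreath, cellAction_ofWreath, cellAction_ofWreath]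
    have hd := isThrough_act h _ (isThrough_toMatching d)
    simp only [Wreath.act_mul, topDangle_act g _ hd, throughWreath_act g _ hd, map_mul,
      Module.End.mul_apply]

end CellModules

section Specht

variable (k : Type*) [CommRing k] (lam : YoungDiagram)

/-- The boxes of a Young diagram. -/
abbrev Box (lam : YoungDiagram) : Type := {c : ℕ × ℕ // c ∈ lam.cells}

open Classical in
/-- The sum of the permutations of the boxes that preserve every row. -/
noncomputable def rowSum : MonoidAlgebra k (Equiv.Perm (Box lam)) :=
  ∑ σ : Equiv.Perm (Box lam) with ∀ c, (σ c).1.1 = c.1.1, MonoidAlgebra.single σ 1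

open Classical in
/-- The signed sum of the permutations of the boxes that preserve every column. -/
noncomputable def colAltSum : MonoidAlgebra k (Equiv.Perm (Box lam)) :=
  ∑ σ : Equiv.Perm (Box lam) with ∀ c, (σ c).1.2 = c.1.2,
    MonoidAlgebra.single σ ((Equiv.Perm.sign σ : ℤ) : k)

/-- The Specht module as a left ideal of the group algebra: the left ideal generated by the Young symmetrizer
`colAltSum * rowSum`. -/
noncomputable def spechtIdeal : Submodule k (MonoidAlgebra k (Equiv.Perm (Box lam))) :=
  LinearMap.range (LinearMap.mulRight k (colAltSum k lam * rowSum k lam))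

/-- The underlying space of the Specht module `S(λ)`. -/
def SpechtModule : Type _ := spechtIdeal k lam

noncomputable instance : AddCommGroup (SpechtModule k lam) :=
  inferInstanceAs (AddCommGroup (spechtIdeal k lam))

noncomputable instance : Module k (SpechtModule k lam) :=
  inferInstanceAs (Module k (spechtIdeal k lam))

/-- The Specht module `S(λ)` of the symmetric group on the boxes of `λ`. -/
noncomputable def specht : Representation k (Equiv.Perm (Box lam)) (SpechtModule k lam) where
  toFun σ := (LinearMap.mulLeft k (MonoidAlgebra.single σ 1)).restrict
    (p := spechtIdeal k lam) (q := spechtIdeal k lam) (by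
      rintro _ ⟨a, rfl⟩
      exact ⟨MonoidAlgebra.single σ 1 * a, by simp [mul_assoc]⟩)
  map_one' := LinearMap.ext fun a => Subtype.ext (one_mul a.1)
  map_mul' σ τ := LinearMap.ext fun a => Subtype.ext <| by
    change MonoidAlgebra.single (σ * τ) 1 * a.1 =
      MonoidAlgebra.single σ 1 * (MonoidAlgebra.single τ 1 * a.1)
    rw [← mul_assoc, MonoidAlgebra.single_mul_single, one_mul]

end Specht

section WreathModules

variable {m : ℕ} [NeZero m] {k : Type*} [CommRing k] {ξ : k} (hξ : IsPrimitiveRoot ξ m)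

/-- The character of `(ℤ/m) ≀ Σ_X` by which every generator `t_x` acts as `ξ ^ r` and every
permutation as `1`. -/
noncomputable def Wreath.char {X : Type} [Fintype X] (r : ZMod m) : Wreath m X →* k where
  toFun g := ∏ x, ξ ^ (r * Wreath.lab g x).val
  map_one' := by simp
  map_mul' g h := by
    have hadd : ∀ a b : ZMod m, ξ ^ (a + b).val = ξ ^ a.val * ξ ^ b.val := fun a b => by
      have h := pow_mod_orderOf ξ (a.val + b.val)
      rwa [← hξ.eq_orderOf, ← ZMod.val_add, pow_add] at h
    simp only [Wreath.lab_mul, mul_add, hadd, Finset.prod_mul_distrib]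
    congr 1
    exact Equiv.prod_comp g.right.symm fun x => ξ ^ (r * Wreath.lab h x).val

/-- The module `S(λ)^{(r)}`: the symmetric group acts as on `S(λ)` and every `t_x` as `ξ ^ r`. -/
noncomputable def twistedSpecht (lam : YoungDiagram) (r : ZMod m) :
    Representation k (Wreath m (Box lam)) (SpechtModule k lam) where
  toFun g := Wreath.char hξ r g • specht k lam g.right
  map_one' := by simp
  map_mul' g h := by
    simp only [map_mul, SemidirectProduct.mul_right, smul_mul_smul_comm]

/-- The embedding of a product of wreath products as a Young subgroup. -/
def Wreath.block {ι : Type} (X : ι → Type) :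
    (∀ i, Wreath m (X i)) →* Wreath m (Σ i, X i) where
  toFun g := ⟨fun x => (g x.1).left x.2, Equiv.Perm.sigmaCongrRight fun i => (g i).right⟩
  map_one' := rfl
  map_mul' _ _ := rfl

/-- The map of wreath products induced by a bijection. -/
def Wreath.congr {X Y : Type} (e : X ≃ Y) : Wreath m X →* Wreath m Y where
  toFun g := ⟨fun y => g.left (e.symm y), e.permCongr g.right⟩
  map_one' := by
    refine SemidirectProduct.ext rfl ?_
    ext; simp
  map_mul' g h := by
    refine SemidirectProduct.ext (funext fun y => ?_) ?_
    · exact congrArg (fun x => g.left (e.symm y) * h.left x)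
        (e.symm_apply_apply (g.right.symm (e.symm y))).symm
    · ext; simp

/-- An `m`-partition of `n`, with components indexed by `ℤ/m`. -/
structure MPartition (m : ℕ) [NeZero m] (n : ℕ) where
  part : ZMod m → YoungDiagram
  sum_card : ∑ i, (part i).card = n

/-- The `m`-composition `|λ|`. -/
def MPartition.size {n : ℕ} (lam : MPartition m n) (i : ZMod m) : ℕ := (lam.part i).card

theorem MPartition.card_boxes {n : ℕ} (lam : MPartition m n) :
    Fintype.card (Σ i, Box (lam.part i)) = n := by
  simpa using lam.sum_card

/-- A numbering of the boxes of an `m`-partition. -/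
noncomputable def MPartition.numbering {n : ℕ} (lam : MPartition m n) :
    (Σ i, Box (lam.part i)) ≃ Fin n :=
  Fintype.equivFinOfCardEq lam.card_boxes

/-- The embedding of the Young subgroup `∏ i, (ℤ/m) ≀ Σ_{|λ^i|}` of `(ℤ/m) ≀ Σ_n`. Another numbering
gives a conjugate embedding. -/
noncomputable def MPartition.young {n : ℕ} (lam : MPartition m n) :
    (∀ i, Wreath m (Box (lam.part i))) →* Wreath m (Fin n) :=
  (Wreath.congr lam.numbering).comp (Wreath.block fun i => Box (lam.part i))

/-- The module `⨂ i, S(λ^i)^{(i)}` of the Young subgroup. -/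
noncomputable def outerSpecht {n : ℕ} (lam : MPartition m n) :
    Representation k (∀ i, Wreath m (Box (lam.part i)))
      (⨂[k] i, SpechtModule k (lam.part i)) where
  toFun g := PiTensorProduct.map fun i => twistedSpecht hξ (lam.part i) i (g i)
  map_one' := by
    simp only [Pi.one_apply, map_one]
    exact PiTensorProduct.map_one
  map_mul' g h := by
    simp only [Pi.mul_apply, map_mul]
    exact PiTensorProduct.map_mul _ _

/-- The Specht module `𝐒(λ)` of `H_n^m`, induced from the Young subgroup. -/
noncomputable def wreathSpecht {n : ℕ} (lam : MPartition m n) :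
    Representation k (Wreath m (Fin n))
      (Representation.IndV lam.young (outerSpecht hξ lam)) :=
  Representation.ind lam.young (outerSpecht hξ lam)

/-- The restriction to `H_n^m` of the standard module `Δ_n(λ) = V(m,n,l) ⊗ 𝐒(λ)` of `B_n^m(δ)`,
for an `m`-partition `λ` of `f = n - 2l`. -/
noncomputable def standardRestriction {f : ℕ} (n : ℕ) (δ : ZMod m → k) (lam : MPartition m f) :
    Representation k (Wreath m (Fin n)) (DangleSpace m n f k ⊗[k]
      Representation.IndV lam.young (outerSpecht hξ lam)) :=
  cellRestriction δ (wreathSpecht hξ lam)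

end WreathModules

section Multiplicity

/-- The number of factors of a composition series that are isomorphic to `S`. -/
noncomputable def seriesMult {R M : Type*} (S : Type*) [Ring R] [AddCommGroup M] [Module R M]
    [AddCommGroup S] [Module R S] (s : CompositionSeries (Submodule R M)) : ℕ :=
  Nat.card {i : Fin s.length //
    Nonempty ((s i.succ ⧸ (s i.castSucc).comap (s i.succ).subtype) ≃ₗ[R] S)}

open Classical in
/-- The composition multiplicity `[M : S]` of a module `M` of finite length: the number of factors
isomorphic to `S` in a composition series of `M`. -/
noncomputable def compMult (R M S : Type*) [Ring R] [AddCommGroup M] [Module R M]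
    [AddCommGroup S] [Module R S] : ℕ :=
  if h : ∃ s : CompositionSeries (Submodule R M), s.head = ⊥ ∧ s.last = ⊤ then
    seriesMult S h.choose
  else 0

/-- Every composition series computes the multiplicity. -/
theorem compMult_eq {R M : Type*} (S : Type*) [Ring R] [AddCommGroup M] [Module R M]
    [AddCommGroup S] [Module R S] (s : CompositionSeries (Submodule R M))
    (hb : s.head = ⊥) (ht : s.last = ⊤) : compMult R M S = seriesMult S s := by
  have h : ∃ s : CompositionSeries (Submodule R M), s.head = ⊥ ∧ s.last = ⊤ := ⟨s, hb, ht⟩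
  rw [compMult, dif_pos h]
  obtain ⟨e, he⟩ := CompositionSeries.jordan_holder h.choose s
    (h.choose_spec.1.trans hb.symm) (h.choose_spec.2.trans ht.symm)
  refine Nat.card_congr (e.subtypeEquiv fun i => ?_)
  exact ⟨fun ⟨φ⟩ => ⟨(JordanHolderLattice.Iso.linearEquiv (he i)).symm.trans φ⟩,
    fun ⟨φ⟩ => ⟨(JordanHolderLattice.Iso.linearEquiv (he i)).trans φ⟩⟩

/-- The composition multiplicity of representations of a group `G`, as modules of the group
algebra. -/
noncomputable def repMult {k G V W : Type*} [CommRing k] [Group G] [AddCommGroup V] [Module k V]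
    [AddCommGroup W] [Module k W] (ρ : Representation k G V) (σ : Representation k G W) : ℕ :=
  compMult (MonoidAlgebra k G) ρ.asModule σ.asModule

end Multiplicity

section LittlewoodRichardson

/-- The module `S(λ) ⊠ S(μ)` of `Σ_{|λ|} × Σ_{|μ|}`. -/
noncomputable def boxSpecht (k : Type*) [CommRing k] (lam mu : YoungDiagram) :
    Representation k (Equiv.Perm (Box lam) × Equiv.Perm (Box mu))
      (SpechtModule k lam ⊗[k] SpechtModule k mu) :=
  Representation.tprod
    (MonoidHom.comp (specht k lam) (MonoidHom.fst (Equiv.Perm (Box lam)) (Equiv.Perm (Box mu))))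
    (MonoidHom.comp (specht k mu) (MonoidHom.snd (Equiv.Perm (Box lam)) (Equiv.Perm (Box mu))))

/-- The module `S(λ) ⊠ S(μ)` induced to `Σ_{|λ|+|μ|}`, the symmetric group on the boxes of `λ` and the boxes of `μ`. -/
noncomputable def spechtInduction (k : Type*) [CommRing k] (lam mu : YoungDiagram) :
    Representation k (Equiv.Perm (Box lam ⊕ Box mu))
      (Representation.IndV (Equiv.Perm.sumCongrHom (Box lam) (Box mu)) (boxSpecht k lam mu)) :=
  Representation.ind (Equiv.Perm.sumCongrHom (Box lam) (Box mu)) (boxSpecht k lam mu)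

open Classical in
/-- The Littlewood-Richardson coefficient `c^ν_{λ,μ}`: the multiplicity of `S(ν)` in the module
induced from `S(λ) ⊠ S(μ)` in characteristic zero, and `0` if `|ν| ≠ |λ| + |μ|`. -/
noncomputable def lrCoeff (lam mu nu : YoungDiagram) : ℕ :=
  if h : Nonempty (Box lam ⊕ Box mu ≃ Box nu) then
    repMult (spechtInduction ℚ lam mu)
      (MonoidHom.comp (specht ℚ nu) h.some.permCongrHom.toMonoidHom)
  else 0

theorem finite_card_eq (a : ℕ) : {τ : YoungDiagram | τ.card = a}.Finite := by
  refine Set.Finite.of_finite_image (f := YoungDiagram.cells)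
    (((Finset.range a ×ˢ Finset.range a).powerset.finite_toSet).subset ?_)
    (fun _ _ _ _ h => YoungDiagram.ext h)
  rintro _ ⟨τ, hτ, rfl⟩
  rw [Finset.mem_coe, Finset.mem_powerset]
  rintro ⟨i, j⟩ hij
  have hτ' : τ.cells.card = a := hτ
  rw [Finset.mem_product, Finset.mem_range, Finset.mem_range]
  constructor
  · have : (Finset.range (i + 1)).image (fun x => (x, j)) ⊆ τ.cells := by
      intro c hc
      obtain ⟨x, hx, rfl⟩ := Finset.mem_image.1 hc
      exact τ.up_left_mem (Nat.lt_succ_iff.1 (Finset.mem_range.1 hx)) le_rfl hij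
    have := Finset.card_le_card this
    rw [Finset.card_image_of_injective _ (fun x y h => (Prod.mk.inj h).1)] at this
    simp at this; omega
  · have : (Finset.range (j + 1)).image (fun x => (i, x)) ⊆ τ.cells := by
      intro c hc
      obtain ⟨x, hx, rfl⟩ := Finset.mem_image.1 hc
      exact τ.up_left_mem le_rfl (Nat.lt_succ_iff.1 (Finset.mem_range.1 hx)) hij
    have := Finset.card_le_card this
    rw [Finset.card_image_of_injective _ (fun x y h => (Prod.mk.inj h).2)] at this
    simp at this; omega

/-- The partitions of `a`. -/
noncomputable def partitionsOf (a : ℕ) : Finset YoungDiagram := (finite_card_eq a).toFinset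

open Classical in
/-- The partitions of `a` all of whose parts are even. -/
noncomputable def evenPartitionsOf (a : ℕ) : Finset YoungDiagram :=
  (partitionsOf a).filter fun η => ∀ i, Even (η.rowLen i)

end LittlewoodRichardson

section Poset

variable {m : ℕ}

/-- The order `ω ⪯ ω'` on `m`-compositions; `r = -r` in `ℤ/m` means `r = 0` or `r = m/2`. -/
def Prec (ω ω' : ZMod m → ℕ) : Prop :=
  (∀ r, ω r ≤ ω' r) ∧
  (∀ r, r ≠ -r → (ω r : ℤ) - ω' r = (ω (-r) : ℤ) - ω' (-r)) ∧
  ∀ r, r = -r → (2 : ℤ) ∣ (ω r : ℤ) - ω' r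

/-- The relation `ω ⪯_{∑ a_r ξ^r} ω'`, with `a` extended to all of `ℤ/m` by `a_{-r} = a_r`. -/
def PrecSum (a : ZMod m → ℕ) (ω ω' : ZMod m → ℕ) : Prop :=
  Prec ω ω' ∧ (∀ r, r ≠ -r → (a r : ℤ) = (ω' r : ℤ) - ω r) ∧
    ∀ r, r = -r → 2 * (a r : ℤ) = (ω' r : ℤ) - ω r

/-- The order `λ ≤ μ` on `Λ(m,n)`. -/
def MPartition.Le [NeZero m] {f n : ℕ} (lam : MPartition m f) (mu : MPartition m n) : Prop :=
  (∀ i, lam.part i ≤ mu.part i) ∧ Prec lam.size mu.size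

end Poset

end CyclotomicBrauer

open CyclotomicBrauer

/-!
The restriction of a standard module to the group algebra of the wreath product does not see the
parameters `δ`: group elements never close loops, so they only move the labelled dangles, and moving
dangles is the same as moving the labelled perfect matchings of `Fin n ⊕ Fin f` in which no two of the
`f` lower nodes are joined ("through matchings").

All modules in question are left ideals generated by a multiple of an idempotent. The Specht module
of a partition is generated by its Young symmetrizer `c`, with `c * c = h • c` for the hook product
`h`; twisting, outer tensor products and induction preserve this kind of presentation (`IsPresented`),
and so `wreathSpecht` is presented by an explicit element `wreathElt`. The multiplicity of such a
module in another one is the rank of the generating element (`repMult_eq_finrank`), and on a standard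
module this rank is the rank of the pair of generating elements for `μ` and `λ` on the permutation
module of through matchings (`finrank_cellRestriction`, `repMult_eq_rank`).

The idempotents of the label groups project to one weight. A through matching contributes to this
weight only if its strands join nodes of opposite components, where the components of the lower nodes
count negatively: otherwise some label fixes the matching but has a nontrivial weight. The labels
can then be moved away, which leaves unlabelled matchings acted on by the Young subgroups of
`Σ_n × Σ_f` (`rank_throughMatching`). In particular the strands between the two rows stay in one
component and the arcs join a component `r` to the component `-r`.

What remains is the rank of a product of Young symmetrizers on a permutation module. An integral
matrix `P` with `P * P = α • P` has rank `tr P / α` over every field in which `α ≠ 0`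
(`rank_mul_eq_trace`), so that the rank may be computed in characteristic zero, by counting fixed
points (`rank_youngMatching`). An unlabelled matching amounts to an embedding of the boxes of every
`λ^i` into the boxes of `μ^i`, together with a matching of the remaining boxes; after numbering the
remaining boxes of the component `i` by a set `Y i`, this becomes an average over `∏ i, Perm (Y i)` of
the product of the skew characters of `μ^i / λ^i` and the number of fixed matchings of opposite
elements (`rank_mul_card`). These matchings split into bijections `Y r ≃ Y (-r)`, one for every pair
of opposite components, and perfect matchings of the sets `Y r` with `r = -r`, and the average splits
accordingly. For a pair it is the inner product of two skew characters; for a self-opposite component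
it is the inner product of a skew character with the permutation character on perfect matchings.

The multiplicity of the character of `τ` in the skew character is the Littlewood-Richardson coefficient
(`charInner_skewChar`). That the characters of partitions form an orthonormal basis of the class
functions, and that the permutation character on perfect matchings is the sum of the characters of the
even partitions (`charInner_matchChar`), are proved by counting. Young's lattice gives
`∑ (number of standard tableaux)² = n!`, and the number of standard tableaux of even shape is at least
the number of perfect matchings; restricting Young symmetrizers, respectively fixing one matching by
dominoes, shows that every multiplicity is at least the expected one, and the totals leave no room for
more.
-/

open scoped TensorProduct

namespace CyclotomicBrauer

/-! ### Coefficients in group algebras -/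

section GroupAlgebra

variable {R G : Type*} [CommRing R] [Group G] [Fintype G]

theorem coeff_mul_fintype (x y : MonoidAlgebra R G) (g : G) :
    (x * y).coeff g = ∑ h, x.coeff h * y.coeff (h⁻¹ * g) := by
  rw [MonoidAlgebra.coeff_mul_apply_left, Finsupp.sum_fintype]
  simp

theorem sum_single_coeff (x : MonoidAlgebra R G) :
    ∑ g, MonoidAlgebra.single g (x.coeff g) = x := by
  ext g
  simp [MonoidAlgebra.coeff_sum]

theorem coeff_sum_single (c : G → R) (g : G) :
    (∑ h, MonoidAlgebra.single h (c h) : MonoidAlgebra R G).coeff g = c g := by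
  classical
  simp [MonoidAlgebra.coeff_sum, Finsupp.single_apply]

end GroupAlgebra

/-! ### Sums of distinct natural numbers -/

theorem sum_range_card_le_sum (s : Finset ℕ) : ∑ i ∈ Finset.range s.card, i ≤ ∑ i ∈ s, i := by
  have h : ∑ i ∈ s, i = ∑ i : Fin s.card, s.orderEmbOfFin rfl i := by
    rw [← Finset.sum_coe_sort s]
    exact (Equiv.sum_comp (s.orderIsoOfFin rfl).toEquiv (fun x : s => (x : ℕ))).symm
  rw [h, ← Fin.sum_univ_eq_sum_range (fun i => i)]
  refine Finset.sum_le_sum fun i _ => ?_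
  have key : ∀ j (hj : j < s.card), j ≤ s.orderEmbOfFin rfl ⟨j, hj⟩ := by
    intro j
    induction j with
    | zero => intro _; exact Nat.zero_le _
    | succ j ih =>
      intro hj
      have h1 := ih (by omega)
      have h2 : s.orderEmbOfFin rfl ⟨j, by omega⟩ < s.orderEmbOfFin rfl ⟨j + 1, hj⟩ :=
        (s.orderEmbOfFin rfl).strictMono (Nat.lt_succ_self j)
      omega
  exact key i i.2

theorem eq_range_of_sum_le (s : Finset ℕ) (h : ∑ i ∈ s, i ≤ ∑ i ∈ Finset.range s.card, i) :
    s = Finset.range s.card := by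
  induction hc : s.card generalizing s with
  | zero => simpa using hc
  | succ n ih =>
    have hne : s.Nonempty := Finset.card_pos.1 (by omega)
    set a := s.max' hne with ha
    have ham : a ∈ s := s.max'_mem hne
    have hcard : (s.erase a).card = n := by rw [Finset.card_erase_of_mem ham, hc]; rfl
    have hsum := Finset.sum_erase_add s (fun i => i) ham
    have h1 := sum_range_card_le_sum (s.erase a)
    rw [hcard] at h1
    rw [hc, Finset.sum_range_succ] at h
    have han : n ≤ a := by
      by_contra hlt
      have : s ⊆ Finset.range n := fun x hx =>
        Finset.mem_range.2 (lt_of_le_of_lt (s.le_max' x hx) (by omega))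
      have := Finset.card_le_card this
      rw [Finset.card_range] at this; omega
    have h2 := ih (s.erase a) (by rw [hcard]; omega) hcard
    have h3 : a = n := by
      rw [h2] at hsum; omega
    rw [← Finset.insert_erase ham, h2, h3, Finset.range_add_one]

/-! ### Young symmetrizers -/

section Symmetrizer

/-- The statistic `∑ i λ_i`, which refines the reverse of the dominance order. -/
def rowWeight (lam : YoungDiagram) : ℕ := ∑ c ∈ lam.cells, c.1

/-- A permutation of boxes preserves every row. -/
def IsRowPerm {lam : YoungDiagram} (σ : Equiv.Perm (Box lam)) : Prop := ∀ c, (σ c).1.1 = c.1.1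

/-- A permutation of boxes preserves every column. -/
def IsColPerm {lam : YoungDiagram} (σ : Equiv.Perm (Box lam)) : Prop := ∀ c, (σ c).1.2 = c.1.2

variable {lam mu : YoungDiagram}

theorem IsRowPerm.inv {σ : Equiv.Perm (Box lam)} (h : IsRowPerm σ) : IsRowPerm σ⁻¹ := fun c => by
  have := h (σ⁻¹ c); simpa using this.symm

theorem IsColPerm.inv {σ : Equiv.Perm (Box lam)} (h : IsColPerm σ) : IsColPerm σ⁻¹ := fun c => by
  have := h (σ⁻¹ c); simpa using this.symm

theorem IsRowPerm.mul {σ τ : Equiv.Perm (Box lam)} (h : IsRowPerm σ) (h' : IsRowPerm τ) :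
    IsRowPerm (σ * τ) := fun c => (h _).trans (h' c)

theorem IsColPerm.mul {σ τ : Equiv.Perm (Box lam)} (h : IsColPerm σ) (h' : IsColPerm τ) :
    IsColPerm (σ * τ) := fun c => (h _).trans (h' c)

theorem isRowPerm_mul_right {σ τ : Equiv.Perm (Box lam)} (h : IsRowPerm τ) :
    IsRowPerm (σ * τ) ↔ IsRowPerm σ :=
  ⟨fun h' => by simpa [mul_assoc] using h'.mul h.inv, fun h' => h'.mul h⟩

theorem isColPerm_mul_left {σ τ : Equiv.Perm (Box lam)} (h : IsColPerm σ) :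
    IsColPerm (σ * τ) ↔ IsColPerm τ :=
  ⟨fun h' => by simpa using h.inv.mul h', h.mul⟩

theorem isRowPerm_swap {x y : Box lam} (h : x.1.1 = y.1.1) : IsRowPerm (Equiv.swap x y) := by
  intro c
  rcases eq_or_ne c x with rfl | h1
  · simp [h]
  rcases eq_or_ne c y with rfl | h2
  · simp [h]
  · rw [Equiv.swap_apply_of_ne_of_ne h1 h2]

theorem isColPerm_swap {x y : Box lam} (h : x.1.2 = y.1.2) : IsColPerm (Equiv.swap x y) := by
  intro c
  rcases eq_or_ne c x with rfl | h1
  · simp [h]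
  rcases eq_or_ne c y with rfl | h2
  · simp [h]
  · rw [Equiv.swap_apply_of_ne_of_ne h1 h2]

theorem eq_one_of_row_col {σ : Equiv.Perm (Box lam)} (h : IsRowPerm σ) (h' : IsColPerm σ) :
    σ = 1 := Equiv.ext fun c => Subtype.ext (Prod.ext (h c) (h' c))

/-- Boxes of one row of `λ` going to different columns of `μ` forces `μ` to dominate `λ`; if the row
weights do not exceed, the diagrams agree and the bijection factors through a row permutation. -/
theorem exists_rowPerm_of_bijection (g : Box lam ≃ Box mu)
    (hg : ∀ x y, x.1.1 = y.1.1 → (g x).1.2 = (g y).1.2 → x = y)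
    (hw : rowWeight lam ≤ rowWeight mu) :
    lam = mu ∧ ∃ p : Equiv.Perm (Box lam), IsRowPerm p ∧ ∀ x, (g x).1.2 = (p x).1.2 := by
  classical
  set F : Box lam → ℕ × ℕ := fun x => (x.1.1, (g x).1.2) with hF
  have hFi : Function.Injective F := fun x y h =>
    hg x y (Prod.mk.inj h).1 (Prod.mk.inj h).2
  set D : Finset (ℕ × ℕ) := Finset.univ.image F with hD
  set J : Finset ℕ := mu.cells.image Prod.snd with hJ
  have hDJ : ∀ c ∈ D, c.2 ∈ J := by
    intro c hc
    obtain ⟨x, -, rfl⟩ := Finset.mem_image.1 hc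
    exact Finset.mem_image.2 ⟨_, (g x).2, rfl⟩
  -- the rows that `D` occupies in a given column
  set col : ℕ → Finset ℕ := fun j => (D.filter fun c => c.2 = j).image Prod.fst with hcol
  have hinj : ∀ (E : Finset (ℕ × ℕ)) (j : ℕ),
      Set.InjOn (Prod.fst : ℕ × ℕ → ℕ) (E.filter fun c => c.2 = j) := by
    intro E j c hc d hd h
    have hc := (Finset.mem_filter.1 hc).2
    have hd := (Finset.mem_filter.1 hd).2
    exact Prod.ext h (hc.trans hd.symm)
  have hcolcard : ∀ j, (col j).card = mu.colLen j := by
    intro j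
    rw [hcol, Finset.card_image_of_injOn (hinj _ _), YoungDiagram.colLen_eq_card]
    have h1 : (D.filter fun c => c.2 = j) =
        (Finset.univ.filter fun x : Box lam => (g x).1.2 = j).image F := by
      ext c
      simp only [hD, Finset.mem_filter, Finset.mem_image, Finset.mem_univ, true_and]
      constructor
      · rintro ⟨⟨x, rfl⟩, h⟩; exact ⟨x, h, rfl⟩
      · rintro ⟨x, h, rfl⟩; exact ⟨⟨x, rfl⟩, h⟩
    rw [h1, Finset.card_image_of_injective _ hFi]
    refine Finset.card_bij (fun x _ => (g x).1) ?_ ?_ ?_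
    · intro x hx
      exact YoungDiagram.mem_col_iff.2 ⟨(g x).2, (Finset.mem_filter.1 hx).2⟩
    · intro x _ y _ h
      exact g.injective (Subtype.ext h)
    · intro c hc
      obtain ⟨h1, h2⟩ := YoungDiagram.mem_col_iff.1 hc
      exact ⟨g.symm ⟨c, h1⟩, by simp [h2], by simp⟩
  have hsumD : ∑ j ∈ J, ∑ i ∈ col j, i = rowWeight lam := by
    have h1 : ∑ c ∈ D, c.1 = rowWeight lam := by
      rw [hD, Finset.sum_image (fun x _ y _ h => hFi h), rowWeight]
      exact Finset.sum_coe_sort lam.cells (fun c => c.1)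
    rw [← h1, ← Finset.sum_fiberwise_of_maps_to hDJ]
    refine Finset.sum_congr rfl fun j _ => ?_
    rw [hcol, Finset.sum_image (hinj _ _)]
  have hmucol : ∀ j, (mu.cells.filter fun c => c.2 = j).image Prod.fst
      = Finset.range (mu.colLen j) := by
    intro j
    ext i
    simp only [Finset.mem_image, Finset.mem_filter, Finset.mem_range, Prod.exists,
      ← YoungDiagram.mem_iff_lt_colLen, YoungDiagram.mem_cells]
    constructor
    · rintro ⟨a, b, ⟨h1, rfl⟩, rfl⟩; exact h1
    · intro h; exact ⟨i, j, ⟨h, rfl⟩, rfl⟩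
  have hsummu : ∑ j ∈ J, ∑ i ∈ Finset.range (mu.colLen j), i = rowWeight mu := by
    rw [rowWeight, ← Finset.sum_fiberwise_of_maps_to (t := J)
      (fun c hc => Finset.mem_image_of_mem Prod.snd hc)]
    refine Finset.sum_congr rfl fun j _ => ?_
    rw [← hmucol, Finset.sum_image (hinj _ _)]
  have hle : ∀ j ∈ J, ∑ i ∈ Finset.range (mu.colLen j), i ≤ ∑ i ∈ col j, i := fun j _ => by
    rw [← hcolcard]; exact sum_range_card_le_sum _
  have heq := (Finset.sum_eq_sum_iff_of_le hle).1
    (le_antisymm (Finset.sum_le_sum hle) (by rw [hsumD, hsummu]; exact hw))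
  have hcoleq : ∀ j ∈ J, col j = Finset.range (mu.colLen j) := fun j hj => by
    rw [← hcolcard]
    exact eq_range_of_sum_le _ (by rw [hcolcard]; exact (heq j hj).ge)
  have hDmem : ∀ c, c ∈ D → c ∈ mu.cells := by
    rintro ⟨i, j⟩ hc
    have h1 : i ∈ col j := Finset.mem_image.2 ⟨(i, j), Finset.mem_filter.2 ⟨hc, rfl⟩, rfl⟩
    rw [hcoleq j (hDJ _ hc), Finset.mem_range, ← YoungDiagram.mem_iff_lt_colLen] at h1
    exact h1
  have hDcard : D.card = Fintype.card (Box lam) := by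
    rw [hD, Finset.card_image_of_injective _ hFi, Finset.card_univ]
  have hDeq : D = mu.cells := Finset.eq_of_subset_of_card_le hDmem (by
    rw [hDcard, Fintype.card_congr g]; simp)
  -- equal row lengths
  have hrow : ∀ i, lam.rowLen i = mu.rowLen i := by
    intro i
    rw [YoungDiagram.rowLen_eq_card, YoungDiagram.rowLen_eq_card]
    refine Finset.card_bij (fun c hc => F ⟨c, (YoungDiagram.mem_row_iff.1 hc).1⟩) ?_ ?_ ?_
    · intro c hc
      refine YoungDiagram.mem_row_iff.2 ⟨?_, (YoungDiagram.mem_row_iff.1 hc).2⟩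
      exact hDmem _ (Finset.mem_image_of_mem _ (Finset.mem_univ _))
    · intro c _ d _ h
      exact congrArg Subtype.val (hFi h)
    · intro c hc
      obtain ⟨h1, h2⟩ := YoungDiagram.mem_row_iff.1 hc
      have h3 : c ∈ D := by rw [hDeq]; exact h1
      obtain ⟨x, -, rfl⟩ := Finset.mem_image.1 h3
      exact ⟨x.1, YoungDiagram.mem_row_iff.2 ⟨x.2, h2⟩, rfl⟩
  have hlm : lam = mu := by
    ext ⟨i, j⟩
    rw [YoungDiagram.mem_cells, YoungDiagram.mem_cells, YoungDiagram.mem_iff_lt_rowLen,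
      YoungDiagram.mem_iff_lt_rowLen, hrow]
  subst hlm
  refine ⟨rfl, Equiv.ofBijective (fun x => ⟨F x, hDmem _
    (Finset.mem_image_of_mem _ (Finset.mem_univ x))⟩) (Finite.injective_iff_bijective.1
      fun x y h => hFi (congrArg Subtype.val h)), fun _ => rfl, fun _ => rfl⟩

/-- A permutation that is not of the form `q p` with `p` a row and `q` a column permutation sends two
boxes of one row to one column. -/
theorem exists_pair_of_not_col_row (g : Equiv.Perm (Box lam))
    (hg : ¬ ∃ q p, IsColPerm q ∧ IsRowPerm p ∧ g = q * p) :
    ∃ x y, x ≠ y ∧ x.1.1 = y.1.1 ∧ (g x).1.2 = (g y).1.2 := by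
  by_contra hcon
  push Not at hcon
  obtain ⟨-, p, hp, h⟩ := exists_rowPerm_of_bijection g
    (fun x y h1 h2 => by_contra fun hne => hcon x y hne h1 h2) le_rfl
  refine hg ⟨g * p⁻¹, p, fun c => ?_, hp, by simp⟩
  have := h (p⁻¹ c)
  simpa using this

variable (R : Type*) [CommRing R]

/-- The Young symmetrizer of `λ`, the generator of the Specht module. -/
noncomputable def youngSym (lam : YoungDiagram) : MonoidAlgebra R (Equiv.Perm (Box lam)) :=
  colAltSum R lam * rowSum R lam

open Classical in
theorem coeff_rowSum (σ : Equiv.Perm (Box lam)) :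
    (rowSum R lam).coeff σ = if IsRowPerm σ then 1 else 0 := by
  simp only [rowSum, MonoidAlgebra.coeff_sum, MonoidAlgebra.coeff_single, Finsupp.coe_finsetSum,
    Finset.sum_apply, Finsupp.single_apply, IsRowPerm]
  rw [Finset.sum_ite_eq']
  simp

open Classical in
theorem coeff_colAltSum (σ : Equiv.Perm (Box lam)) :
    (colAltSum R lam).coeff σ = if IsColPerm σ then ((Equiv.Perm.sign σ : ℤ) : R) else 0 := by
  simp only [colAltSum, MonoidAlgebra.coeff_sum, MonoidAlgebra.coeff_single,
    Finsupp.coe_finsetSum, Finset.sum_apply, Finsupp.single_apply, IsColPerm]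
  rw [Finset.sum_ite_eq']
  simp

variable {R}

theorem rowSum_mul_single {p : Equiv.Perm (Box lam)} (hp : IsRowPerm p) :
    rowSum R lam * MonoidAlgebra.single p 1 = rowSum R lam := by
  ext g
  rw [MonoidAlgebra.coeff_mul_single_apply, coeff_rowSum, coeff_rowSum, mul_one,
    isRowPerm_mul_right hp.inv]

theorem single_mul_colAltSum {q : Equiv.Perm (Box lam)} (hq : IsColPerm q) :
    MonoidAlgebra.single q 1 * colAltSum R lam =
      ((Equiv.Perm.sign q : ℤ) : R) • colAltSum R lam := by
  ext g
  rw [MonoidAlgebra.coeff_single_mul_apply, coeff_colAltSum, MonoidAlgebra.coeff_smul_apply,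
    coeff_colAltSum, one_mul, isColPerm_mul_left hq.inv]
  split_ifs <;> simp

theorem coeff_one_youngSym : (youngSym R lam).coeff 1 = 1 := by
  classical
  rw [youngSym, coeff_mul_fintype, Finset.sum_eq_single 1]
  · have h1 : IsColPerm (1 : Equiv.Perm (Box lam)) := fun _ => rfl
    have h2 : IsRowPerm (1⁻¹ * 1 : Equiv.Perm (Box lam)) := fun _ => rfl
    rw [coeff_colAltSum, coeff_rowSum, if_pos h1, if_pos h2]; simp
  · intro q _ hq
    rw [coeff_colAltSum, coeff_rowSum]
    by_cases h : IsColPerm q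
    · have h1 : ¬ IsRowPerm (q⁻¹ * 1) := fun h' =>
        hq (eq_one_of_row_col (by simpa using h'.inv) h)
      rw [if_neg h1, mul_zero]
    · rw [if_neg h, zero_mul]
  · simp

theorem youngSym_mul_single {p : Equiv.Perm (Box lam)} (hp : IsRowPerm p) :
    youngSym R lam * MonoidAlgebra.single p 1 = youngSym R lam := by
  rw [youngSym, mul_assoc, rowSum_mul_single hp]

theorem single_mul_youngSym {q : Equiv.Perm (Box lam)} (hq : IsColPerm q) :
    MonoidAlgebra.single q 1 * youngSym R lam = ((Equiv.Perm.sign q : ℤ) : R) • youngSym R lam := by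
  rw [youngSym, ← mul_assoc, single_mul_colAltSum hq, smul_mul_assoc]

/-- Von Neumann's lemma: the Young symmetrizer is determined up to a scalar by its behaviour under
row permutations on the right and column permutations on the left. -/
theorem eq_smul_youngSym (h2 : ∀ r : R, r + r = 0 → r = 0)
    (y : MonoidAlgebra R (Equiv.Perm (Box lam)))
    (hr : ∀ p, IsRowPerm p → y * MonoidAlgebra.single p 1 = y)
    (hc : ∀ q, IsColPerm q →
      MonoidAlgebra.single q 1 * y = ((Equiv.Perm.sign q : ℤ) : R) • y) :
    y = y.coeff 1 • youngSym R lam := by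
  have key : ∀ y : MonoidAlgebra R (Equiv.Perm (Box lam)),
      (∀ p, IsRowPerm p → y * MonoidAlgebra.single p 1 = y) →
      (∀ q, IsColPerm q →
        MonoidAlgebra.single q 1 * y = ((Equiv.Perm.sign q : ℤ) : R) • y) →
      y.coeff 1 = 0 → y = 0 := by
    intro y hr hc h1
    have hr' : ∀ g p, IsRowPerm p → y.coeff (g * p) = y.coeff g := by
      intro g p hp
      have := congrArg (fun z => z.coeff g) (hr p⁻¹ hp.inv)
      simpa [MonoidAlgebra.coeff_mul_single_apply] using this
    have hc' : ∀ g q, IsColPerm q → y.coeff (q * g) = ((Equiv.Perm.sign q : ℤ) : R) * y.coeff g := by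
      intro g q hq
      have := congrArg (fun z => z.coeff g) (hc q⁻¹ hq.inv)
      simpa [MonoidAlgebra.coeff_single_mul_apply] using this
    ext g
    rw [MonoidAlgebra.coeff_zero, Finsupp.zero_apply]
    by_cases hg : ∃ q p, IsColPerm q ∧ IsRowPerm p ∧ g = q * p
    · obtain ⟨q, p, hq, hp, rfl⟩ := hg
      have := hc' 1 q hq
      rw [hr' _ _ hp]
      rw [mul_one, h1, mul_zero] at this
      exact this
    · obtain ⟨x, z, hne, hrow, hcol⟩ := exists_pair_of_not_col_row g hg
      have e1 := hr' g _ (isRowPerm_swap hrow)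
      have e2 : g * Equiv.swap x z = Equiv.swap (g x) (g z) * g := by
        rw [Equiv.mul_swap_eq_swap_mul]
      rw [e2, hc' _ _ (isColPerm_swap hcol), Equiv.Perm.sign_swap
        (fun h => hne (g.injective h))] at e1
      refine h2 _ ?_
      have e3 : -y.coeff g = y.coeff g := by simpa using e1
      rw [← eq_neg_iff_add_eq_zero]; exact e3.symm
  have := key (y - y.coeff 1 • youngSym R lam) ?_ ?_ ?_
  · exact sub_eq_zero.1 this
  · intro p hp
    rw [sub_mul, hr p hp, smul_mul_assoc, youngSym_mul_single hp]
  · intro q hq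
    rw [mul_sub, hc q hq, mul_smul_comm, single_mul_youngSym hq, smul_sub, smul_comm]
  · simp [coeff_one_youngSym]

theorem youngSym_mul_mul_int (x : MonoidAlgebra ℤ (Equiv.Perm (Box lam))) :
    youngSym ℤ lam * x * youngSym ℤ lam =
      (youngSym ℤ lam * x * youngSym ℤ lam).coeff 1 • youngSym ℤ lam := by
  apply eq_smul_youngSym
  · intro r h; omega
  · intro p hp
    rw [mul_assoc, youngSym_mul_single hp]
  · intro q hq
    rw [← mul_assoc, ← mul_assoc, single_mul_youngSym hq, smul_mul_assoc, smul_mul_assoc]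

theorem map_youngSym {S : Type*} [CommRing S] (f : R →+* S) :
    MonoidAlgebra.mapRingHom (Equiv.Perm (Box lam)) f (youngSym R lam) = youngSym S lam := by
  rw [youngSym, map_mul, youngSym]
  congr 1
  · ext g
    rw [MonoidAlgebra.coeff_mapRingHom, coeff_colAltSum, coeff_colAltSum]
    split_ifs <;> simp
  · ext g
    rw [MonoidAlgebra.coeff_mapRingHom, coeff_rowSum, coeff_rowSum]
    split_ifs <;> simp

/-- `c x c` is a multiple of `c`, over every commutative ring. -/
theorem exists_youngSym_mul_mul (x : MonoidAlgebra R (Equiv.Perm (Box lam))) :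
    ∃ r : R, youngSym R lam * x * youngSym R lam = r • youngSym R lam := by
  induction x using MonoidAlgebra.induction_on with
  | of g =>
    refine ⟨(((youngSym ℤ lam * MonoidAlgebra.of ℤ _ g * youngSym ℤ lam).coeff 1 : ℤ) : R), ?_⟩
    have := congrArg (MonoidAlgebra.mapRingHom (Equiv.Perm (Box lam)) (Int.castRingHom R))
      (youngSym_mul_mul_int (lam := lam) (MonoidAlgebra.of ℤ _ g))
    rw [map_mul, map_mul, map_youngSym, map_zsmul, map_youngSym] at this
    rw [Int.cast_smul_eq_zsmul, ← this]
    simp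
  | add x y hx hy =>
    obtain ⟨r, hr⟩ := hx
    obtain ⟨s, hs⟩ := hy
    exact ⟨r + s, by rw [mul_add, add_mul, hr, hs, add_smul]⟩
  | smul a x hx =>
    obtain ⟨r, hr⟩ := hx
    exact ⟨a * r, by rw [mul_smul_comm, smul_mul_assoc, hr, mul_smul]⟩

/-- The integer `α` with `c ^ 2 = α c`, the product of the hook lengths of `λ`. -/
noncomputable def hookProd (lam : YoungDiagram) : ℤ :=
  (youngSym ℤ lam * youngSym ℤ lam).coeff 1

variable (R lam) in
/-- The Young symmetrizer is the hook product times an idempotent. -/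
theorem youngSym_mul_self :
    youngSym R lam * youngSym R lam = (hookProd lam : R) • youngSym R lam := by
  have h := youngSym_mul_mul_int (lam := lam) 1
  rw [mul_one] at h
  have := congrArg (MonoidAlgebra.mapRingHom (Equiv.Perm (Box lam)) (Int.castRingHom R)) h
  rw [map_mul, map_youngSym, map_zsmul, map_youngSym] at this
  rw [Int.cast_smul_eq_zsmul, this, hookProd]

end Symmetrizer

/-! ### Ranks and traces of multiples of idempotents -/

section Rank

open Polynomial

variable {K V : Type*} [Field K] [AddCommGroup V] [Module K V] [FiniteDimensional K V]

theorem isProj_range_of_sq {f : Module.End K V} {α : K} (hα : α ≠ 0) (hf : f * f = α • f) :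
    LinearMap.IsProj (LinearMap.range f) (α⁻¹ • f) := by
  refine ⟨fun x => ⟨α⁻¹ • x, by simp⟩, ?_⟩
  rintro _ ⟨x, rfl⟩
  have : f (f x) = α • f x := LinearMap.congr_fun hf x
  simp [this, smul_smul, inv_mul_cancel₀ hα]

theorem trace_eq_of_sq {f : Module.End K V} {α : K} (hα : α ≠ 0) (hf : f * f = α • f) :
    LinearMap.trace K V f = α * Module.finrank K (LinearMap.range f) := by
  have := (isProj_range_of_sq hα hf).trace
  rw [map_smul, smul_eq_mul] at this
  rw [← this, mul_inv_cancel_left₀ hα]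

/-- A nonzero multiple of an idempotent is diagonalizable with two eigenvalues. -/
theorem charpoly_eq_of_sq {f : Module.End K V} {α : K} (hα : α ≠ 0) (hf : f * f = α • f) :
    f.charpoly = (X - C α) ^ Module.finrank K (LinearMap.range f) *
      X ^ Module.finrank K (LinearMap.ker (α⁻¹ • f)) := by
  have h := isProj_range_of_sq hα hf
  set e := (LinearMap.range f).prodEquivOfIsCompl _ h.isCompl with he
  have h1 : f = e.conj (LinearMap.prodMap (α • LinearMap.id) 0) := by
    have h2 : LinearMap.prodMap (α • LinearMap.id) 0 =
        α • (LinearMap.prodMap LinearMap.id 0 : Module.End K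
          (LinearMap.range f × LinearMap.ker (α⁻¹ • f))) := by ext <;> simp
    rw [h2, map_smul, ← h.eq_conj_prodMap, smul_smul, mul_inv_cancel₀ hα, one_smul]
  have h3 : (α • LinearMap.id : Module.End K (LinearMap.range f)).charpoly =
      (X - C α) ^ Module.finrank K (LinearMap.range f) := by
    let b := Module.finBasis K (LinearMap.range f)
    have : (α • LinearMap.id : Module.End K (LinearMap.range f)) =
        Matrix.toLin b b (Matrix.diagonal fun _ => α) := by
      rw [← Matrix.smul_one_eq_diagonal, map_smul, Matrix.toLin_one]
    rw [this, Matrix.charpoly_toLin, Matrix.charpoly_diagonal]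
    simp
  conv_lhs => rw [h1]
  rw [LinearEquiv.charpoly_conj, LinearMap.charpoly_prodMap, h3, LinearMap.charpoly_zero]

theorem rootMultiplicity_charpoly_of_sq {f : Module.End K V} {α : K} (hα : α ≠ 0)
    (hf : f * f = α • f) :
    f.charpoly.rootMultiplicity α = Module.finrank K (LinearMap.range f) := by
  rw [charpoly_eq_of_sq hα hf, rootMultiplicity_mul, rootMultiplicity_X_sub_C_pow,
    rootMultiplicity_eq_zero, add_zero]
  · simp [hα]
  · exact mul_ne_zero (pow_ne_zero _ (X_sub_C_ne_zero _)) (pow_ne_zero _ X_ne_zero)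

variable {Ω : Type*} [Fintype Ω] [DecidableEq Ω]

theorem toLin'_map_sq (P : Matrix Ω Ω ℤ) {α : ℤ} (hP : P * P = α • P) :
    Matrix.toLin' (P.map (Int.castRingHom K)) * Matrix.toLin' (P.map (Int.castRingHom K)) =
      (α : K) • Matrix.toLin' (P.map (Int.castRingHom K)) := by
  rw [Module.End.mul_eq_comp, ← Matrix.toLin'_mul, ← map_smul, ← Matrix.map_mul, hP]
  congr 1
  ext; simp [-zsmul_eq_mul]

theorem charpoly_map_of_sq (P : Matrix Ω Ω ℤ) {α : ℤ} (hα : (α : K) ≠ 0) (hP : P * P = α • P) :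
    ((P.map (Int.castRingHom K)).charpoly).rootMultiplicity (α : K) =
        (P.map (Int.castRingHom K)).rank ∧
      ∃ s, (P.map (Int.castRingHom K)).charpoly =
        (X - C (α : K)) ^ (P.map (Int.castRingHom K)).rank * X ^ s := by
  have hf := toLin'_map_sq (K := K) P hP
  have hr : (P.map (Int.castRingHom K)).rank =
      Module.finrank K (LinearMap.range (Matrix.toLin' (P.map (Int.castRingHom K)))) := rfl
  rw [← Matrix.charpoly_toLin', hr]
  exact ⟨rootMultiplicity_charpoly_of_sq hα hf, _, charpoly_eq_of_sq hα hf⟩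

/-- An integral multiple of an idempotent has the same rank over every field in which the multiple
does not vanish, and there this rank is computed by the trace. -/
theorem rank_mul_eq_trace (P : Matrix Ω Ω ℤ) {α : ℤ} (hα : (α : K) ≠ 0) (hP : P * P = α • P) :
    ((P.map (Int.castRingHom K)).rank : ℤ) * α = P.trace := by
  have hαZ : α ≠ 0 := by rintro rfl; simp at hα
  have hαQ : (α : ℚ) ≠ 0 := by exact_mod_cast hαZ
  obtain ⟨hQ, s, hs⟩ := charpoly_map_of_sq P hαQ hP
  set r := (P.map (Int.castRingHom ℚ)).rank with hr
  -- the characteristic polynomial over the integers determines the multiplicity of `α` over `K`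
  have hZ : P.charpoly = (X - C α) ^ r * X ^ s := by
    apply Polynomial.map_injective (Int.castRingHom ℚ) Int.cast_injective
    rw [← Matrix.charpoly_map, hs]
    simp
  have hK : (P.map (Int.castRingHom K)).rank = r := by
    rw [← (charpoly_map_of_sq P hα hP).1, Matrix.charpoly_map, hZ]
    have hm : (((X - C α) ^ r * X ^ s : ℤ[X])).map (Int.castRingHom K) =
        (X - C (α : K)) ^ r * X ^ s := by simp
    rw [hm]
    rw [rootMultiplicity_mul, rootMultiplicity_X_sub_C_pow, rootMultiplicity_eq_zero, add_zero]
    · simp [hα]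
    · exact mul_ne_zero (pow_ne_zero _ (X_sub_C_ne_zero _)) (pow_ne_zero _ X_ne_zero)
  rw [hK]
  have hf := toLin'_map_sq (K := ℚ) P hP
  have ht := trace_eq_of_sq hαQ hf
  rw [Matrix.trace_toLin'_eq] at ht
  have h1 : (P.map (Int.castRingHom ℚ)).trace = ((P.trace : ℤ) : ℚ) := by
    simp [Matrix.trace]
  have h2 : Module.finrank ℚ (LinearMap.range (Matrix.toLin' (P.map (Int.castRingHom ℚ)))) = r :=
    rfl
  rw [h1, h2, mul_comm] at ht
  exact_mod_cast ht.symm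

end Rank

/-! ### Permutation modules -/

section PermMat

variable (R : Type*) [CommRing R] {G : Type*} [Group G] (Ω : Type*) [Fintype Ω] [DecidableEq Ω]
  [MulAction G Ω]

/-- The action of the group algebra on the permutation module of a finite `G`-set, by matrices. -/
noncomputable def permMat : MonoidAlgebra R G →ₐ[R] Matrix Ω Ω R :=
  MonoidAlgebra.lift R (Matrix Ω Ω R) G
    { toFun := fun g => Matrix.of fun a b => if g • b = a then 1 else 0
      map_one' := by ext a b; simp [Matrix.one_apply, eq_comm]
      map_mul' := fun g h => by
        ext a b
        simp [Matrix.mul_apply, mul_smul] }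

variable {R}

theorem permMat_single (g : G) (r : R) :
    permMat R Ω (MonoidAlgebra.single g r) = Matrix.of fun a b => if g • b = a then r else 0 := by
  ext a b
  simp [permMat, MonoidAlgebra.lift_single]

variable [Fintype G]

theorem permMat_eq_sum (x : MonoidAlgebra R G) (a b : Ω) :
    permMat R Ω x a b = ∑ g, if g • b = a then x.coeff g else 0 := by
  conv_lhs => rw [← sum_single_coeff x, map_sum]
  simp only [permMat_single, Matrix.sum_apply, Matrix.of_apply]

theorem trace_permMat (x : MonoidAlgebra R G) :
    (permMat R Ω x).trace = ∑ g, x.coeff g * (Fintype.card {a : Ω // g • a = a} : R) := by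
  simp only [Matrix.trace, Matrix.diag_apply, permMat_eq_sum]
  rw [Finset.sum_comm]
  refine Finset.sum_congr rfl fun g _ => ?_
  rw [Finset.sum_ite, Finset.sum_const_zero, add_zero, Finset.sum_const, nsmul_eq_mul,
    Fintype.card_subtype, mul_comm]

theorem map_permMat {S : Type*} [CommRing S] (f : R →+* S) (x : MonoidAlgebra R G) :
    permMat S Ω (MonoidAlgebra.mapRingHom G f x) = (permMat R Ω x).map f := by
  ext a b
  rw [Matrix.map_apply, permMat_eq_sum, permMat_eq_sum, map_sum]
  refine Finset.sum_congr rfl fun g _ => ?_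
  split_ifs <;> simp

/-- The rank of a multiple of an idempotent of the group algebra on a permutation module, over any field in
which the multiple does not vanish, by counting fixed points. -/
theorem rank_permMat_mul_eq {K : Type*} [Field K] (x : MonoidAlgebra ℤ G) {α : ℤ}
    (hα : (α : K) ≠ 0) (hx : x * x = α • x) :
    ((permMat K Ω (MonoidAlgebra.mapRingHom G (Int.castRingHom K) x)).rank : ℤ) * α =
      ∑ g, x.coeff g * (Fintype.card {a : Ω // g • a = a} : ℤ) := by
  rw [map_permMat, rank_mul_eq_trace _ hα (by rw [← map_mul, hx, map_zsmul]), trace_permMat]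

end PermMat

/-! ### Inversion and outer products in group algebras -/

section Products

variable {R : Type*} [CommRing R] {G H : Type*} [Group G] [Group H] [Fintype G] [Fintype H]

/-- The linear extension of inversion. -/
noncomputable def invElt (x : MonoidAlgebra R G) : MonoidAlgebra R G :=
  ∑ g, MonoidAlgebra.single g (x.coeff g⁻¹)

@[simp] theorem coeff_invElt (x : MonoidAlgebra R G) (g : G) :
    (invElt x).coeff g = x.coeff g⁻¹ := coeff_sum_single _ g

theorem invElt_mul (x y : MonoidAlgebra R G) : invElt (x * y) = invElt y * invElt x := by
  ext g
  rw [coeff_invElt, coeff_mul_fintype, coeff_mul_fintype]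
  refine Fintype.sum_equiv ((Equiv.mulLeft g).trans (Equiv.refl _)) _ _ fun h => ?_
  simp [mul_comm]

theorem invElt_smul (r : R) (x : MonoidAlgebra R G) : invElt (r • x) = r • invElt x := by
  ext g; simp

/-- The outer product of elements of two group algebras. -/
noncomputable def prodElt (x : MonoidAlgebra R G) (y : MonoidAlgebra R H) :
    MonoidAlgebra R (G × H) := ∑ g, MonoidAlgebra.single g (x.coeff g.1 * y.coeff g.2)

@[simp] theorem coeff_prodElt (x : MonoidAlgebra R G) (y : MonoidAlgebra R H) (g : G × H) :
    (prodElt x y).coeff g = x.coeff g.1 * y.coeff g.2 := coeff_sum_single _ g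

theorem prodElt_mul (x x' : MonoidAlgebra R G) (y y' : MonoidAlgebra R H) :
    prodElt x y * prodElt x' y' = prodElt (x * x') (y * y') := by
  ext g
  rw [coeff_mul_fintype, coeff_prodElt, coeff_mul_fintype, coeff_mul_fintype, Finset.sum_mul_sum,
    Fintype.sum_prod_type]
  refine Finset.sum_congr rfl fun a _ => Finset.sum_congr rfl fun b _ => ?_
  simp only [coeff_prodElt, Prod.fst_mul, Prod.snd_mul, Prod.fst_inv, Prod.snd_inv]
  ring

theorem prodElt_smul (r s : R) (x : MonoidAlgebra R G) (y : MonoidAlgebra R H) :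
    prodElt (r • x) (s • y) = (r * s) • prodElt x y := by
  ext g; simp; ring

theorem map_prodElt {S : Type*} [CommRing S] (f : R →+* S) (x : MonoidAlgebra R G)
    (y : MonoidAlgebra R H) :
    MonoidAlgebra.mapRingHom (G × H) f (prodElt x y) =
      prodElt (MonoidAlgebra.mapRingHom G f x) (MonoidAlgebra.mapRingHom H f y) := by
  ext g; simp

theorem map_invElt {S : Type*} [CommRing S] (f : R →+* S) (x : MonoidAlgebra R G) :
    MonoidAlgebra.mapRingHom G f (invElt x) = invElt (MonoidAlgebra.mapRingHom G f x) := by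
  ext g; simp

variable {ι : Type*} [Fintype ι] [DecidableEq ι] {Γ : ι → Type*} [∀ i, Group (Γ i)]
  [∀ i, Fintype (Γ i)]

/-- The outer product of a family of elements of group algebras. -/
noncomputable def piElt (x : ∀ i, MonoidAlgebra R (Γ i)) : MonoidAlgebra R (∀ i, Γ i) :=
  ∑ g, MonoidAlgebra.single g (∏ i, (x i).coeff (g i))

@[simp] theorem coeff_piElt (x : ∀ i, MonoidAlgebra R (Γ i)) (g : ∀ i, Γ i) :
    (piElt x).coeff g = ∏ i, (x i).coeff (g i) := coeff_sum_single _ g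

theorem piElt_mul (x y : ∀ i, MonoidAlgebra R (Γ i)) :
    piElt x * piElt y = piElt fun i => x i * y i := by
  ext g
  rw [coeff_mul_fintype, coeff_piElt]
  simp only [coeff_mul_fintype, coeff_piElt]
  rw [Finset.prod_univ_sum, Fintype.piFinset_univ]
  refine Finset.sum_congr rfl fun h _ => ?_
  rw [← Finset.prod_mul_distrib]
  rfl

theorem piElt_smul (r : ι → R) (x : ∀ i, MonoidAlgebra R (Γ i)) :
    piElt (fun i => r i • x i) = (∏ i, r i) • piElt x := by
  ext g; simp [Finset.prod_mul_distrib]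

theorem map_piElt {S : Type*} [CommRing S] (f : R →+* S) (x : ∀ i, MonoidAlgebra R (Γ i)) :
    MonoidAlgebra.mapRingHom (∀ i, Γ i) f (piElt x) =
      piElt fun i => MonoidAlgebra.mapRingHom (Γ i) f (x i) := by
  ext g; simp

end Products

/-! ### Orthogonality of Young symmetrizers -/

section Transport

variable {R : Type*} [CommRing R] {X Y : Type*} [Fintype X] [DecidableEq X] [Fintype Y]
  [DecidableEq Y]

/-- Transport of elements of the group algebra of a symmetric group along a bijection. -/
noncomputable def transp (e : X ≃ Y) :
    MonoidAlgebra R (Equiv.Perm X) ≃ₐ[R] MonoidAlgebra R (Equiv.Perm Y) :=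
  MonoidAlgebra.domCongr R R e.permCongrHom

@[simp] theorem coeff_transp (e : X ≃ Y) (x : MonoidAlgebra R (Equiv.Perm X)) (g : Equiv.Perm Y) :
    (transp e x).coeff g = x.coeff (e.symm.permCongr g) := by
  rw [transp, MonoidAlgebra.coeff_domCongr]; rfl

theorem transp_single (e : X ≃ Y) (g : Equiv.Perm X) (r : R) :
    transp e (MonoidAlgebra.single g r) = MonoidAlgebra.single (e.permCongr g) r := by
  rw [transp, MonoidAlgebra.domCongr_single]; rfl

end Transport

section Orthogonality

variable {lam mu : YoungDiagram} {R : Type*} [CommRing R]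

/-- Some two boxes are in one row of `λ` and one column of `μ`, and their transposition changes the sign
of the product. -/
theorem rowSum_mul_transp_colAltSum (h2 : ∀ r : R, r + r = 0 → r = 0) (e : Box mu ≃ Box lam)
    (hne : lam ≠ mu) (hw : rowWeight lam ≤ rowWeight mu) :
    rowSum R lam * transp e (colAltSum R mu) = 0 := by
  have : ∃ x y, x ≠ y ∧ x.1.1 = y.1.1 ∧ (e.symm x).1.2 = (e.symm y).1.2 := by
    by_contra hcon
    push Not at hcon
    exact hne (exists_rowPerm_of_bijection e.symm
      (fun x y h1 h2 => by_contra fun hne => hcon x y hne h1 h2) hw).1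
  obtain ⟨x, y, hxy, hrow, hcol⟩ := this
  have h1 : MonoidAlgebra.single (Equiv.swap x y) 1 * transp e (colAltSum R mu) =
      - transp e (colAltSum R mu) := by
    have h3 : e.permCongr (Equiv.swap (e.symm x) (e.symm y)) = Equiv.swap x y := by
      ext1 z
      simp [Equiv.permCongr_apply, Equiv.swap_apply_def, apply_ite e]
    rw [← h3, ← transp_single, ← map_mul, single_mul_colAltSum (isColPerm_swap hcol),
      Equiv.Perm.sign_swap (fun h => hxy (e.symm.injective h))]
    simp
  have h3 : rowSum R lam * transp e (colAltSum R mu) =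
      - (rowSum R lam * transp e (colAltSum R mu)) := by
    conv_lhs => rw [← rowSum_mul_single (isRowPerm_swap hrow), mul_assoc, h1, mul_neg]
  ext g
  refine h2 _ ?_
  have := congrArg (fun z => z.coeff g) h3
  simp only [MonoidAlgebra.coeff_neg, Finsupp.neg_apply] at this
  rw [← eq_neg_iff_add_eq_zero]; exact this

theorem youngSym_mul_transp_of_le (e : Box mu ≃ Box lam)
    (hne : lam ≠ mu) (hw : rowWeight lam ≤ rowWeight mu) :
    youngSym ℚ lam * transp e (youngSym ℚ mu) = 0 := by
  rw [youngSym, youngSym, map_mul, mul_assoc, ← mul_assoc (rowSum ℚ lam),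
    rowSum_mul_transp_colAltSum (fun r h => by linarith) e hne hw, zero_mul, mul_zero]

/-- Positivity of `y y*`: if `v x u = 0` for all `x`, then `u v = 0`. -/
theorem mul_eq_zero_of_forall {G : Type*} [Group G] [Fintype G] (u v : MonoidAlgebra ℚ G)
    (h : ∀ x, v * x * u = 0) : u * v = 0 := by
  have pos : ∀ y : MonoidAlgebra ℚ G, (y * invElt y).coeff 1 = 0 → y = 0 := by
    intro y hy
    rw [coeff_mul_fintype] at hy
    simp only [coeff_invElt, mul_one, inv_inv] at hy
    have := (Finset.sum_eq_zero_iff_of_nonneg (fun g _ => mul_self_nonneg (y.coeff g))).1 hy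
    ext g
    simpa using this g (Finset.mem_univ g)
  set y := u * v with hy
  have hinv : ∀ z : MonoidAlgebra ℚ G, invElt (invElt z) = z := fun z => by ext g; simp
  apply pos
  have hh : invElt (y * invElt y) = y * invElt y := by rw [invElt_mul, hinv]
  have : y * invElt y = 0 := by
    apply pos
    rw [hh]
    have : y * invElt y * (y * invElt y) = u * (v * invElt y * u) * v * invElt y := by
      conv_lhs => rw [hy]
      simp only [mul_assoc]
      rw [hy]
    rw [this, h]; simp
  rw [this]; simp

/-- If the row weights are in the other order, the product vanishes with its factors exchanged, and
`mul_eq_zero_of_forall` exchanges them again. -/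
theorem youngSym_mul_transp_of_ne (e : Box mu ≃ Box lam) (hne : lam ≠ mu) :
    youngSym ℚ lam * transp e (youngSym ℚ mu) = 0 := by
  rcases le_or_gt (rowWeight lam) (rowWeight mu) with hw | hw
  · exact youngSym_mul_transp_of_le e hne hw
  · apply mul_eq_zero_of_forall
    intro x
    induction x using MonoidAlgebra.induction_on with
    | of g =>
      -- move `g` past the second symmetrizer, which changes the bijection between the boxes
      have h1 : transp e (youngSym ℚ mu) * MonoidAlgebra.of ℚ _ g =
          MonoidAlgebra.of ℚ _ g * transp (e.trans g⁻¹) (youngSym ℚ mu) := by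
        ext z
        simp only [MonoidAlgebra.of_apply, MonoidAlgebra.coeff_mul_single_apply,
          MonoidAlgebra.coeff_single_mul_apply, coeff_transp, mul_one, one_mul]
        congr 1
        ext1 w
        simp [Equiv.permCongr_apply, Equiv.Perm.inv_def]
      have h2 := youngSym_mul_transp_of_le (e.trans g⁻¹).symm hne.symm hw.le
      have h3 := congrArg (transp (e.trans g⁻¹)) h2
      rw [map_mul, map_zero] at h3
      have h4 : transp (e.trans g⁻¹) (transp (e.trans g⁻¹).symm (youngSym ℚ lam)) =
          youngSym ℚ lam := by
        ext z; simp only [coeff_transp]; congr 1; ext1 w; simp [Equiv.permCongr_apply]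
      rw [h4] at h3
      rw [h1, mul_assoc, h3, mul_zero]
    | add x y hx hy => rw [mul_add, add_mul, hx, hy, add_zero]
    | smul a x hx => rw [mul_smul_comm, smul_mul_assoc, hx, smul_zero]

end Orthogonality

/-! ### Hook products and degrees -/

section Degree

variable (lam : YoungDiagram)

theorem card_box : Fintype.card (Box lam) = lam.card := by simp

theorem coeff_youngSym_cast (R : Type*) [CommRing R] (σ : Equiv.Perm (Box lam)) :
    (youngSym R lam).coeff σ = (((youngSym ℤ lam).coeff σ : ℤ) : R) := by
  rw [← map_youngSym (Int.castRingHom R), MonoidAlgebra.coeff_mapRingHom]; rfl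

theorem card_fix_mul {G : Type*} [Group G] [Fintype G] [DecidableEq G] (g : G) :
    Fintype.card {a : G // g • a = a} = if g = 1 then Fintype.card G else 0 := by
  split_ifs with h
  · subst h; simp
  · rw [Fintype.card_eq_zero_iff]
    exact ⟨fun a => h (by simpa using a.2)⟩

theorem hookProd_ne_zero : hookProd lam ≠ 0 := by
  intro h0
  have h1 := youngSym_mul_self lam ℚ
  rw [h0, Int.cast_zero, zero_smul] at h1
  have h2 : permMat ℚ (Equiv.Perm (Box lam)) (youngSym ℚ lam) ^ 2 = 0 := by
    rw [pow_two, ← map_mul, h1, map_zero]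
  have h3 := Matrix.isNilpotent_trace_of_isNilpotent (⟨2, h2⟩ : IsNilpotent _)
  rw [isNilpotent_iff_eq_zero, trace_permMat] at h3
  simp only [card_fix_mul, Nat.cast_ite, Nat.cast_zero, mul_ite, mul_zero, Finset.sum_ite_eq',
    Finset.mem_univ, if_true, coeff_one_youngSym, one_mul] at h3
  exact Fintype.card_ne_zero (Nat.cast_eq_zero.1 h3)

/-- The quotient `n! / h` is the rank of the Young symmetrizer on the regular representation. -/
theorem exists_hookProd_mul : ∃ f : ℕ, (f : ℤ) * hookProd lam = lam.card.factorial := by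
  have h := rank_permMat_mul_eq (K := ℚ) (Equiv.Perm (Box lam)) (youngSym ℤ lam)
    (Int.cast_ne_zero.2 (hookProd_ne_zero lam)) (by
      rw [youngSym_mul_self lam ℤ, Int.cast_id])
  refine ⟨_, h.trans ?_⟩
  simp only [card_fix_mul, Nat.cast_ite, Nat.cast_zero, mul_ite, mul_zero, Finset.sum_ite_eq',
    Finset.mem_univ, if_true, coeff_one_youngSym, one_mul]
  rw [Fintype.card_perm, card_box]

/-- The degree `n! / h` of the irreducible character of `λ`. -/
noncomputable def degree : ℕ := (exists_hookProd_mul lam).choose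

theorem degree_mul_hookProd : (degree lam : ℤ) * hookProd lam = lam.card.factorial :=
  (exists_hookProd_mul lam).choose_spec

theorem degree_pos : 0 < degree lam := by
  rcases Nat.eq_zero_or_pos (degree lam) with h | h
  · have := degree_mul_hookProd lam
    rw [h, Nat.cast_zero, zero_mul] at this
    exact absurd this.symm (by exact_mod_cast Nat.factorial_ne_zero _)
  · exact h

theorem hookProd_cast_ne_zero {k : Type*} [Field k] (h : ((lam.card.factorial : ℕ) : k) ≠ 0) :
    (hookProd lam : k) ≠ 0 := by
  intro h0
  have := congrArg (Int.cast : ℤ → k) (degree_mul_hookProd lam)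
  rw [Int.cast_mul, h0, mul_zero] at this
  exact h (by exact_mod_cast this.symm)

theorem hookProdQ_ne_zero : (hookProd lam : ℚ) ≠ 0 := Int.cast_ne_zero.2 (hookProd_ne_zero lam)

theorem degree_eq : (degree lam : ℚ) = lam.card.factorial / hookProd lam := by
  rw [eq_div_iff (hookProdQ_ne_zero lam)]
  exact_mod_cast degree_mul_hookProd lam

end Degree

/-! ### Class functions on symmetric groups -/

section ClassFunctions

variable {X Y : Type} [Fintype X] [DecidableEq X] [Fintype Y] [DecidableEq Y]

/-- The function is constant on conjugacy classes. -/
def IsClassFun (φ : Equiv.Perm X → ℚ) : Prop := ∀ g h, φ (h * g * h⁻¹) = φ g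

theorem IsClassFun.inv {φ : Equiv.Perm X → ℚ} (hφ : IsClassFun φ) (g : Equiv.Perm X) :
    φ g⁻¹ = φ g := by
  have : IsConj g g⁻¹ := Equiv.Perm.isConj_iff_cycleType_eq.2 (by simp)
  obtain ⟨h, hh⟩ := isConj_iff.1 this
  rw [← hh, hφ]

/-- The scalar product of class functions; symmetric group characters are real, so no inversion is
needed. -/
noncomputable def charInner (φ ψ : Equiv.Perm X → ℚ) : ℚ :=
  (∑ g, φ g * ψ g) / (Fintype.card X).factorial

theorem charInner_comm (φ ψ : Equiv.Perm X → ℚ) : charInner φ ψ = charInner ψ φ := by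
  simp [charInner, mul_comm]

theorem charInner_sum_right {ι : Type*} (s : Finset ι) (φ : Equiv.Perm X → ℚ) (a : ι → ℚ)
    (ψ : ι → Equiv.Perm X → ℚ) :
    charInner φ (fun g => ∑ i ∈ s, a i * ψ i g) = ∑ i ∈ s, a i * charInner φ (ψ i) := by
  simp only [charInner, Finset.mul_sum, mul_div_assoc', ← Finset.sum_div]
  rw [Finset.sum_comm]
  refine congrArg (· / _) (Finset.sum_congr rfl fun i _ => Finset.sum_congr rfl fun g _ => by ring)

variable (X) in
/-- The irreducible character of `λ` on the permutations of a set `X`: the conjugates of the Young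
symmetrizer, summed over all numberings of `X` by the boxes of `λ`. -/
noncomputable def chi (lam : YoungDiagram) (g : Equiv.Perm X) : ℚ :=
  (∑ t : Box lam ≃ X, (youngSym ℚ lam).coeff (t.symm.permCongr g)) / hookProd lam

theorem chi_permCongr (lam : YoungDiagram) (e : X ≃ Y) (g : Equiv.Perm X) :
    chi Y lam (e.permCongr g) = chi X lam g := by
  rw [chi, chi]
  congr 1
  refine Fintype.sum_equiv (Equiv.equivCongr (Equiv.refl _) e.symm) _ _ fun t => ?_
  congr 1

theorem chi_isClassFun (lam : YoungDiagram) : IsClassFun (chi X lam) := fun g h => by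
  rw [← chi_permCongr lam h g]
  congr 1

theorem chi_one {lam : YoungDiagram} (h : lam.card = Fintype.card X) :
    chi X lam 1 = degree lam := by
  have h1 : ∀ t : Box lam ≃ X, (youngSym ℚ lam).coeff (t.symm.permCongr 1) = 1 := fun t => by
    rw [show t.symm.permCongr 1 = 1 by ext1 x; simp [Equiv.permCongr_apply], coeff_one_youngSym]
  obtain ⟨e⟩ : Nonempty (Box lam ≃ X) := Fintype.card_eq.1 (by rw [card_box, h])
  rw [chi, degree_eq]
  simp only [h1, Finset.sum_const, Finset.card_univ, nsmul_eq_mul, mul_one]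
  rw [Fintype.card_equiv e, card_box]

theorem charInner_chi {lam : YoungDiagram} {φ : Equiv.Perm X → ℚ} (hφ : IsClassFun φ)
    (t : Box lam ≃ X) :
    charInner (chi X lam) φ =
      (∑ σ, (youngSym ℚ lam).coeff σ * φ (t.permCongr σ)) / hookProd lam := by
  have h1 : ∀ s : Box lam ≃ X, ∑ g, (youngSym ℚ lam).coeff (s.symm.permCongr g) * φ g =
      ∑ σ, (youngSym ℚ lam).coeff σ * φ (t.permCongr σ) := by
    intro s
    refine Fintype.sum_equiv s.symm.permCongr _ _ fun g => ?_
    congr 1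
    rw [← hφ g (s.symm.trans t)]
    congr 1
  have hfac : ((Fintype.card X).factorial : ℚ) ≠ 0 := by exact_mod_cast Nat.factorial_ne_zero _
  have hcard : Fintype.card (Box lam ≃ X) = (Fintype.card X).factorial := by
    rw [Fintype.card_equiv t, Fintype.card_congr t]
  rw [charInner]
  simp only [chi, div_mul_eq_mul_div, ← Finset.sum_div, Finset.sum_mul]
  rw [Finset.sum_comm]
  simp only [h1, Finset.sum_const, Finset.card_univ, hcard, nsmul_eq_mul]
  rw [div_div, mul_comm (hookProd lam : ℚ), mul_div_mul_left _ _ hfac]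

theorem charInner_chi_chi_of_ne {lam mu : YoungDiagram} (hl : lam.card = Fintype.card X)
    (hne : lam ≠ mu) : charInner (chi X lam) (chi X mu) = 0 := by
  obtain ⟨t⟩ : Nonempty (Box lam ≃ X) := Fintype.card_eq.1 (by rw [card_box, hl])
  rw [charInner_chi (chi_isClassFun mu) t]
  have h1 : ∀ σ, chi X mu (t.permCongr σ) = chi (Box lam) mu σ⁻¹ := fun σ => by
    rw [chi_permCongr, (chi_isClassFun mu).inv]
  simp only [h1]
  simp only [chi, mul_div_assoc', ← Finset.sum_div, Finset.mul_sum]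
  rw [Finset.sum_comm, Finset.sum_eq_zero, zero_div, zero_div]
  intro u _
  have := congrArg (fun z => z.coeff 1) (youngSym_mul_transp_of_ne u hne)
  simpa [coeff_mul_fintype] using this

/-- Comparing coefficients in `c * c * c`, where `c` is the Young symmetrizer. -/
theorem charInner_chi_self {lam : YoungDiagram} (hl : lam.card = Fintype.card X) :
    charInner (chi X lam) (chi X lam) = 1 := by
  obtain ⟨t⟩ : Nonempty (Box lam ≃ X) := Fintype.card_eq.1 (by rw [card_box, hl])
  rw [charInner_chi (chi_isClassFun lam) t]
  have h1 : ∀ σ, chi X lam (t.permCongr σ) = chi (Box lam) lam σ⁻¹ := fun σ => by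
    rw [chi_permCongr, (chi_isClassFun lam).inv]
  simp only [h1]
  simp only [chi, mul_div_assoc', ← Finset.sum_div, Finset.mul_sum]
  rw [Finset.sum_comm]
  set c := youngSym ℚ lam with hc
  -- `c u c = n u • c`
  choose n hn using fun u : Equiv.Perm (Box lam) =>
    exists_youngSym_mul_mul (R := ℚ) (lam := lam) (MonoidAlgebra.single u 1)
  have h2 : ∀ u : Equiv.Perm (Box lam),
      ∑ σ, c.coeff σ * c.coeff (u.symm.permCongr σ⁻¹) = n u * c.coeff u := by
    intro u
    have h3 := congrArg (fun z => z.coeff u) (hn u)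
    simp only [MonoidAlgebra.coeff_smul_apply, smul_eq_mul] at h3
    rw [← h3, mul_assoc, coeff_mul_fintype]
    refine Finset.sum_congr rfl fun σ _ => ?_
    rw [MonoidAlgebra.coeff_single_mul_apply, one_mul]
    congr 2
  have h3 : ∑ u, n u * c.coeff u = hookProd lam * hookProd lam := by
    have h4 : c * c * c = ((hookProd lam : ℚ) * hookProd lam) • c := by
      rw [hc, youngSym_mul_self, smul_mul_assoc, youngSym_mul_self, smul_smul]
    have h5 : c * c * c = (∑ u, n u * c.coeff u) • c := by
      conv_lhs => rw [← sum_single_coeff c]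
      conv_lhs =>
        rw [show (∑ g, MonoidAlgebra.single g (c.coeff g)) = c from sum_single_coeff c]
        arg 1; arg 2; rw [← sum_single_coeff c]
      rw [Finset.mul_sum, Finset.sum_mul, Finset.sum_smul]
      refine Finset.sum_congr rfl fun u _ => ?_
      rw [show MonoidAlgebra.single u (c.coeff u) = c.coeff u • MonoidAlgebra.single u (1 : ℚ) by
        simp, mul_smul_comm, smul_mul_assoc, hn, smul_smul, mul_comm]
    have h6 := congrArg (fun z => z.coeff 1) (h4.symm.trans h5)
    simpa [hc, coeff_one_youngSym] using h6.symm
  rw [Finset.sum_congr rfl fun u _ => h2 u, h3]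
  have := hookProdQ_ne_zero lam
  field_simp

theorem mem_partitionsOf {a : ℕ} {lam : YoungDiagram} : lam ∈ partitionsOf a ↔ lam.card = a := by
  simp [partitionsOf]

open Classical in
theorem charInner_chi_chi {lam mu : YoungDiagram} (hl : lam.card = Fintype.card X) :
    charInner (chi X lam) (chi X mu) = if lam = mu then 1 else 0 := by
  split_ifs with h
  · rw [← h, charInner_chi_self hl]
  · exact charInner_chi_chi_of_ne hl h

/-- Bessel's inequality for the class function supported at `1`. -/
theorem sum_degree_sq_le (n : ℕ) : ∑ lam ∈ partitionsOf n, degree lam ^ 2 ≤ n.factorial ∧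
    (∑ lam ∈ partitionsOf n, degree lam ^ 2 = n.factorial →
      ∀ g : Equiv.Perm (Fin n), (if g = 1 then (1 : ℚ) else 0) =
        ∑ lam ∈ partitionsOf n, (degree lam / n.factorial : ℚ) * chi (Fin n) lam g) := by
  classical
  have hfac : (n.factorial : ℚ) ≠ 0 := by exact_mod_cast Nat.factorial_ne_zero _
  have hfpos : (0 : ℚ) < n.factorial := by exact_mod_cast Nat.factorial_pos _
  set δ : Equiv.Perm (Fin n) → ℚ := fun g => if g = 1 then 1 else 0 with hδ
  set ψ : Equiv.Perm (Fin n) → ℚ := fun g =>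
    ∑ lam ∈ partitionsOf n, (degree lam / n.factorial : ℚ) * chi (Fin n) lam g with hψ
  have h1 : ∀ lam ∈ partitionsOf n, charInner δ (chi (Fin n) lam) = degree lam / n.factorial := by
    intro lam hlam
    rw [charInner]
    simp [hδ, chi_one (X := Fin n) (by simpa using mem_partitionsOf.1 hlam)]
  have h2 : charInner δ δ = 1 / n.factorial := by simp [charInner, hδ]
  have h3 : charInner δ ψ = (∑ lam ∈ partitionsOf n, (degree lam : ℚ) ^ 2) / n.factorial ^ 2 := by
    rw [hψ, charInner_sum_right, Finset.sum_div]
    refine Finset.sum_congr rfl fun lam hlam => ?_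
    rw [h1 lam hlam]; ring
  have h4 : charInner ψ ψ = (∑ lam ∈ partitionsOf n, (degree lam : ℚ) ^ 2) / n.factorial ^ 2 := by
    have h0 : charInner ψ ψ = ∑ lam ∈ partitionsOf n, (degree lam / n.factorial : ℚ) *
        charInner ψ (chi (Fin n) lam) := charInner_sum_right _ _ _ _
    rw [h0, Finset.sum_div]
    refine Finset.sum_congr rfl fun lam hlam => ?_
    rw [charInner_comm, hψ, charInner_sum_right]
    have : ∀ mu ∈ partitionsOf n, (degree mu / n.factorial : ℚ) *
        charInner (chi (Fin n) lam) (chi (Fin n) mu) =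
        if lam = mu then (degree mu / n.factorial : ℚ) else 0 := fun mu _ => by
      rw [charInner_chi_chi (by simpa using mem_partitionsOf.1 hlam)]; split_ifs <;> simp
    rw [Finset.sum_congr rfl this, Finset.sum_ite_eq, if_pos hlam]; ring
  have h5 : (∑ g, (δ g - ψ g) ^ 2) / n.factorial =
      charInner δ δ - 2 * charInner δ ψ + charInner ψ ψ := by
    simp only [charInner, Fintype.card_fin]
    rw [mul_div_assoc', ← sub_div, ← add_div, Finset.mul_sum, ← Finset.sum_sub_distrib,
      ← Finset.sum_add_distrib]
    congr 1
    exact Finset.sum_congr rfl fun g _ => by ring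
  rw [h2, h3, h4] at h5
  have h6 : ∑ g, (δ g - ψ g) ^ 2 =
      1 - (∑ lam ∈ partitionsOf n, (degree lam : ℚ) ^ 2) / n.factorial := by
    field_simp at h5 ⊢; linarith
  have h7 : 0 ≤ ∑ g, (δ g - ψ g) ^ 2 := Finset.sum_nonneg fun g _ => sq_nonneg _
  constructor
  · have : (∑ lam ∈ partitionsOf n, (degree lam : ℚ) ^ 2) ≤ n.factorial := by
      rw [h6, sub_nonneg, div_le_one hfpos] at h7; exact h7
    exact_mod_cast this
  · intro heq g
    have h8 : (∑ lam ∈ partitionsOf n, (degree lam : ℚ) ^ 2) = n.factorial := by exact_mod_cast heq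
    rw [h8, div_self hfac, sub_self] at h6
    have := (Finset.sum_eq_zero_iff_of_nonneg (fun g _ => sq_nonneg _)).1 h6 g (Finset.mem_univ g)
    exact sub_eq_zero.1 (pow_eq_zero_iff (two_ne_zero)|>.1 this)

/-- Convolution of a class function with an irreducible character. -/
theorem sum_mul_chi {lam : YoungDiagram} (hl : lam.card = Fintype.card X) {φ : Equiv.Perm X → ℚ}
    (hφ : IsClassFun φ) (g : Equiv.Perm X) :
    ∑ h, φ h * chi X lam (h⁻¹ * g) = hookProd lam * charInner (chi X lam) φ * chi X lam g := by
  have key : ∀ t : Box lam ≃ X, ∑ h, φ h * (youngSym ℚ lam).coeff (t.symm.permCongr (h⁻¹ * g)) =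
      hookProd lam * charInner (chi X lam) φ * (youngSym ℚ lam).coeff (t.symm.permCongr g) := by
    intro t
    set Φ : MonoidAlgebra ℚ (Equiv.Perm (Box lam)) :=
      ∑ σ, MonoidAlgebra.single σ (φ (t.permCongr σ)) with hΦ
    have hcoeff : ∀ σ, Φ.coeff σ = φ (t.permCongr σ) := fun σ => coeff_sum_single _ σ
    have hcentral : ∀ q, MonoidAlgebra.single q 1 * Φ = Φ * MonoidAlgebra.single q 1 := by
      intro q
      ext z
      rw [MonoidAlgebra.coeff_single_mul_apply, MonoidAlgebra.coeff_mul_single_apply, hcoeff,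
        hcoeff, one_mul, mul_one, ← hφ (t.permCongr (z * q⁻¹)) (t.permCongr q⁻¹)]
      congr 1
      ext1 x
      simp [Equiv.permCongr_apply, Equiv.Perm.inv_def]
    have h1 := eq_smul_youngSym (R := ℚ) (lam := lam) (fun r h => by linarith)
      (Φ * youngSym ℚ lam)
      (fun p hp => by rw [mul_assoc, youngSym_mul_single hp])
      (fun q hq => by
        rw [← mul_assoc, hcentral, mul_assoc, single_mul_youngSym hq, mul_smul_comm])
    have h2 : (Φ * youngSym ℚ lam).coeff 1 = hookProd lam * charInner (chi X lam) φ := by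
      rw [charInner_chi hφ t, mul_div_cancel₀ _ (hookProdQ_ne_zero lam), coeff_mul_fintype]
      refine Fintype.sum_equiv (Equiv.inv _) _ _ fun σ => ?_
      rw [hcoeff, mul_one, mul_comm, Equiv.inv_apply,
        show t.permCongr σ⁻¹ = (t.permCongr σ)⁻¹ from map_inv t.permCongrHom σ, hφ.inv]
    rw [h2] at h1
    have h3 := congrArg (fun z => z.coeff (t.symm.permCongr g)) h1
    simp only [MonoidAlgebra.coeff_smul_apply, smul_eq_mul] at h3
    rw [← h3, coeff_mul_fintype]
    refine Fintype.sum_equiv t.symm.permCongr _ _ fun h => ?_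
    rw [hcoeff]
    congr 2
    · ext1 x; simp [Equiv.permCongr_apply]
    · rw [show (t.symm.permCongr h)⁻¹ = t.symm.permCongr h⁻¹ from
        (map_inv t.symm.permCongrHom h).symm]
      ext1 x; simp [Equiv.permCongr_apply]
  simp only [chi, mul_div_assoc', ← Finset.sum_div, Finset.mul_sum]
  rw [Finset.sum_comm, Finset.sum_congr rfl fun t _ => key t]

/-- If the squares of the degrees add up to the order of the group, the characters of partitions span
the class functions. -/
theorem eq_sum_chi_of_sum_degree_sq
    (h : ∑ lam ∈ partitionsOf (Fintype.card X), degree lam ^ 2 = (Fintype.card X).factorial)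
    {φ : Equiv.Perm X → ℚ} (hφ : IsClassFun φ) (g : Equiv.Perm X) :
    φ g = ∑ lam ∈ partitionsOf (Fintype.card X), charInner (chi X lam) φ * chi X lam g := by
  have hδ : ∀ g : Equiv.Perm X, (if g = 1 then (1 : ℚ) else 0) =
      ∑ lam ∈ partitionsOf (Fintype.card X),
        (degree lam / (Fintype.card X).factorial : ℚ) * chi X lam g := by
    intro g
    have e := Fintype.equivFin X
    have := (sum_degree_sq_le (Fintype.card X)).2 h (e.permCongr g)
    simp only [chi_permCongr] at this
    rw [← this]
    have h1 : e.permCongr g = 1 ↔ g = 1 := by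
      rw [← map_eq_one_iff e.permCongrHom e.permCongrHom.injective]; rfl
    simp only [h1]
  have h1 : φ g = ∑ h, φ h * (if h⁻¹ * g = 1 then (1 : ℚ) else 0) := by
    simp [inv_mul_eq_one]
  rw [h1]
  simp only [hδ, Finset.mul_sum]
  rw [Finset.sum_comm]
  refine Finset.sum_congr rfl fun lam hlam => ?_
  have hl := mem_partitionsOf.1 hlam
  have h2 := sum_mul_chi hl hφ g
  have hfac : ((Fintype.card X).factorial : ℚ) ≠ 0 := by exact_mod_cast Nat.factorial_ne_zero _
  have h3 : (degree lam / (Fintype.card X).factorial : ℚ) * hookProd lam = 1 := by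
    rw [degree_eq, hl]
    have := hookProdQ_ne_zero lam
    field_simp
  calc _ = (degree lam / (Fintype.card X).factorial : ℚ) * ∑ h, φ h * chi X lam (h⁻¹ * g) := by
        rw [Finset.mul_sum]; exact Finset.sum_congr rfl fun h _ => by ring
    _ = _ := by rw [h2, ← mul_assoc, ← mul_assoc, h3, one_mul]

end ClassFunctions

/-! ### Young's lattice -/

section YoungLattice

open YoungDiagram

theorem youngDiagram_ext_rowLen {lam mu : YoungDiagram} (h : ∀ i, lam.rowLen i = mu.rowLen i) :
    lam = mu := by
  ext ⟨i, j⟩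
  rw [mem_cells, mem_cells, mem_iff_lt_rowLen, mem_iff_lt_rowLen, h]

theorem youngDiagram_le_iff {lam mu : YoungDiagram} :
    lam ≤ mu ↔ ∀ i, lam.rowLen i ≤ mu.rowLen i := by
  constructor
  · intro h i
    by_contra hlt
    have h1 : (i, mu.rowLen i) ∈ lam := mem_iff_lt_rowLen.2 (by omega)
    have h2 := mem_iff_lt_rowLen.1 (cells_subset_iff.2 h h1)
    omega
  · rintro h ⟨i, j⟩ hc
    exact mem_iff_lt_rowLen.2 (lt_of_lt_of_le (mem_iff_lt_rowLen.1 hc) (h i))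

/-- The Young diagram with given row lengths. -/
def ofRows (f : ℕ → ℕ) (hf : Antitone f) (N : ℕ) (hN : f N = 0) : YoungDiagram where
  cells := (Finset.range N ×ˢ Finset.range (f 0)).filter fun c => c.2 < f c.1
  isLowerSet := by
    rintro ⟨i, j⟩ ⟨i', j'⟩ ⟨hi, hj⟩ h
    simp only [Finset.coe_filter, Finset.mem_product, Finset.mem_range, Set.mem_ofPred_eq] at h ⊢
    have := hf hi
    simp only at hi hj this
    omega

theorem rowLen_ofRows (f : ℕ → ℕ) (hf : Antitone f) (N : ℕ) (hN : f N = 0) (i : ℕ) :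
    (ofRows f hf N hN).rowLen i = f i := by
  have h : ∀ j, (i, j) ∈ ofRows f hf N hN ↔ j < f i := by
    intro j
    rw [← mem_cells]
    simp only [ofRows, Finset.mem_filter, Finset.mem_product, Finset.mem_range]
    refine ⟨fun h => h.2, fun h => ⟨⟨?_, lt_of_lt_of_le h (hf (Nat.zero_le i))⟩, h⟩⟩
    by_contra hi
    have := hf (not_lt.1 hi)
    omega
  have h1 := h ((ofRows f hf N hN).rowLen i)
  have h2 := h (f i)
  rw [mem_iff_lt_rowLen] at h1 h2
  omega

theorem exists_rowLen_eq_zero (lam : YoungDiagram) : ∃ N, ∀ i, N ≤ i → lam.rowLen i = 0 := by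
  refine ⟨lam.colLen 0, fun i hi => ?_⟩
  by_contra h
  have : (i, 0) ∈ lam := mem_iff_lt_rowLen.2 (by omega)
  rw [mem_iff_lt_colLen] at this
  omega

theorem card_eq_sum_rowLen (lam : YoungDiagram) {N : ℕ} (hN : ∀ i, N ≤ i → lam.rowLen i = 0) :
    lam.card = ∑ i ∈ Finset.range N, lam.rowLen i := by
  have : ∀ c ∈ lam.cells, c.1 ∈ Finset.range N := by
    rintro ⟨i, j⟩ hc
    rw [mem_cells, mem_iff_lt_rowLen] at hc
    rw [Finset.mem_range]
    by_contra h
    have := hN i (not_lt.1 h)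
    omega
  rw [YoungDiagram.card, Finset.card_eq_sum_card_fiberwise this]
  refine Finset.sum_congr rfl fun i _ => ?_
  rw [rowLen_eq_card, row]

/-- A covering relation of Young's lattice changes exactly one row length. -/
theorem exists_row_of_cover {lam mu : YoungDiagram} (h : lam ≤ mu) (hc : mu.card = lam.card + 1) :
    ∃ i, mu.rowLen i = lam.rowLen i + 1 ∧ ∀ j, j ≠ i → mu.rowLen j = lam.rowLen j := by
  obtain ⟨N, hN⟩ := exists_rowLen_eq_zero mu
  have hle := youngDiagram_le_iff.1 h
  have hN' : ∀ i, N ≤ i → lam.rowLen i = 0 := fun i hi => by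
    have := hle i; have := hN i hi; omega
  rw [card_eq_sum_rowLen mu hN, card_eq_sum_rowLen lam hN'] at hc
  have h1 : ∑ i ∈ Finset.range N, (mu.rowLen i - lam.rowLen i) = 1 := by
    have : ∑ i ∈ Finset.range N, (mu.rowLen i - lam.rowLen i) +
        ∑ i ∈ Finset.range N, lam.rowLen i = ∑ i ∈ Finset.range N, mu.rowLen i := by
      rw [← Finset.sum_add_distrib]
      exact Finset.sum_congr rfl fun i _ => Nat.sub_add_cancel (hle i)
    omega
  obtain ⟨i, hi, hne⟩ := Finset.exists_ne_zero_of_sum_ne_zero (by rw [h1]; exact one_ne_zero)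
  have h2 := Finset.sum_erase_add _ (fun i => mu.rowLen i - lam.rowLen i) hi
  have h3 : ∑ i ∈ (Finset.range N).erase i, (mu.rowLen i - lam.rowLen i) = 0 := by omega
  refine ⟨i, by omega, fun j hj => ?_⟩
  have := hle j
  by_cases hjN : N ≤ j
  · rw [hN j hjN, hN' j hjN]
  · have := Finset.sum_eq_zero_iff.1 h3 j
      (Finset.mem_erase.2 ⟨hj, Finset.mem_range.2 (not_le.1 hjN)⟩)
    omega

theorem exists_add_box (lam : YoungDiagram) (i : ℕ)
    (hi : i = 0 ∨ lam.rowLen i < lam.rowLen (i - 1)) :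
    ∃ mu : YoungDiagram, mu.card = lam.card + 1 ∧ mu.rowLen i = lam.rowLen i + 1 ∧
      ∀ j, j ≠ i → mu.rowLen j = lam.rowLen j := by
  obtain ⟨N, hN⟩ := exists_rowLen_eq_zero lam
  set f := Function.update lam.rowLen i (lam.rowLen i + 1) with hf
  have hfi : f i = lam.rowLen i + 1 := by simp [hf]
  have hfj : ∀ j, j ≠ i → f j = lam.rowLen j := fun j hj => by simp [hf, hj]
  have hanti : Antitone f := by
    refine antitone_nat_of_succ_le fun j => ?_
    have := lam.rowLen_anti j (j + 1) (by omega)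
    rcases eq_or_ne (j + 1) i with h | h
    · subst h
      rw [hfi, hfj j (by omega)]
      rcases hi with h | h
      · omega
      · exact h
    · rw [hfj _ h]
      rcases eq_or_ne j i with h' | h'
      · subst h'; rw [hfi]; omega
      · rw [hfj _ h']; exact this
  set M := max N (i + 1) with hM
  have hMz : ∀ j, M ≤ j → f j = 0 := fun j hj => by
    rw [hfj j (by omega), hN j (by omega)]
  refine ⟨ofRows f hanti M (hMz M le_rfl), ?_, ?_, ?_⟩
  · rw [card_eq_sum_rowLen _ (N := M) (fun j hj => by rw [rowLen_ofRows, hMz j hj]),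
      card_eq_sum_rowLen lam (N := M) (fun j hj => hN j (by omega))]
    simp only [rowLen_ofRows]
    have hmem : i ∈ Finset.range M := Finset.mem_range.2 (by omega)
    rw [← Finset.sum_erase_add _ _ hmem, ← Finset.sum_erase_add _ lam.rowLen hmem, hfi,
      Finset.sum_congr rfl fun j hj => hfj j (Finset.ne_of_mem_erase hj)]
    ring
  · rw [rowLen_ofRows, hfi]
  · intro j hj; rw [rowLen_ofRows, hfj j hj]

theorem exists_remove_box (lam : YoungDiagram) (i : ℕ)
    (hi : lam.rowLen (i + 1) < lam.rowLen i) :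
    ∃ mu : YoungDiagram, mu.card + 1 = lam.card ∧ mu.rowLen i + 1 = lam.rowLen i ∧
      ∀ j, j ≠ i → mu.rowLen j = lam.rowLen j := by
  obtain ⟨N, hN⟩ := exists_rowLen_eq_zero lam
  set f := Function.update lam.rowLen i (lam.rowLen i - 1) with hf
  have hfi : f i = lam.rowLen i - 1 := by simp [hf]
  have hfj : ∀ j, j ≠ i → f j = lam.rowLen j := fun j hj => by simp [hf, hj]
  have hanti : Antitone f := by
    refine antitone_nat_of_succ_le fun j => ?_
    have := lam.rowLen_anti j (j + 1) (by omega)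
    rcases eq_or_ne (j + 1) i with h | h
    · subst h
      rw [hfi, hfj j (by omega)]
      omega
    · rw [hfj _ h]
      rcases eq_or_ne j i with h' | h'
      · subst h'; rw [hfi]; omega
      · rw [hfj _ h']; exact this
  set M := max N (i + 1) with hM
  have hMz : ∀ j, M ≤ j → f j = 0 := fun j hj => by
    rw [hfj j (by omega), hN j (by omega)]
  refine ⟨ofRows f hanti M (hMz M le_rfl), ?_, ?_, ?_⟩
  · rw [card_eq_sum_rowLen _ (N := M) (fun j hj => by rw [rowLen_ofRows, hMz j hj]),
      card_eq_sum_rowLen lam (N := M) (fun j hj => hN j (by omega))]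
    simp only [rowLen_ofRows]
    have hmem : i ∈ Finset.range M := Finset.mem_range.2 (by omega)
    rw [← Finset.sum_erase_add _ _ hmem, ← Finset.sum_erase_add _ lam.rowLen hmem, hfi,
      Finset.sum_congr rfl fun j hj => hfj j (Finset.ne_of_mem_erase hj), add_assoc,
      Nat.sub_add_cancel (by omega)]
  · rw [rowLen_ofRows, hfi]; omega
  · intro j hj; rw [rowLen_ofRows, hfj j hj]

open Classical in
/-- The partitions of `n` containing `λ`. -/
noncomputable def above (n : ℕ) (lam : YoungDiagram) : Finset YoungDiagram :=
  (partitionsOf n).filter fun mu => lam ≤ mu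

open Classical in
/-- The partitions of `n` contained in `λ`. -/
noncomputable def below (n : ℕ) (lam : YoungDiagram) : Finset YoungDiagram :=
  (partitionsOf n).filter fun mu => mu ≤ lam

theorem mem_above {n : ℕ} {lam mu : YoungDiagram} : mu ∈ above n lam ↔ mu.card = n ∧ lam ≤ mu := by
  classical
  rw [above, Finset.mem_filter, mem_partitionsOf]

theorem mem_below {n : ℕ} {lam mu : YoungDiagram} : mu ∈ below n lam ↔ mu.card = n ∧ mu ≤ lam := by
  classical
  rw [below, Finset.mem_filter, mem_partitionsOf]

/-- A partition can be enlarged in one more row than it can be shrunk. -/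
theorem card_above_eq {n : ℕ} {lam : YoungDiagram} (hl : lam.card = n + 1) :
    (above (n + 2) lam).card = (below n lam).card + 1 := by
  classical
  obtain ⟨N, hN⟩ := exists_rowLen_eq_zero lam
  set A := (Finset.range (N + 1)).filter fun i => i = 0 ∨ lam.rowLen i < lam.rowLen (i - 1) with hA
  set B := (Finset.range N).filter fun i => lam.rowLen (i + 1) < lam.rowLen i with hB
  have hAB : A = insert 0 (B.image Nat.succ) := by
    ext i
    simp only [hA, hB, Finset.mem_filter, Finset.mem_range, Finset.mem_insert, Finset.mem_image]
    rcases i with _ | i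
    · simp
    · simp
  have h1 : A.card = (above (n + 2) lam).card := by
    have hA1 : ∀ i ∈ A, i = 0 ∨ lam.rowLen i < lam.rowLen (i - 1) := fun i hi =>
      (Finset.mem_filter.1 hi).2
    refine Finset.card_bij (fun i hi => (exists_add_box lam i (hA1 i hi)).choose) ?_ ?_ ?_
    · intro i hi
      obtain ⟨h1, h2, h3⟩ := (exists_add_box lam i (hA1 i hi)).choose_spec
      refine mem_above.2 ⟨by rw [h1, hl], youngDiagram_le_iff.2 fun j => ?_⟩
      rcases eq_or_ne j i with rfl | hj
      · omega
      · rw [h3 j hj]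
    · intro i hi j hj hij
      obtain ⟨-, h2, -⟩ := (exists_add_box lam i (hA1 i hi)).choose_spec
      obtain ⟨-, -, h3⟩ := (exists_add_box lam j (hA1 j hj)).choose_spec
      by_contra hne
      have := h3 i hne
      rw [← hij, h2] at this
      omega
    · intro mu hmu
      obtain ⟨hc, hle⟩ := mem_above.1 hmu
      obtain ⟨i, h1, h2⟩ := exists_row_of_cover hle (by rw [hc, hl])
      have hi : i = 0 ∨ lam.rowLen i < lam.rowLen (i - 1) := by
        rcases Nat.eq_zero_or_pos i with h | h
        · exact Or.inl h
        · right
          have := mu.rowLen_anti (i - 1) i (by omega)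
          rw [h2 (i - 1) (by omega), h1] at this
          omega
      have hiA : i ∈ A := by
        refine Finset.mem_filter.2 ⟨Finset.mem_range.2 ?_, hi⟩
        by_contra hlt
        rcases hi with h | h
        · omega
        · rw [hN (i - 1) (by omega)] at h; omega
      refine ⟨i, hiA, youngDiagram_ext_rowLen fun j => ?_⟩
      obtain ⟨-, h3, h4⟩ := (exists_add_box lam i (hA1 i hiA)).choose_spec
      rcases eq_or_ne j i with rfl | hj
      · rw [h3, h1]
      · rw [h4 j hj, h2 j hj]
  have h2 : B.card = (below n lam).card := by
    have hB1 : ∀ i ∈ B, lam.rowLen (i + 1) < lam.rowLen i := fun i hi =>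
      (Finset.mem_filter.1 hi).2
    refine Finset.card_bij (fun i hi => (exists_remove_box lam i (hB1 i hi)).choose) ?_ ?_ ?_
    · intro i hi
      obtain ⟨h1, h2, h3⟩ := (exists_remove_box lam i (hB1 i hi)).choose_spec
      refine mem_below.2 ⟨by omega, youngDiagram_le_iff.2 fun j => ?_⟩
      rcases eq_or_ne j i with rfl | hj
      · omega
      · rw [h3 j hj]
    · intro i hi j hj hij
      obtain ⟨-, h2, -⟩ := (exists_remove_box lam i (hB1 i hi)).choose_spec
      obtain ⟨-, -, h3⟩ := (exists_remove_box lam j (hB1 j hj)).choose_spec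
      by_contra hne
      have := h3 i hne
      rw [← hij] at this
      omega
    · intro mu hmu
      obtain ⟨hc, hle⟩ := mem_below.1 hmu
      obtain ⟨i, h1, h2⟩ := exists_row_of_cover hle (by rw [hc, hl])
      have hi : lam.rowLen (i + 1) < lam.rowLen i := by
        have := mu.rowLen_anti i (i + 1) (by omega)
        rw [h2 (i + 1) (by omega), h1]
        omega
      have hiB : i ∈ B := by
        refine Finset.mem_filter.2 ⟨Finset.mem_range.2 ?_, hi⟩
        by_contra hlt
        rw [hN i (by omega)] at hi; omega
      refine ⟨i, hiB, youngDiagram_ext_rowLen fun j => ?_⟩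
      obtain ⟨-, h3, h4⟩ := (exists_remove_box lam i (hB1 i hiB)).choose_spec
      rcases eq_or_ne j i with rfl | hj
      · omega
      · rw [h4 j hj, h2 j hj]
  rw [← h1, hAB, Finset.card_insert_of_notMem (by simp), Finset.card_image_of_injective _
    Nat.succ_injective, h2]

open Classical in
/-- Two different partitions of `n` have a common cover exactly when they cover a common
partition. -/
theorem card_common_above {n : ℕ} {lam nu : YoungDiagram} (hl : lam.card = n + 1)
    (hn : nu.card = n + 1) (hne : lam ≠ nu) :
    ((above (n + 2) lam).filter fun mu => mu ∈ above (n + 2) nu).card =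
      ((below n lam).filter fun mu => mu ∈ below n nu).card := by
  classical
  have hcard : (lam ⊔ nu).card + (lam ⊓ nu).card = 2 * (n + 1) := by
    have := Finset.card_union_add_card_inter lam.cells nu.cells
    simp only [YoungDiagram.card] at hl hn ⊢
    rw [cells_sup, cells_inf, this]; omega
  have hlt : lam.card < (lam ⊔ nu).card := by
    refine Finset.card_lt_card (cells_ssubset_iff.2 (lt_of_le_of_ne le_sup_left fun h => ?_))
    have h1 : nu ≤ lam := by rw [h]; exact le_sup_right
    exact hne (YoungDiagram.ext (Finset.eq_of_subset_of_card_le (cells_subset_iff.2 h1)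
      (by change lam.card ≤ nu.card; omega))).symm
  have hA : (above (n + 2) lam).filter (fun mu => mu ∈ above (n + 2) nu) =
      if (lam ⊔ nu).card = n + 2 then {lam ⊔ nu} else ∅ := by
    ext mu
    simp only [Finset.mem_filter, mem_above]
    split_ifs with h
    · rw [Finset.mem_singleton]
      constructor
      · rintro ⟨⟨h1, h2⟩, -, h3⟩
        exact (YoungDiagram.ext (Finset.eq_of_subset_of_card_le
          (cells_subset_iff.2 (sup_le h2 h3)) (by change mu.card ≤ (lam ⊔ nu).card; omega))).symm
      · rintro rfl
        exact ⟨⟨h, le_sup_left⟩, h, le_sup_right⟩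
    · simp only [Finset.notMem_empty, iff_false]
      rintro ⟨⟨h1, h2⟩, -, h3⟩
      have h4 : (lam ⊔ nu).card ≤ mu.card :=
        Finset.card_le_card (cells_subset_iff.2 (sup_le h2 h3))
      omega
  have hB : (below n lam).filter (fun mu => mu ∈ below n nu) =
      if (lam ⊔ nu).card = n + 2 then {lam ⊓ nu} else ∅ := by
    ext mu
    simp only [Finset.mem_filter, mem_below]
    split_ifs with h
    · rw [Finset.mem_singleton]
      constructor
      · rintro ⟨⟨h1, h2⟩, -, h3⟩
        exact (YoungDiagram.ext (Finset.eq_of_subset_of_card_le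
          (cells_subset_iff.2 (le_inf h2 h3)) (by change (lam ⊓ nu).card ≤ mu.card; omega)))
      · rintro rfl
        exact ⟨⟨by omega, inf_le_left⟩, by omega, inf_le_right⟩
    · simp only [Finset.notMem_empty, iff_false]
      rintro ⟨⟨h1, h2⟩, -, h3⟩
      have h4 : mu.card ≤ (lam ⊓ nu).card :=
        Finset.card_le_card (cells_subset_iff.2 (le_inf h2 h3))
      omega
  rw [hA, hB]
  split_ifs <;> rfl

/-- The number of standard tableaux of a partition of `n`, counted as saturated chains. -/
noncomputable def chainCount : ℕ → YoungDiagram → ℕ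
  | 0, _ => 1
  | n + 1, lam => ∑ nu ∈ below n lam, chainCount n nu

theorem chainCount_succ (n : ℕ) (lam : YoungDiagram) :
    chainCount (n + 1) lam = ∑ nu ∈ below n lam, chainCount n nu := rfl

/-- Young's lattice is a differential poset: `card_above_eq` and `card_common_above` allow one to exchange
going up and going down. -/
theorem sum_above_chainCount (n : ℕ) : ∀ {lam : YoungDiagram}, lam.card = n →
    ∑ mu ∈ above (n + 1) lam, chainCount (n + 1) mu = (n + 1) * chainCount n lam := by
  classical
  have hswap : ∀ (n : ℕ) (lam : YoungDiagram), ∑ mu ∈ above (n + 1) lam, chainCount (n + 1) mu =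
      ∑ nu ∈ partitionsOf n,
        ((above (n + 1) lam).filter fun mu => mu ∈ above (n + 1) nu).card * chainCount n nu := by
    intro n lam
    have h1 : ∀ mu ∈ above (n + 1) lam, chainCount (n + 1) mu =
        ∑ nu ∈ partitionsOf n, if mu ∈ above (n + 1) nu then chainCount n nu else 0 := by
      intro mu hmu
      rw [chainCount, below, Finset.sum_filter]
      refine Finset.sum_congr rfl fun nu _ => ?_
      simp [mem_above, (mem_above.1 hmu).1]
    rw [Finset.sum_congr rfl h1, Finset.sum_comm]
    refine Finset.sum_congr rfl fun nu _ => ?_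
    rw [← Finset.sum_filter, Finset.sum_const, smul_eq_mul]
  induction n with
  | zero =>
    intro lam hl
    have hbot : ∀ nu : YoungDiagram, nu.card = 0 → nu = ⊥ := fun nu h =>
      YoungDiagram.ext (Finset.card_eq_zero.1 h)
    have hp : partitionsOf 0 = {⊥} := by
      ext nu
      rw [mem_partitionsOf, Finset.mem_singleton]
      exact ⟨hbot nu, fun h => by rw [h]; rfl⟩
    obtain rfl := hbot lam hl
    rw [hswap, hp, Finset.sum_singleton]
    simp only [chainCount, zero_add, mul_one, Finset.filter_mem_eq_inter, Finset.inter_self]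
    have hbr : ∀ i, (⊥ : YoungDiagram).rowLen i = 0 := fun i => by
      by_contra h
      exact YoungDiagram.notMem_bot (i, 0) (mem_iff_lt_rowLen.2 (Nat.pos_of_ne_zero h))
    rw [Finset.card_eq_one]
    obtain ⟨mu, h1, h2, h3⟩ := exists_add_box ⊥ 0 (Or.inl rfl)
    refine ⟨mu, ?_⟩
    ext nu
    rw [mem_above, Finset.mem_singleton]
    constructor
    · rintro ⟨h4, h5⟩
      obtain ⟨i, h6, h7⟩ := exists_row_of_cover h5 (by rw [h4]; rfl)
      have hi : i = 0 := by
        by_contra hi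
        have := nu.rowLen_anti 0 i (Nat.zero_le i)
        rw [h7 0 (Ne.symm hi), h6, hbr, hbr] at this
        omega
      subst hi
      refine youngDiagram_ext_rowLen fun j => ?_
      rcases eq_or_ne j 0 with rfl | hj
      · rw [h2, h6]
      · rw [h3 j hj, h7 j hj]
    · rintro rfl
      exact ⟨by rw [h1]; rfl, bot_le⟩
  | succ n ih =>
    intro lam hl
    rw [hswap]
    have hmem : lam ∈ partitionsOf (n + 1) := mem_partitionsOf.2 hl
    have h2 : ∀ nu ∈ partitionsOf (n + 1),
        ((above (n + 2) lam).filter fun mu => mu ∈ above (n + 2) nu).card * chainCount (n + 1) nu =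
        ((below n lam).filter fun mu => mu ∈ below n nu).card * chainCount (n + 1) nu +
          if nu = lam then chainCount (n + 1) nu else 0 := by
      intro nu hnu
      split_ifs with h
      · subst h
        simp only [Finset.filter_mem_eq_inter, Finset.inter_self]
        rw [card_above_eq hl]; ring
      · rw [card_common_above hl (mem_partitionsOf.1 hnu) (Ne.symm h), add_zero]
    rw [Finset.sum_congr rfl h2, Finset.sum_add_distrib, Finset.sum_ite_eq', if_pos hmem]
    have h3 : ∑ nu ∈ partitionsOf (n + 1),
        ((below n lam).filter fun mu => mu ∈ below n nu).card * chainCount (n + 1) nu =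
        ∑ rho ∈ below n lam, ∑ nu ∈ above (n + 1) rho, chainCount (n + 1) nu := by
      have h4 : ∀ nu ∈ partitionsOf (n + 1),
          ((below n lam).filter fun mu => mu ∈ below n nu).card * chainCount (n + 1) nu =
          ∑ rho ∈ below n lam, if rho ≤ nu then chainCount (n + 1) nu else 0 := by
        intro nu _
        rw [← Finset.sum_filter, Finset.sum_const, smul_eq_mul]
        congr 2
        refine Finset.filter_congr fun rho hrho => ?_
        rw [mem_below]
        exact ⟨fun h => h.2, fun h => ⟨(mem_below.1 hrho).1, h⟩⟩
      rw [Finset.sum_congr rfl h4, Finset.sum_comm]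
      refine Finset.sum_congr rfl fun rho _ => ?_
      rw [above, Finset.sum_filter]
    rw [h3, Finset.sum_congr rfl fun rho hrho => ih (mem_below.1 hrho).1, ← Finset.mul_sum,
      ← chainCount_succ]
    ring

theorem sum_below_eq_sum_above {n : ℕ} (F : YoungDiagram → YoungDiagram → ℕ) :
    ∑ mu ∈ partitionsOf (n + 1), ∑ nu ∈ below n mu, F mu nu =
      ∑ nu ∈ partitionsOf n, ∑ mu ∈ above (n + 1) nu, F mu nu := by
  classical
  simp only [below, above, Finset.sum_filter]
  rw [Finset.sum_comm]

/-- The number of pairs of standard tableaux of one shape with `n` boxes is `n!`. -/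
theorem sum_chainCount_sq (n : ℕ) : ∑ lam ∈ partitionsOf n, chainCount n lam ^ 2 = n.factorial := by
  induction n with
  | zero =>
    have hp : partitionsOf 0 = {⊥} := by
      ext nu
      rw [mem_partitionsOf, Finset.mem_singleton]
      exact ⟨fun h => YoungDiagram.ext (Finset.card_eq_zero.1 h), fun h => by rw [h]; rfl⟩
    rw [hp]; simp [chainCount]
  | succ n ih =>
    have h1 : ∀ mu ∈ partitionsOf (n + 1), chainCount (n + 1) mu ^ 2 =
        ∑ nu ∈ below n mu, chainCount (n + 1) mu * chainCount n nu := by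
      intro mu _
      rw [← Finset.mul_sum, ← chainCount_succ, pow_two]
    rw [Finset.sum_congr rfl h1,
      sum_below_eq_sum_above fun mu nu => chainCount (n + 1) mu * chainCount n nu]
    have h2 : ∀ nu ∈ partitionsOf n, ∑ mu ∈ above (n + 1) nu,
        chainCount (n + 1) mu * chainCount n nu = (n + 1) * chainCount n nu ^ 2 := by
      intro nu hnu
      rw [← Finset.sum_mul, sum_above_chainCount n (mem_partitionsOf.1 hnu)]; ring
    rw [Finset.sum_congr rfl h2, ← Finset.mul_sum, ih, Nat.factorial_succ]

/-! ### Even partitions -/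

theorem mem_evenPartitionsOf {n : ℕ} {eta : YoungDiagram} :
    eta ∈ evenPartitionsOf n ↔ eta.card = n ∧ ∀ i, Even (eta.rowLen i) := by
  classical
  rw [evenPartitionsOf, Finset.mem_filter, mem_partitionsOf]

open Classical in
/-- A partition of an odd number has as many even covers as it covers even partitions: both numbers
are one if exactly one row is odd, and zero otherwise. -/
theorem card_even_above_eq {n : ℕ} {nu : YoungDiagram} (hn : nu.card = n + 1) :
    ((evenPartitionsOf (n + 2)).filter fun mu => mu ∈ above (n + 2) nu).card =
      ((evenPartitionsOf n).filter fun mu => mu ∈ below n nu).card := by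
  classical
  by_cases h : ∃ i, ¬ Even (nu.rowLen i) ∧ ∀ j, j ≠ i → Even (nu.rowLen j)
  · obtain ⟨i, hi, hj⟩ := h
    have hne : ∀ j, j ≠ i → nu.rowLen j ≠ nu.rowLen i := fun j hji h => hi (h ▸ hj j hji)
    obtain ⟨mu, a1, a2, a3⟩ := exists_add_box nu i (by
      rcases Nat.eq_zero_or_pos i with h | h
      · exact Or.inl h
      · exact Or.inr (lt_of_le_of_ne (nu.rowLen_anti _ _ (by omega)) (hne _ (by omega)).symm))
    obtain ⟨mu', b1, b2, b3⟩ := exists_remove_box nu i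
      (lt_of_le_of_ne (nu.rowLen_anti _ _ (by omega)) (hne _ (by omega)))
    have hA : (evenPartitionsOf (n + 2)).filter (fun mu => mu ∈ above (n + 2) nu) = {mu} := by
      ext ka
      rw [Finset.mem_filter, mem_evenPartitionsOf, mem_above, Finset.mem_singleton]
      constructor
      · rintro ⟨⟨h1, h2⟩, -, h3⟩
        obtain ⟨r, h4, h5⟩ := exists_row_of_cover h3 (by omega)
        have hr : r = i := by
          by_contra hr
          have := h2 i
          rw [h5 i (Ne.symm hr)] at this
          exact hi this
        subst hr
        refine youngDiagram_ext_rowLen fun j => ?_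
        rcases eq_or_ne j r with rfl | hjr
        · rw [h4, a2]
        · rw [h5 j hjr, a3 j hjr]
      · rintro rfl
        refine ⟨⟨by omega, fun j => ?_⟩, by omega, youngDiagram_le_iff.2 fun j => ?_⟩
        · rcases eq_or_ne j i with rfl | hji
          · rw [a2]; exact Nat.even_add_one.2 hi
          · rw [a3 j hji]; exact hj j hji
        · rcases eq_or_ne j i with rfl | hji
          · omega
          · rw [a3 j hji]
    have hB : (evenPartitionsOf n).filter (fun mu => mu ∈ below n nu) = {mu'} := by
      ext ka
      rw [Finset.mem_filter, mem_evenPartitionsOf, mem_below, Finset.mem_singleton]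
      constructor
      · rintro ⟨⟨h1, h2⟩, -, h3⟩
        obtain ⟨r, h4, h5⟩ := exists_row_of_cover h3 (by omega)
        have hr : r = i := by
          by_contra hr
          have := h2 i
          rw [← h5 i (Ne.symm hr)] at this
          exact hi this
        subst hr
        refine youngDiagram_ext_rowLen fun j => ?_
        rcases eq_or_ne j r with rfl | hjr
        · omega
        · rw [b3 j hjr, h5 j hjr]
      · rintro rfl
        refine ⟨⟨by omega, fun j => ?_⟩, by omega, youngDiagram_le_iff.2 fun j => ?_⟩
        · rcases eq_or_ne j i with rfl | hji
          · rw [← b2, Nat.even_add_one, not_not] at hi; exact hi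
          · rw [b3 j hji]; exact hj j hji
        · rcases eq_or_ne j i with rfl | hji
          · omega
          · rw [b3 j hji]
    rw [hA, hB]; rfl
  · have hA : ∀ ka ∈ evenPartitionsOf (n + 2), ka ∉ above (n + 2) nu := by
      intro ka hka hka'
      obtain ⟨h1, h2⟩ := mem_evenPartitionsOf.1 hka
      obtain ⟨i, h4, h5⟩ := exists_row_of_cover (mem_above.1 hka').2 (by omega)
      refine h ⟨i, fun h6 => ?_, fun j hj => by rw [← h5 j hj]; exact h2 j⟩
      have := h2 i
      rw [h4, Nat.even_add_one] at this
      exact this h6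
    have hB : ∀ ka ∈ evenPartitionsOf n, ka ∉ below n nu := by
      intro ka hka hka'
      obtain ⟨h1, h2⟩ := mem_evenPartitionsOf.1 hka
      obtain ⟨i, h4, h5⟩ := exists_row_of_cover (mem_below.1 hka').2 (by omega)
      exact h ⟨i, by rw [h4, Nat.even_add_one, not_not]; exact h2 i,
        fun j hj => by rw [h5 j hj]; exact h2 j⟩
    rw [Finset.filter_false_of_mem hA, Finset.filter_false_of_mem hB]

/-- The number of standard tableaux of even shape satisfies the recursion of the number of perfect
matchings. -/
theorem sum_even_chainCount_succ (n : ℕ) :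
    ∑ eta ∈ evenPartitionsOf (n + 2), chainCount (n + 2) eta =
      (n + 1) * ∑ eta ∈ evenPartitionsOf n, chainCount n eta := by
  classical
  have h1 : ∀ eta ∈ evenPartitionsOf (n + 2), chainCount (n + 2) eta =
      ∑ nu ∈ partitionsOf (n + 1), if eta ∈ above (n + 2) nu then chainCount (n + 1) nu else 0 := by
    intro eta heta
    rw [chainCount, below, Finset.sum_filter]
    refine Finset.sum_congr rfl fun nu _ => ?_
    simp [mem_above, (mem_evenPartitionsOf.1 heta).1]
  have h2 : ∀ eta ∈ evenPartitionsOf n, (n + 1) * chainCount n eta =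
      ∑ nu ∈ partitionsOf (n + 1), if eta ∈ below n nu then chainCount (n + 1) nu else 0 := by
    intro eta heta
    rw [← sum_above_chainCount n (mem_evenPartitionsOf.1 heta).1, above, Finset.sum_filter]
    refine Finset.sum_congr rfl fun nu _ => ?_
    simp [mem_below, (mem_evenPartitionsOf.1 heta).1]
  have h3 := Finset.sum_congr rfl h2
  have h4 := Finset.sum_congr rfl h1
  rw [h4, Finset.mul_sum, h3, Finset.sum_comm]
  conv_rhs => rw [Finset.sum_comm]
  refine Finset.sum_congr rfl fun nu hnu => ?_
  rw [← Finset.sum_filter, ← Finset.sum_filter, Finset.sum_const, Finset.sum_const,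
    card_even_above_eq (mem_partitionsOf.1 hnu)]

end YoungLattice

/-! ### Restriction of characters -/

section Restriction

theorem coeff_youngSym_mul {R : Type*} [CommRing R] {lam : YoungDiagram}
    {q p : Equiv.Perm (Box lam)} (hq : IsColPerm q) (hp : IsRowPerm p) :
    (youngSym R lam).coeff (q * p) = ((Equiv.Perm.sign q : ℤ) : R) := by
  have h1 := congrArg (fun z => z.coeff (q * p)) (single_mul_youngSym (R := R) hq)
  have h2 := congrArg (fun z => z.coeff p) (youngSym_mul_single (R := R) hp)
  simp only [MonoidAlgebra.coeff_single_mul_apply, MonoidAlgebra.coeff_mul_single_apply,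
    inv_mul_cancel_left, mul_inv_cancel, one_mul, mul_one, coeff_one_youngSym,
    MonoidAlgebra.coeff_smul_apply, smul_eq_mul] at h1 h2
  rw [← h2] at h1
  have h3 : ((Equiv.Perm.sign q : ℤ) : R) * ((Equiv.Perm.sign q : ℤ) : R) = 1 := by
    rw [← Int.cast_mul, ← Units.val_mul, Int.units_mul_self]; simp
  calc _ = ((Equiv.Perm.sign q : ℤ) : R) * (((Equiv.Perm.sign q : ℤ) : R) *
      (youngSym R lam).coeff (q * p)) := by rw [← mul_assoc, h3, one_mul]
    _ = _ := by rw [← h1, mul_one]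

theorem exists_of_coeff_youngSym_ne_zero {R : Type*} [CommRing R] {lam : YoungDiagram}
    {g : Equiv.Perm (Box lam)} (h : (youngSym R lam).coeff g ≠ 0) :
    ∃ q p, IsColPerm q ∧ IsRowPerm p ∧ g = q * p := by
  classical
  rw [youngSym, coeff_mul_fintype] at h
  obtain ⟨q, -, hq⟩ := Finset.exists_ne_zero_of_sum_ne_zero h
  rw [coeff_colAltSum, coeff_rowSum] at hq
  by_cases h1 : IsColPerm q
  · by_cases h2 : IsRowPerm (q⁻¹ * g)
    · exact ⟨q, q⁻¹ * g, h1, h2, by simp⟩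
    · rw [if_neg h2, mul_zero] at hq; exact absurd rfl hq
  · rw [if_neg h1, zero_mul] at hq; exact absurd rfl hq

/-- The action of `G × H` on bijections `F ≃ X` by composition on both sides. -/
@[reducible] def bijAction {G H F X : Type*} [Group G] [Group H] (a : G →* Equiv.Perm X)
    (b : H →* Equiv.Perm F) : MulAction (G × H) (F ≃ X) where
  smul p s := ((b p.2)⁻¹ : Equiv.Perm F).trans (s.trans (a p.1))
  one_smul s := by
    change ((b 1)⁻¹ : Equiv.Perm F).trans (s.trans (a 1)) = s
    ext x; simp
  mul_smul p q s := by
    change ((b (p.2 * q.2))⁻¹ : Equiv.Perm F).trans (s.trans (a (p.1 * q.1))) =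
      ((b p.2)⁻¹ : Equiv.Perm F).trans ((((b q.2)⁻¹ : Equiv.Perm F).trans
        (s.trans (a q.1))).trans (a p.1))
    ext x; simp

/-- The trace of the outer product of two multiples of idempotents on the bijections `F ≃ X`; the
operator vanishes if the trace does. -/
theorem exists_rank_bij {G H F X : Type} [Group G] [Group H] [Fintype G] [Fintype H] [Fintype F]
    [DecidableEq F] [Fintype X] [DecidableEq X] (a : G →* Equiv.Perm X) (b : H →* Equiv.Perm F)
    {x : MonoidAlgebra ℤ G} {y : MonoidAlgebra ℤ H} {α β : ℤ} (hx : x * x = α • x)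
    (hy : y * y = β • y) (hα : α ≠ 0) (hβ : β ≠ 0) :
    ∃ r : ℕ, (r : ℤ) * (α * β) = ∑ g, ∑ h, x.coeff g * y.coeff h *
        (Fintype.card {s : F ≃ X // ∀ z, a g (s z) = s (b h z)} : ℤ) ∧
      (r = 0 → letI := bijAction a b; permMat ℚ (F ≃ X)
        (MonoidAlgebra.mapRingHom (G × H) (Int.castRingHom ℚ) (prodElt x y)) = 0) := by
  let _ := bijAction a b
  have hxy : prodElt x y * prodElt x y = (α * β) • prodElt x y := by
    rw [prodElt_mul, hx, hy, ← prodElt_smul]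
  have h := rank_permMat_mul_eq (K := ℚ) (F ≃ X) (prodElt x y)
    (Int.cast_ne_zero.2 (mul_ne_zero hα hβ)) hxy
  refine ⟨(permMat ℚ (F ≃ X) (MonoidAlgebra.mapRingHom (G × H) (Int.castRingHom ℚ)
    (prodElt x y))).rank, ?_, fun h0 => ?_⟩
  swap
  · rw [Matrix.rank, Submodule.finrank_eq_zero, LinearMap.range_eq_bot] at h0
    exact Matrix.toLin'.injective (h0.trans (map_zero _).symm)
  rw [h, Fintype.sum_prod_type]
  refine Finset.sum_congr rfl fun g _ => Finset.sum_congr rfl fun k _ => ?_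
  rw [coeff_prodElt]
  congr 2
  refine Fintype.card_congr (Equiv.subtypeEquivRight fun s => ?_)
  change ((b k)⁻¹ : Equiv.Perm F).trans (s.trans (a g)) = s ↔ _
  rw [Equiv.ext_iff]
  constructor
  · intro h z
    have := h (b k z)
    simpa using this
  · intro h z
    have := h ((b k)⁻¹ z)
    simpa using this

theorem exists_equiv_extending {A B C : Type*} [Fintype B] [Fintype C] (f : A ↪ B) (g : A ↪ C)
    (h : Fintype.card B = Fintype.card C) : ∃ e : B ≃ C, ∀ a, e (f a) = g a := by
  classical
  obtain ⟨e⟩ := Fintype.card_eq.1 h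
  let e1 : {x // x ∈ Set.range (fun a => e (f a))} ≃ {x // x ∈ Set.range g} :=
    (Equiv.ofInjective _ (e.injective.comp f.injective)).symm.trans (Equiv.ofInjective _ g.injective)
  refine ⟨e.trans e1.extendSubtype, fun a => ?_⟩
  have hmem : e (f a) ∈ Set.range (fun a => e (f a)) := ⟨a, rfl⟩
  rw [Equiv.trans_apply, Equiv.extendSubtype_apply_of_mem e1 _ hmem]
  have : (Equiv.ofInjective _ (e.injective.comp f.injective)).symm ⟨e (f a), hmem⟩ = a := by
    rw [Equiv.symm_apply_eq]; rfl
  simp only [e1, Equiv.trans_apply]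
  erw [this]
  rfl

variable {Y Z : Type} [Fintype Y] [DecidableEq Y] [Fintype Z] [DecidableEq Z]

/-- The restriction of a class function to the permutations of a subset. -/
noncomputable def resFun (i : Y ↪ Z) (φ : Equiv.Perm Z → ℚ) (h : Equiv.Perm Y) : ℚ :=
  φ (h.viaEmbedding i)

theorem resFun_isClassFun (i : Y ↪ Z) {φ : Equiv.Perm Z → ℚ} (hφ : IsClassFun φ) :
    IsClassFun (resFun i φ) := fun g h => by
  have : ∀ g : Equiv.Perm Y, g.viaEmbedding i = Equiv.Perm.viaEmbeddingHom i g := fun _ => rfl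
  rw [resFun, resFun, this, map_mul, map_mul, map_inv, hφ]
  rfl

variable {lam mu : YoungDiagram}

/-- The trace formula for the multiplicity of `λ` in the restriction of `μ`. -/
theorem charInner_resFun (i : Y ↪ Z) (t : Box lam ≃ Y) (hm : mu.card = Fintype.card Z) :
    charInner (chi Y lam) (resFun i (chi Z mu)) * (hookProd lam * hookProd mu) =
      ((∑ σ, ∑ ρ, (youngSym ℤ lam).coeff σ * (youngSym ℤ mu).coeff ρ *
        (Fintype.card {s : Box mu ≃ Z // ∀ z, (t.permCongr σ).viaEmbedding i (s z) = s (ρ z)} : ℤ)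
        : ℤ) : ℚ) := by
  rw [charInner_chi (resFun_isClassFun i (chi_isClassFun mu)) t]
  simp only [resFun, chi, mul_div_assoc', ← Finset.sum_div, Finset.mul_sum]
  have h1 := hookProdQ_ne_zero lam
  have h2 := hookProdQ_ne_zero mu
  rw [div_div, mul_comm (hookProd mu : ℚ), div_mul_cancel₀ _ (mul_ne_zero h1 h2)]
  push_cast
  refine Finset.sum_congr rfl fun σ _ => ?_
  have h3 : ∀ s : Box mu ≃ Z, (youngSym ℚ lam).coeff σ *
      (youngSym ℚ mu).coeff (s.symm.permCongr ((t.permCongr σ).viaEmbedding i)) =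
      ∑ ρ, if ∀ z, (t.permCongr σ).viaEmbedding i (s z) = s (ρ z) then
        (((youngSym ℤ lam).coeff σ : ℤ) : ℚ) * (((youngSym ℤ mu).coeff ρ : ℤ) : ℚ) else 0 := by
    intro s
    rw [Finset.sum_eq_single (s.symm.permCongr ((t.permCongr σ).viaEmbedding i)), if_pos]
    · rw [coeff_youngSym_cast lam ℚ σ, coeff_youngSym_cast mu ℚ]
    · intro z; simp [Equiv.permCongr_apply]
    · intro ρ _ hne
      refine if_neg fun h => hne (Equiv.ext fun z => ?_)
      rw [Equiv.permCongr_apply, Equiv.symm_symm, h z, Equiv.symm_apply_apply]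
    · simp
  rw [Finset.sum_congr rfl fun s _ => h3 s, Finset.sum_comm]
  refine Finset.sum_congr rfl fun ρ _ => ?_
  rw [← Finset.sum_filter, Finset.sum_const, nsmul_eq_mul, Fintype.card_subtype]
  ring

/-- Restriction multiplicities are natural numbers, and positive when `λ ⊆ μ`: the Young
symmetrizers of `λ` and `μ` then agree on the permutations of the boxes of `λ`. -/
theorem exists_charInner_resFun (i : Y ↪ Z) (hl : lam.card = Fintype.card Y)
    (hm : mu.card = Fintype.card Z) :
    ∃ r : ℕ, charInner (chi Y lam) (resFun i (chi Z mu)) = r ∧ (lam ≤ mu → r ≠ 0) := by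
  obtain ⟨t⟩ : Nonempty (Box lam ≃ Y) := Fintype.card_eq.1 (by rw [card_box, hl])
  set a : Equiv.Perm (Box lam) →* Equiv.Perm Z :=
    (Equiv.Perm.viaEmbeddingHom i).comp t.permCongrHom.toMonoidHom with ha
  obtain ⟨r, hr, hr0⟩ := exists_rank_bij a (MonoidHom.id (Equiv.Perm (Box mu)))
    (x := youngSym ℤ lam) (y := youngSym ℤ mu) (by rw [youngSym_mul_self, Int.cast_id])
    (by rw [youngSym_mul_self, Int.cast_id]) (hookProd_ne_zero lam) (hookProd_ne_zero mu)
  have h1 := charInner_resFun (lam := lam) (mu := mu) i t hm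
  have h2 : charInner (chi Y lam) (resFun i (chi Z mu)) = r := by
    have h3 := mul_ne_zero (hookProdQ_ne_zero lam) (hookProdQ_ne_zero mu)
    apply mul_right_cancel₀ h3
    rw [h1]
    have h4 := congrArg (Int.cast : ℤ → ℚ) hr
    push_cast at h4 ⊢
    exact h4.symm
  refine ⟨r, h2, fun hle h0 => ?_⟩
  -- a numbering of the boxes of `μ` that extends the numbering of the boxes of `λ`
  obtain ⟨s, hs⟩ := exists_equiv_extending
    (⟨fun x => ⟨x.1, hle x.2⟩, fun x y h => Subtype.ext (Subtype.mk.inj h)⟩ : Box lam ↪ Box mu)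
    (t.toEmbedding.trans i) (by rw [card_box, hm])
  let j : Box lam → Box mu := fun x => ⟨x.1, hle x.2⟩
  replace hs : ∀ x, s (j x) = i (t x) := hs
  -- the permutation of the boxes of `μ` that extends a permutation of the boxes of `λ`
  set E : Equiv.Perm (Box lam) →* Equiv.Perm (Box mu) :=
    s.symm.permCongrHom.toMonoidHom.comp a with hE
  have hEs : ∀ σ z, s (E σ z) = a σ (s z) := by
    intro σ z
    simp [hE, Equiv.permCongr_apply]
  have hEj : ∀ σ x, E σ (j x) = j (σ x) := by
    intro σ x
    apply s.injective
    rw [hEs, hs, hs]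
    simp only [ha, MonoidHom.comp_apply, Equiv.Perm.viaEmbeddingHom_apply]
    erw [Equiv.Perm.viaEmbedding_apply]
    simp [Equiv.permCongr_apply]
  have hEn : ∀ σ z, z ∉ Set.range j → E σ z = z := by
    intro σ z hz
    apply s.injective
    rw [hEs]
    simp only [ha, MonoidHom.comp_apply, Equiv.Perm.viaEmbeddingHom_apply]
    apply Equiv.Perm.viaEmbedding_apply_of_notMem
    rintro ⟨y, hy⟩
    apply hz
    refine ⟨t.symm y, s.injective ?_⟩
    rw [hs, Equiv.apply_symm_apply, hy]
  have hEcol : ∀ σ, IsColPerm σ → IsColPerm (E σ) := by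
    intro σ hσ z
    by_cases hz : z ∈ Set.range j
    · obtain ⟨x, rfl⟩ := hz; rw [hEj]; exact hσ x
    · rw [hEn σ z hz]
  have hErow : ∀ σ, IsRowPerm σ → IsRowPerm (E σ) := by
    intro σ hσ z
    by_cases hz : z ∈ Set.range j
    · obtain ⟨x, rfl⟩ := hz; rw [hEj]; exact hσ x
    · rw [hEn σ z hz]
  have hEsign : ∀ σ, Equiv.Perm.sign (E σ) = Equiv.Perm.sign σ := by
    intro σ
    have h5 : E σ = s.symm.permCongr ((t.permCongr σ).viaEmbedding i) := rfl
    rw [h5, Equiv.Perm.sign_permCongr, Equiv.Perm.viaEmbedding, Equiv.Perm.sign_extendDomain,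
      Equiv.Perm.sign_permCongr]
  have hco : ∀ σ, (youngSym ℚ lam).coeff σ ≠ 0 →
      (youngSym ℚ mu).coeff (E σ) = (youngSym ℚ lam).coeff σ := by
    intro σ hσ
    obtain ⟨q, p, hq, hp, rfl⟩ := exists_of_coeff_youngSym_ne_zero hσ
    rw [map_mul, coeff_youngSym_mul (hEcol q hq) (hErow p hp), coeff_youngSym_mul hq hp, hEsign]
  have h5 := hr0 h0
  let _ := bijAction a (MonoidHom.id (Equiv.Perm (Box mu)))
  -- the diagonal entry at `s` is a sum of squares, one of which is `1`
  have h6 := congrFun (congrFun h5 s) s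
  rw [map_prodElt, map_youngSym, map_youngSym, permMat_eq_sum, Fintype.sum_prod_type] at h6
  have h7 : ∀ σ, (∑ ρ, if ((σ, ρ) : Equiv.Perm (Box lam) × Equiv.Perm (Box mu)) • s = s then
      (prodElt (youngSym ℚ lam) (youngSym ℚ mu)).coeff (σ, ρ) else 0) =
      (youngSym ℚ lam).coeff σ * (youngSym ℚ lam).coeff σ := by
    intro σ
    have h8 : ∀ ρ : Equiv.Perm (Box mu),
        ((σ, ρ) : Equiv.Perm (Box lam) × Equiv.Perm (Box mu)) • s = s ↔ ρ = E σ := by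
      intro ρ
      change ((MonoidHom.id _ ρ)⁻¹ : Equiv.Perm _).trans (s.trans (a σ)) = s ↔ _
      rw [Equiv.ext_iff, Equiv.ext_iff]
      constructor
      · intro h z
        have := h (ρ z)
        apply s.injective
        rw [hEs, ← this]
        simp
      · intro h z
        have := congrArg s (h (ρ⁻¹ z))
        rw [hEs] at this
        simpa using this.symm
    simp only [h8, Finset.sum_ite_eq', Finset.mem_univ, if_true, coeff_prodElt]
    by_cases h9 : (youngSym ℚ lam).coeff σ = 0
    · rw [h9, zero_mul, zero_mul]
    · rw [hco σ h9]
  rw [Finset.sum_congr rfl fun σ _ => h7 σ] at h6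
  have h8 := (Finset.sum_eq_zero_iff_of_nonneg
    (fun σ _ => mul_self_nonneg ((youngSym ℚ lam).coeff σ))).1 h6 1 (Finset.mem_univ _)
  rw [coeff_one_youngSym] at h8
  norm_num at h8

theorem sum_pos_eq {ι : Type*} {s : Finset ι} {a b : ι → ℕ} (hab : ∀ i ∈ s, a i ≤ b i)
    (h : ∑ i ∈ s, b i ≤ ∑ i ∈ s, a i) : ∀ i ∈ s, a i = b i :=
  (Finset.sum_eq_sum_iff_of_le hab).1 (le_antisymm (Finset.sum_le_sum hab) h)

/-- If the degrees of the characters of level `n` are the chain counts, every restriction from level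
`n + 1` contains the characters below, and its degree is at least the chain count. -/
theorem restriction_of_degree_eq {n : ℕ} (hn : ∀ lam : YoungDiagram, lam.card = n →
      degree lam = chainCount n lam) (hY : Fintype.card Y = n) (i : Y ↪ Z)
    (hZ : Fintype.card Z = n + 1) (hm : mu.card = n + 1) :
    ∃ r : YoungDiagram → ℕ, (∀ lam ∈ below n mu, r lam ≠ 0) ∧
      (∀ h, resFun i (chi Z mu) h = ∑ lam ∈ partitionsOf n, r lam * chi Y lam h) ∧
      degree mu = ∑ lam ∈ partitionsOf n, r lam * degree lam := by
  classical
  subst hY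
  have hsq : ∑ lam ∈ partitionsOf (Fintype.card Y), degree lam ^ 2 =
      (Fintype.card Y).factorial := by
    rw [← sum_chainCount_sq]
    exact Finset.sum_congr rfl fun lam hlam => by rw [hn lam (mem_partitionsOf.1 hlam)]
  have hex : ∀ lam : YoungDiagram, ∃ r : ℕ, lam.card = Fintype.card Y →
      charInner (chi Y lam) (resFun i (chi Z mu)) = r ∧ (lam ≤ mu → r ≠ 0) := by
    intro lam
    by_cases hl : lam.card = Fintype.card Y
    · obtain ⟨r, hr⟩ := exists_charInner_resFun (mu := mu) i hl (by rw [hm, hZ])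
      exact ⟨r, fun _ => hr⟩
    · exact ⟨0, fun h => absurd h hl⟩
  choose r hr using hex
  have hres : ∀ h, resFun i (chi Z mu) h =
      ∑ lam ∈ partitionsOf (Fintype.card Y), r lam * chi Y lam h := by
    intro h
    rw [eq_sum_chi_of_sum_degree_sq hsq (resFun_isClassFun i (chi_isClassFun mu))]
    exact Finset.sum_congr rfl fun lam hlam => by rw [(hr lam (mem_partitionsOf.1 hlam)).1]
  refine ⟨r, fun lam hlam => (hr lam (mem_below.1 hlam).1).2 (mem_below.1 hlam).2, hres, ?_⟩
  have h1 := hres 1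
  have h2 : resFun i (chi Z mu) 1 = degree mu := by
    rw [resFun, show (1 : Equiv.Perm Y).viaEmbedding i = 1 from map_one
      (Equiv.Perm.viaEmbeddingHom i), chi_one (by rw [hm, hZ])]
  rw [h2] at h1
  have h3 : ∀ lam ∈ partitionsOf (Fintype.card Y), (r lam : ℚ) * chi Y lam 1 =
      ((r lam * degree lam : ℕ) : ℚ) := fun lam hlam => by
    rw [chi_one (mem_partitionsOf.1 hlam)]; push_cast; ring
  rw [Finset.sum_congr rfl h3, ← Nat.cast_sum] at h1
  exact_mod_cast h1

theorem sum_below_le_sum {n : ℕ} {r F : YoungDiagram → ℕ} (hr : ∀ lam ∈ below n mu, r lam ≠ 0) :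
    ∑ lam ∈ below n mu, F lam ≤ ∑ lam ∈ partitionsOf n, r lam * F lam := by
  classical
  rw [below, Finset.sum_filter]
  refine Finset.sum_le_sum fun lam hlam => ?_
  split_ifs with h
  · have := hr lam (mem_below.2 ⟨mem_partitionsOf.1 hlam, h⟩)
    exact Nat.le_mul_of_pos_left _ (Nat.pos_of_ne_zero this)
  · exact Nat.zero_le _

/-- The degree of the character of `λ` is the number of standard tableaux. The inequality
`∑ (degree λ) ^ 2 ≤ n!` forces equality everywhere. -/
theorem degree_eq_chainCount (n : ℕ) : ∀ lam : YoungDiagram, lam.card = n →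
    degree lam = chainCount n lam := by
  induction n with
  | zero =>
    intro lam hl
    have h1 := degree_mul_hookProd lam
    rw [hl] at h1
    have h2 : (degree lam : ℤ) ∣ 1 := ⟨_, by simpa using h1.symm⟩
    have h3 : degree lam ∣ 1 := by exact_mod_cast h2
    rw [Nat.dvd_one.1 h3, chainCount]
  | succ n ih =>
    have hle : ∀ mu ∈ partitionsOf (n + 1), chainCount (n + 1) mu ≤ degree mu := by
      intro mu hmu
      obtain ⟨r, hr, -, hd⟩ := restriction_of_degree_eq (Y := Fin n) (Z := Fin (n + 1)) (mu := mu)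
        ih (Fintype.card_fin n) Fin.castSuccEmb (Fintype.card_fin _) (mem_partitionsOf.1 hmu)
      rw [hd, chainCount_succ, Finset.sum_congr rfl fun lam hlam =>
        (ih lam (mem_below.1 hlam).1).symm]
      exact sum_below_le_sum hr
    have h := sum_pos_eq (fun mu hmu => Nat.pow_le_pow_left (hle mu hmu) 2)
      ((sum_degree_sq_le (n + 1)).1.trans (sum_chainCount_sq (n + 1)).ge)
    intro mu hmu
    have := h mu (mem_partitionsOf.2 hmu)
    exact (Nat.pow_left_injective two_ne_zero this).symm

theorem sum_degree_sq (n : ℕ) : ∑ lam ∈ partitionsOf n, degree lam ^ 2 = n.factorial := by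
  rw [← sum_chainCount_sq]
  exact Finset.sum_congr rfl fun lam hlam => by
    rw [degree_eq_chainCount n lam (mem_partitionsOf.1 hlam)]

/-- The characters of partitions span the class functions. -/
theorem eq_sum_chi {φ : Equiv.Perm Y → ℚ} (hφ : IsClassFun φ) (g : Equiv.Perm Y) :
    φ g = ∑ lam ∈ partitionsOf (Fintype.card Y), charInner (chi Y lam) φ * chi Y lam g :=
  eq_sum_chi_of_sum_degree_sq (sum_degree_sq _) hφ g

theorem charInner_eq_sum {φ ψ : Equiv.Perm Y → ℚ} (hψ : IsClassFun ψ) :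
    charInner φ ψ = ∑ lam ∈ partitionsOf (Fintype.card Y),
      charInner (chi Y lam) φ * charInner (chi Y lam) ψ := by
  have h : ψ = fun g => ∑ lam ∈ partitionsOf (Fintype.card Y),
      charInner (chi Y lam) ψ * chi Y lam g := funext fun g => eq_sum_chi hψ g
  conv_lhs => rw [h]
  rw [charInner_sum_right]
  exact Finset.sum_congr rfl fun lam _ => by rw [charInner_comm φ]; ring

/-- The branching rule. -/
theorem resFun_chi {n : ℕ} (hY : Fintype.card Y = n) (i : Y ↪ Z) (hZ : Fintype.card Z = n + 1)
    (hm : mu.card = n + 1) (h : Equiv.Perm Y) :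
    resFun i (chi Z mu) h = ∑ lam ∈ below n mu, chi Y lam h := by
  classical
  obtain ⟨r, hr, hres, hd⟩ := restriction_of_degree_eq (degree_eq_chainCount n) hY i hZ hm
  have h1 : degree mu = ∑ lam ∈ partitionsOf n, if lam ≤ mu then degree lam else 0 := by
    rw [degree_eq_chainCount (n + 1) mu hm, chainCount_succ, below, Finset.sum_filter]
    refine Finset.sum_congr rfl fun lam hlam => ?_
    rw [degree_eq_chainCount n lam (mem_partitionsOf.1 hlam)]
  have h2 : ∀ lam ∈ partitionsOf n, (if lam ≤ mu then degree lam else 0) = r lam * degree lam := by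
    refine sum_pos_eq (fun lam hlam => ?_) (by rw [← h1, ← hd])
    split_ifs with hle
    · exact Nat.le_mul_of_pos_left _ (Nat.pos_of_ne_zero
        (hr lam (mem_below.2 ⟨mem_partitionsOf.1 hlam, hle⟩)))
    · exact Nat.zero_le _
  rw [hres, below, Finset.sum_filter]
  refine Finset.sum_congr rfl fun lam hlam => ?_
  have h3 := h2 lam hlam
  have hp := degree_pos lam
  split_ifs at h3 ⊢ with hle
  · have : r lam = 1 := Nat.eq_of_mul_eq_mul_right hp (by rw [← h3, one_mul])
    rw [this]; simp
  · have : r lam = 0 := by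
      rcases Nat.mul_eq_zero.1 h3.symm with h | h
      · exact h
      · omega
    rw [this]; simp

theorem resFun_resFun {W : Type} [Fintype W] [DecidableEq W] (i : Y ↪ Z) (j : Z ↪ W)
    (φ : Equiv.Perm W → ℚ) : resFun i (resFun j φ) = resFun (i.trans j) φ := by
  funext h
  simp only [resFun]
  congr 1
  ext w
  by_cases hw : w ∈ Set.range j
  · obtain ⟨z, rfl⟩ := hw
    rw [Equiv.Perm.viaEmbedding_apply]
    by_cases hz : z ∈ Set.range i
    · obtain ⟨y, rfl⟩ := hz
      rw [Equiv.Perm.viaEmbedding_apply]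
      exact (Equiv.Perm.viaEmbedding_apply h (i.trans j) y).symm
    · rw [Equiv.Perm.viaEmbedding_apply_of_notMem _ _ _ hz,
        Equiv.Perm.viaEmbedding_apply_of_notMem]
      rintro ⟨y, hy⟩
      exact hz ⟨y, j.injective hy⟩
  · rw [Equiv.Perm.viaEmbedding_apply_of_notMem _ _ _ hw,
      Equiv.Perm.viaEmbedding_apply_of_notMem]
    rintro ⟨y, hy⟩
    exact hw ⟨i y, hy⟩

/-- Only subdiagrams of `μ` occur in restrictions of the character of `μ`. -/
theorem charInner_resFun_eq_zero (d : ℕ) : ∀ {Z : Type} [Fintype Z] [DecidableEq Z] (i : Y ↪ Z)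
    {mu : YoungDiagram}, Fintype.card Z = Fintype.card Y + d → lam.card = Fintype.card Y →
    mu.card = Fintype.card Z → ¬ lam ≤ mu →
    charInner (chi Y lam) (resFun i (chi Z mu)) = 0 := by
  induction d with
  | zero =>
    intro Z _ _ i mu hZ hl hm hle
    have hb : Function.Bijective i := (Fintype.bijective_iff_injective_and_card i).2
      ⟨i.injective, by omega⟩
    have h1 : resFun i (chi Z mu) = chi Y mu := by
      funext h
      rw [resFun, ← chi_permCongr mu (Equiv.ofBijective i hb) h]
      congr 1
      ext z
      obtain ⟨y, rfl⟩ := hb.2 z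
      rw [Equiv.Perm.viaEmbedding_apply, Equiv.permCongr_apply]
      have : (Equiv.ofBijective i hb).symm (i y) = y := by
        rw [Equiv.symm_apply_eq]; rfl
      rw [this]; rfl
    rw [h1, charInner_chi_chi_of_ne hl]
    rintro rfl
    exact hle le_rfl
  | succ d ih =>
    intro Z _ _ i mu hZ hl hm hle
    obtain ⟨z, hz⟩ : ∃ z, z ∉ Set.range i := by
      by_contra hcon
      push Not at hcon
      have := Fintype.card_le_of_surjective i hcon
      omega
    let i' : Y ↪ {x // x ≠ z} := ⟨fun y => ⟨i y, fun h => hz ⟨y, h⟩⟩,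
      fun a b h => i.injective (congrArg Subtype.val h)⟩
    have hcard : Fintype.card {x // x ≠ z} = Fintype.card Y + d := by
      rw [Fintype.card_subtype_compl, Fintype.card_subtype_eq]; omega
    have h1 : resFun i (chi Z mu) = resFun i' (resFun (Function.Embedding.subtype _) (chi Z mu)) :=
      by rw [resFun_resFun]; rfl
    have h2 : resFun (Function.Embedding.subtype fun x => x ≠ z) (chi Z mu) =
        fun h => ∑ nu ∈ below (Fintype.card Y + d) mu, chi {x // x ≠ z} nu h :=
      funext fun h => resFun_chi hcard _ (by omega) (by omega) h
    have h3 : resFun i' (fun h => ∑ nu ∈ below (Fintype.card Y + d) mu, chi {x // x ≠ z} nu h) =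
        fun h => ∑ nu ∈ below (Fintype.card Y + d) mu,
          (1 : ℚ) * resFun i' (chi {x // x ≠ z} nu) h := by
      funext h; simp [resFun]
    rw [h1, h2, h3, charInner_sum_right]
    refine Finset.sum_eq_zero fun nu hnu => ?_
    obtain ⟨hc, hn⟩ := mem_below.1 hnu
    rw [ih i' hcard hl (by rw [hc, hcard]) (fun h => hle (h.trans hn)), mul_zero]

end Restriction

/-! ### The permutation character on perfect matchings -/

section Matchings

/-- The perfect matchings of `Y`, as involutions without fixed points. -/
def PerfectMatching (Y : Type) : Type := {s : Equiv.Perm Y // (∀ y, s (s y) = y) ∧ ∀ y, s y ≠ y}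

noncomputable instance (Y : Type) [Fintype Y] : Fintype (PerfectMatching Y) := by
  classical exact inferInstanceAs (Fintype {s : Equiv.Perm Y // _})

noncomputable instance (Y : Type) : DecidableEq (PerfectMatching Y) := Classical.decEq _

/-- Permutations act on matchings by conjugation. -/
instance (Y : Type) : MulAction (Equiv.Perm Y) (PerfectMatching Y) where
  smul g s := ⟨g * s.1 * g⁻¹, fun y => by simp [s.2.1], fun y => by
    have h := s.2.2 (g⁻¹ y)
    intro h'
    apply h
    apply g.injective
    simpa using h'⟩
  one_smul s := Subtype.ext (by change 1 * s.1 * 1⁻¹ = s.1; simp)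
  mul_smul g h s := Subtype.ext (by
    change g * h * s.1 * (g * h)⁻¹ = g * (h * s.1 * h⁻¹) * g⁻¹
    simp [mul_assoc])

theorem PerfectMatching.smul_eq_iff {Y : Type} (g : Equiv.Perm Y) (s : PerfectMatching Y) :
    g • s = s ↔ ∀ y, g (s.1 y) = s.1 (g y) := by
  have h1 : g • s = s ↔ g * s.1 * g⁻¹ = s.1 := Subtype.ext_iff
  rw [h1, mul_inv_eq_iff_eq_mul, Equiv.ext_iff]
  rfl

variable {Y : Type} [Fintype Y] [DecidableEq Y]

/-- Both sides equal `(2a)! / (2 ^ a a!)` if `Y` has `2a` elements. -/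
theorem card_perfectMatching_le : Fintype.card (PerfectMatching Y) ≤
    ∑ eta ∈ evenPartitionsOf (Fintype.card Y), chainCount (Fintype.card Y) eta := by
  classical
  have hev : ∀ a : ℕ, (2 * a).factorial ≤
      (∑ eta ∈ evenPartitionsOf (2 * a), chainCount (2 * a) eta) * (2 ^ a * a.factorial) := by
    intro a
    induction a with
    | zero =>
      have h0 : (⊥ : YoungDiagram) ∈ evenPartitionsOf 0 := mem_evenPartitionsOf.2
        ⟨by simp, fun i => by
          have : (⊥ : YoungDiagram).rowLen i = 0 := by
            by_contra h
            have := YoungDiagram.mem_iff_lt_rowLen.2 (Nat.pos_of_ne_zero h)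
            exact absurd this (YoungDiagram.notMem_bot _)
          rw [this]; exact Even.zero⟩
      have := Finset.single_le_sum (f := fun eta => chainCount 0 eta)
        (fun _ _ => Nat.zero_le _) h0
      simpa [chainCount] using this
    | succ a ih =>
      rw [show 2 * (a + 1) = 2 * a + 2 by ring, sum_even_chainCount_succ, Nat.factorial_succ,
        Nat.factorial_succ, Nat.factorial_succ]
      calc (2 * a + 1 + 1) * ((2 * a + 1) * (2 * a).factorial)
          ≤ (2 * a + 1 + 1) * ((2 * a + 1) * _) := Nat.mul_le_mul_left _ (Nat.mul_le_mul_left _ ih)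
        _ = _ := by ring
  rcases isEmpty_or_nonempty (PerfectMatching Y) with h | ⟨⟨s⟩⟩
  · rw [Fintype.card_eq_zero]; exact Nat.zero_le _
  have hcyc : ∀ s : PerfectMatching Y, s.1.cycleType = Multiset.replicate s.1.cycleType.card 2 ∧
      Fintype.card Y = 2 * s.1.cycleType.card := by
    intro s
    have h2 : s.1 ^ 2 = 1 := by ext y; rw [pow_two]; exact s.2.1 y
    have h3 := Equiv.Perm.cycleType_of_pow_prime_eq_one (p := 2) h2
    refine ⟨h3, ?_⟩
    have h4 := s.1.sum_cycleType
    rw [h3] at h4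
    have h5 : s.1.support = Finset.univ := Finset.eq_univ_of_forall fun y =>
      Equiv.Perm.mem_support.2 (s.2.2 y)
    rw [h5, Finset.card_univ, Multiset.sum_replicate] at h4
    rw [← h4, smul_eq_mul, mul_comm]
  obtain ⟨a, ha⟩ : ∃ a, Fintype.card Y = 2 * a := ⟨_, (hcyc s).2⟩
  have hle : Fintype.card (PerfectMatching Y) ≤
      (Finset.univ.filter fun g : Equiv.Perm Y => g.cycleType = Multiset.replicate a 2).card := by
    rw [← Finset.card_univ]
    refine Finset.card_le_card_of_injOn Subtype.val (fun s _ => ?_)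
      (fun s _ t _ h => Subtype.ext h)
    have h1 := hcyc s
    have h2 : s.1.cycleType.card = a := by omega
    simp only [Finset.coe_filter, Finset.mem_univ, true_and, Set.mem_ofPred_eq]
    rw [h1.1, h2]
  refine hle.trans (Nat.le_of_mul_le_mul_right (c := 2 ^ a * a.factorial) ?_ (by positivity))
  have h := Equiv.Perm.card_of_cycleType_mul_eq (α := Y) (Multiset.replicate a 2)
  rw [Multiset.sum_replicate, Multiset.prod_replicate, ha, smul_eq_mul, mul_comm a 2,
    Nat.sub_self, Nat.factorial_zero, one_mul, if_pos ⟨le_rfl, fun b hb => by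
      rw [Multiset.eq_of_mem_replicate hb]⟩] at h
  have h2 : ∏ n ∈ (Multiset.replicate a 2).toFinset, ((Multiset.replicate a 2).count n).factorial =
      a.factorial := by
    rcases Nat.eq_zero_or_pos a with rfl | hpos
    · simp
    · rw [Multiset.toFinset_replicate, if_neg hpos.ne', Finset.prod_singleton,
        Multiset.count_replicate_self]
  rw [h2] at h
  rw [ha, h]
  exact hev a

/-- The permutation character on perfect matchings. -/
noncomputable def matchChar (g : Equiv.Perm Y) : ℚ :=
  Fintype.card {s : PerfectMatching Y // g • s = s}

theorem matchChar_permCongr {X : Type} [Fintype X] [DecidableEq X] (e : X ≃ Y)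
    (g : Equiv.Perm X) : matchChar (e.permCongr g) = matchChar g := by
  let E : PerfectMatching X ≃ PerfectMatching Y := Equiv.subtypeEquiv e.permCongr fun s => by
    simp only [Equiv.permCongr_apply, Equiv.symm_apply_apply]
    constructor
    · rintro ⟨h1, h2⟩
      refine ⟨fun y => by rw [h1, Equiv.apply_symm_apply], fun y h => h2 (e.symm y) ?_⟩
      exact e.injective (h.trans (e.apply_symm_apply y).symm)
    · rintro ⟨h1, h2⟩
      refine ⟨fun x => ?_, fun x h => h2 (e x) ?_⟩
      · have := h1 (e x)
        rw [Equiv.symm_apply_apply] at this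
        exact e.injective this
      · rw [Equiv.symm_apply_apply, h]
  rw [matchChar, matchChar]
  congr 1
  refine (Fintype.card_congr (E.subtypeEquiv fun s => ?_)).symm
  rw [PerfectMatching.smul_eq_iff, PerfectMatching.smul_eq_iff]
  have hE : (E s).1 = e.permCongr s.1 := rfl
  rw [hE]
  simp only [Equiv.permCongr_apply, Equiv.symm_apply_apply, EmbeddingLike.apply_eq_iff_eq]
  exact ⟨fun h y => h _, fun h x => by simpa using h (e x)⟩

theorem matchChar_isClassFun : IsClassFun (matchChar (Y := Y)) := fun g h => by
  have : h * g * h⁻¹ = Equiv.permCongr h g := rfl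
  rw [this, matchChar_permCongr]

theorem matchChar_one : matchChar (1 : Equiv.Perm Y) = Fintype.card (PerfectMatching Y) := by
  rw [matchChar]
  congr 1
  exact Fintype.card_congr (Equiv.subtypeUnivEquiv fun s => one_smul _ s)

/-- If `q p` commutes with a matching `M` of the boxes into horizontal dominoes, then so do `q` and
`p`, hence `q` has the same effect on the two columns of every domino and is even. -/
theorem sign_eq_one_of_domino {eta : YoungDiagram} {M q p : Equiv.Perm (Box eta)}
    (hrow : ∀ x, (M x).1.1 = x.1.1) {dom : ℕ → ℕ} (hcol : ∀ x, (M x).1.2 = dom x.1.2)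
    (hM : ∀ x, M (M x) = x) (hdom : ∀ j, (Even (dom j) ↔ ¬ Even j))
    (hq : IsColPerm q) (hp : IsRowPerm p) (h : ∀ x, (q * p) (M x) = M ((q * p) x)) :
    Equiv.Perm.sign q = 1 := by
  have h1 : ∀ x, p (M x) = M (p x) := by
    intro x
    have h2 := congrArg (fun z => z.1.2) (h x)
    simp only [Equiv.Perm.mul_apply, hcol] at h2
    rw [hq, hq] at h2
    refine Subtype.ext (Prod.ext ?_ ?_)
    · rw [hp, hrow, hrow, hp]
    · rw [h2, hcol]
  have h2 : ∀ y, q (M y) = M (q y) := by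
    intro y
    have := h (p⁻¹ y)
    simp only [Equiv.Perm.mul_apply, h1] at this
    simpa using this
  let P : Box eta → Prop := fun x => Even x.1.2
  have hPq : ∀ x, P (q x) ↔ P x := fun x => by simp only [P]; rw [hq]
  have hPM : ∀ x, P (M x) ↔ ¬ P x := fun x => by simp only [P]; rw [hcol, hdom]
  -- the part of `q` on the even columns; `M` conjugates it to the part on the odd columns
  let q1 : Equiv.Perm (Box eta) := Equiv.Perm.ofSubtype (q.subtypePerm hPq)
  have hq1 : ∀ x, P x → q1 x = q x := fun x hx => by
    rw [Equiv.Perm.ofSubtype_apply_of_mem _ hx]; rfl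
  have hq1' : ∀ x, ¬ P x → q1 x = x := fun x hx => Equiv.Perm.ofSubtype_apply_of_not_mem _ hx
  have hMi : ∀ x, M⁻¹ x = M x := fun x => by rw [Equiv.Perm.inv_eq_iff_eq, hM]
  have h3 : q = q1 * (M * q1 * M⁻¹) := by
    ext1 x
    rw [Equiv.Perm.mul_apply, Equiv.Perm.mul_apply, Equiv.Perm.mul_apply, hMi]
    by_cases hx : P x
    · rw [hq1' (M x) (by rw [hPM, not_not]; exact hx), hM, hq1 x hx]
    · rw [hq1 (M x) ((hPM x).2 hx), h2, hM, hq1']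
      rwa [hPq]
  rw [h3, map_mul, map_mul, map_mul, map_inv, mul_inv_cancel_comm, Int.units_mul_self]

/-- The multiplicity of the character of a partition in the matching character is a natural number,
and it is positive for even partitions. -/
theorem exists_charInner_matchChar {lam : YoungDiagram} (hl : lam.card = Fintype.card Y) :
    ∃ r : ℕ, charInner (chi Y lam) matchChar = r ∧ ((∀ i, Even (lam.rowLen i)) → r ≠ 0) := by
  obtain ⟨t⟩ : Nonempty (Box lam ≃ Y) := Fintype.card_eq.1 (by rw [card_box, hl])
  have h1 := rank_permMat_mul_eq (K := ℚ) (PerfectMatching (Box lam)) (youngSym ℤ lam)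
    (α := hookProd lam) (hookProdQ_ne_zero lam) (by rw [youngSym_mul_self, Int.cast_id])
  refine ⟨(permMat ℚ (PerfectMatching (Box lam)) (MonoidAlgebra.mapRingHom _ (Int.castRingHom ℚ)
    (youngSym ℤ lam))).rank, ?_, fun hev h0 => ?_⟩
  · rw [charInner_chi matchChar_isClassFun t, div_eq_iff (hookProdQ_ne_zero lam)]
    have h2 := congrArg (Int.cast : ℤ → ℚ) h1
    push_cast at h2
    rw [h2]
    refine Finset.sum_congr rfl fun σ _ => ?_
    rw [matchChar_permCongr, coeff_youngSym_cast lam ℚ σ, matchChar]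
  · rw [Matrix.rank, Submodule.finrank_eq_zero, LinearMap.range_eq_bot] at h0
    have h3 : permMat ℚ (PerfectMatching (Box lam)) (MonoidAlgebra.mapRingHom _ (Int.castRingHom ℚ)
      (youngSym ℤ lam)) = 0 := Matrix.toLin'.injective (h0.trans (map_zero _).symm)
    rw [map_youngSym] at h3
    -- the matching of the boxes of every row by dominoes in the columns `2 i` and `2 i + 1`
    let dom : ℕ → ℕ := fun j => if Even j then j + 1 else j - 1
    have hd2 : ∀ j, dom (dom j) = j := by
      intro j
      by_cases hj : Even j
      · simp [dom, hj, Nat.even_add_one]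
      · obtain ⟨i, rfl⟩ := Nat.not_even_iff_odd.1 hj
        simp [dom]
    have hdom : ∀ j, (Even (dom j) ↔ ¬ Even j) := by
      intro j
      by_cases hj : Even j
      · simp [dom, hj, Nat.even_add_one]
      · obtain ⟨i, rfl⟩ := Nat.not_even_iff_odd.1 hj
        simp [dom]
    have hmem : ∀ x : Box lam, (x.1.1, dom x.1.2) ∈ lam.cells := by
      intro x
      have h4 : x.1.2 < lam.rowLen x.1.1 := YoungDiagram.mem_iff_lt_rowLen.1 x.2
      refine YoungDiagram.mem_iff_lt_rowLen.2 ?_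
      obtain ⟨c, hc⟩ := hev x.1.1
      by_cases hj : Even x.1.2
      · obtain ⟨i, hi⟩ := hj
        simp only [dom, hi, Even.add_self, if_true]
        omega
      · simp only [dom, hj, if_false]; omega
    let f : Box lam → Box lam := fun x => ⟨(x.1.1, dom x.1.2), hmem x⟩
    have hf : Function.Involutive f := fun x => Subtype.ext (Prod.ext rfl (hd2 _))
    let M : PerfectMatching (Box lam) := ⟨hf.toPerm f, hf, fun x hx => by
      have h4 : dom x.1.2 = x.1.2 := congrArg (fun z => z.1.2) hx
      have h5 := hdom x.1.2
      rw [h4] at h5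
      tauto⟩
    -- every contribution to the diagonal entry at `M` is nonnegative, and that of `1` is `1`
    have h6 := congrFun (congrFun h3 M) M
    rw [permMat_eq_sum, Matrix.zero_apply] at h6
    have h7 : ∀ g : Equiv.Perm (Box lam), 0 ≤
        (if g • M = M then (youngSym ℚ lam).coeff g else 0) := by
      intro g
      split_ifs with hg
      · by_cases hz : (youngSym ℚ lam).coeff g = 0
        · rw [hz]
        · obtain ⟨q, p, hq, hp, rfl⟩ := exists_of_coeff_youngSym_ne_zero hz
          rw [coeff_youngSym_mul hq hp, sign_eq_one_of_domino (M := M.1) (fun x => rfl)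
            (dom := dom) (fun x => rfl) hf hdom hq hp ((PerfectMatching.smul_eq_iff _ _).1 hg)]
          simp
      · exact le_rfl
    have h8 := (Finset.sum_eq_zero_iff_of_nonneg (fun g _ => h7 g)).1 h6 1 (Finset.mem_univ _)
    rw [one_smul, if_pos rfl, coeff_one_youngSym] at h8
    exact one_ne_zero h8

open Classical in
/-- The permutation character on perfect matchings is the sum of the characters of the even
partitions, each with multiplicity one. -/
theorem charInner_matchChar {lam : YoungDiagram} (hl : lam.card = Fintype.card Y) :
    charInner (chi Y lam) matchChar =
      if lam ∈ evenPartitionsOf (Fintype.card Y) then 1 else 0 := by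
  have hex : ∀ lam : YoungDiagram, ∃ r : ℕ, lam.card = Fintype.card Y →
      charInner (chi Y lam) matchChar = r ∧ ((∀ i, Even (lam.rowLen i)) → r ≠ 0) := by
    intro lam
    by_cases hl : lam.card = Fintype.card Y
    · obtain ⟨r, hr⟩ := exists_charInner_matchChar (Y := Y) hl
      exact ⟨r, fun _ => hr⟩
    · exact ⟨0, fun h => absurd h hl⟩
  choose r hr using hex
  have h1 : (Fintype.card (PerfectMatching Y) : ℚ) =
      ((∑ lam ∈ partitionsOf (Fintype.card Y), r lam * degree lam : ℕ) : ℚ) := by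
    rw [← matchChar_one, eq_sum_chi matchChar_isClassFun, Nat.cast_sum]
    refine Finset.sum_congr rfl fun lam hlam => ?_
    rw [(hr lam (mem_partitionsOf.1 hlam)).1, chi_one (mem_partitionsOf.1 hlam), Nat.cast_mul]
  have h2 : ∑ lam ∈ partitionsOf (Fintype.card Y), r lam * degree lam ≤
      ∑ lam ∈ partitionsOf (Fintype.card Y),
        if ∀ i, Even (lam.rowLen i) then degree lam else 0 := by
    rw [← Nat.cast_inj.1 h1, ← Finset.sum_filter]
    refine card_perfectMatching_le.trans (le_of_eq ?_)
    refine Finset.sum_congr ?_ fun eta heta => ?_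
    · rw [evenPartitionsOf]
    · rw [degree_eq_chainCount _ _ (mem_partitionsOf.1 (Finset.mem_filter.1 heta).1)]
  have h3 := sum_pos_eq (a := fun lam => if ∀ i, Even (lam.rowLen i) then degree lam else 0)
    (b := fun lam => r lam * degree lam) (fun lam hlam => ?_) h2 lam (mem_partitionsOf.2 hl)
  · rw [(hr lam hl).1]
    simp only [mem_evenPartitionsOf, hl, true_and]
    have hp := degree_pos lam
    split_ifs at h3 ⊢ with hev
    · have : r lam = 1 := Nat.eq_of_mul_eq_mul_right hp (by rw [← h3, one_mul])
      rw [this]; simp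
    · have : r lam = 0 := by
        rcases Nat.mul_eq_zero.1 h3.symm with h | h
        · exact h
        · omega
      rw [this]; simp
  · split_ifs with hev
    · exact Nat.le_mul_of_pos_left _ (Nat.pos_of_ne_zero
        ((hr lam (mem_partitionsOf.1 hlam)).2 hev))
    · exact Nat.zero_le _

end Matchings

/-! ### Composition multiplicities and idempotents -/

section EigenRank

variable {k R : Type*} [Field k] [Ring R] [Algebra k R] (e : R)

/-- The dimension of `e M`. For a multiple `e` of an idempotent it is additive in `M`. -/
noncomputable def actionRank (k : Type*) {R : Type*} [Field k] [Ring R] [Algebra k R] (e : R)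
    (M : Type*) [AddCommGroup M] [Module k M] [Module R M] [IsScalarTower k R M] : ℕ :=
  Module.finrank k (LinearMap.range (Algebra.lsmul k k M e))

variable {M N : Type*} [AddCommGroup M] [Module k M] [Module R M] [IsScalarTower k R M]
  [AddCommGroup N] [Module k N] [Module R N] [IsScalarTower k R N]

theorem actionRank_congr (f : M ≃ₗ[R] N) : actionRank k e M = actionRank k e N := by
  let f' : M ≃ₗ[k] N := f.restrictScalars k
  have h : (LinearMap.range (Algebra.lsmul k k M e)).map (f' : M →ₗ[k] N) =
      LinearMap.range (Algebra.lsmul k k N e) := by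
    ext y
    simp only [Submodule.mem_map, LinearMap.mem_range, Algebra.lsmul_coe]
    constructor
    · rintro ⟨_, ⟨x, rfl⟩, rfl⟩
      exact ⟨f x, (f.map_smul e x).symm⟩
    · rintro ⟨x, rfl⟩
      exact ⟨e • f.symm x, ⟨_, rfl⟩, (f.map_smul e _).trans (by rw [f.apply_symm_apply])⟩
  rw [actionRank, actionRank, ← h]
  exact (LinearEquiv.finrank_eq (f'.submoduleMap _))

theorem actionRank_add [FiniteDimensional k M] {α : k} (hα : α ≠ 0) (he : e * e = α • e)
    (P : Submodule R M) : actionRank k e M = actionRank k e P + actionRank k e (M ⧸ P) := by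
  have hev : ∀ (x : M), e • e • x = α • e • x := fun x => by
    rw [← mul_smul, he, smul_assoc]
  set E := LinearMap.range (Algebra.lsmul k k M e) with hE
  let q : M →ₗ[k] M ⧸ P := P.mkQ.restrictScalars k
  have h1 := LinearMap.finrank_range_add_finrank_ker (q.comp E.subtype)
  have h2 : LinearMap.range (q.comp E.subtype) = LinearMap.range (Algebra.lsmul k k (M ⧸ P) e) := by
    ext y
    simp only [LinearMap.mem_range, LinearMap.comp_apply, Algebra.lsmul_coe]
    constructor
    · rintro ⟨⟨_, ⟨x, rfl⟩⟩, rfl⟩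
      exact ⟨P.mkQ x, (P.mkQ.map_smul e x).symm⟩
    · rintro ⟨x, rfl⟩
      obtain ⟨x, rfl⟩ := P.mkQ_surjective x
      exact ⟨⟨e • x, ⟨x, rfl⟩⟩, P.mkQ.map_smul e x⟩
  -- `e M ∩ P = e P`, as `e` acts on `e M` by the scalar `α`
  have h3 : (LinearMap.ker (q.comp E.subtype)).map E.subtype =
      (LinearMap.range (Algebra.lsmul k k P e)).map (P.subtype.restrictScalars k) := by
    ext y
    simp only [Submodule.mem_map, LinearMap.mem_ker, LinearMap.mem_range]
    constructor
    · rintro ⟨⟨_, ⟨x, rfl⟩⟩, hx, rfl⟩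
      have hx' : e • x ∈ P := (Submodule.Quotient.mk_eq_zero P).1 hx
      refine ⟨_, ⟨α⁻¹ • ⟨e • x, hx'⟩, rfl⟩, ?_⟩
      change e • α⁻¹ • e • x = e • x
      rw [smul_comm e α⁻¹, hev, smul_smul, inv_mul_cancel₀ hα, one_smul]
    · rintro ⟨_, ⟨x, rfl⟩, rfl⟩
      exact ⟨⟨e • x.1, ⟨x.1, rfl⟩⟩, (Submodule.Quotient.mk_eq_zero P).2 (P.smul_mem e x.2), rfl⟩
  have h4 := (Submodule.equivMapOfInjective E.subtype E.injective_subtype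
    (LinearMap.ker (q.comp E.subtype))).finrank_eq
  have h5 := (Submodule.equivMapOfInjective (P.subtype.restrictScalars k) P.injective_subtype
    (LinearMap.range (Algebra.lsmul k k P e))).finrank_eq
  rw [h3, ← h5] at h4
  rw [h2, h4] at h1
  rw [actionRank, ← h1, add_comm]
  rfl

theorem fin_telescope : ∀ {n : ℕ} (f : Fin (n + 1) → ℕ) (g : Fin n → ℕ),
    (∀ i, f i.succ = f i.castSucc + g i) → f (Fin.last n) = f 0 + ∑ i, g i
  | 0, f, g, _ => by simp
  | n + 1, f, g, h => by
    have h1 := fin_telescope (fun i => f i.castSucc) (fun i => g i.castSucc) fun i => by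
      rw [← h i.castSucc]; rfl
    rw [Fin.sum_univ_castSucc, ← add_assoc, ← Fin.succ_last, h, h1]
    rfl

variable {S : Type*} [AddCommGroup S] [Module k S] [Module R S] [IsScalarTower k R S]
  {e} {α : k} (hα : α ≠ 0) (he0 : e ≠ 0) (hcorner : ∀ x : R, ∃ c : k, e * x * e = c • e)
  {A : S →ₗ[R] R} {w : S} (hAw : A w = e) (hA : ∀ v, A v • w = α • v)
include hα he0 hcorner hAw hA

/-- If `S` is isomorphic to the left ideal `R e` and `e R e` is one-dimensional, then `S` has only scalar
endomorphisms; being semisimple, it is simple. -/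
theorem isSimpleModule_of_corner [IsSemisimpleModule R S] : IsSimpleModule R S := by
  have hw : w ≠ 0 := fun h => he0 (by rw [← hAw, h, map_zero])
  have hv : ∀ v : S, v = α⁻¹ • (A v • w) := fun v => by
    rw [hA, smul_smul, inv_mul_cancel₀ hα, one_smul]
  have hew : e • w = α • w := by rw [← hAw, hA]
  have hee : e * e = α • e := by
    conv_lhs => rw [← hAw]
    rw [← smul_eq_mul, ← map_smul, hAw, hew, ← algebraMap_smul R α w, map_smul, hAw,
      algebraMap_smul]
  have hnt : Nontrivial S := ⟨⟨w, 0, hw⟩⟩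
  -- an endomorphism maps `w` into `e S`, which is spanned by `w`
  have hsc : ∀ ψ : S →ₗ[R] S, ∃ c : k, ψ w = c • w := by
    intro ψ
    obtain ⟨c, hc⟩ := hcorner (A (ψ w))
    have h1 : e • ψ w = α • ψ w := by
      rw [← map_smul, hew, ← algebraMap_smul R α w, map_smul, algebraMap_smul]
    have h2 : (e * A (ψ w) * e) • w = (α * α * α) • ψ w := by
      rw [mul_smul, mul_smul, hew, smul_comm (A (ψ w)) α w, hA, smul_smul, smul_comm e (α * α), h1,
        smul_smul]
    refine ⟨(α * α * α)⁻¹ * (c * α), ?_⟩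
    rw [hc, smul_assoc, hew, smul_smul] at h2
    rw [← smul_smul, h2, smul_smul, inv_mul_cancel₀ (by simp [hα]), one_smul]
  refine (isSimpleModule_iff R S).2 { eq_bot_or_eq_top := fun P => ?_ }
  obtain ⟨Q, hQ⟩ := exists_isCompl P
  let π : S →ₗ[R] S := P.subtype.comp (Submodule.projectionOnto P Q hQ)
  obtain ⟨c, hc⟩ := hsc π
  have hπ : ∀ v, π v = c • v := fun v => by
    rw [hv v, ← algebraMap_smul R α⁻¹, map_smul, map_smul, hc, smul_comm (A v) c,
      smul_comm _ c]
  by_cases h0 : c = 0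
  · left
    rw [eq_bot_iff]
    intro x hx
    have h1 : π x = x := by
      simp only [π, LinearMap.comp_apply, Submodule.subtype_apply]
      exact congrArg Subtype.val (Submodule.projectionOnto_apply_left hQ ⟨x, hx⟩)
    rw [hπ, h0, zero_smul] at h1
    exact h1.symm
  · right
    rw [eq_top_iff]
    intro x _
    have h1 : c • x ∈ P := by
      rw [← hπ]; exact (Submodule.projectionOnto P Q hQ x).2
    have h2 := P.smul_of_tower_mem c⁻¹ h1
    rwa [smul_smul, inv_mul_cancel₀ h0, one_smul] at h2

theorem actionRank_eq_one : actionRank k e S = 1 := by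
  have hw : w ≠ 0 := fun h => he0 (by rw [← hAw, h, map_zero])
  have hew : e • w = α • w := by rw [← hAw, hA]
  refine finrank_eq_one (v := ⟨e • w, ⟨w, rfl⟩⟩) (fun h => ?_) ?_
  · have h1 := congrArg Subtype.val h
    change e • w = 0 at h1
    rw [hew] at h1
    exact (smul_ne_zero hα hw) h1
  · rintro ⟨_, ⟨v, rfl⟩⟩
    obtain ⟨c, hc⟩ := hcorner (A v)
    refine ⟨(α * α)⁻¹ * c, Subtype.ext ?_⟩
    change ((α * α)⁻¹ * c) • e • w = e • v
    have h1 : (e * A v * e) • w = (α * α) • e • v := by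
      rw [mul_smul, mul_smul, hew, smul_comm (A v) α w, hA, smul_smul, smul_comm e (α * α)]
    rw [hc, smul_assoc] at h1
    rw [← smul_smul, h1, smul_smul, inv_mul_cancel₀ (by simp [hα]), one_smul]

/-- The multiplicity of the simple module `S = R e` in `M` is the dimension of `e M`. -/
theorem compMult_eq_actionRank [IsSemisimpleModule R S] [FiniteDimensional k M] :
    compMult R M S = actionRank k e M := by
  classical
  have hS := isSimpleModule_of_corner hα he0 hcorner hAw hA
  have hew : e • w = α • w := by rw [← hAw, hA]
  have hee : e * e = α • e := by
    conv_lhs => rw [← hAw]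
    rw [← smul_eq_mul, ← map_smul, hAw, hew, ← algebraMap_smul R α w, map_smul, hAw,
      algebraMap_smul]
  -- `e` acts by zero on every simple module that is not isomorphic to `S`
  have hsimple : ∀ (Q : Type _) [AddCommGroup Q] [Module k Q] [Module R Q] [IsScalarTower k R Q]
      [IsSimpleModule R Q], actionRank k e Q = if Nonempty (Q ≃ₗ[R] S) then 1 else 0 := by
    intro Q _ _ _ _ _
    split_ifs with h
    · rw [actionRank_congr e h.some, actionRank_eq_one hα he0 hcorner hAw hA]
    · have h0 : ∀ x : Q, e • x = 0 := by
        intro x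
        by_contra hx
        let φ : S →ₗ[R] Q := (LinearMap.toSpanSingleton R Q x).comp A
        rcases LinearMap.bijective_or_eq_zero φ with hb | hz
        · exact h ⟨(LinearEquiv.ofBijective φ hb).symm⟩
        · apply hx
          have := LinearMap.congr_fun hz w
          simpa [φ, hAw] using this
      rw [actionRank, show Algebra.lsmul k k Q e = 0 from LinearMap.ext h0, LinearMap.range_zero,
        finrank_bot]
  have : IsNoetherian R M := isNoetherian_of_tower k inferInstance
  have : IsArtinian R M := isArtinian_of_tower k inferInstance
  obtain ⟨s, hs0, hs1⟩ := exists_compositionSeries_of_isNoetherian_isArtinian R M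
  rw [compMult_eq S s hs0 hs1, seriesMult]
  have h1 := fin_telescope (fun i => actionRank k e (s i))
    (fun i => if Nonempty ((s i.succ ⧸ (s i.castSucc).comap (s i.succ).subtype) ≃ₗ[R] S)
      then 1 else 0) (fun i => by
      have hstep := s.step i
      have hcov : s i.castSucc ⋖ s i.succ := hstep
      have : IsSimpleModule R (s i.succ ⧸ (s i.castSucc).comap (s i.succ).subtype) :=
        (covBy_iff_quot_is_simple hcov.le).1 hcov
      have : FiniteDimensional k (s i.succ) := Module.Finite.of_injective
        ((s i.succ).subtype.restrictScalars k) (s i.succ).injective_subtype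
      rw [← hsimple, actionRank_add e hα hee ((s i.castSucc).comap (s i.succ).subtype),
        actionRank_congr e (Submodule.comapSubtypeEquivOfLe hcov.le)])
  have h2 : actionRank k e (s (Fin.last s.length)) = actionRank k e M := by
    have : s (Fin.last s.length) = ⊤ := hs1
    rw [this]
    exact actionRank_congr e Submodule.topEquiv
  have h3 : actionRank k e (s 0) = 0 := by
    have : s 0 = ⊥ := hs0
    rw [this, actionRank]
    have : Algebra.lsmul k k (⊥ : Submodule R M) e = 0 := LinearMap.ext fun x => by
      exact Subsingleton.elim _ _
    rw [this, LinearMap.range_zero, finrank_bot]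
  simp only [h2, h3, zero_add] at h1
  rw [h1, Nat.card_eq_fintype_card, Fintype.card_subtype, Finset.card_filter]

end EigenRank

section Presented

variable {k G V : Type*} [Field k] [Group G] [Fintype G] [AddCommGroup V] [Module k V]

/-- The representation `ρ` is isomorphic to the left ideal `k[G] f`, where `f` is `α` times an
idempotent: the isomorphism is `A`, and `w` is its value at `f`. -/
def IsPresented (ρ : Representation k G V) (w : V) (f : MonoidAlgebra k G) (α : k) : Prop :=
  ∃ A : V →ₗ[k] MonoidAlgebra k G, (∀ g v, A (ρ g v) = MonoidAlgebra.single g 1 * A v) ∧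
    A w = f ∧ ∀ v, ρ.asAlgebraHom (A v) w = α • v

theorem asAlgebraHom_eq_sum (ρ : Representation k G V) (x : MonoidAlgebra k G) (v : V) :
    ρ.asAlgebraHom x v = ∑ g, x.coeff g • ρ g v := by
  conv_lhs => rw [← sum_single_coeff x, map_sum]
  rw [LinearMap.sum_apply]
  refine Finset.sum_congr rfl fun g _ => ?_
  rw [Representation.asAlgebraHom_single, LinearMap.smul_apply]

omit [Fintype G] in
theorem equivariant_asAlgebraHom {ρ : Representation k G V} {A : V →ₗ[k] MonoidAlgebra k G}
    (hA : ∀ g v, A (ρ g v) = MonoidAlgebra.single g 1 * A v) (x : MonoidAlgebra k G) (v : V) :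
    A (ρ.asAlgebraHom x v) = x * A v := by
  induction x using MonoidAlgebra.induction_on with
  | of g => simpa using hA g v
  | add x y hx hy => rw [map_add, LinearMap.add_apply, map_add, hx, hy, add_mul]
  | smul r x hx => rw [map_smul, LinearMap.smul_apply, map_smul, hx, smul_mul_assoc]

theorem IsPresented.finiteDimensional {ρ : Representation k G V} {w : V} {f : MonoidAlgebra k G}
    {α : k} (h : IsPresented ρ w f α) (hα : α ≠ 0) : FiniteDimensional k V := by
  obtain ⟨A, -, -, hw⟩ := h
  have hf : FiniteDimensional k (MonoidAlgebra k G) := inferInstance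
  refine FiniteDimensional.of_injective A fun u v huv => ?_
  have := hw u
  rw [huv, hw v] at this
  exact (smul_right_injective V hα this).symm

/-- If `ρ` is presented by `e` and `e` acts with rank at most one, then `ρ` is simple and its
multiplicity in a representation is the rank of `e`. -/
theorem repMult_eq_finrank {W : Type*} [AddCommGroup W] [Module k W] [FiniteDimensional k W]
    (hG : (Fintype.card G : k) ≠ 0) (ρ : Representation k G W) {σ : Representation k G V} {w : V}
    {e : MonoidAlgebra k G} {α : k} (hσ : IsPresented σ w e α) (hα : α ≠ 0) (he0 : e ≠ 0)
    (hcorner : ∀ v, ∃ c : k, σ.asAlgebraHom e v = c • w) :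
    repMult ρ σ = Module.finrank k (LinearMap.range (ρ.asAlgebraHom e)) := by
  obtain ⟨A, hA, hAw, hw⟩ := hσ
  have : NeZero (Nat.card G : k) := ⟨by rwa [Nat.card_eq_fintype_card]⟩
  let A' : σ.asModule →ₗ[MonoidAlgebra k G] MonoidAlgebra k G :=
    { toFun := fun v => A (σ.asModuleEquiv v)
      map_add' := fun u v => map_add A _ _
      map_smul' := fun x v => equivariant_asAlgebraHom hA x _ }
  have hcorner' : ∀ x, ∃ c : k, e * x * e = c • e := fun x => by
    obtain ⟨c, hc⟩ := hcorner (σ.asAlgebraHom x w)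
    refine ⟨c, ?_⟩
    conv_lhs => rw [← hAw]
    rw [hAw, mul_assoc, ← hAw, ← equivariant_asAlgebraHom hA, hAw, ← equivariant_asAlgebraHom hA,
      hc, map_smul, hAw]
  rw [repMult]
  exact compMult_eq_actionRank (k := k) (M := ρ.asModule) (S := σ.asModule) (e := e) (A := A')
    (w := w) hα he0 hcorner' hAw hw

end Presented

/-! ### Specht modules as left ideals -/

section SpechtPresentation

variable {k : Type*} [Field k]

/-- The generator of the Specht module. -/
noncomputable def spechtGen (k : Type*) [CommRing k] (lam : YoungDiagram) : SpechtModule k lam :=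
  (⟨youngSym k lam, 1, one_mul _⟩ : spechtIdeal k lam)

theorem specht_isPresented (lam : YoungDiagram) :
    IsPresented (specht k lam) (spechtGen k lam) (youngSym k lam) (hookProd lam : k) := by
  let A : SpechtModule k lam →ₗ[k] MonoidAlgebra k (Equiv.Perm (Box lam)) :=
    (spechtIdeal k lam).subtype
  have hA : ∀ g v, A (specht k lam g v) = MonoidAlgebra.single g 1 * A v := fun _ _ => rfl
  refine ⟨A, hA, rfl, fun v => ?_⟩
  apply (spechtIdeal k lam).injective_subtype
  change A _ = A _
  rw [equivariant_asAlgebraHom hA, map_smul]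
  obtain ⟨a, ha⟩ := v.2
  have hv : A v = a * youngSym k lam := ha.symm
  change A v * youngSym k lam = _
  rw [hv, mul_assoc, youngSym_mul_self, mul_smul_comm]

theorem specht_corner (lam : YoungDiagram) (v : SpechtModule k lam) :
    ∃ c : k, (specht k lam).asAlgebraHom (youngSym k lam) v = c • spechtGen k lam := by
  let A : SpechtModule k lam →ₗ[k] MonoidAlgebra k (Equiv.Perm (Box lam)) :=
    (spechtIdeal k lam).subtype
  have hA : ∀ g v, A (specht k lam g v) = MonoidAlgebra.single g 1 * A v := fun _ _ => rfl
  obtain ⟨a, ha⟩ := v.2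
  have hv : A v = a * youngSym k lam := ha.symm
  obtain ⟨c, hc⟩ := exists_youngSym_mul_mul (R := k) (lam := lam) a
  refine ⟨c, (spechtIdeal k lam).injective_subtype ?_⟩
  change A _ = A _
  rw [equivariant_asAlgebraHom hA, map_smul, hv, ← mul_assoc, hc]
  rfl

end SpechtPresentation

section TwistPresentation

variable {m : ℕ} [NeZero m] {k : Type*} [Field k] {X : Type} [Fintype X] [DecidableEq X]

noncomputable instance : Fintype (Wreath m X) := Fintype.ofEquiv _ SemidirectProduct.equivProd.symm

theorem sum_wreath {M : Type*} [AddCommMonoid M] (F : Wreath m X → M) :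
    ∑ g, F g = ∑ σ : Equiv.Perm X, ∑ t : X → Multiplicative (ZMod m), F ⟨t, σ⟩ := by
  rw [Fintype.sum_equiv SemidirectProduct.equivProd F (fun p => F ⟨p.1, p.2⟩) fun g => rfl,
    Fintype.sum_prod_type, Finset.sum_comm]

/-- The order of the group of labels. -/
noncomputable def torusCard (m : ℕ) [NeZero m] (X : Type) [Fintype X] [DecidableEq X] : ℕ :=
  Fintype.card (X → Multiplicative (ZMod m))

theorem torusCard_ne_zero (hm : (m : k) ≠ 0) : (torusCard m X : k) ≠ 0 := by
  rw [torusCard, Fintype.card_fun, Nat.cast_pow]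
  refine pow_ne_zero _ ?_
  rwa [Fintype.card_multiplicative, ZMod.card]

/-- The twist of an element of the group algebra of the symmetric group by a linear character of the
wreath product. -/
noncomputable def twist (χ : Wreath m X →* k) :
    MonoidAlgebra k (Equiv.Perm X) →ₗ[k] MonoidAlgebra k (Wreath m X) where
  toFun x := ∑ g, MonoidAlgebra.single g ((torusCard m X : k)⁻¹ * χ g⁻¹ * x.coeff g.right)
  map_add' x y := by
    ext g
    rw [MonoidAlgebra.coeff_add, MonoidAlgebra.coeff_add, Finsupp.add_apply, coeff_sum_single,
      coeff_sum_single, coeff_sum_single, Finsupp.add_apply, mul_add]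
  map_smul' r x := by
    ext g
    rw [RingHom.id_apply, MonoidAlgebra.coeff_smul_apply, coeff_sum_single, coeff_sum_single,
      MonoidAlgebra.coeff_smul_apply, smul_eq_mul, smul_eq_mul]
    ring

@[simp] theorem coeff_twist (χ : Wreath m X →* k) (x : MonoidAlgebra k (Equiv.Perm X))
    (g : Wreath m X) :
    (twist χ x).coeff g = (torusCard m X : k)⁻¹ * χ g⁻¹ * x.coeff g.right := coeff_sum_single _ g

theorem single_mul_twist (χ : Wreath m X →* k) (x : MonoidAlgebra k (Equiv.Perm X))
    (g : Wreath m X) : MonoidAlgebra.single g 1 * twist χ x =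
      χ g • twist χ (MonoidAlgebra.single g.right 1 * x) := by
  ext h
  rw [MonoidAlgebra.coeff_single_mul_apply, MonoidAlgebra.coeff_smul_apply, coeff_twist, coeff_twist,
    MonoidAlgebra.coeff_single_mul_apply, mul_inv_rev, inv_inv, map_mul, smul_eq_mul,
    SemidirectProduct.mul_right, SemidirectProduct.inv_right]
  ring

theorem twist_mul_single (χ : Wreath m X →* k) (x : MonoidAlgebra k (Equiv.Perm X))
    (g : Wreath m X) : twist χ x * MonoidAlgebra.single g 1 =
      χ g • twist χ (x * MonoidAlgebra.single g.right 1) := by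
  ext h
  rw [MonoidAlgebra.coeff_mul_single_apply, MonoidAlgebra.coeff_smul_apply, coeff_twist, coeff_twist,
    MonoidAlgebra.coeff_mul_single_apply, mul_inv_rev, inv_inv, map_mul, smul_eq_mul,
    SemidirectProduct.mul_right, SemidirectProduct.inv_right]
  ring

variable {V : Type*} [AddCommGroup V] [Module k V]

theorem asAlgebraHom_twist (hm : (m : k) ≠ 0) {χ : Wreath m X →* k}
    {ρ : Representation k (Equiv.Perm X) V} {ρ' : Representation k (Wreath m X) V}
    (h : ∀ g v, ρ' g v = χ g • ρ g.right v) (x : MonoidAlgebra k (Equiv.Perm X)) (v : V) :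
    ρ'.asAlgebraHom (twist χ x) v = ρ.asAlgebraHom x v := by
  rw [asAlgebraHom_eq_sum, asAlgebraHom_eq_sum, sum_wreath]
  refine Finset.sum_congr rfl fun σ _ => ?_
  have h1 : ∀ t : X → Multiplicative (ZMod m), (twist χ x).coeff (⟨t, σ⟩ : Wreath m X) •
      ρ' (⟨t, σ⟩ : Wreath m X) v = (torusCard m X : k)⁻¹ • x.coeff σ • ρ σ v := by
    intro t
    have hχ : χ (⟨t, σ⟩ : Wreath m X)⁻¹ * χ (⟨t, σ⟩ : Wreath m X) = 1 := by
      rw [← map_mul, inv_mul_cancel, map_one]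
    rw [h, coeff_twist, smul_smul, smul_smul]
    congr 1
    linear_combination (torusCard m X : k)⁻¹ * x.coeff σ * hχ
  rw [Finset.sum_congr rfl fun t _ => h1 t, Finset.sum_const, Finset.card_univ, ← torusCard,
    ← Nat.cast_smul_eq_nsmul k, smul_smul, mul_inv_cancel₀ (torusCard_ne_zero hm), one_smul]

theorem twist_isPresented (hm : (m : k) ≠ 0) {χ : Wreath m X →* k}
    {ρ : Representation k (Equiv.Perm X) V} {ρ' : Representation k (Wreath m X) V}
    (h : ∀ g v, ρ' g v = χ g • ρ g.right v) {w : V} {f : MonoidAlgebra k (Equiv.Perm X)} {α : k}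
    (hρ : IsPresented ρ w f α) : IsPresented ρ' w (twist χ f) α := by
  obtain ⟨A, hA, rfl, hw⟩ := hρ
  refine ⟨(twist χ).comp A, fun g v => ?_, rfl, fun v => ?_⟩
  · rw [LinearMap.comp_apply, LinearMap.comp_apply, single_mul_twist, h, map_smul, map_smul, hA]
  · rw [LinearMap.comp_apply, asAlgebraHom_twist hm h, hw]

end TwistPresentation

section ProductPresentation

variable {k : Type*} [Field k]

/-- The coefficient at `g`. -/
noncomputable def coeffLin {G : Type*} (g : G) : MonoidAlgebra k G →ₗ[k] k where
  toFun x := x.coeff g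
  map_add' _ _ := rfl
  map_smul' _ _ := rfl

theorem ext_coeffLin {G : Type*} {x y : MonoidAlgebra k G} (h : ∀ g, x.coeff g = y.coeff g) :
    x = y := by ext g; exact h g

variable {ι : Type} [Fintype ι] [DecidableEq ι] {Γ : ι → Type} [∀ i, Group (Γ i)]
  [∀ i, Fintype (Γ i)] {V : ι → Type*} [∀ i, AddCommGroup (V i)] [∀ i, Module k (V i)]

/-- The outer product of elements of group algebras as a multilinear map. -/
noncomputable def piEltMulti : MultilinearMap k (fun i => MonoidAlgebra k (Γ i))
    (MonoidAlgebra k (∀ i, Γ i)) :=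
  ∑ g : ∀ i, Γ i, (MonoidAlgebra.lsingle (R := k) g).compMultilinearMap
    ((MultilinearMap.mkPiAlgebra k ι k).compLinearMap fun i => coeffLin (g i))

theorem piEltMulti_apply (x : ∀ i, MonoidAlgebra k (Γ i)) : piEltMulti x = piElt x := by
  rw [piEltMulti, sum_apply]
  rfl

theorem asAlgebraHom_piElt {ρ : ∀ i, Representation k (Γ i) (V i)}
    {ρ' : Representation k (∀ i, Γ i) (⨂[k] i, V i)}
    (h : ∀ g, ρ' g = PiTensorProduct.map fun i => ρ i (g i))
    (x : ∀ i, MonoidAlgebra k (Γ i)) (v : ∀ i, V i) :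
    ρ'.asAlgebraHom (piElt x) (PiTensorProduct.tprod k v) =
      PiTensorProduct.tprod k fun i => (ρ i).asAlgebraHom (x i) (v i) := by
  rw [asAlgebraHom_eq_sum]
  simp only [asAlgebraHom_eq_sum]
  rw [MultilinearMap.map_sum]
  refine Finset.sum_congr rfl fun g _ => ?_
  rw [MultilinearMap.map_smul_univ, coeff_piElt, h, PiTensorProduct.map_tprod]

theorem pi_isPresented {ρ : ∀ i, Representation k (Γ i) (V i)}
    {ρ' : Representation k (∀ i, Γ i) (⨂[k] i, V i)}
    (h : ∀ g, ρ' g = PiTensorProduct.map fun i => ρ i (g i)) {w : ∀ i, V i}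
    {f : ∀ i, MonoidAlgebra k (Γ i)} {α : ι → k}
    (hρ : ∀ i, IsPresented (ρ i) (w i) (f i) (α i)) :
    IsPresented ρ' (PiTensorProduct.tprod k w) (piElt f) (∏ i, α i) := by
  choose A hA hAw hw using hρ
  have hAt : ∀ v, PiTensorProduct.lift (piEltMulti.compLinearMap A) (PiTensorProduct.tprod k v) =
      piElt fun i => A i (v i) := fun v => by
    rw [PiTensorProduct.lift.tprod, MultilinearMap.compLinearMap_apply, piEltMulti_apply]
  refine ⟨PiTensorProduct.lift (piEltMulti.compLinearMap A), fun g v => ?_, ?_, fun v => ?_⟩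
  · induction v using PiTensorProduct.induction_on with
    | smul_tprod r v =>
      rw [map_smul, map_smul, map_smul, mul_smul_comm, h, PiTensorProduct.map_tprod, hAt, hAt]
      congr 1
      have h1 : MonoidAlgebra.single g (1 : k) =
          piElt fun i => MonoidAlgebra.single (g i) (1 : k) := by
        refine ext_coeffLin fun x => ?_
        rw [coeff_piElt]
        by_cases hx : g = x
        · subst hx; simp
        · obtain ⟨i, hi⟩ := Function.ne_iff.1 hx
          rw [Finset.prod_eq_zero (Finset.mem_univ i) (by simp [Finsupp.single_apply, hi])]
          simp [Finsupp.single_apply, hx]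
      rw [h1, piElt_mul]
      simp only [hA]
    | add u v hu hv => rw [map_add, map_add, map_add, mul_add, hu, hv]
  · rw [hAt]; simp only [hAw]
  · induction v using PiTensorProduct.induction_on with
    | smul_tprod r v =>
      rw [map_smul, map_smul, LinearMap.smul_apply, hAt, asAlgebraHom_piElt h, smul_comm]
      simp only [hw]
      rw [MultilinearMap.map_smul_univ]
    | add u v hu hv => rw [map_add, map_add, LinearMap.add_apply, hu, hv, smul_add]

theorem pi_corner {ρ : ∀ i, Representation k (Γ i) (V i)}
    {ρ' : Representation k (∀ i, Γ i) (⨂[k] i, V i)}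
    (h : ∀ g, ρ' g = PiTensorProduct.map fun i => ρ i (g i)) {w : ∀ i, V i}
    {f : ∀ i, MonoidAlgebra k (Γ i)}
    (hρ : ∀ i v, ∃ c : k, (ρ i).asAlgebraHom (f i) v = c • w i) (v : ⨂[k] i, V i) :
    ∃ c : k, ρ'.asAlgebraHom (piElt f) v = c • PiTensorProduct.tprod k w := by
  induction v using PiTensorProduct.induction_on with
  | smul_tprod r v =>
    choose c hc using hρ
    refine ⟨r * ∏ i, c i (v i), ?_⟩
    rw [map_smul, asAlgebraHom_piElt h]
    simp only [hc]
    rw [MultilinearMap.map_smul_univ, smul_smul]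
  | add u v hu hv =>
    obtain ⟨a, ha⟩ := hu
    obtain ⟨b, hb⟩ := hv
    exact ⟨a + b, by rw [map_add, ha, hb, add_smul]⟩

variable {G H : Type} [Group G] [Group H] [Fintype G] [Fintype H] {U W : Type*} [AddCommGroup U]
  [Module k U] [AddCommGroup W] [Module k W]

theorem tensor_isPresented {ρ : Representation k G U} {σ : Representation k H W}
    {ρ' : Representation k (G × H) (U ⊗[k] W)}
    (h : ∀ g u v, ρ' g (u ⊗ₜ v) = ρ g.1 u ⊗ₜ σ g.2 v) {u : U} {w : W} {x : MonoidAlgebra k G}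
    {y : MonoidAlgebra k H} {α β : k} (hρ : IsPresented ρ u x α) (hσ : IsPresented σ w y β) :
    IsPresented ρ' (u ⊗ₜ w) (prodElt x y) (α * β) := by
  obtain ⟨A, hA, rfl, hu⟩ := hρ
  obtain ⟨B, hB, rfl, hw⟩ := hσ
  let P : U →ₗ[k] W →ₗ[k] MonoidAlgebra k (G × H) := LinearMap.mk₂ k (fun a b => prodElt (A a) (B b))
    (fun a a' b => ext_coeffLin fun g => by simp [add_mul])
    (fun c a b => ext_coeffLin fun g => by simp [mul_assoc])
    (fun a b b' => ext_coeffLin fun g => by simp [mul_add])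
    (fun c a b => ext_coeffLin fun g => by simp [mul_left_comm])
  refine ⟨TensorProduct.lift P, fun g v => ?_, rfl, fun v => ?_⟩
  · induction v using TensorProduct.induction_on with
    | zero => simp
    | tmul a b =>
      rw [h, TensorProduct.lift.tmul, TensorProduct.lift.tmul]
      change prodElt _ _ = _ * prodElt _ _
      have h1 : MonoidAlgebra.single g (1 : k) =
          prodElt (MonoidAlgebra.single g.1 (1 : k)) (MonoidAlgebra.single g.2 (1 : k)) := by
        classical
        refine ext_coeffLin fun z => ?_
        rw [coeff_prodElt]
        simp only [MonoidAlgebra.coeff_single, Finsupp.single_apply, Prod.ext_iff]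
        by_cases h1 : g.1 = z.1 <;> by_cases h2 : g.2 = z.2 <;> simp [h1, h2]
      rw [h1, prodElt_mul, hA, hB]
    | add a b ha hb => rw [map_add, map_add, map_add, mul_add, ha, hb]
  · induction v using TensorProduct.induction_on with
    | zero => simp
    | tmul a b =>
      rw [TensorProduct.lift.tmul]
      change ρ'.asAlgebraHom (prodElt _ _) _ = _
      have h2 : (α * β) • a ⊗ₜ[k] b = (α • a) ⊗ₜ[k] (β • b) := by
        rw [TensorProduct.smul_tmul_smul]
      rw [asAlgebraHom_eq_sum, Fintype.sum_prod_type, h2, ← hu, ← hw, asAlgebraHom_eq_sum,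
        asAlgebraHom_eq_sum, TensorProduct.sum_tmul]
      refine Finset.sum_congr rfl fun g _ => ?_
      rw [TensorProduct.tmul_sum]
      refine Finset.sum_congr rfl fun k _ => ?_
      rw [coeff_prodElt, h, TensorProduct.smul_tmul_smul]
    | add a b ha hb => rw [map_add, map_add, LinearMap.add_apply, ha, hb, smul_add]

end ProductPresentation

section InducedPresentation

variable {k : Type*} [Field k] {G H : Type} [Group G] [Group H] {W : Type*} [AddCommGroup W]
  [Module k W] (φ : H →* G) (ρ : Representation k H W)

/-- The element `⟦g ⊗ v⟧` of an induced module, on which `h` acts by `g ↦ g h⁻¹`. -/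
noncomputable def indMk (g : G) : W →ₗ[k] Representation.IndV φ ρ := Representation.IndV.mk φ ρ g

theorem ind_indMk (h g : G) (v : W) :
    Representation.ind φ ρ h (indMk φ ρ g v) = indMk φ ρ (g * h⁻¹) v :=
  Representation.ind_mk φ ρ h g v

theorem indMk_map (h : H) (g : G) (v : W) : indMk φ ρ (φ h * g) (ρ h v) = indMk φ ρ g v := by
  have := Representation.Coinvariants.mk_self_apply
    (Representation.tprod ((Representation.leftRegular k G).comp φ) ρ) h
    (MonoidAlgebra.single g 1 ⊗ₜ v)
  rw [Representation.tprod_apply, TensorProduct.map_tmul] at this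
  rw [indMk, indMk]
  refine Eq.trans ?_ this
  simp [Representation.IndV.mk]

theorem ind_hom_ext {U : Type*} [AddCommGroup U] [Module k U]
    {C D : Representation.IndV φ ρ →ₗ[k] U}
    (h : ∀ g v, C (indMk φ ρ g v) = D (indMk φ ρ g v)) : C = D :=
  Representation.IndV.hom_ext _ _ fun g => LinearMap.ext (h g)

theorem mapDomain_mul_left (g : G) (x : MonoidAlgebra k G) :
    MonoidAlgebra.mapDomain (fun y => g * y) x = MonoidAlgebra.single g 1 * x := by
  induction x using MonoidAlgebra.induction_on with
  | of h => simp
  | add x y hx hy => rw [MonoidAlgebra.mapDomain_add, hx, hy, mul_add]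
  | smul r x hx => rw [MonoidAlgebra.mapDomain_smul, hx, mul_smul_comm]

theorem ind_map_indMk_one (x : MonoidAlgebra k H) (v : W) :
    (Representation.ind φ ρ).asAlgebraHom (MonoidAlgebra.mapDomainAlgHom k k φ x)
      (indMk φ ρ 1 v) = indMk φ ρ 1 (ρ.asAlgebraHom x v) := by
  induction x using MonoidAlgebra.induction_on with
  | of h =>
    have := indMk_map φ ρ h (φ h)⁻¹ v
    rw [mul_inv_cancel] at this
    simp only [MonoidAlgebra.of_apply, MonoidAlgebra.mapDomainAlgHom_apply,
      MonoidAlgebra.mapDomain_single, Representation.asAlgebraHom_single, one_smul]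
    rw [ind_indMk, one_mul, this]
  | add x y hx hy =>
    rw [map_add, map_add, map_add, LinearMap.add_apply, LinearMap.add_apply, map_add, hx, hy]
  | smul r x hx =>
    rw [map_smul, map_smul, map_smul, LinearMap.smul_apply, LinearMap.smul_apply, map_smul, hx]

variable [Fintype G] [Fintype H]

theorem invElt_single (h : G) :
    invElt (MonoidAlgebra.single h (1 : k)) = MonoidAlgebra.single h⁻¹ 1 := by
  refine ext_coeffLin fun z => ?_
  rw [coeff_invElt, MonoidAlgebra.coeff_single, MonoidAlgebra.coeff_single]
  classical
  rw [Finsupp.single_apply, Finsupp.single_apply]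
  exact if_congr ⟨fun h => by rw [h, inv_inv], fun h => by rw [← h, inv_inv]⟩ rfl rfl

variable {ρ}

/-- An induced module is presented by the same element of the larger group algebra. -/
theorem ind_isPresented {w : W} {f : MonoidAlgebra k H} {α : k} (hρ : IsPresented ρ w f α) :
    IsPresented (Representation.ind φ ρ) (indMk φ ρ 1 w)
      (MonoidAlgebra.mapDomainAlgHom k k φ f) α := by
  obtain ⟨A, hA, rfl, hw⟩ := hρ
  let P : MonoidAlgebra k G →ₗ[k] W →ₗ[k] MonoidAlgebra k G := LinearMap.mk₂ k
    (fun x v => invElt x * MonoidAlgebra.mapDomainAlgHom k k φ (A v))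
    (fun x x' v => by
      rw [← add_mul]; congr 1; exact ext_coeffLin fun g => by simp)
    (fun c x v => by rw [invElt_smul, smul_mul_assoc])
    (fun x v v' => by rw [map_add, map_add, mul_add])
    (fun c x v => by rw [map_smul, map_smul, mul_smul_comm])
  have hmap : ∀ h : H, MonoidAlgebra.mapDomainAlgHom k k φ (MonoidAlgebra.single h (1 : k)) =
      MonoidAlgebra.single (φ h) 1 := fun h => by simp
  let B : Representation.IndV φ ρ →ₗ[k] MonoidAlgebra k G :=
    Representation.Coinvariants.lift _ (TensorProduct.lift P) fun h => by
      refine TensorProduct.ext' fun x v => ?_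
      change invElt (MonoidAlgebra.mapDomain (fun y => φ h * y) x) * _ = invElt x * _
      rw [mapDomain_mul_left, invElt_mul, invElt_single, hA, map_mul, hmap, mul_assoc,
        ← mul_assoc (MonoidAlgebra.single _ _), MonoidAlgebra.single_mul_single, inv_mul_cancel,
        one_mul, ← MonoidAlgebra.one_def, one_mul]
  have hB : ∀ h v, B (indMk φ ρ h v) =
      MonoidAlgebra.single h⁻¹ 1 * MonoidAlgebra.mapDomainAlgHom k k φ (A v) := fun h v => by
    rw [← invElt_single]; rfl
  have hBG : ∀ g v, B (Representation.ind φ ρ g v) = MonoidAlgebra.single g 1 * B v := by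
    intro g v
    refine LinearMap.congr_fun (ind_hom_ext φ ρ (C := B ∘ₗ Representation.ind φ ρ g)
      (D := LinearMap.mulLeft k (MonoidAlgebra.single g 1) ∘ₗ B) fun h v => ?_) v
    rw [LinearMap.comp_apply, LinearMap.comp_apply, ind_indMk, hB, hB,
      LinearMap.mulLeft_apply, ← mul_assoc, MonoidAlgebra.single_mul_single, one_mul, mul_inv_rev,
      inv_inv]
  refine ⟨B, hBG, ?_, fun v => ?_⟩
  · rw [hB, inv_one, ← MonoidAlgebra.one_def, one_mul]
  · let E : Representation.IndV φ ρ →ₗ[k] Representation.IndV φ ρ :=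
      (LinearMap.applyₗ (indMk φ ρ 1 w)) ∘ₗ
        (Representation.ind φ ρ).asAlgebraHom.toLinearMap ∘ₗ B
    refine LinearMap.congr_fun (ind_hom_ext φ ρ (C := E) (D := α • LinearMap.id) fun h v => ?_) v
    change (Representation.ind φ ρ).asAlgebraHom (B (indMk φ ρ h v)) (indMk φ ρ 1 w) =
      α • indMk φ ρ h v
    rw [hB, map_mul, Module.End.mul_apply, ind_map_indMk_one, hw,
      Representation.asAlgebraHom_single, one_smul, ind_indMk, one_mul, inv_inv, map_smul]

omit [Fintype G] [Fintype H] in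
/-- The rank-one condition for an induced module: an element `g` outside the image of `φ` has to be
separated from it by a pair `s`, `t` with `s g = g t` acting by different scalars. -/
theorem ind_corner {w : W} {f : MonoidAlgebra k H} (hf : ∀ v, ∃ c : k, ρ.asAlgebraHom f v = c • w)
    (hg : ∀ g : G, g ∉ Set.range φ → ∃ (s t : H) (a b : k), φ s * g = g * φ t ∧ a ≠ b ∧
      f * MonoidAlgebra.single s 1 = a • f ∧ ∀ v, ρ t v = b • v)
    (v : Representation.IndV φ ρ) : ∃ c : k, (Representation.ind φ ρ).asAlgebraHom
      (MonoidAlgebra.mapDomainAlgHom k k φ f) v = c • indMk φ ρ 1 w := by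
  have key : ∀ g v, ∃ c : k, (Representation.ind φ ρ).asAlgebraHom
      (MonoidAlgebra.mapDomainAlgHom k k φ f) (indMk φ ρ g v) = c • indMk φ ρ 1 w := by
    intro g v
    by_cases hmem : g ∈ Set.range φ
    · obtain ⟨h, rfl⟩ := hmem
      have h1 := indMk_map φ ρ h⁻¹ (φ h) v
      rw [map_inv, inv_mul_cancel] at h1
      obtain ⟨c, hc⟩ := hf (ρ h⁻¹ v)
      exact ⟨c, by rw [← h1, ind_map_indMk_one, hc, map_smul]⟩
    · obtain ⟨s, t, a, b, hst, hab, hs, ht⟩ := hg g⁻¹ (by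
        rintro ⟨h, hh⟩
        exact hmem ⟨h⁻¹, by rw [map_inv, hh, inv_inv]⟩)
      refine ⟨0, ?_⟩
      rw [zero_smul]
      set F := (Representation.ind φ ρ).asAlgebraHom (MonoidAlgebra.mapDomainAlgHom k k φ f)
      have h1 : ∀ z, F (Representation.ind φ ρ (φ s) z) = a • F z := by
        intro z
        have h2 := congrArg (fun y => (Representation.ind φ ρ).asAlgebraHom
          (MonoidAlgebra.mapDomainAlgHom k k φ y) z) hs
        simp only [map_mul, Module.End.mul_apply, map_smul, LinearMap.smul_apply,
          MonoidAlgebra.mapDomainAlgHom_apply, MonoidAlgebra.mapDomain_single,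
          Representation.asAlgebraHom_single, one_smul] at h2
        exact h2
      have h2 : Representation.ind φ ρ (φ s) (indMk φ ρ g v) = b • indMk φ ρ g v := by
        have h3 := indMk_map φ ρ t (g * (φ s)⁻¹) v
        have h4 : φ t * (g * (φ s)⁻¹) = g := by
          rw [← mul_assoc, mul_inv_eq_iff_eq_mul]
          have := congrArg (fun y => g * y * g) hst
          simpa [mul_assoc] using this.symm
        rw [h4, ht, map_smul] at h3
        rw [ind_indMk, h3]
      have h3 := h1 (indMk φ ρ g v)
      rw [h2, map_smul] at h3
      have h4 : (b - a) • F (indMk φ ρ g v) = 0 := by rw [sub_smul, h3, sub_self]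
      exact (smul_eq_zero.1 h4).resolve_left (sub_ne_zero.2 hab.symm)
  have hv : v ∈ (Submodule.span k {indMk φ ρ 1 w}).comap ((Representation.ind φ ρ).asAlgebraHom
      (MonoidAlgebra.mapDomainAlgHom k k φ f)) := by
    have h1 : (Submodule.mkQ (Submodule.span k {indMk φ ρ 1 w})) ∘ₗ
        ((Representation.ind φ ρ).asAlgebraHom (MonoidAlgebra.mapDomainAlgHom k k φ f)) = 0 := by
      refine ind_hom_ext φ ρ fun g v => ?_
      obtain ⟨c, hc⟩ := key g v
      rw [LinearMap.comp_apply, hc, LinearMap.zero_apply, Submodule.mkQ_apply,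
        Submodule.Quotient.mk_eq_zero]
      exact Submodule.smul_mem _ _ (Submodule.mem_span_singleton_self _)
    have h2 := LinearMap.congr_fun h1 v
    rwa [LinearMap.comp_apply, LinearMap.zero_apply, Submodule.mkQ_apply,
      Submodule.Quotient.mk_eq_zero] at h2
  obtain ⟨c, hc⟩ := Submodule.mem_span_singleton.1 hv
  exact ⟨c, hc.symm⟩

end InducedPresentation

/-! ### Ranks on permutation modules and Littlewood-Richardson coefficients -/

section PermOp

variable (k : Type*) [Field k] {G : Type*} [Group G] (Ω : Type*) [Fintype Ω] [DecidableEq Ω]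
  [MulAction G Ω]

/-- The action of the group algebra on the functions on a finite `G`-set. -/
noncomputable def permOp : MonoidAlgebra k G →ₐ[k] Module.End k (Ω → k) :=
  (Matrix.toLinAlgEquiv' : Matrix Ω Ω k ≃ₐ[k] _).toAlgHom.comp (permMat k Ω)

theorem rank_permMat_eq (x : MonoidAlgebra k G) :
    (permMat k Ω x).rank = Module.finrank k (LinearMap.range (permOp k Ω x)) := rfl

variable {k Ω}

theorem permOp_single (g : G) (r : k) (ω : Ω) :
    permOp k Ω (MonoidAlgebra.single g r) (Pi.single ω 1) = r • Pi.single (g • ω) 1 := by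
  ext a
  change (permMat k Ω (MonoidAlgebra.single g r)).mulVec (Pi.single ω 1) a = _
  rw [Matrix.mulVec_single_one, permMat_single, Matrix.col_apply, Matrix.of_apply, Pi.smul_apply,
    Pi.single_apply, smul_eq_mul]
  simp [eq_comm]

theorem permOp_apply [Fintype G] (x : MonoidAlgebra k G) (ω : Ω) :
    permOp k Ω x (Pi.single ω 1) = ∑ g, x.coeff g • Pi.single (g • ω) 1 := by
  conv_lhs => rw [← sum_single_coeff x, map_sum, LinearMap.sum_apply]
  exact Finset.sum_congr rfl fun g _ => permOp_single g _ ω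

theorem pi_hom_ext {V : Type*} [AddCommGroup V] [Module k V] {C D : (Ω → k) →ₗ[k] V}
    (h : ∀ ω, C (Pi.single ω 1) = D (Pi.single ω 1)) : C = D :=
  LinearMap.pi_ext' fun ω => LinearMap.ext_ring (h ω)

end PermOp

section RankTransfer

variable {k : Type*} [Field k] {G H : Type} [Group G] [Group H] [Fintype G] [Fintype H]
  {Ω : Type*} [Fintype Ω] [DecidableEq Ω] [MulAction (G × H) Ω]

/-- If a representation of `G` is the part of a `(G × H)`-permutation module cut out by a multiple
of an idempotent of `H`, then the rank of `e` on it is the rank of the product of both on the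
permutation module. -/
theorem finrank_range_eq_rank_permMat {V : Type*} [AddCommGroup V] [Module k V]
    (ρ : Representation k G V) (Ψ : (Ω → k) →ₗ[k] V) (Φ : V →ₗ[k] (Ω → k)) {α : k} (hα : α ≠ 0)
    {f : MonoidAlgebra k H} (h1 : ∀ v, Ψ (Φ v) = α • v)
    (h2 : ∀ ω, Φ (Ψ (Pi.single ω 1)) = ∑ h, f.coeff h • Pi.single (((1 : G), h) • ω) 1)
    (h3 : ∀ g ω, Ψ (Pi.single ((g, (1 : H)) • ω) 1) = ρ g (Ψ (Pi.single ω 1)))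
    (e : MonoidAlgebra k G) :
    Module.finrank k (LinearMap.range (ρ.asAlgebraHom e)) =
      (permMat k Ω (prodElt e f)).rank := by
  have hΨ : Function.Surjective Ψ := fun v => ⟨α⁻¹ • Φ v, by
    rw [map_smul, h1, smul_smul, inv_mul_cancel₀ hα, one_smul]⟩
  have hΦ : Function.Injective Φ := fun u v huv => by
    have := h1 u
    rw [huv, h1 v] at this
    exact (smul_right_injective V hα this).symm
  have key : Φ ∘ₗ (ρ.asAlgebraHom e) ∘ₗ Ψ = permOp k Ω (prodElt e f) := by
    refine pi_hom_ext fun ω => ?_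
    rw [LinearMap.comp_apply, LinearMap.comp_apply, asAlgebraHom_eq_sum, map_sum, permOp_apply,
      Fintype.sum_prod_type]
    refine Finset.sum_congr rfl fun g _ => ?_
    rw [map_smul, ← h3, h2, Finset.smul_sum]
    refine Finset.sum_congr rfl fun h _ => ?_
    rw [coeff_prodElt, smul_smul, ← mul_smul, Prod.mk_mul_mk, one_mul, mul_one]
  rw [rank_permMat_eq, ← key, LinearMap.range_comp, LinearMap.range_comp,
    LinearMap.range_eq_top.2 hΨ, Submodule.map_top]
  exact (Submodule.equivMapOfInjective Φ hΦ _).finrank_eq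

end RankTransfer

section LittlewoodRichardson

/-- The skew character: the function on `Perm Y` obtained from the character of `ν` on the boxes of
`λ` and `Y` by taking the `λ`-component on the boxes of `λ`. -/
noncomputable def skewChar (lam nu : YoungDiagram) (Y : Type) [Fintype Y] [DecidableEq Y]
    (y : Equiv.Perm Y) : ℚ :=
  (∑ σ, (youngSym ℚ lam).coeff σ * chi (Box lam ⊕ Y) nu (Equiv.Perm.sumCongr σ y)) / hookProd lam

variable {lam tau nu : YoungDiagram} {Y Z : Type} [Fintype Y] [DecidableEq Y] [Fintype Z]
  [DecidableEq Z]

theorem skewChar_permCongr (e : Y ≃ Z) (y : Equiv.Perm Y) :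
    skewChar lam nu Z (e.permCongr y) = skewChar lam nu Y y := by
  rw [skewChar, skewChar]
  congr 1
  refine Finset.sum_congr rfl fun σ _ => ?_
  rw [← chi_permCongr nu (Equiv.sumCongr (Equiv.refl (Box lam)) e)]
  congr 2
  ext z
  rcases z with z | z <;> simp [Equiv.permCongr_apply]

theorem skewChar_isClassFun : IsClassFun (skewChar lam nu Y) := fun g h => by
  rw [← skewChar_permCongr h g]
  congr 1

/-- The group `G` under multiplication by `G` on the left and, through `φ`, by `H` on the right. -/
@[reducible] def biAction {G H : Type} [Group G] [Group H] (φ : H →* G) : MulAction (G × H) G where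
  smul p x := p.1 * x * (φ p.2)⁻¹
  one_smul x := by
    change 1 * x * (φ 1)⁻¹ = x
    simp
  mul_smul p q x := by
    change p.1 * q.1 * x * (φ (p.2 * q.2))⁻¹ = p.1 * (q.1 * x * (φ q.2)⁻¹) * (φ p.2)⁻¹
    simp [mul_assoc]

theorem coeff_mapDomainAlgHom {k : Type*} [Field k] {G H : Type} [Group G] [Group H] [Fintype H]
    [DecidableEq G] (φ : H →* G) (f : MonoidAlgebra k H) (x : G) :
    (MonoidAlgebra.mapDomainAlgHom k k φ f).coeff x =
      ∑ h, if φ h = x then f.coeff h else 0 := by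
  conv_lhs => rw [← sum_single_coeff f]
  rw [map_sum, MonoidAlgebra.coeff_sum, Finsupp.finsetSum_apply]
  refine Finset.sum_congr rfl fun h _ => ?_
  rw [MonoidAlgebra.mapDomainAlgHom_apply, MonoidAlgebra.mapDomain_single,
    MonoidAlgebra.coeff_single, Finsupp.single_apply]

/-- The rank of a group algebra element on a module induced from a presented module. -/
theorem finrank_ind_eq_rank {k : Type*} [Field k] {G H : Type} [Group G] [Group H] [Fintype G]
    [Fintype H] [DecidableEq G] (φ : H →* G) {W : Type*} [AddCommGroup W] [Module k W]
    {ρ : Representation k H W} {w : W} {f : MonoidAlgebra k H} {α : k} (hα : α ≠ 0)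
    (hρ : IsPresented ρ w f α) (e : MonoidAlgebra k G) :
    letI := biAction φ
    Module.finrank k (LinearMap.range ((Representation.ind φ ρ).asAlgebraHom e)) =
      (permMat k G (prodElt e (invElt f))).rank := by
  let _ := biAction φ
  obtain ⟨A, hA, hAw, hw⟩ := ind_isPresented (k := k) φ hρ
  set σ := Representation.ind φ ρ
  set u := indMk φ ρ 1 w
  let Ψ : (G → k) →ₗ[k] Representation.IndV φ ρ := ∑ g, (LinearMap.toSpanSingleton k _ (σ g u)) ∘ₗ
    LinearMap.proj g
  have hΨ : ∀ z, Ψ z = ∑ g, z g • σ g u := fun z => by simp [Ψ]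
  have hΨ1 : ∀ g, Ψ (Pi.single g 1) = σ g u := fun g => by
    rw [hΨ, Finset.sum_eq_single g]
    · simp
    · intro b _ hb; rw [Pi.single_eq_of_ne hb, zero_smul]
    · simp
  let Φ : Representation.IndV φ ρ →ₗ[k] (G → k) := LinearMap.pi fun g => coeffLin g ∘ₗ A
  have hΦ : ∀ v g, Φ v g = (A v).coeff g := fun _ _ => rfl
  refine finrank_range_eq_rank_permMat σ Ψ Φ hα (fun v => ?_) (fun g => ?_) (fun g h => ?_) e
  · rw [← hw, hΨ, asAlgebraHom_eq_sum]
    rfl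
  · rw [hΨ1]
    ext x
    rw [hΦ, hA, hAw, MonoidAlgebra.coeff_single_mul_apply, one_mul, Finset.sum_apply]
    have h1 : ∀ h : H, ((invElt f).coeff h • (Pi.single (((1 : G), h) • g) 1 : G → k)) x =
        if φ h⁻¹ = g⁻¹ * x then f.coeff h⁻¹ else 0 := by
      intro h
      have h2 : ((1 : G), h) • g = g * φ h⁻¹ := by
        change 1 * g * (φ h)⁻¹ = _
        rw [one_mul, map_inv]
      rw [coeff_invElt, Pi.smul_apply, h2, Pi.single_apply, smul_eq_mul, mul_ite, mul_one, mul_zero]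
      exact if_congr ⟨fun h => by rw [h]; simp, fun h => by rw [h]; simp⟩ rfl rfl
    rw [Finset.sum_congr rfl fun h _ => h1 h, coeff_mapDomainAlgHom]
    exact (Fintype.sum_equiv (Equiv.inv H) _ (fun h => if φ h = g⁻¹ * x then f.coeff h else 0)
        fun h => rfl).symm
  · rw [hΨ1, hΨ1]
    change σ (g * h * (φ 1)⁻¹) u = _
    rw [map_one, inv_one, mul_one, map_mul, Module.End.mul_apply]

/-- The trace formula for the multiplicity in an induced representation. -/
theorem rank_biAction_mul_eq {G H : Type} [Group G] [Group H] [Fintype G] [Fintype H]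
    [DecidableEq G] (φ : H →* G) {x : MonoidAlgebra ℤ G} {y : MonoidAlgebra ℤ H} {α β : ℤ}
    (hα : α ≠ 0) (hβ : β ≠ 0) (hx : x * x = α • x) (hy : y * y = β • y) :
    letI := biAction φ
    ((permMat ℚ G (MonoidAlgebra.mapRingHom _ (Int.castRingHom ℚ) (prodElt x (invElt y)))).rank : ℤ)
      * (α * β) = ∑ h, y.coeff h * ∑ a, x.coeff (a * φ h⁻¹ * a⁻¹) := by
  let _ := biAction φ
  have hsq : prodElt x (invElt y) * prodElt x (invElt y) = (α * β) • prodElt x (invElt y) := by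
    rw [prodElt_mul, ← invElt_mul, hx, hy, invElt_smul, prodElt_smul]
  rw [rank_permMat_mul_eq (K := ℚ) G (prodElt x (invElt y))
    (Int.cast_ne_zero.2 (mul_ne_zero hα hβ)) hsq, Fintype.sum_prod_type, Finset.sum_comm]
  refine Fintype.sum_equiv (Equiv.inv H) _ _ fun h => ?_
  have h2 : ∀ g : G, (Fintype.card {a : G // (g, h) • a = a} : ℤ) =
      ∑ a, if g = a * φ h * a⁻¹ then 1 else 0 := by
    intro g
    rw [Fintype.card_subtype, Finset.card_filter, Nat.cast_sum]
    refine Finset.sum_congr rfl fun a _ => ?_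
    rw [Nat.cast_ite, Nat.cast_one, Nat.cast_zero]
    refine if_congr ?_ rfl rfl
    change g * a * (φ h)⁻¹ = a ↔ _
    rw [mul_inv_eq_iff_eq_mul, eq_mul_inv_iff_mul_eq]
  simp only [h2, coeff_prodElt, coeff_invElt, Finset.mul_sum, Equiv.inv_apply, inv_inv]
  rw [Finset.sum_comm]
  refine Finset.sum_congr rfl fun a _ => ?_
  simp only [mul_ite, mul_one, mul_zero, Finset.sum_ite_eq', Finset.mem_univ, if_true]
  ring

theorem asAlgebraHom_comp {k : Type*} [Field k] {G H : Type} [Group G] [Group H] [Fintype G]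
    [Fintype H] (θ : G ≃* H) {V : Type*} [AddCommGroup V] [Module k V] (ρ : Representation k H V)
    (x : MonoidAlgebra k G) (v : V) :
    Representation.asAlgebraHom (MonoidHom.comp ρ θ.toMonoidHom) x v =
      ρ.asAlgebraHom (MonoidAlgebra.domCongr k k θ x) v := by
  rw [asAlgebraHom_eq_sum, asAlgebraHom_eq_sum]
  refine Fintype.sum_equiv θ.toEquiv _ _ fun g => ?_
  rw [MonoidAlgebra.coeff_domCongr]
  change _ = x.coeff (θ.symm (θ g)) • ρ (θ g) v
  rw [θ.symm_apply_apply]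
  rfl

theorem comp_isPresented {k : Type*} [Field k] {G H : Type} [Group G] [Group H] [Fintype G]
    [Fintype H] (θ : G ≃* H) {V : Type*} [AddCommGroup V] [Module k V] {ρ : Representation k H V}
    {w : V} {f : MonoidAlgebra k H} {α : k} (hρ : IsPresented ρ w f α) :
    IsPresented (MonoidHom.comp ρ θ.toMonoidHom) w (MonoidAlgebra.domCongr k k θ.symm f) α := by
  obtain ⟨A, hA, rfl, hw⟩ := hρ
  refine ⟨(MonoidAlgebra.domCongr k k θ.symm).toLinearMap ∘ₗ A, fun g v => ?_, rfl, fun v => ?_⟩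
  · change MonoidAlgebra.domCongr k k θ.symm (A (ρ (θ g) v)) =
      _ * MonoidAlgebra.domCongr k k θ.symm (A v)
    rw [hA, map_mul, MonoidAlgebra.domCongr_single, θ.symm_apply_apply]
  · rw [asAlgebraHom_comp]
    change ρ.asAlgebraHom (MonoidAlgebra.domCongr k k θ (MonoidAlgebra.domCongr k k θ.symm (A v))) w
      = _
    rw [← MonoidAlgebra.domCongr_symm, AlgEquiv.apply_symm_apply, hw]

theorem chi_eq_zero {X : Type} [Fintype X] [DecidableEq X] (h : nu.card ≠ Fintype.card X)
    (g : Equiv.Perm X) : chi X nu g = 0 := by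
  have : IsEmpty (Box nu ≃ X) := ⟨fun e => h (by rw [← card_box, Fintype.card_congr e])⟩
  rw [chi, Fintype.sum_empty, zero_div]

/-- The trace formula for Littlewood-Richardson coefficients. -/
theorem lrCoeff_mul_eq (lam tau nu : YoungDiagram) :
    (lrCoeff lam tau nu : ℚ) * (hookProd lam * hookProd tau) =
      ∑ p : Equiv.Perm (Box lam) × Equiv.Perm (Box tau), (youngSym ℚ lam).coeff p.1 *
        (youngSym ℚ tau).coeff p.2 * chi (Box lam ⊕ Box tau) nu (Equiv.Perm.sumCongr p.1 p.2) := by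
  classical
  rw [lrCoeff]
  split_ifs with h
  swap
  · have : nu.card ≠ Fintype.card (Box lam ⊕ Box tau) := fun hc =>
      h (Fintype.card_eq.1 (by rw [← hc, card_box]))
    simp [chi_eq_zero this]
  set b := h.some
  set θ : Equiv.Perm (Box lam ⊕ Box tau) ≃* Equiv.Perm (Box nu) := b.permCongrHom
  set φ := Equiv.Perm.sumCongrHom (Box lam) (Box tau)
  have hbox : IsPresented (boxSpecht ℚ lam tau) (spechtGen ℚ lam ⊗ₜ spechtGen ℚ tau)
      (prodElt (youngSym ℚ lam) (youngSym ℚ tau)) ((hookProd lam : ℚ) * (hookProd tau : ℚ)) :=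
    tensor_isPresented (fun g u v => rfl) (specht_isPresented lam) (specht_isPresented tau)
  have hα : (hookProd lam : ℚ) * (hookProd tau : ℚ) ≠ 0 :=
    mul_ne_zero (hookProdQ_ne_zero lam) (hookProdQ_ne_zero tau)
  have hfin : FiniteDimensional ℚ (Representation.IndV φ (boxSpecht ℚ lam tau)) :=
    (ind_isPresented φ hbox).finiteDimensional hα
  have hrep := repMult_eq_finrank (k := ℚ) (by exact_mod_cast Fintype.card_ne_zero)
    (spechtInduction ℚ lam tau) (comp_isPresented θ (specht_isPresented nu))
    (hookProdQ_ne_zero nu) (fun h0 => by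
      have := congrArg (fun x => x.coeff 1) h0
      rw [MonoidAlgebra.coeff_domCongr, map_one, coeff_one_youngSym] at this
      exact one_ne_zero this) (fun v => by
      obtain ⟨c, hc⟩ := specht_corner (k := ℚ) nu v
      refine ⟨c, ?_⟩
      rw [asAlgebraHom_comp, ← MonoidAlgebra.domCongr_symm, AlgEquiv.apply_symm_apply, hc])
  let _ := biAction φ
  rw [show repMult (spechtInduction ℚ lam tau) (MonoidHom.comp (specht ℚ nu) θ.toMonoidHom) =
    (permMat ℚ (Equiv.Perm (Box lam ⊕ Box tau)) (prodElt (MonoidAlgebra.domCongr ℚ ℚ θ.symm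
      (youngSym ℚ nu)) (invElt (prodElt (youngSym ℚ lam) (youngSym ℚ tau))))).rank from
      hrep.trans (finrank_ind_eq_rank φ hα hbox _)]
  -- the generating elements are integral
  have hint : MonoidAlgebra.mapRingHom _ (Int.castRingHom ℚ)
      (prodElt (transp b.symm (youngSym ℤ nu))
        (invElt (prodElt (youngSym ℤ lam) (youngSym ℤ tau)))) =
      prodElt (MonoidAlgebra.domCongr ℚ ℚ θ.symm (youngSym ℚ nu))
        (invElt (prodElt (youngSym ℚ lam) (youngSym ℚ tau))) := by
    rw [map_prodElt, map_invElt, map_prodElt, map_youngSym, map_youngSym]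
    congr 1
    refine ext_coeffLin fun g => ?_
    rw [MonoidAlgebra.coeff_domCongr, coeff_youngSym_cast nu ℚ, MonoidAlgebra.coeff_mapRingHom,
      coeff_transp]
    rfl
  have hrank := rank_biAction_mul_eq φ (x := transp b.symm (youngSym ℤ nu))
    (y := prodElt (youngSym ℤ lam) (youngSym ℤ tau)) (hookProd_ne_zero nu)
    (mul_ne_zero (hookProd_ne_zero lam) (hookProd_ne_zero tau))
    (by rw [← map_mul, youngSym_mul_self, map_smul, Int.cast_id])
    (by rw [prodElt_mul, youngSym_mul_self, youngSym_mul_self, prodElt_smul, Int.cast_id,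
      Int.cast_id])
  rw [hint] at hrank
  have h1 := congrArg (Int.cast : ℤ → ℚ) hrank
  push_cast at h1
  apply mul_left_cancel₀ (hookProdQ_ne_zero nu)
  rw [mul_left_comm, h1, Finset.mul_sum]
  refine Finset.sum_congr rfl fun p _ => ?_
  rw [coeff_prodElt, Int.cast_mul, ← coeff_youngSym_cast lam ℚ, ← coeff_youngSym_cast tau ℚ,
    mul_left_comm]
  congr 1
  rw [show Equiv.Perm.sumCongr p.1 p.2 = φ p from rfl, ← (chi_isClassFun nu).inv, ← map_inv, chi,
    mul_div_cancel₀ _ (hookProdQ_ne_zero nu)]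
  refine Fintype.sum_equiv ⟨fun a => (a.trans b).symm, fun t => t.symm.trans b.symm,
    fun a => by ext; simp, fun t => by ext; simp⟩ _ _ fun a => ?_
  rw [coeff_transp, ← coeff_youngSym_cast nu ℚ]
  rfl

/-- Littlewood-Richardson coefficients are the multiplicities in the skew character. -/
theorem charInner_skewChar (h : tau.card = Fintype.card Y) :
    charInner (chi Y tau) (skewChar lam nu Y) = lrCoeff lam tau nu := by
  obtain ⟨t⟩ : Nonempty (Box tau ≃ Y) := Fintype.card_eq.1 (by rw [card_box, h])
  rw [charInner_chi skewChar_isClassFun t]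
  have h1 := lrCoeff_mul_eq lam tau nu
  rw [div_eq_iff (hookProdQ_ne_zero tau)]
  apply mul_right_cancel₀ (hookProdQ_ne_zero lam)
  rw [mul_assoc, mul_comm (hookProd tau : ℚ), h1, Fintype.sum_prod_type, Finset.sum_comm,
    Finset.sum_mul]
  refine Finset.sum_congr rfl fun σ _ => ?_
  rw [skewChar_permCongr, skewChar, mul_div_assoc', div_mul_cancel₀ _ (hookProdQ_ne_zero lam),
    Finset.mul_sum]
  exact Finset.sum_congr rfl fun ρ _ => by ring

theorem skewChar_eq_sum (y : Equiv.Perm Y) : skewChar lam nu Y y =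
    ∑ tau ∈ partitionsOf (Fintype.card Y), lrCoeff lam tau nu * chi Y tau y := by
  rw [eq_sum_chi skewChar_isClassFun y]
  exact Finset.sum_congr rfl fun tau htau => by rw [charInner_skewChar (mem_partitionsOf.1 htau)]

/-- If `λ` is not contained in `ν`, then the multiplicity of `λ` in the restriction of the character
of `ν` vanishes; this is the value at `1` of the skew character. -/
theorem skewChar_eq_zero_of_not_le (h : ¬ lam ≤ nu) (y : Equiv.Perm Y) :
    skewChar lam nu Y y = 0 := by
  by_cases hc : nu.card = Fintype.card (Box lam ⊕ Y)
  swap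
  · simp [skewChar, chi_eq_zero hc]
  have h1 : skewChar lam nu Y 1 = 0 := by
    have h2 := charInner_resFun_eq_zero (lam := lam) (Y := Box lam) (Fintype.card Y)
      (Function.Embedding.inl : Box lam ↪ Box lam ⊕ Y) (mu := nu) (Fintype.card_sum)
      (card_box lam).symm hc h
    rw [charInner_chi (resFun_isClassFun _ (chi_isClassFun nu)) (Equiv.refl _)] at h2
    rw [← h2, skewChar]
    congr 1
    refine Finset.sum_congr rfl fun σ _ => ?_
    rw [resFun]
    congr 2
    ext z
    rcases z with z | z
    · have h5 := Equiv.Perm.viaEmbedding_apply σ (Function.Embedding.inl : Box lam ↪ Box lam ⊕ Y) z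
      exact h5.symm
    · have h5 := Equiv.Perm.viaEmbedding_apply_of_notMem σ
        (Function.Embedding.inl : Box lam ↪ Box lam ⊕ Y) (Sum.inr z) (by rintro ⟨a, ha⟩; cases ha)
      exact h5.symm
  rw [skewChar_eq_sum] at h1 ⊢
  have h2 : ∀ tau ∈ partitionsOf (Fintype.card Y), (lrCoeff lam tau nu : ℚ) = 0 := by
    intro tau htau
    have h3 := (Finset.sum_eq_zero_iff_of_nonneg (fun tau htau => by
      rw [chi_one (mem_partitionsOf.1 htau)]; positivity)).1 h1 tau htau
    rw [chi_one (mem_partitionsOf.1 htau)] at h3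
    have := degree_pos tau
    rcases mul_eq_zero.1 h3 with h | h
    · exact h
    · have : degree tau = 0 := by exact_mod_cast h
      omega
  exact Finset.sum_eq_zero fun tau htau => by rw [h2 tau htau, zero_mul]

theorem charInner_skewChar_skewChar {lam' nu' : YoungDiagram} :
    charInner (skewChar lam nu Y) (skewChar lam' nu' Y) =
      ((∑ tau ∈ partitionsOf (Fintype.card Y), lrCoeff lam tau nu * lrCoeff lam' tau nu' : ℕ) : ℚ) := by
  rw [charInner_eq_sum skewChar_isClassFun]
  push_cast
  refine Finset.sum_congr rfl fun tau htau => ?_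
  rw [charInner_skewChar (mem_partitionsOf.1 htau), charInner_skewChar (mem_partitionsOf.1 htau)]

theorem charInner_skewChar_matchChar :
    charInner (skewChar lam nu Y) matchChar =
      ((∑ eta ∈ evenPartitionsOf (Fintype.card Y), lrCoeff lam eta nu : ℕ) : ℚ) := by
  classical
  rw [charInner_eq_sum matchChar_isClassFun]
  push_cast
  have h1 : ∀ tau ∈ partitionsOf (Fintype.card Y), charInner (chi Y tau) (skewChar lam nu Y) *
      charInner (chi Y tau) matchChar =
      if tau ∈ evenPartitionsOf (Fintype.card Y) then (lrCoeff lam tau nu : ℚ) else 0 := by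
    intro tau htau
    rw [charInner_skewChar (mem_partitionsOf.1 htau), charInner_matchChar (mem_partitionsOf.1 htau)]
    split_ifs <;> simp
  rw [Finset.sum_congr rfl h1, ← Finset.sum_filter]
  refine Finset.sum_congr ?_ fun _ _ => rfl
  ext tau
  rw [Finset.mem_filter]
  exact ⟨fun h => h.2, fun h => ⟨mem_partitionsOf.2 (mem_evenPartitionsOf.1 h).1, h⟩⟩

end LittlewoodRichardson

/-! ### The standard module as part of a permutation module -/

section LabelledMatchings

variable {m : ℕ} {X F : Type}

/-- The wreath product acts on labelled matchings by conjugation and by changing the labels at both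
ends of every strand. -/
instance {Z : Type} : MulAction (Wreath m Z) (LMatching m Z) where
  smul g D :=
    { inv := fun z => g.right (D.inv (g.right.symm z))
      inv_inv := fun z => by simp [D.inv_inv]
      inv_ne := fun z h => D.inv_ne (g.right.symm z) (by
        rw [Equiv.eq_symm_apply]; exact h)
      lab := fun z => Wreath.lab g z + D.lab (g.right.symm z) -
        Wreath.lab g (g.right (D.inv (g.right.symm z)))
      lab_inv := fun z => by
        simp only [Equiv.symm_apply_apply, D.inv_inv, D.lab_inv, Equiv.apply_symm_apply]
        ring }
  one_smul D := by
    refine LMatching.ext (funext fun z => ?_) (funext fun z => ?_)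
    · rfl
    · change Wreath.lab (1 : Wreath m Z) z + D.lab z - Wreath.lab (1 : Wreath m Z) (D.inv z) = D.lab z
      simp
  mul_smul g h D := by
    refine LMatching.ext (funext fun z => rfl) (funext fun z => ?_)
    change Wreath.lab (g * h) z + D.lab (h.right.symm (g.right.symm z)) -
        Wreath.lab (g * h) (g.right (h.right (D.inv (h.right.symm (g.right.symm z))))) =
      Wreath.lab g z + (Wreath.lab h (g.right.symm z) + D.lab (h.right.symm (g.right.symm z)) -
        Wreath.lab h (h.right (D.inv (h.right.symm (g.right.symm z))))) -
        Wreath.lab g (g.right (h.right (D.inv (h.right.symm (g.right.symm z)))))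
    rw [Wreath.lab_mul, Wreath.lab_mul, Equiv.symm_apply_apply]
    ring

theorem LMatching.smul_inv {Z : Type} (g : Wreath m Z) (D : LMatching m Z) (z : Z) :
    (g • D).inv z = g.right (D.inv (g.right.symm z)) := rfl

theorem LMatching.smul_lab {Z : Type} (g : Wreath m Z) (D : LMatching m Z) (z : Z) :
    (g • D).lab z = Wreath.lab g z + D.lab (g.right.symm z) -
        Wreath.lab g (g.right (D.inv (g.right.symm z))) := rfl

/-- The embedding of a product of two wreath products. -/
def Wreath.sumHom : Wreath m X × Wreath m F →* Wreath m (X ⊕ F) where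
  toFun p := ⟨Sum.elim p.1.left p.2.left, Equiv.Perm.sumCongr p.1.right p.2.right⟩
  map_one' := by
    refine SemidirectProduct.ext ?_ ?_
    · funext z; rcases z with z | z <;> rfl
    · exact Equiv.Perm.sumCongr_one
  map_mul' p q := by
    refine SemidirectProduct.ext ?_ ?_
    · funext z; rcases z with z | z <;> rfl
    · exact (Equiv.Perm.sumCongr_mul _ _ _ _).symm

theorem Wreath.act_eq_smul (g : Wreath m X) (D : LMatching m (X ⊕ F)) :
    Wreath.act g D = Wreath.sumHom (g, (1 : Wreath m F)) • D := by
  have h1 : ∀ z : X ⊕ F, Sum.map g.right id z = (Wreath.sumHom (g, (1 : Wreath m F))).right z := by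
    rintro (z | z) <;> rfl
  have h2 : ∀ z : X ⊕ F, Sum.map g.right.symm id z =
      (Wreath.sumHom (g, (1 : Wreath m F))).right.symm z := by
    rintro (z | z) <;> rfl
  have h3 : ∀ z : X ⊕ F, Sum.elim (Wreath.lab g) 0 z =
      Wreath.lab (Wreath.sumHom (g, (1 : Wreath m F))) z := by
    rintro (z | z) <;> rfl
  refine LMatching.ext (funext fun z => ?_) (funext fun z => ?_)
  · rw [LMatching.smul_inv, ← h1, ← h2]; rfl
  · rw [LMatching.smul_lab, ← h1, ← h2, ← h3, ← h3]; rfl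

/-- All southern nodes lie on through strands. -/
def LMatching.Through (D : LMatching m (X ⊕ F)) : Prop := ∀ y, (D.inv (.inr y)).isLeft

theorem LMatching.Through.smul {D : LMatching m (X ⊕ F)} (h : D.Through)
    (p : Wreath m X × Wreath m F) : (Wreath.sumHom p • D).Through := by
  intro y
  have := h (p.2.right.symm y)
  obtain ⟨x, hx⟩ := Sum.isLeft_iff.1 this
  rw [LMatching.smul_inv, show (Wreath.sumHom p).right.symm (.inr y) = .inr (p.2.right.symm y) from
    rfl, hx]
  rfl

variable (m X F) in
/-- The labelled matchings of northern nodes `X` and southern nodes `F` without arcs in the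
south. -/
abbrev ThroughMatching : Type := {D : LMatching m (X ⊕ F) // D.Through}

instance : MulAction (Wreath m X × Wreath m F) (ThroughMatching m X F) where
  smul p D := ⟨Wreath.sumHom p • D.1, D.2.smul p⟩
  one_smul D := Subtype.ext (by
    change Wreath.sumHom 1 • D.1 = D.1
    rw [map_one, one_smul])
  mul_smul p q D := Subtype.ext (by
    change Wreath.sumHom (p * q) • D.1 = Wreath.sumHom p • Wreath.sumHom q • D.1
    rw [map_mul, mul_smul])

theorem ThroughMatching.smul_val (p : Wreath m X × Wreath m F) (D : ThroughMatching m X F) :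
    (p • D).1 = Wreath.sumHom p • D.1 := rfl

instance [NeZero m] {Z : Type} [Finite Z] : Finite (LMatching m Z) :=
  Finite.of_injective (fun D : LMatching m Z => (D.inv, D.lab)) fun D E h =>
    LMatching.ext (congrArg Prod.fst h) (congrArg Prod.snd h)

noncomputable instance [NeZero m] [Finite X] [Finite F] : Fintype (ThroughMatching m X F) :=
  haveI : Finite {D : LMatching m (X ⊕ F) // D.Through} := inferInstance
  Fintype.ofFinite {D : LMatching m (X ⊕ F) // D.Through}

noncomputable instance : DecidableEq (ThroughMatching m X F) := Classical.decEq _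

theorem ThroughMatching.ext' {D E : ThroughMatching m X F}
    (hinv : ∀ x, D.1.inv (.inl x) = E.1.inv (.inl x))
    (hlab : ∀ x, D.1.lab (.inl x) = E.1.lab (.inl x)) : D = E := by
  have hr : ∀ y, ∃ x, D.1.inv (.inr y) = .inl x ∧ E.1.inv (.inr y) = .inl x := by
    intro y
    obtain ⟨x, hx⟩ := Sum.isLeft_iff.1 (D.2 y)
    refine ⟨x, hx, ?_⟩
    have h1 := hinv x
    rw [← hx, D.1.inv_inv] at h1
    rw [h1, E.1.inv_inv, hx]
  refine Subtype.ext (LMatching.ext (funext fun z => ?_) (funext fun z => ?_))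
  · rcases z with x | y
    · exact hinv x
    · obtain ⟨x, h1, h2⟩ := hr y
      rw [h1, h2]
  · rcases z with x | y
    · exact hlab x
    · obtain ⟨x, h1, h2⟩ := hr y
      rw [← neg_inj, ← D.1.lab_inv, ← E.1.lab_inv, h1, h2, hlab]

end LabelledMatchings

section CellPresentation

variable {m n f : ℕ}

/-- The through matching of a dangle. -/
noncomputable def Dangle.through (d : Dangle m n f) : ThroughMatching m (Fin n) (Fin f) :=
  ⟨d.toMatching, isThrough_toMatching d⟩

theorem ThroughMatching.isThrough (D : ThroughMatching m (Fin n) (Fin f)) : IsThrough D.1 := D.2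

/-- The dangle at the top of a through matching. -/
def ThroughMatching.top (D : ThroughMatching m (Fin n) (Fin f)) : Dangle m n f := topDangle D.1 D.isThrough

/-- The element of the wreath product given by the through strands. -/
noncomputable def ThroughMatching.wreath (D : ThroughMatching m (Fin n) (Fin f)) :
    Wreath m (Fin f) := throughWreath D.1 D.isThrough

theorem ThroughMatching.inv_inl_free (D : ThroughMatching m (Fin n) (Fin f)) (s : Fin f) :
    D.1.inv (.inl (D.top.free (D.wreath.right s))) = .inr s := by
  have h := free_throughWreath D.1 D.isThrough s
  change D.1.inv (.inl ((topDangle D.1 D.isThrough).free ((throughWreath D.1 D.isThrough).right s))) = _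
  rw [h, inl_throughTop, D.1.inv_inv]

theorem ThroughMatching.top_smul_right (D : ThroughMatching m (Fin n) (Fin f))
    (h : Wreath m (Fin f)) : (((1 : Wreath m (Fin n)), h) • D).top = D.top := by
  refine Dangle.ext (funext fun i => ?_) (funext fun i => ?_)
  · rw [ThroughMatching.top, ThroughMatching.top, topDangle_inv, topDangle_inv,
      ThroughMatching.smul_val, LMatching.smul_inv]
    change Sum.elim id (fun _ => i) (Equiv.Perm.sumCongr 1 h.right (D.1.inv (.inl i))) = _
    rcases D.1.inv (.inl i) with j | s <;> rfl
  · rw [ThroughMatching.top, ThroughMatching.top, topDangle_lab, topDangle_lab,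
      ThroughMatching.smul_val, LMatching.smul_inv, LMatching.smul_lab]
    change Sum.elim (fun _ => 0 + D.1.lab (.inl i) - Wreath.lab (Wreath.sumHom (1, h))
      (Equiv.Perm.sumCongr 1 h.right (D.1.inv (.inl i)))) (fun _ => 0)
      (Equiv.Perm.sumCongr 1 h.right (D.1.inv (.inl i))) = _
    rcases D.1.inv (.inl i) with j | s
    · change 0 + D.1.lab (.inl i) - 0 = D.1.lab (.inl i)
      ring
    · rfl

theorem ThroughMatching.wreath_smul_right (D : ThroughMatching m (Fin n) (Fin f))
    (h : Wreath m (Fin f)) :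
    (((1 : Wreath m (Fin n)), h) • D).wreath = D.wreath * h⁻¹ := by
  set E := ((1 : Wreath m (Fin n)), h) • D with hE
  have htop : E.top = D.top := D.top_smul_right h
  have hr : E.wreath.right = (D.wreath * h⁻¹).right := by
    refine Equiv.ext fun s => ?_
    obtain ⟨t, rfl⟩ := h.right.surjective s
    have h1 := E.inv_inl_free (h.right t)
    have h2 := D.inv_inl_free t
    have h3 : E.1.inv (.inl (D.top.free (D.wreath.right t))) = .inr (h.right t) := by
      rw [hE, ThroughMatching.smul_val, LMatching.smul_inv]
      change Equiv.Perm.sumCongr 1 h.right (D.1.inv (.inl (D.top.free (D.wreath.right t)))) = _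
      rw [h2]; rfl
    rw [htop] at h1
    have h4 : D.top.free (E.wreath.right (h.right t)) = D.top.free (D.wreath.right t) := by
      have := congrArg E.1.inv (h1.trans h3.symm)
      rw [E.1.inv_inv, E.1.inv_inv] at this
      exact Sum.inl_injective this
    rw [D.top.free_injective h4]
    change _ = D.wreath.right (h.right.symm (h.right t))
    rw [Equiv.symm_apply_apply]
  refine Wreath.ext' (fun q => ?_) hr
  obtain ⟨s, rfl⟩ := D.wreath.right.surjective q
  rw [Wreath.lab_mul, Equiv.symm_apply_apply]
  have h5 := D.inv_inl_free s
  change E.1.lab (.inl (E.top.free (D.wreath.right s))) =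
    D.1.lab (.inl (D.top.free (D.wreath.right s))) + _
  rw [htop, hE, ThroughMatching.smul_val, LMatching.smul_lab]
  change 0 + D.1.lab (.inl (D.top.free (D.wreath.right s))) - Wreath.lab (Wreath.sumHom (1, h))
    (Equiv.Perm.sumCongr 1 h.right (D.1.inv (.inl (D.top.free (D.wreath.right s))))) = _
  rw [h5]
  change 0 + _ - Wreath.lab h (h.right s) = _ + - Wreath.lab h (h.right.symm.symm s)
  rw [Equiv.symm_symm]
  ring

theorem Dangle.top_through (d : Dangle m n f) : d.through.top = d := topDangle_toMatching d

theorem Dangle.wreath_through (d : Dangle m n f) : d.through.wreath = 1 :=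
  throughWreath_toMatching d

theorem ThroughMatching.smul_through_top (D : ThroughMatching m (Fin n) (Fin f)) :
    ((1 : Wreath m (Fin n)), D.wreath⁻¹) • D.top.through = D := by
  set w := D.wreath with hw
  have hval : (((1 : Wreath m (Fin n)), w⁻¹) • D.top.through).1 =
      Wreath.sumHom ((1 : Wreath m (Fin n)), w⁻¹) • D.top.toMatching := rfl
  have hinv : ∀ i, (((1 : Wreath m (Fin n)), w⁻¹) • D.top.through).1.inv (.inl i) =
      Equiv.Perm.sumCongr 1 w.right.symm (D.top.toMatching.inv (.inl i)) := fun i => rfl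
  have hcase : ∀ i, (∃ j, D.1.inv (.inl i) = .inl j ∧ D.top.toMatching.inv (.inl i) = .inl j ∧
      D.top.toMatching.lab (.inl i) = D.1.lab (.inl i)) ∨
      ∃ s, i = D.top.free (w.right s) ∧ D.1.inv (.inl i) = .inr s ∧
        D.top.toMatching.inv (.inl i) = .inr (w.right s) ∧ D.top.toMatching.lab (.inl i) = 0 := by
    intro i
    rcases hD : D.1.inv (.inl i) with j | s
    · left
      have hji : j ≠ i := fun e => D.1.inv_ne (.inl i) (by rw [hD, e])
      have h1 : D.top.inv i = j := by
        rw [ThroughMatching.top, topDangle_inv, hD]; rfl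
      refine ⟨j, rfl, ?_, ?_⟩
      · simp [Dangle.toMatching, h1, hji]
      · change D.top.lab i = _
        rw [ThroughMatching.top, topDangle_lab, hD]; rfl
    · right
      have h1 := D.inv_inl_free s
      have h2 : i = D.top.free (w.right s) := by
        have := congrArg D.1.inv (hD.trans h1.symm)
        rw [D.1.inv_inv, D.1.inv_inv] at this
        exact Sum.inl_injective this
      refine ⟨s, h2, rfl, ?_, ?_⟩
      · have h3 : D.top.toMatching.inv (.inr (w.right s)) = .inl (D.top.free (w.right s)) := rfl
        rw [h2, ← h3, D.top.toMatching.inv_inv]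
      · change D.top.lab i = 0
        rw [h2]
        exact D.top.lab_free _ (D.top.inv_free _)
  refine ThroughMatching.ext' (fun i => ?_) (fun i => ?_)
  · rw [hinv]
    rcases hcase i with ⟨j, h1, h2, -⟩ | ⟨s, -, h1, h2, -⟩
    · rw [h1, h2]; rfl
    · rw [h1, h2]
      change Sum.inr (w.right.symm (w.right s)) = _
      rw [Equiv.symm_apply_apply]
  · rw [hval, LMatching.smul_lab]
    change 0 + D.top.toMatching.lab (.inl i) - Wreath.lab (Wreath.sumHom (1, w⁻¹))
      (Equiv.Perm.sumCongr 1 w.right.symm (D.top.toMatching.inv (.inl i))) = _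
    rcases hcase i with ⟨j, h1, h2, h3⟩ | ⟨s, h0, h1, h2, h3⟩
    · rw [h2, h3]
      change 0 + D.1.lab (.inl i) - 0 = _
      ring
    · rw [h2, h3]
      change 0 + 0 - - Wreath.lab w (w.right (w.right.symm (w.right s))) = _
      rw [Equiv.symm_apply_apply, h0, hw]
      change 0 + 0 - - D.1.lab (.inl (D.top.free (D.wreath.right s))) = _
      ring

variable [NeZero m] {k : Type*} [Field k] (δ : ZMod m → k) {N : Type*} [AddCommGroup N] [Module k N]

theorem cellRestriction_of (ρ : Representation k (Wreath m (Fin f)) N) (g : Wreath m (Fin n))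
    (D : ThroughMatching m (Fin n) (Fin f)) (v : N) :
    cellRestriction δ ρ g (DangleSpace.of k D.top ⊗ₜ ρ D.wreath v) =
      DangleSpace.of k ((g, (1 : Wreath m (Fin f))) • D).top ⊗ₜ
        ρ ((g, (1 : Wreath m (Fin f))) • D).wreath v := by
  have hD : ∀ (E : LMatching m (Fin n ⊕ Fin f)) (hE : IsThrough E), Wreath.act g D.1 = E →
      cellRestriction δ ρ g (DangleSpace.of k D.top ⊗ₜ ρ D.wreath v) =
        DangleSpace.of k (topDangle E hE) ⊗ₜ ρ (throughWreath E hE) v := by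
    rintro E hE rfl
    refine (cellAction_ofWreath δ ρ g D.top _).trans ?_
    rw [ThroughMatching.top, topDangle_act g D.1 D.isThrough, throughWreath_act g D.1 D.isThrough, map_mul]
    rfl
  exact hD _ ((g, (1 : Wreath m (Fin f))) • D).isThrough (Wreath.act_eq_smul g D.1)

/-- The rank of a group algebra element on a cell module, in terms of a permutation module of through
matchings. -/
theorem finrank_cellRestriction {ρ : Representation k (Wreath m (Fin f)) N} {w : N}
    {x : MonoidAlgebra k (Wreath m (Fin f))} {α : k} (hα : α ≠ 0) (hρ : IsPresented ρ w x α)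
    (e : MonoidAlgebra k (Wreath m (Fin n))) :
    FiniteDimensional k (DangleSpace m n f k ⊗[k] N) ∧
    Module.finrank k (LinearMap.range ((cellRestriction δ ρ).asAlgebraHom e)) =
      (permMat k (ThroughMatching m (Fin n) (Fin f)) (prodElt e (invElt x))).rank := by
  obtain ⟨A, hA, hAw, hw⟩ := hρ
  let Ω := ThroughMatching m (Fin n) (Fin f)
  let ψ : Ω → DangleSpace m n f k ⊗[k] N := fun D => DangleSpace.of k D.top ⊗ₜ ρ D.wreath w
  let Ψ : (Ω → k) →ₗ[k] DangleSpace m n f k ⊗[k] N :=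
    ∑ D, (LinearMap.toSpanSingleton k _ (ψ D)) ∘ₗ LinearMap.proj D
  have hΨ1 : ∀ D, Ψ (Pi.single D 1) = ψ D := fun D => by
    have hΨ : ∀ z, Ψ z = ∑ D, z D • ψ D := fun z => by simp [Ψ]
    rw [hΨ, Finset.sum_eq_single D]
    · simp
    · intro b _ hb; rw [Pi.single_eq_of_ne hb, zero_smul]
    · simp
  let φ : Dangle m n f → N →ₗ[k] (Ω → k) := fun d =>
    ∑ h, (LinearMap.toSpanSingleton k (Ω → k)
      (Pi.single (((1 : Wreath m (Fin n)), h⁻¹) • d.through) 1)) ∘ₗ coeffLin h ∘ₗ A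
  have hφ : ∀ d v, φ d v = ∑ h, (A v).coeff h •
      (Pi.single (((1 : Wreath m (Fin n)), h⁻¹) • d.through) 1 : Ω → k) := fun d v => by
    simp only [φ, LinearMap.sum_apply]; rfl
  let Φ : DangleSpace m n f k ⊗[k] N →ₗ[k] (Ω → k) := TensorProduct.lift (DangleSpace.lift φ)
  have hΦ : ∀ d v, Φ (DangleSpace.of k d ⊗ₜ v) = φ d v := fun d v => by
    simp only [Φ, TensorProduct.lift.tmul, DangleSpace.lift_of]
  have h1 : ∀ v, Ψ (Φ v) = α • v := by
    intro v
    refine LinearMap.congr_fun (DangleSpace.tensor_hom_ext (F := Ψ ∘ₗ Φ) (G := α • LinearMap.id)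
      fun d v => ?_) v
    rw [LinearMap.comp_apply, hΦ, hφ, map_sum, LinearMap.smul_apply, LinearMap.id_apply,
      ← TensorProduct.tmul_smul, ← hw, asAlgebraHom_eq_sum, TensorProduct.tmul_sum]
    refine Finset.sum_congr rfl fun h _ => ?_
    rw [map_smul, hΨ1, TensorProduct.tmul_smul]
    simp only [ψ]
    rw [ThroughMatching.top_smul_right, ThroughMatching.wreath_smul_right, Dangle.top_through,
      Dangle.wreath_through, one_mul, inv_inv]
  refine ⟨Module.Finite.of_surjective Ψ fun v => ⟨α⁻¹ • Φ v, by
    rw [map_smul, h1, smul_smul, inv_mul_cancel₀ hα, one_smul]⟩,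
    finrank_range_eq_rank_permMat _ Ψ Φ hα h1 (fun D => ?_) (fun g D => ?_) e⟩
  · rw [hΨ1, hΦ, hφ, hA, hAw]
    refine Fintype.sum_equiv ((Equiv.mulLeft D.wreath⁻¹).trans (Equiv.inv _)) _ _ fun h => ?_
    rw [MonoidAlgebra.coeff_single_mul_apply, one_mul, coeff_invElt]
    simp only [Equiv.trans_apply, Equiv.coe_mulLeft, Equiv.inv_apply, inv_inv]
    congr 2
    have h5 : D.top.through = ((1 : Wreath m (Fin n)), D.wreath) • D := by
      have h6 := congrArg (fun E => ((1 : Wreath m (Fin n)), D.wreath) • E) D.smul_through_top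
      rwa [← mul_smul, Prod.mk_mul_mk, one_mul, mul_inv_cancel, ← Prod.one_eq_mk, one_smul] at h6
    rw [h5, ← mul_smul, Prod.mk_mul_mk, one_mul, mul_inv_rev, inv_inv]
  · rw [hΨ1, hΨ1]
    exact (cellRestriction_of δ ρ g D w).symm

end CellPresentation

/-! ### Specht modules of the wreath product -/

section WreathSpecht

variable {m : ℕ} [NeZero m] {k : Type*} [Field k] {ξ : k} (hξ : IsPrimitiveRoot ξ m) {n : ℕ}

/-- The character `a ↦ ξ ^ a` of `ℤ/m`. -/
noncomputable def rootChar : AddChar (ZMod m) k := AddChar.zmodChar m hξ.pow_eq_one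

theorem rootChar_apply (a : ZMod m) : rootChar hξ a = ξ ^ a.val := AddChar.zmodChar_apply _ a

theorem rootChar_injective : Function.Injective (rootChar hξ) := fun a b h => by
  rw [rootChar_apply, rootChar_apply] at h
  exact ZMod.val_injective m (hξ.pow_inj (ZMod.val_lt a) (ZMod.val_lt b) h)

theorem Wreath.char_eq {X : Type} [Fintype X] (r : ZMod m) (g : Wreath m X) :
    Wreath.char hξ r g = ∏ x, rootChar hξ (r * Wreath.lab g x) :=
  Finset.prod_congr rfl fun x _ => (rootChar_apply hξ _).symm

/-- The component of the `m`-partition which contains the box with a given number. -/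
noncomputable def MPartition.colour (lam : MPartition m n) (x : Fin n) : ZMod m :=
  (lam.numbering.symm x).1

/-- The group of labels, indexed by the boxes of an `m`-partition. -/
abbrev MPartition.Torus (lam : MPartition m n) : Type :=
  ∀ i, Box (lam.part i) → Multiplicative (ZMod m)

noncomputable instance (lam : MPartition m n) : Fintype lam.Torus := inferInstance

namespace MPartition

variable (lam : MPartition m n)

/-- The inclusion of the group of labels in the Young subgroup. -/
def torusHom : lam.Torus →* ∀ i, Wreath m (Box (lam.part i)) where
  toFun t i := SemidirectProduct.inl (t i)
  map_one' := rfl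
  map_mul' t u := funext fun i => map_mul SemidirectProduct.inl (t i) (u i)

/-- The label at the box with a given number. -/
noncomputable def torusLab (t : lam.Torus) (x : Fin n) : ZMod m :=
  (t (lam.numbering.symm x).1 (lam.numbering.symm x).2).toAdd

/-- The element of the group of labels with prescribed labels. -/
noncomputable def torusOfLab (u : Fin n → ZMod m) : lam.Torus :=
  fun i y => Multiplicative.ofAdd (u (lam.numbering ⟨i, y⟩))

@[simp] theorem torusLab_torusOfLab (u : Fin n → ZMod m) (x : Fin n) :
    lam.torusLab (lam.torusOfLab u) x = u x := by
  change u (lam.numbering (lam.numbering.symm x)) = u x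
  rw [Equiv.apply_symm_apply]

theorem young_torusHom (t : lam.Torus) :
    lam.young (lam.torusHom t) =
      SemidirectProduct.inl fun x => Multiplicative.ofAdd (lam.torusLab t x) := by
  refine SemidirectProduct.ext rfl ?_
  change lam.numbering.permCongr (Equiv.Perm.sigmaCongrRight fun i => 1) = 1
  ext x
  simp

/-- The character of the group of labels by which it acts on the Specht module of the Young
subgroup. -/
noncomputable def torusChar : lam.Torus →* k where
  toFun t := ∏ i, Wreath.char hξ i (lam.torusHom t i)
  map_one' := by simp
  map_mul' t u := by simp [Finset.prod_mul_distrib]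

theorem torusChar_apply (t : lam.Torus) :
    lam.torusChar hξ t = ∏ i, Wreath.char hξ i (lam.torusHom t i) := rfl

theorem torusChar_eq (t : lam.Torus) :
    lam.torusChar hξ t = ∏ x, rootChar hξ (lam.colour x * lam.torusLab t x) := by
  rw [torusChar_apply]
  simp only [Wreath.char_eq]
  rw [← Fintype.prod_sigma' (fun i y => rootChar hξ (i * Wreath.lab (lam.torusHom t i) y))]
  exact (Equiv.prod_comp lam.numbering.symm fun z : Σ i, Box (lam.part i) =>
    rootChar hξ (z.1 * Wreath.lab (lam.torusHom t z.1) z.2)).symm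

/-- The generator of the Specht module of the Young subgroup, as an element of the group algebra. -/
noncomputable def outerElt : MonoidAlgebra k (∀ i, Wreath m (Box (lam.part i))) :=
  piElt fun i => twist (Wreath.char hξ i) (youngSym k (lam.part i))

/-- The generator of the Specht module of the wreath product, as an element of the group algebra. -/
noncomputable def wreathElt : MonoidAlgebra k (Wreath m (Fin n)) :=
  MonoidAlgebra.mapDomainAlgHom k k lam.young (lam.outerElt hξ)

end MPartition

theorem piElt_single {ι : Type*} [Fintype ι] [DecidableEq ι] {Γ : ι → Type*} [∀ i, Group (Γ i)]
    [∀ i, Fintype (Γ i)] (g : ∀ i, Γ i) :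
    piElt (fun i => MonoidAlgebra.single (g i) (1 : k)) = MonoidAlgebra.single g 1 := by
  classical
  refine ext_coeffLin fun h => ?_
  simp only [coeff_piElt, MonoidAlgebra.coeff_single, Finsupp.single_apply]
  by_cases hgh : g = h
  · rw [if_pos hgh]
    exact Finset.prod_eq_one fun i _ => if_pos (congrFun hgh i)
  · rw [if_neg hgh]
    obtain ⟨i, hi⟩ := Function.ne_iff.1 hgh
    exact Finset.prod_eq_zero (Finset.mem_univ i) (if_neg hi)

namespace MPartition

variable (lam : MPartition m n)

theorem outerElt_mul_torus (t : lam.Torus) :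
    lam.outerElt hξ * MonoidAlgebra.single (lam.torusHom t) 1 =
      lam.torusChar hξ t • lam.outerElt hξ := by
  rw [← piElt_single, outerElt, piElt_mul, torusChar_apply, ← piElt_smul]
  congr 1
  funext i
  rw [twist_mul_single]
  change _ • twist _ (_ * MonoidAlgebra.single 1 1) = _
  rw [← MonoidAlgebra.one_def, mul_one]

theorem torus_mul_outerElt (t : lam.Torus) :
    MonoidAlgebra.single (lam.torusHom t) 1 * lam.outerElt hξ =
      lam.torusChar hξ t • lam.outerElt hξ := by
  rw [← piElt_single, outerElt, piElt_mul, torusChar_apply, ← piElt_smul]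
  congr 1
  funext i
  rw [single_mul_twist]
  change _ • twist _ (MonoidAlgebra.single 1 1 * _) = _
  rw [← MonoidAlgebra.one_def, one_mul]

theorem outerSpecht_torus (t : lam.Torus) (v : ⨂[k] i, SpechtModule k (lam.part i)) :
    outerSpecht hξ lam (lam.torusHom t) v = lam.torusChar hξ t • v := by
  have h : ∀ i v, twistedSpecht hξ (lam.part i) i (lam.torusHom t i) v =
      Wreath.char hξ i (lam.torusHom t i) • v := fun i v => by
    change Wreath.char hξ i (lam.torusHom t i) • specht k (lam.part i) 1 v = _
    rw [map_one]; rfl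
  induction v using PiTensorProduct.induction_on with
  | smul_tprod r v =>
    rw [map_smul]
    change r • PiTensorProduct.map _ _ = _
    rw [PiTensorProduct.map_tprod]
    simp only [h]
    rw [MultilinearMap.map_smul_univ, torusChar_apply, smul_comm]
  | add a b ha hb => rw [map_add, ha, hb, smul_add]

theorem outerSpecht_isPresented (hm : (m : k) ≠ 0) :
    IsPresented (outerSpecht hξ lam) (PiTensorProduct.tprod k fun i => spechtGen k (lam.part i))
      (lam.outerElt hξ) (∏ i, (hookProd (lam.part i) : k)) :=
  pi_isPresented (ρ := fun i => twistedSpecht hξ (lam.part i) i) (fun _ => rfl) fun i =>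
    twist_isPresented hm (fun _ _ => rfl) (specht_isPresented (lam.part i))

theorem outerSpecht_corner (hm : (m : k) ≠ 0) (v : ⨂[k] i, SpechtModule k (lam.part i)) :
    ∃ c : k, (outerSpecht hξ lam).asAlgebraHom (lam.outerElt hξ) v =
      c • PiTensorProduct.tprod k fun i => spechtGen k (lam.part i) :=
  pi_corner (ρ := fun i => twistedSpecht hξ (lam.part i) i) (fun _ => rfl) (fun i v => by
    rw [asAlgebraHom_twist hm (ρ := specht k (lam.part i)) fun _ _ => rfl]
    exact specht_corner (lam.part i) v) v

theorem young_injective : Function.Injective lam.young := by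
  rw [injective_iff_map_eq_one]
  intro g hg
  have hl : ∀ x, lam.torusLab (fun i => (g i).left) x = 0 := fun x =>
    congrArg (fun h => Wreath.lab h x) hg
  have hr : ∀ z, (Equiv.Perm.sigmaCongrRight fun i => (g i).right) z = z := fun z => by
    have h1 := congrArg (fun h : Wreath m (Fin n) => h.right (lam.numbering z)) hg
    change lam.numbering ((Equiv.Perm.sigmaCongrRight fun i => (g i).right)
      (lam.numbering.symm (lam.numbering z))) = lam.numbering z at h1
    rwa [Equiv.symm_apply_apply, lam.numbering.injective.eq_iff] at h1
  refine funext fun i => Wreath.ext' (fun y => ?_) (Equiv.ext fun y => ?_)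
  · have h1 := hl (lam.numbering ⟨i, y⟩)
    rw [torusLab, Equiv.symm_apply_apply] at h1
    exact h1
  · exact eq_of_heq (Sigma.mk.inj (hr ⟨i, y⟩)).2

/-- The Young subgroup consists of the elements that preserve the components. -/
theorem mem_range_young {g : Wreath m (Fin n)} (h : ∀ x, lam.colour (g.right x) = lam.colour x) :
    g ∈ Set.range lam.young := by
  have h1 : ∀ i (y : Box (lam.part i)), ∃ y' : Box (lam.part i),
      g.right (lam.numbering ⟨i, y⟩) = lam.numbering ⟨i, y'⟩ := by
    intro i y
    have h2 := h (lam.numbering ⟨i, y⟩)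
    rw [colour, colour, Equiv.symm_apply_apply] at h2
    obtain ⟨⟨j, y'⟩, hz⟩ := lam.numbering.surjective (g.right (lam.numbering ⟨i, y⟩))
    rw [← hz, Equiv.symm_apply_apply] at h2
    obtain rfl : j = i := h2
    exact ⟨y', hz.symm⟩
  choose F hF using h1
  have hinj : ∀ i, Function.Injective (F i) := fun i y y' hy => by
    have h2 := hF i y
    rw [hy, ← hF] at h2
    exact eq_of_heq (Sigma.mk.inj (lam.numbering.injective (g.right.injective h2))).2
  refine ⟨fun i => ⟨fun y => Multiplicative.ofAdd (Wreath.lab g (lam.numbering ⟨i, y⟩)),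
    Equiv.ofBijective (F i) (Finite.injective_iff_bijective.1 (hinj i))⟩,
    Wreath.ext' (fun x => ?_) (Equiv.ext fun x => ?_)⟩
  · exact lam.torusLab_torusOfLab (Wreath.lab g) x
  · obtain ⟨⟨i, y⟩, rfl⟩ := lam.numbering.surjective x
    rw [hF]
    change lam.numbering ((Equiv.Perm.sigmaCongrRight fun i => Equiv.ofBijective (F i)
      (Finite.injective_iff_bijective.1 (hinj i)))
      (lam.numbering.symm (lam.numbering ⟨i, y⟩))) = _
    rw [Equiv.symm_apply_apply]
    rfl

theorem torusChar_single (x : Fin n) :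
    lam.torusChar hξ (lam.torusOfLab (Pi.single x 1)) = rootChar hξ (lam.colour x) := by
  rw [torusChar_eq, Finset.prod_eq_single x]
  · simp
  · intro y _ hy
    simp [hy]
  · simp

theorem wreathSpecht_isPresented (hm : (m : k) ≠ 0) :
    IsPresented (wreathSpecht hξ lam) (indMk lam.young (outerSpecht hξ lam) 1
        (PiTensorProduct.tprod k fun i => spechtGen k (lam.part i)))
      (lam.wreathElt hξ) (∏ i, (hookProd (lam.part i) : k)) :=
  ind_isPresented lam.young (lam.outerSpecht_isPresented hξ hm)

/-- An element outside the Young subgroup moves some box to another component, and there the two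
actions of the group of labels are by different characters. -/
theorem wreathSpecht_corner (hm : (m : k) ≠ 0)
    (v : Representation.IndV lam.young (outerSpecht hξ lam)) :
    ∃ c : k, (wreathSpecht hξ lam).asAlgebraHom (lam.wreathElt hξ) v =
      c • indMk lam.young (outerSpecht hξ lam) 1
        (PiTensorProduct.tprod k fun i => spechtGen k (lam.part i)) := by
  refine ind_corner lam.young (lam.outerSpecht_corner hξ hm) (fun g hg => ?_) v
  have : ∃ x, lam.colour (g.right x) ≠ lam.colour x := by
    by_contra! h
    exact hg (lam.mem_range_young h)
  obtain ⟨x, hx⟩ := this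
  refine ⟨lam.torusHom (lam.torusOfLab (Pi.single (g.right x) 1)),
    lam.torusHom (lam.torusOfLab (Pi.single x 1)), _, _, ?_, fun h => hx (rootChar_injective hξ h),
    ?_, ?_⟩
  · rw [young_torusHom, young_torusHom]
    refine Wreath.ext' (fun y => ?_) ?_
    · change lam.torusLab (lam.torusOfLab (Pi.single (g.right x) 1)) y + Wreath.lab g y =
        Wreath.lab g y + lam.torusLab (lam.torusOfLab (Pi.single x 1)) (g.right.symm y)
      rw [add_comm, torusLab_torusOfLab, torusLab_torusOfLab, Pi.single_apply, Pi.single_apply]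
      simp only [Equiv.symm_apply_eq]
    · change 1 * g.right = g.right * 1
      rw [one_mul, mul_one]
  · rw [outerElt_mul_torus, torusChar_single]
  · intro v
    rw [outerSpecht_torus, torusChar_single]

theorem wreathElt_ne_zero (hm : (m : k) ≠ 0) : lam.wreathElt hξ ≠ 0 := by
  intro h
  have h1 := congrArg (fun z => MonoidAlgebra.coeff z 1) h
  classical
  rw [wreathElt, coeff_mapDomainAlgHom, Finset.sum_eq_single 1, if_pos (map_one _), outerElt,
    coeff_piElt] at h1
  · refine Finset.prod_ne_zero_iff.2 (fun i _ => ?_) h1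
    change (twist _ _).coeff 1 ≠ 0
    rw [coeff_twist, inv_one, map_one]
    change _ * _ * (youngSym k (lam.part i)).coeff 1 ≠ 0
    rw [coeff_one_youngSym, mul_one, mul_one]
    exact inv_ne_zero (torusCard_ne_zero hm)
  · intro g _ hg
    rw [if_neg]
    intro h2
    exact hg (lam.young_injective (h2.trans (map_one _).symm))
  · simp

theorem prod_hookProd_ne_zero (hn : ((n.factorial : ℕ) : k) ≠ 0) :
    (∏ i, (hookProd (lam.part i) : k)) ≠ 0 := by
  refine Finset.prod_ne_zero_iff.2 fun i _ => hookProd_cast_ne_zero (lam.part i) fun h => hn ?_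
  have h1 : (lam.part i).card ≤ n :=
    (Finset.single_le_sum (f := fun i => (lam.part i).card) (fun _ _ => Nat.zero_le _)
      (Finset.mem_univ i)).trans_eq lam.sum_card
  obtain ⟨c, hc⟩ := Nat.factorial_dvd_factorial h1
  rw [hc, Nat.cast_mul, h, zero_mul]

end MPartition

theorem card_wreath_ne_zero (hm : (m : k) ≠ 0) (hn : ((n.factorial : ℕ) : k) ≠ 0) :
    ((Fintype.card (Wreath m (Fin n)) : ℕ) : k) ≠ 0 := by
  rw [Fintype.card_congr SemidirectProduct.equivProd, Fintype.card_prod, Fintype.card_perm,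
    Fintype.card_fin, Nat.cast_mul]
  exact mul_ne_zero (torusCard_ne_zero hm) hn

/-- The multiplicity as a rank on a permutation module. -/
theorem repMult_eq_rank (hm : (m : k) ≠ 0) {f : ℕ} (δ : ZMod m → k)
    (hn : ((n.factorial : ℕ) : k) ≠ 0) (hf : ((f.factorial : ℕ) : k) ≠ 0)
    (lam : MPartition m f) (mu : MPartition m n) :
    repMult (standardRestriction hξ n δ lam) (wreathSpecht hξ mu) =
      (permMat k (ThroughMatching m (Fin n) (Fin f))
        (prodElt (mu.wreathElt hξ) (invElt (lam.wreathElt hξ)))).rank := by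
  obtain ⟨hfin, h⟩ := finrank_cellRestriction δ (lam.prod_hookProd_ne_zero hf)
    (lam.wreathSpecht_isPresented hξ hm) (mu.wreathElt hξ)
  rw [← h]
  exact repMult_eq_finrank (card_wreath_ne_zero hm hn) _ (mu.wreathSpecht_isPresented hξ hm)
    (mu.prod_hookProd_ne_zero hn) (mu.wreathElt_ne_zero hξ hm) (mu.wreathSpecht_corner hξ hm)

end WreathSpecht

/-! ### Reduction to unlabelled matchings -/

section Section

variable {k : Type*} [Field k] {Ω U : Type*} [Fintype Ω] [DecidableEq Ω] [Fintype U] [DecidableEq U]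

/-- An operator on functions on `Ω` that is semi-invariant under the maps `act t` has the same rank as
the operator that it induces on functions on a set of representatives `sec u` of those orbits on which
the weight is trivial. -/
theorem finrank_range_eq_of_section {T : Type*} [Fintype T] (sec : U → Ω) (act : T → Ω → Ω)
    (wt a : T → k) (E : (Ω → k) →ₗ[k] (Ω → k)) (C : (U → k) →ₗ[k] (U → k))
    (P : (U → k) →ₗ[k] (Ω → k))
    (hfac : ∀ u, E (Pi.single (sec u) 1) = P (C (Pi.single u 1)))
    (hP : ∀ u, P (Pi.single u 1) = ∑ t, a t • Pi.single (act t (sec u)) 1)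
    (hwt : ∀ t ω, E (Pi.single (act t ω) 1) = wt t • E (Pi.single ω 1))
    (hdiag : ∀ t u u', act t (sec u) = sec u' → u = u')
    (hnz : ∀ u, ∑ t with act t (sec u) = sec u, a t ≠ 0)
    (hcov : ∀ ω, (∃ t u, ω = act t (sec u)) ∨ ∃ t, act t ω = ω ∧ wt t ≠ 1) :
    Module.finrank k (LinearMap.range E) = Module.finrank k (LinearMap.range C) := by
  let S : (U → k) →ₗ[k] (Ω → k) :=
    ∑ u, (LinearMap.toSpanSingleton k (Ω → k) (Pi.single (sec u) 1)) ∘ₗ LinearMap.proj u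
  have hS : ∀ u, S (Pi.single u 1) = Pi.single (sec u) 1 := fun u => by
    simp only [S, LinearMap.sum_apply, LinearMap.comp_apply, LinearMap.proj_apply,
      LinearMap.toSpanSingleton_apply]
    rw [Finset.sum_eq_single u]
    · rw [Pi.single_eq_same, one_smul]
    · intro b _ hb; rw [Pi.single_eq_of_ne hb, zero_smul]
    · simp
  have hES : E ∘ₗ S = P ∘ₗ C := pi_hom_ext fun u => by
    rw [LinearMap.comp_apply, LinearMap.comp_apply, hS, hfac]
  have hE : ∀ ω, E (Pi.single ω 1) ∈ LinearMap.range (E ∘ₗ S) := by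
    intro ω
    rcases hcov ω with ⟨t, u, rfl⟩ | ⟨t, ht, hne⟩
    · rw [hwt]
      exact Submodule.smul_mem _ _ ⟨Pi.single u 1, by rw [LinearMap.comp_apply, hS]⟩
    · have h1 := hwt t ω
      rw [ht] at h1
      have h2 : (1 - wt t) • E (Pi.single ω 1) = 0 := by rw [sub_smul, one_smul, ← h1, sub_self]
      rw [(smul_eq_zero.1 h2).resolve_left (sub_ne_zero.2 hne.symm)]
      exact Submodule.zero_mem _
  have hrange : LinearMap.range E = LinearMap.range (E ∘ₗ S) := by
    refine le_antisymm ?_ (LinearMap.range_comp_le_range S E)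
    rintro _ ⟨v, rfl⟩
    have hv : v = ∑ ω, v ω • (Pi.single ω 1 : Ω → k) := pi_eq_sum_univ' v
    rw [hv, map_sum]
    refine Submodule.sum_mem _ fun ω _ => ?_
    rw [map_smul]
    exact Submodule.smul_mem _ _ (hE ω)
  -- the coordinate of `P v` at `sec u` is a nonzero multiple of `v u`
  have hinj : Function.Injective P := by
    have h1 : ∀ u, LinearMap.proj (sec u) ∘ₗ P =
        (∑ t with act t (sec u) = sec u, a t) • (LinearMap.proj u : (U → k) →ₗ[k] k) := by
      intro u
      refine pi_hom_ext fun u' => ?_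
      rw [LinearMap.comp_apply, hP, LinearMap.proj_apply, Finset.sum_apply, LinearMap.smul_apply,
        LinearMap.proj_apply]
      by_cases huu : u' = u
      · subst huu
        rw [Pi.single_eq_same, smul_eq_mul, mul_one, Finset.sum_filter]
        refine Finset.sum_congr rfl fun t _ => ?_
        rw [Pi.smul_apply, Pi.single_apply, smul_eq_mul, mul_ite, mul_one, mul_zero]
        exact if_congr eq_comm rfl rfl
      · rw [Pi.single_eq_of_ne (Ne.symm huu), smul_zero]
        refine Finset.sum_eq_zero fun t _ => ?_
        rw [Pi.smul_apply, Pi.single_eq_of_ne, smul_zero]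
        exact fun h => huu (hdiag t u' u h.symm)
    rw [← LinearMap.ker_eq_bot, LinearMap.ker_eq_bot']
    intro v hv
    funext u
    have h2 := LinearMap.congr_fun (h1 u) v
    rw [LinearMap.comp_apply, hv, map_zero, LinearMap.smul_apply] at h2
    exact (smul_eq_zero.1 h2.symm).resolve_left (hnz u)
  rw [hrange, hES, LinearMap.range_comp]
  exact (Submodule.equivMapOfInjective P hinj _).finrank_eq.symm

end Section

section MapDomain

variable {k : Type*} [Field k]

theorem prodElt_mapDomain {G G' H H' : Type} [Group G] [Group G'] [Group H] [Group H'] [Fintype G]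
    [Fintype G'] [Fintype H] [Fintype H'] (φ : G →* G') (ψ : H →* H') (x : MonoidAlgebra k G)
    (y : MonoidAlgebra k H) :
    prodElt (MonoidAlgebra.mapDomainAlgHom k k φ x) (MonoidAlgebra.mapDomainAlgHom k k ψ y) =
      MonoidAlgebra.mapDomainAlgHom k k (φ.prodMap ψ) (prodElt x y) := by
  classical
  refine ext_coeffLin fun g => ?_
  rw [coeff_prodElt, coeff_mapDomainAlgHom, coeff_mapDomainAlgHom, coeff_mapDomainAlgHom,
    Finset.sum_mul_sum, Fintype.sum_prod_type]
  refine Finset.sum_congr rfl fun a _ => Finset.sum_congr rfl fun b _ => ?_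
  rw [coeff_prodElt, ite_zero_mul_ite_zero]
  exact if_congr (Prod.mk_inj (a₁ := φ a) (b₁ := ψ b)).symm rfl rfl

theorem invElt_mapDomain {G G' : Type} [Group G] [Group G'] [Fintype G] [Fintype G'] (φ : G →* G')
    (x : MonoidAlgebra k G) : invElt (MonoidAlgebra.mapDomainAlgHom k k φ x) =
      MonoidAlgebra.mapDomainAlgHom k k φ (invElt x) := by
  classical
  refine ext_coeffLin fun g => ?_
  rw [coeff_invElt, coeff_mapDomainAlgHom, coeff_mapDomainAlgHom]
  refine Fintype.sum_equiv (Equiv.inv G) _ _ fun h => ?_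
  rw [coeff_invElt, Equiv.inv_apply, inv_inv, map_inv]
  exact if_congr (by rw [inv_eq_iff_eq_inv]) rfl rfl

theorem piElt_mapDomain {ι : Type} [Fintype ι] [DecidableEq ι] {Γ Γ' : ι → Type} [∀ i, Group (Γ i)]
    [∀ i, Group (Γ' i)] [∀ i, Fintype (Γ i)] [∀ i, Fintype (Γ' i)] (φ : ∀ i, Γ i →* Γ' i)
    (Φ : (∀ i, Γ i) →* ∀ i, Γ' i) (hΦ : ∀ g i, Φ g i = φ i (g i)) (x : ∀ i, MonoidAlgebra k (Γ i)) :
    piElt (fun i => MonoidAlgebra.mapDomainAlgHom k k (φ i) (x i)) =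
      MonoidAlgebra.mapDomainAlgHom k k Φ (piElt x) := by
  classical
  refine ext_coeffLin fun g => ?_
  rw [coeff_piElt, coeff_mapDomainAlgHom]
  simp only [coeff_mapDomainAlgHom]
  rw [Finset.prod_univ_sum, Fintype.piFinset_univ]
  refine Finset.sum_congr rfl fun h _ => ?_
  rw [coeff_piElt]
  by_cases hh : Φ h = g
  · rw [if_pos hh]
    exact Finset.prod_congr rfl fun i _ => if_pos (by rw [← hh, hΦ])
  · rw [if_neg hh]
    obtain ⟨i, hi⟩ := Function.ne_iff.1 hh
    exact Finset.prod_eq_zero (Finset.mem_univ i) (if_neg (by rwa [← hΦ]))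

theorem prodElt_single {G H : Type} [Group G] [Group H] [Fintype G] [Fintype H] (g : G) (h : H) :
    prodElt (MonoidAlgebra.single g (1 : k)) (MonoidAlgebra.single h 1) =
      MonoidAlgebra.single (g, h) 1 := by
  classical
  refine ext_coeffLin fun z => ?_
  rw [coeff_prodElt, MonoidAlgebra.coeff_single, MonoidAlgebra.coeff_single,
    MonoidAlgebra.coeff_single, Finsupp.single_apply, Finsupp.single_apply, Finsupp.single_apply,
    ite_zero_mul_ite_zero, one_mul]
  exact if_congr (Prod.mk_inj (a₁ := g) (b₁ := h)).symm rfl rfl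

theorem permOp_mapDomain {G H : Type} [Group G] [Group H] [Fintype H] {Ω : Type*} [Fintype Ω]
    [DecidableEq Ω] [MulAction G Ω] (φ : H →* G) (x : MonoidAlgebra k H) (ω : Ω) :
    permOp k Ω (MonoidAlgebra.mapDomainAlgHom k k φ x) (Pi.single ω 1) =
      ∑ h, x.coeff h • Pi.single (φ h • ω) 1 := by
  conv_lhs => rw [← sum_single_coeff x]
  rw [map_sum, map_sum, LinearMap.sum_apply]
  refine Finset.sum_congr rfl fun h _ => ?_
  rw [MonoidAlgebra.mapDomainAlgHom_apply, MonoidAlgebra.mapDomain_single]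
  exact permOp_single _ _ _

end MapDomain

section TwistFactorization

variable {m : ℕ} [NeZero m] {k : Type*} [Field k] {X : Type} [Fintype X] [DecidableEq X]

/-- The projector onto a weight space of the group of labels. -/
noncomputable def labelElt (χ : Wreath m X →* k) :
    MonoidAlgebra k (X → Multiplicative (ZMod m)) :=
  ∑ t, MonoidAlgebra.single t ((torusCard m X : k)⁻¹ * χ (SemidirectProduct.inl t)⁻¹)

theorem twist_single (χ : Wreath m X →* k) (σ : Equiv.Perm X) :
    twist χ (MonoidAlgebra.single σ 1) =
      ∑ t, MonoidAlgebra.single ⟨t, σ⟩ ((torusCard m X : k)⁻¹ * χ (⟨t, σ⟩ : Wreath m X)⁻¹) := by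
  classical
  rw [twist]
  change ∑ g, _ = _
  rw [sum_wreath, Finset.sum_eq_single σ]
  · simp [MonoidAlgebra.coeff_single]
  · intro τ _ hτ
    refine Finset.sum_eq_zero fun t _ => ?_
    rw [MonoidAlgebra.coeff_single, Finsupp.single_apply, if_neg (Ne.symm hτ), mul_zero,
      MonoidAlgebra.single_zero]
  · simp

theorem twist_eq_label_mul {χ : Wreath m X →* k}
    (hχ : ∀ σ, χ (SemidirectProduct.inr σ) = 1) (x : MonoidAlgebra k (Equiv.Perm X)) :
    twist χ x = MonoidAlgebra.mapDomainAlgHom k k SemidirectProduct.inl (labelElt χ) *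
      MonoidAlgebra.mapDomainAlgHom k k SemidirectProduct.inr x := by
  induction x using MonoidAlgebra.induction_on with
  | of σ =>
    rw [MonoidAlgebra.of_apply, twist_single, labelElt, map_sum, Finset.sum_mul]
    refine Finset.sum_congr rfl fun t _ => ?_
    rw [MonoidAlgebra.mapDomainAlgHom_apply, MonoidAlgebra.mapDomain_single,
      MonoidAlgebra.mapDomainAlgHom_apply, MonoidAlgebra.mapDomain_single,
      MonoidAlgebra.single_mul_single, mul_one]
    rw [SemidirectProduct.mk_eq_inl_mul_inr σ t, mul_inv_rev, map_mul, ← map_inv, hχ, one_mul]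
  | add a b ha hb => rw [map_add, map_add, ha, hb, mul_add]
  | smul r a ha => rw [map_smul, map_smul, ha, mul_smul_comm]

theorem twist_eq_mul_label {χ : Wreath m X →* k}
    (hχ : ∀ σ, χ (SemidirectProduct.inr σ) = 1) (x : MonoidAlgebra k (Equiv.Perm X)) :
    twist χ x = MonoidAlgebra.mapDomainAlgHom k k SemidirectProduct.inr x *
      MonoidAlgebra.mapDomainAlgHom k k SemidirectProduct.inl (labelElt χ) := by
  have h1 : MonoidAlgebra.mapDomainAlgHom k k SemidirectProduct.inl (labelElt χ) = twist χ 1 := by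
    rw [twist_eq_label_mul hχ, map_one, mul_one]
  rw [h1]
  induction x using MonoidAlgebra.induction_on with
  | of σ =>
    rw [MonoidAlgebra.of_apply, MonoidAlgebra.mapDomainAlgHom_apply, MonoidAlgebra.mapDomain_single,
      single_mul_twist, hχ, one_smul, SemidirectProduct.right_inr, mul_one]
  | add a b ha hb => rw [map_add, map_add, ha, hb, add_mul]
  | smul r a ha => rw [map_smul, map_smul, ha, smul_mul_assoc]

end TwistFactorization

section YoungMatching

variable {m : ℕ} [NeZero m] {k : Type*} [Field k] {ξ : k} (hξ : IsPrimitiveRoot ξ m) {n f : ℕ}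

namespace MPartition

/-- The Young subgroup of the symmetric group, as a product of symmetric groups. -/
abbrev YoungGroup (lam : MPartition m n) : Type := ∀ i, Equiv.Perm (Box (lam.part i))

variable (lam : MPartition m n)

/-- The embedding of the Young subgroup in the symmetric group. -/
noncomputable def permYoung : lam.YoungGroup →* Equiv.Perm (Fin n) where
  toFun σ := lam.numbering.permCongr (Equiv.Perm.sigmaCongrRight σ)
  map_one' := by ext; simp
  map_mul' σ τ := by ext; simp

theorem colour_permYoung (σ : lam.YoungGroup) (x : Fin n) :
    lam.colour (lam.permYoung σ x) = lam.colour x := by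
  change (lam.numbering.symm (lam.numbering
    (Equiv.Perm.sigmaCongrRight σ (lam.numbering.symm x)))).1 = _
  rw [Equiv.symm_apply_apply]
  rfl

/-- The inclusion of the Young subgroup of the symmetric group in that of the wreath product. -/
def permHom : lam.YoungGroup →* ∀ i, Wreath m (Box (lam.part i)) where
  toFun σ i := SemidirectProduct.inr (σ i)
  map_one' := rfl
  map_mul' t u := funext fun i => map_mul SemidirectProduct.inr (t i) (u i)

/-- The product of the Young symmetrizers. -/
noncomputable def symElt (R : Type*) [CommRing R] : MonoidAlgebra R lam.YoungGroup :=
  piElt fun i => youngSym R (lam.part i)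

/-- The projector onto the weight space of the group of labels. -/
noncomputable def torusElt : MonoidAlgebra k lam.Torus :=
  piElt fun i => labelElt (Wreath.char hξ i)

theorem char_inr {X : Type} [Fintype X] (r : ZMod m) (σ : Equiv.Perm X) :
    Wreath.char hξ r (SemidirectProduct.inr σ) = 1 := by
  rw [Wreath.char_eq]
  refine Finset.prod_eq_one fun x _ => ?_
  change rootChar hξ (r * 0) = 1
  rw [mul_zero, AddChar.map_zero_eq_one]

theorem wreathElt_eq : lam.wreathElt hξ =
    MonoidAlgebra.mapDomainAlgHom k k (lam.young.comp lam.torusHom) (lam.torusElt hξ) *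
      MonoidAlgebra.mapDomainAlgHom k k (lam.young.comp lam.permHom) (lam.symElt k) := by
  have h1 : lam.outerElt hξ = MonoidAlgebra.mapDomainAlgHom k k lam.torusHom (lam.torusElt hξ) *
      MonoidAlgebra.mapDomainAlgHom k k lam.permHom (lam.symElt k) := by
    rw [torusElt, symElt, ← piElt_mapDomain (fun i => SemidirectProduct.inl) lam.torusHom
      (fun _ _ => rfl), ← piElt_mapDomain (fun i => SemidirectProduct.inr) lam.permHom
      (fun _ _ => rfl), piElt_mul, outerElt]
    congr 1
    exact funext fun i => twist_eq_label_mul (char_inr hξ i) _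
  rw [wreathElt, h1, map_mul]
  rw [MonoidAlgebra.mapDomainAlgHom_comp, MonoidAlgebra.mapDomainAlgHom_comp]
  rfl

theorem wreathElt_eq' : lam.wreathElt hξ =
    MonoidAlgebra.mapDomainAlgHom k k (lam.young.comp lam.permHom) (lam.symElt k) *
      MonoidAlgebra.mapDomainAlgHom k k (lam.young.comp lam.torusHom) (lam.torusElt hξ) := by
  have h1 : lam.outerElt hξ = MonoidAlgebra.mapDomainAlgHom k k lam.permHom (lam.symElt k) *
      MonoidAlgebra.mapDomainAlgHom k k lam.torusHom (lam.torusElt hξ) := by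
    rw [torusElt, symElt, ← piElt_mapDomain (fun i => SemidirectProduct.inl) lam.torusHom
      (fun _ _ => rfl), ← piElt_mapDomain (fun i => SemidirectProduct.inr) lam.permHom
      (fun _ _ => rfl), piElt_mul, outerElt]
    congr 1
    exact funext fun i => twist_eq_mul_label (char_inr hξ i) _
  rw [wreathElt, h1, map_mul]
  rw [MonoidAlgebra.mapDomainAlgHom_comp, MonoidAlgebra.mapDomainAlgHom_comp]
  rfl

theorem wreathElt_mul_torus (t : lam.Torus) :
    lam.wreathElt hξ * MonoidAlgebra.single (lam.young (lam.torusHom t)) 1 =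
      lam.torusChar hξ t • lam.wreathElt hξ := by
  have h := congrArg (MonoidAlgebra.mapDomainAlgHom k k lam.young) (lam.outerElt_mul_torus hξ t)
  rwa [map_mul, map_smul, MonoidAlgebra.mapDomainAlgHom_apply k k lam.young
    (MonoidAlgebra.single _ _), MonoidAlgebra.mapDomain_single] at h

theorem torus_mul_wreathElt (t : lam.Torus) :
    MonoidAlgebra.single (lam.young (lam.torusHom t)) 1 * lam.wreathElt hξ =
      lam.torusChar hξ t • lam.wreathElt hξ := by
  have h := congrArg (MonoidAlgebra.mapDomainAlgHom k k lam.young) (lam.torus_mul_outerElt hξ t)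
  rwa [map_mul, map_smul, MonoidAlgebra.mapDomainAlgHom_apply k k lam.young
    (MonoidAlgebra.single _ _), MonoidAlgebra.mapDomain_single] at h

theorem coeff_torusElt (t : lam.Torus) : (lam.torusElt hξ).coeff t =
    (∏ i, (torusCard m (Box (lam.part i)) : k)⁻¹) * lam.torusChar hξ t⁻¹ := by
  rw [torusElt, coeff_piElt, torusChar_apply, ← Finset.prod_mul_distrib]
  refine Finset.prod_congr rfl fun i _ => ?_
  rw [labelElt, coeff_sum_single]
  rfl

end MPartition

/-- The component of a node: the nodes in the south count negatively. -/
noncomputable def nodeColour (mu : MPartition m n) (lam : MPartition m f) : Fin n ⊕ Fin f → ZMod m :=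
  Sum.elim mu.colour fun y => -lam.colour y

/-- The perfect matchings of northern and southern nodes without arcs in the south, such that the
components of matched nodes are opposite. -/
@[ext] structure YoungMatching (mu : MPartition m n) (lam : MPartition m f) where
  inv : Fin n ⊕ Fin f → Fin n ⊕ Fin f
  inv_inv : ∀ z, inv (inv z) = z
  inv_ne : ∀ z, inv z ≠ z
  colour_inv : ∀ z, nodeColour mu lam (inv z) = -nodeColour mu lam z
  isLeft : ∀ y, (inv (.inr y)).isLeft

variable {mu : MPartition m n} {lam : MPartition m f}

/-- The permutation of the nodes given by two elements of Young subgroups. -/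
noncomputable def nodePerm (g : mu.YoungGroup × lam.YoungGroup) : Equiv.Perm (Fin n ⊕ Fin f) :=
  Equiv.Perm.sumCongr (mu.permYoung g.1) (lam.permYoung g.2)

theorem nodePerm_mul (g h : mu.YoungGroup × lam.YoungGroup) :
    nodePerm (g * h) = nodePerm g * nodePerm h := by
  rw [nodePerm, nodePerm, nodePerm, Equiv.Perm.sumCongr_mul, ← map_mul, ← map_mul]
  rfl

theorem nodePerm_one : nodePerm (1 : mu.YoungGroup × lam.YoungGroup) = 1 := by
  rw [nodePerm, Prod.fst_one, Prod.snd_one, map_one, map_one, Equiv.Perm.sumCongr_one]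

theorem nodeColour_nodePerm (g : mu.YoungGroup × lam.YoungGroup) (z : Fin n ⊕ Fin f) :
    nodeColour mu lam (nodePerm g z) = nodeColour mu lam z := by
  rcases z with x | y
  · exact mu.colour_permYoung g.1 x
  · exact congrArg Neg.neg (lam.colour_permYoung g.2 y)

theorem nodeColour_nodePerm_symm (g : mu.YoungGroup × lam.YoungGroup) (z : Fin n ⊕ Fin f) :
    nodeColour mu lam ((nodePerm g).symm z) = nodeColour mu lam z := by
  rw [← nodeColour_nodePerm g, Equiv.apply_symm_apply]

noncomputable instance : MulAction (mu.YoungGroup × lam.YoungGroup) (YoungMatching mu lam) where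
  smul g u :=
    { inv := fun z => nodePerm g (u.inv ((nodePerm g).symm z))
      inv_inv := fun z => by simp [u.inv_inv]
      inv_ne := fun z h => u.inv_ne ((nodePerm g).symm z) (by rw [Equiv.eq_symm_apply]; exact h)
      colour_inv := fun z => by rw [nodeColour_nodePerm, u.colour_inv, nodeColour_nodePerm_symm]
      isLeft := fun y => by
        obtain ⟨x, hx⟩ := Sum.isLeft_iff.1 (u.isLeft ((lam.permYoung g.2).symm y))
        rw [show (nodePerm g).symm (.inr y) = .inr ((lam.permYoung g.2).symm y) from rfl, hx]
        rfl }
  one_smul u := YoungMatching.ext (funext fun z => by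
    change nodePerm 1 (u.inv ((nodePerm 1).symm z)) = u.inv z
    rw [nodePerm_one]; rfl)
  mul_smul g h u := YoungMatching.ext (funext fun z => by
    change nodePerm (g * h) (u.inv ((nodePerm (g * h)).symm z)) = _
    rw [nodePerm_mul]; rfl)

theorem YoungMatching.smul_inv (g : mu.YoungGroup × lam.YoungGroup) (u : YoungMatching mu lam)
    (z : Fin n ⊕ Fin f) : (g • u).inv z = nodePerm g (u.inv ((nodePerm g).symm z)) := rfl

noncomputable instance : Fintype (YoungMatching mu lam) :=
  haveI := Finite.of_injective (fun u : YoungMatching mu lam => u.inv) fun _ _ h =>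
    YoungMatching.ext h
  Fintype.ofFinite _

noncomputable instance : DecidableEq (YoungMatching mu lam) := Classical.decEq _

/-- The labelled matching all of whose labels are zero. -/
def YoungMatching.unlabelled (u : YoungMatching mu lam) : ThroughMatching m (Fin n) (Fin f) :=
  ⟨⟨u.inv, u.inv_inv, u.inv_ne, fun _ => 0, fun _ => neg_zero.symm⟩, u.isLeft⟩

/-- The embedding of the group of labels in the wreath products. -/
noncomputable def torusPair (mu : MPartition m n) (lam : MPartition m f) :
    mu.Torus × lam.Torus →* Wreath m (Fin n) × Wreath m (Fin f) :=
  (mu.young.comp mu.torusHom).prodMap (lam.young.comp lam.torusHom)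

/-- The label at a node. -/
noncomputable def pairLab (t : mu.Torus × lam.Torus) : Fin n ⊕ Fin f → ZMod m :=
  Sum.elim (mu.torusLab t.1) (lam.torusLab t.2)

theorem torusPair_smul_inv (t : mu.Torus × lam.Torus) (D : ThroughMatching m (Fin n) (Fin f))
    (z : Fin n ⊕ Fin f) : (torusPair mu lam t • D).1.inv z = D.1.inv z := by
  have h : (Wreath.sumHom (torusPair mu lam t)).right = 1 := by
    change Equiv.Perm.sumCongr (mu.young (mu.torusHom t.1)).right
      (lam.young (lam.torusHom t.2)).right = 1
    rw [mu.young_torusHom, lam.young_torusHom]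
    exact Equiv.Perm.sumCongr_one
  rw [ThroughMatching.smul_val, LMatching.smul_inv, h]
  rfl

theorem torusPair_smul_lab (t : mu.Torus × lam.Torus) (D : ThroughMatching m (Fin n) (Fin f))
    (z : Fin n ⊕ Fin f) : (torusPair mu lam t • D).1.lab z =
      pairLab t z + D.1.lab z - pairLab t (D.1.inv z) := by
  have h : (Wreath.sumHom (torusPair mu lam t)).right = 1 := by
    change Equiv.Perm.sumCongr (mu.young (mu.torusHom t.1)).right
      (lam.young (lam.torusHom t.2)).right = 1
    rw [mu.young_torusHom, lam.young_torusHom]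
    exact Equiv.Perm.sumCongr_one
  have hl : ∀ z, Wreath.lab (Wreath.sumHom (torusPair mu lam t)) z = pairLab t z := by
    rintro (x | y) <;> rfl
  rw [ThroughMatching.smul_val, LMatching.smul_lab, h, hl, hl]
  rfl

/-- The character by which the group of labels acts. -/
noncomputable def pairChar (t : mu.Torus × lam.Torus) : k :=
  mu.torusChar hξ t.1 * lam.torusChar hξ t.2⁻¹

theorem pairChar_eq (t : mu.Torus × lam.Torus) :
    pairChar hξ t = ∏ z, rootChar hξ (nodeColour mu lam z * pairLab t z) := by
  rw [Fintype.prod_sum_type, pairChar, MPartition.torusChar_eq, MPartition.torusChar_eq]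
  congr 1
  refine Finset.prod_congr rfl fun y _ => congrArg _ ?_
  change lam.colour y * -lam.torusLab t.2 y = -lam.colour y * lam.torusLab t.2 y
  ring

theorem exists_pairLab (mu : MPartition m n) (lam : MPartition m f) (u : Fin n ⊕ Fin f → ZMod m) :
    ∃ t : mu.Torus × lam.Torus, ∀ z, pairLab t z = u z := by
  refine ⟨(mu.torusOfLab fun x => u (.inl x), lam.torusOfLab fun y => u (.inr y)), ?_⟩
  rintro (x | y)
  · exact mu.torusLab_torusOfLab (fun x => u (.inl x)) x
  · exact lam.torusLab_torusOfLab (fun y => u (.inr y)) y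

theorem unlabelled_smul (g : mu.YoungGroup × lam.YoungGroup) (u : YoungMatching mu lam) :
    (g • u).unlabelled =
      ((mu.young.comp mu.permHom).prodMap (lam.young.comp lam.permHom) g) • u.unlabelled := by
  refine Subtype.ext (LMatching.ext rfl (funext fun z => ?_))
  have hl : ∀ z, Wreath.lab (Wreath.sumHom
      ((mu.young.comp mu.permHom).prodMap (lam.young.comp lam.permHom) g)) z = 0 := by
    rintro (x | y) <;> rfl
  rw [ThroughMatching.smul_val, LMatching.smul_lab, hl, hl]
  change (0 : ZMod m) = 0 + 0 - 0
  ring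

theorem eq_of_torusPair_smul {t : mu.Torus × lam.Torus} {u u' : YoungMatching mu lam}
    (h : torusPair mu lam t • u.unlabelled = u'.unlabelled) : u = u' := by
  refine YoungMatching.ext (funext fun z => ?_)
  have h1 := torusPair_smul_inv t u.unlabelled z
  rw [h] at h1
  exact h1.symm

/-- A label that fixes a matching is equal at both ends of every strand, and their contributions to
the character cancel. -/
theorem pairChar_eq_one {t : mu.Torus × lam.Torus} {u : YoungMatching mu lam}
    (h : torusPair mu lam t • u.unlabelled = u.unlabelled) : pairChar hξ t = 1 := by
  have h1 : ∀ z, pairLab t (u.inv z) = pairLab t z := fun z => by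
    have h2 := torusPair_smul_lab t u.unlabelled z
    rw [h] at h2
    change (0 : ZMod m) = pairLab t z + 0 - pairLab t (u.inv z) at h2
    rw [add_zero, eq_comm, sub_eq_zero] at h2
    exact h2.symm
  rw [pairChar_eq]
  refine Finset.prod_involution (fun z _ => u.inv z) (fun z _ => ?_) (fun z _ _ => u.inv_ne z)
    (fun _ _ => Finset.mem_univ _) fun z _ => u.inv_inv z
  rw [h1, u.colour_inv, ← AddChar.map_add_eq_mul, neg_mul, add_neg_cancel, AddChar.map_zero_eq_one]

/-- Either the strands of a matching join nodes of opposite components, and then the labels can be moved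
away, or some label fixes the matching and has nontrivial weight. -/
theorem exists_torusPair (mu : MPartition m n) (lam : MPartition m f)
    (D : ThroughMatching m (Fin n) (Fin f)) :
    (∃ t, ∃ u : YoungMatching mu lam, D = torusPair mu lam t • u.unlabelled) ∨
      ∃ t, torusPair mu lam t • D = D ∧ pairChar hξ t ≠ 1 := by
  by_cases hD : ∀ z, nodeColour mu lam (D.1.inv z) = -nodeColour mu lam z
  · left
    let u : YoungMatching mu lam := ⟨D.1.inv, D.1.inv_inv, D.1.inv_ne, hD, D.2⟩
    let e : Fin n ⊕ Fin f ≃ Fin (n + f) := finSumFinEquiv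
    -- move the label of a strand to one of its ends
    obtain ⟨t, ht⟩ := exists_pairLab mu lam fun z => if e z < e (D.1.inv z) then D.1.lab z else 0
    refine ⟨t, u, Subtype.ext (LMatching.ext (funext fun z => ?_) (funext fun z => ?_))⟩
    · exact (torusPair_smul_inv t u.unlabelled z).symm
    · rw [torusPair_smul_lab]
      change D.1.lab z = pairLab t z + 0 - pairLab t (D.1.inv z)
      rw [ht, ht, D.1.inv_inv]
      have hne : e z ≠ e (D.1.inv z) := fun h => D.1.inv_ne z (e.injective h).symm
      rcases lt_or_gt_of_ne hne with h | h
      · rw [if_pos h, if_neg h.not_gt]; ring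
      · rw [if_neg h.not_gt, if_pos h, D.1.lab_inv]; ring
  · right
    push Not at hD
    obtain ⟨z₀, hz₀⟩ := hD
    -- put the label `1` at both ends of a strand that does not join opposite components
    obtain ⟨t, ht⟩ := exists_pairLab mu lam
      fun z => (if z = z₀ then 1 else 0) + if z = D.1.inv z₀ then 1 else 0
    have hinv : ∀ z, D.1.inv z = z₀ ↔ z = D.1.inv z₀ := fun z =>
      ⟨fun h => by rw [← h, D.1.inv_inv], fun h => by rw [h, D.1.inv_inv]⟩
    have hinv' : ∀ z, D.1.inv z = D.1.inv z₀ ↔ z = z₀ := fun z =>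
      ⟨fun h => by rw [← D.1.inv_inv z, h, D.1.inv_inv], fun h => by rw [h]⟩
    refine ⟨t, Subtype.ext (LMatching.ext (funext fun z => torusPair_smul_inv t D z)
      (funext fun z => ?_)), fun h => ?_⟩
    · rw [torusPair_smul_lab, ht, ht]
      simp only [hinv, hinv']
      ring
    · have h1 : pairChar hξ t = rootChar hξ (nodeColour mu lam z₀ + nodeColour mu lam (D.1.inv z₀)) := by
        have h2 : ∀ (z z' : Fin n ⊕ Fin f), rootChar hξ (nodeColour mu lam z *
            if z = z' then 1 else 0) = if z = z' then rootChar hξ (nodeColour mu lam z') else 1 := by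
          intro z z'
          split_ifs with hz
          · rw [hz, mul_one]
          · rw [mul_zero, AddChar.map_zero_eq_one]
        rw [pairChar_eq, AddChar.map_add_eq_mul]
        simp only [ht, mul_add, AddChar.map_add_eq_mul, Finset.prod_mul_distrib, h2]
        rw [Finset.prod_ite_eq', Finset.prod_ite_eq', if_pos (Finset.mem_univ _),
          if_pos (Finset.mem_univ _)]
      rw [h1, ← AddChar.map_zero_eq_one (rootChar hξ)] at h
      exact hz₀ (eq_neg_of_add_eq_zero_right (rootChar_injective hξ h))

variable (mu lam)

/-- Only the matchings of nodes of opposite components contribute to the rank. -/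
theorem rank_throughMatching (hm : (m : k) ≠ 0) :
    (permMat k (ThroughMatching m (Fin n) (Fin f))
        (prodElt (mu.wreathElt hξ) (invElt (lam.wreathElt hξ)))).rank =
      (permMat k (YoungMatching mu lam) (prodElt (mu.symElt k) (invElt (lam.symElt k)))).rank := by
  set Ω := ThroughMatching m (Fin n) (Fin f)
  set U := YoungMatching mu lam
  rw [rank_permMat_eq, rank_permMat_eq]
  set a := prodElt (mu.torusElt hξ) (invElt (lam.torusElt hξ)) with ha
  set c := prodElt (mu.symElt k) (invElt (lam.symElt k)) with hc
  have hx : prodElt (mu.wreathElt hξ) (invElt (lam.wreathElt hξ)) =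
      MonoidAlgebra.mapDomainAlgHom k k (torusPair mu lam) a *
        MonoidAlgebra.mapDomainAlgHom k k
          ((mu.young.comp mu.permHom).prodMap (lam.young.comp lam.permHom)) c := by
    rw [mu.wreathElt_eq, lam.wreathElt_eq', invElt_mul, ← prodElt_mul, invElt_mapDomain,
      invElt_mapDomain, prodElt_mapDomain, prodElt_mapDomain]
    rfl
  let S : (U → k) →ₗ[k] (Ω → k) :=
    ∑ u : U, (LinearMap.toSpanSingleton k (Ω → k) (Pi.single u.unlabelled 1)) ∘ₗ LinearMap.proj u
  have hS : ∀ u : U, S (Pi.single u 1) = Pi.single u.unlabelled 1 := fun u => by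
    simp only [S, LinearMap.sum_apply, LinearMap.comp_apply, LinearMap.proj_apply,
      LinearMap.toSpanSingleton_apply]
    rw [Finset.sum_eq_single u]
    · rw [Pi.single_eq_same, one_smul]
    · intro b _ hb; rw [Pi.single_eq_of_ne hb, zero_smul]
    · simp
  have hcoeff : ∀ t, a.coeff t = ((∏ i, (torusCard m (Box (mu.part i)) : k)⁻¹) *
      ∏ i, (torusCard m (Box (lam.part i)) : k)⁻¹) * pairChar hξ t⁻¹ := fun t => by
    rw [ha, coeff_prodElt, coeff_invElt, mu.coeff_torusElt, lam.coeff_torusElt, pairChar]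
    change _ * (_ * lam.torusChar hξ t.2⁻¹⁻¹) = _ * (mu.torusChar hξ t.1⁻¹ *
      lam.torusChar hξ t.2⁻¹⁻¹)
    ring
  refine finrank_range_eq_of_section (fun u : U => u.unlabelled)
    (fun t (D : Ω) => torusPair mu lam t • D) (fun t => pairChar hξ t) (fun t => a.coeff t) _ _
    (permOp k Ω (MonoidAlgebra.mapDomainAlgHom k k (torusPair mu lam) a) ∘ₗ S) (fun u => ?_)
    (fun u => ?_) (fun t ω => ?_) (fun t u u' h => eq_of_torusPair_smul h) (fun u => ?_)
    (exists_torusPair hξ mu lam)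
  · rw [hx, map_mul, Module.End.mul_apply, LinearMap.comp_apply, permOp_mapDomain, permOp_apply,
      map_sum, map_sum, map_sum]
    refine Finset.sum_congr rfl fun g _ => ?_
    rw [map_smul, map_smul, map_smul, hS, unlabelled_smul]
  · rw [LinearMap.comp_apply, hS, permOp_mapDomain]
  · have h1 : prodElt (mu.wreathElt hξ) (invElt (lam.wreathElt hξ)) *
        MonoidAlgebra.single (torusPair mu lam t) 1 =
          pairChar hξ t • prodElt (mu.wreathElt hξ) (invElt (lam.wreathElt hξ)) := by
      change _ * MonoidAlgebra.single (mu.young (mu.torusHom t.1), lam.young (lam.torusHom t.2)) 1 = _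
      rw [← prodElt_single, prodElt_mul, mu.wreathElt_mul_torus,
        show lam.young (lam.torusHom t.2) = (lam.young (lam.torusHom t.2⁻¹))⁻¹ by
          rw [map_inv, map_inv, inv_inv], ← invElt_single, ← invElt_mul, lam.torus_mul_wreathElt,
        invElt_smul, prodElt_smul, pairChar]
    have h2 := LinearMap.congr_fun (congrArg (permOp k Ω) h1) (Pi.single ω 1)
    rwa [map_mul, Module.End.mul_apply, permOp_single, one_smul, map_smul,
      LinearMap.smul_apply] at h2
  · -- the stabilizer has order invertible in `k`, and the coefficients are constant on it
    let St : Subgroup (mu.Torus × lam.Torus) :=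
      (MulAction.stabilizer (Wreath m (Fin n) × Wreath m (Fin f)) u.unlabelled).comap
        (torusPair mu lam)
    have hmem : ∀ t, t ∈ St ↔ torusPair mu lam t • u.unlabelled = u.unlabelled := fun t => Iff.rfl
    rw [Finset.sum_congr rfl (g := fun _ => (∏ i, (torusCard m (Box (mu.part i)) : k)⁻¹) *
      ∏ i, (torusCard m (Box (lam.part i)) : k)⁻¹), Finset.sum_const, nsmul_eq_mul]
    · have htor : ∀ X : Type, ∀ _ : Fintype X, ∀ _ : DecidableEq X,
          (torusCard m X : k) ≠ 0 := fun X _ _ => torusCard_ne_zero hm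
      refine mul_ne_zero ?_ (mul_ne_zero (Finset.prod_ne_zero_iff.2 fun i _ =>
        inv_ne_zero (htor _ _ _)) (Finset.prod_ne_zero_iff.2 fun i _ => inv_ne_zero (htor _ _ _)))
      have hcard : ((Fintype.card (mu.Torus × lam.Torus) : ℕ) : k) ≠ 0 := by
        rw [Fintype.card_prod, Fintype.card_pi, Fintype.card_pi, Nat.cast_mul, Nat.cast_prod,
          Nat.cast_prod]
        exact mul_ne_zero (Finset.prod_ne_zero_iff.2 fun i _ => htor _ _ _)
          (Finset.prod_ne_zero_iff.2 fun i _ => htor _ _ _)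
      have hdvd := Subgroup.card_subgroup_dvd_card St
      rw [Nat.card_eq_fintype_card (α := mu.Torus × lam.Torus)] at hdvd
      have heq : Nat.card St = (Finset.univ.filter fun t =>
          torusPair mu lam t • u.unlabelled = u.unlabelled).card := by
        classical
        rw [Nat.card_eq_fintype_card]
        exact Fintype.card_of_subtype _ fun t => by
          rw [Finset.mem_filter, hmem]
          exact ⟨fun h => h.2, fun h => ⟨Finset.mem_univ _, h⟩⟩
      obtain ⟨d, hd⟩ := hdvd
      intro h0
      rw [hd, heq, Nat.cast_mul, h0, zero_mul] at hcard
      exact hcard rfl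
    · intro t ht
      have h1 : t⁻¹ ∈ St := inv_mem ((hmem t).2 (Finset.mem_filter.1 ht).2)
      rw [hcoeff, pairChar_eq_one hξ ((hmem _).1 h1), mul_one]

end YoungMatching

/-! ### Counting fixed points on the matchings -/

section Torsor

/-- Counting fixed points on the quotient of a set `W` by a free action of `P`: every fixed point of
`a` on the quotient comes from the points of `W` that `a` moves within their orbit. -/
theorem card_fixed_mul_card {P W U : Type*} [Fintype P] [Fintype W] [DecidableEq W] [Fintype U]
    [DecidableEq U] (act : P → W → W) (π : W → U) (hπ : Function.Surjective π)
    (hfib : ∀ z z', π z = π z' ↔ ∃ y, z' = act y z) (hfree : ∀ y y' z, act y z = act y' z → y = y')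
    (a : W → W) (a' : U → U) (h : ∀ z, π (a z) = a' (π z)) :
    Fintype.card {u // a' u = u} * Fintype.card P =
      ∑ y, Fintype.card {z // a z = act y z} := by
  have hact : ∀ y z, π (act y z) = π z := fun y z => ((hfib z _).2 ⟨y, rfl⟩).symm
  have e1 : (Σ y, {z // a z = act y z}) ≃ {z // a' (π z) = π z} := by
    refine Equiv.ofBijective (fun p => ⟨p.2.1, by rw [← h, p.2.2, hact]⟩) ⟨?_, ?_⟩
    · rintro ⟨y, z, hz⟩ ⟨y', z', hz'⟩ hh
      obtain rfl : z = z' := congrArg Subtype.val hh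
      obtain rfl := hfree y y' z (hz.symm.trans hz')
      rfl
    · rintro ⟨z, hz⟩
      obtain ⟨y, hy⟩ := (hfib z (a z)).1 (by rw [h, hz])
      exact ⟨⟨y, z, hy⟩, rfl⟩
  have e2 : {u // a' u = u} × P ≃ {z // a' (π z) = π z} := by
    have hsec := Function.surjInv_eq hπ
    refine Equiv.ofBijective (fun p => ⟨act p.2 (Function.surjInv hπ p.1.1), by
      rw [hact, hsec, p.1.2]⟩) ⟨?_, ?_⟩
    · rintro ⟨⟨u, hu⟩, y⟩ ⟨⟨u', hu'⟩, y'⟩ hh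
      have h1 : act y (Function.surjInv hπ u) = act y' (Function.surjInv hπ u') :=
        congrArg Subtype.val hh
      obtain rfl : u = u' := by
        have h2 := congrArg π h1
        rwa [hact, hact, hsec, hsec] at h2
      obtain rfl := hfree _ _ _ h1
      rfl
    · rintro ⟨z, hz⟩
      obtain ⟨y, hy⟩ := (hfib (Function.surjInv hπ (π z)) z).1 (hsec _)
      exact ⟨(⟨π z, hz⟩, y), Subtype.ext hy.symm⟩
  rw [← Fintype.card_prod, ← Fintype.card_sigma]
  exact Fintype.card_congr (e2.trans e1.symm)

end Torsor

section Bijections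

theorem sum_coeff_mul_card_bij (nu : YoungDiagram) {X : Type} [Fintype X] [DecidableEq X]
    (w : Equiv.Perm X) : ∑ g, (youngSym ℚ nu).coeff g *
      (Fintype.card {b : X ≃ Box nu // ∀ q, g (b q) = b (w q)} : ℚ) = hookProd nu * chi X nu w := by
  have h1 : ∀ g : Equiv.Perm (Box nu), ∀ b : X ≃ Box nu,
      (∀ q, g (b q) = b (w q)) ↔ b.permCongr w = g := by
    intro g b
    rw [eq_comm, Equiv.ext_iff]
    constructor
    · intro h c
      have := h (b.symm c)
      rwa [Equiv.apply_symm_apply] at this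
    · intro h q
      rw [h, Equiv.permCongr_apply, Equiv.symm_apply_apply]
  rw [chi, mul_div_cancel₀ _ (hookProdQ_ne_zero nu),
    Fintype.sum_bijective Equiv.symm Equiv.symm_bijective _
      (fun b : X ≃ Box nu => (youngSym ℚ nu).coeff (b.permCongr w)) fun t => rfl]
  have h2 : ∀ g, (Fintype.card {b : X ≃ Box nu // ∀ q, g (b q) = b (w q)} : ℚ) =
      ∑ b : X ≃ Box nu, if b.permCongr w = g then 1 else 0 := fun g => by
    rw [Fintype.card_subtype, Finset.sum_boole]
    simp only [h1]
  simp only [h2, Finset.mul_sum]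
  rw [Finset.sum_comm]
  refine Finset.sum_congr rfl fun b _ => ?_
  simp

/-- The values of the skew character as a weighted count of bijections. -/
theorem sum_coeff_mul_coeff_mul_card_bij (lam nu : YoungDiagram) {Y : Type} [Fintype Y]
    [DecidableEq Y] (y : Equiv.Perm Y) :
    ∑ g, ∑ h, (youngSym ℚ nu).coeff g * (youngSym ℚ lam).coeff h *
      (Fintype.card {b : Box lam ⊕ Y ≃ Box nu //
        ∀ q, g (b q) = b ((Equiv.Perm.sumCongr h y)⁻¹ q)} : ℚ) =
      hookProd nu * hookProd lam * skewChar lam nu Y y := by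
  rw [Finset.sum_comm, skewChar, mul_assoc, mul_div_cancel₀ _ (hookProdQ_ne_zero lam),
    Finset.mul_sum]
  refine Finset.sum_congr rfl fun h _ => ?_
  rw [mul_left_comm, ← (chi_isClassFun nu).inv, ← sum_coeff_mul_card_bij, Finset.mul_sum]
  exact Finset.sum_congr rfl fun g _ => by ring

end Bijections

section RankFormula

variable {m : ℕ} [NeZero m] {k : Type*} [Field k] {n f : ℕ} (mu : MPartition m n)
  (lam : MPartition m f)

theorem MPartition.coeff_symElt (R : Type*) [CommRing R] (g : mu.YoungGroup) :
    (mu.symElt R).coeff g = ∏ i, (youngSym R (mu.part i)).coeff (g i) := coeff_piElt _ _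

theorem MPartition.symElt_mul_self (R : Type*) [CommRing R] :
    mu.symElt R * mu.symElt R = (∏ i, (hookProd (mu.part i) : R)) • mu.symElt R := by
  rw [symElt, piElt_mul, ← piElt_smul]
  simp only [youngSym_mul_self]

/-- The rank of the product of the Young symmetrizers, over any field in which the hook products are
invertible. -/
theorem rank_youngMatching (hmu : (∏ i, (hookProd (mu.part i) : k)) ≠ 0)
    (hlam : (∏ i, (hookProd (lam.part i) : k)) ≠ 0) :
    ((permMat k (YoungMatching mu lam) (prodElt (mu.symElt k) (invElt (lam.symElt k)))).rank : ℚ) *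
      ((∏ i, (hookProd (mu.part i) : ℚ)) * ∏ i, (hookProd (lam.part i) : ℚ)) =
      ∑ g : mu.YoungGroup, ∑ h : lam.YoungGroup, (∏ i, (youngSym ℚ (mu.part i)).coeff (g i)) *
        (∏ i, (youngSym ℚ (lam.part i)).coeff (h i)) *
          (Fintype.card {u : YoungMatching mu lam // (g, h⁻¹) • u = u} : ℚ) := by
  have hx : MonoidAlgebra.mapRingHom (mu.YoungGroup × lam.YoungGroup) (Int.castRingHom k)
      (prodElt (mu.symElt ℤ) (invElt (lam.symElt ℤ))) =
        prodElt (mu.symElt k) (invElt (lam.symElt k)) := by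
    rw [map_prodElt, map_invElt, MPartition.symElt, MPartition.symElt, map_piElt, map_piElt]
    simp only [map_youngSym]
    rfl
  have hxx : prodElt (mu.symElt ℤ) (invElt (lam.symElt ℤ)) *
      prodElt (mu.symElt ℤ) (invElt (lam.symElt ℤ)) =
        ((∏ i, hookProd (mu.part i)) * ∏ i, hookProd (lam.part i)) •
          prodElt (mu.symElt ℤ) (invElt (lam.symElt ℤ)) := by
    rw [prodElt_mul, ← invElt_mul, mu.symElt_mul_self, lam.symElt_mul_self, invElt_smul,
      prodElt_smul]
    simp only [Int.cast_id]
  have hα : (((∏ i, hookProd (mu.part i)) * ∏ i, hookProd (lam.part i) : ℤ) : k) ≠ 0 := by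
    rw [Int.cast_mul, Int.cast_prod, Int.cast_prod]
    exact mul_ne_zero hmu hlam
  have key := rank_permMat_mul_eq (Ω := YoungMatching mu lam) _ hα hxx
  rw [hx] at key
  have key' := congrArg (Int.cast : ℤ → ℚ) key
  push_cast at key'
  rw [key', Fintype.sum_prod_type]
  refine Finset.sum_congr rfl fun g _ => ?_
  refine Fintype.sum_equiv (Equiv.inv _) _ _ fun h => ?_
  rw [coeff_prodElt, coeff_invElt, mu.coeff_symElt, lam.coeff_symElt, Int.cast_mul, Int.cast_prod,
    Int.cast_prod, Equiv.inv_apply, inv_inv]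
  simp only [fun nu => coeff_youngSym_cast nu ℚ]

end RankFormula

/-! ### Matchings of the ends of arcs -/

section ColouredMatching

/-- The perfect matchings of a family of sets indexed by colours, such that the colours of matched
elements are opposite. -/
@[ext] structure ColouredMatching {ι : Type} [Neg ι] (Y : ι → Type) where
  inv : (Σ i, Y i) → Σ i, Y i
  inv_inv : ∀ z, inv (inv z) = z
  inv_ne : ∀ z, inv z ≠ z
  fst_inv : ∀ z, (inv z).1 = -z.1

variable {ι : Type} [Neg ι] {Y : ι → Type}

/-- Permutations act by conjugation. -/
instance : SMul (∀ i, Equiv.Perm (Y i)) (ColouredMatching Y) where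
  smul y s :=
    { inv := fun z => Equiv.Perm.sigmaCongrRight y (s.inv ((Equiv.Perm.sigmaCongrRight y).symm z))
      inv_inv := fun z => by rw [Equiv.symm_apply_apply, s.inv_inv, Equiv.apply_symm_apply]
      inv_ne := fun z h => s.inv_ne ((Equiv.Perm.sigmaCongrRight y).symm z) (by
        rw [Equiv.eq_symm_apply]; exact h)
      fst_inv := fun z => s.fst_inv ((Equiv.Perm.sigmaCongrRight y).symm z) }

theorem ColouredMatching.smul_inv (y : ∀ i, Equiv.Perm (Y i)) (s : ColouredMatching Y)
    (z : Σ i, Y i) : (y • s).inv z =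
      Equiv.Perm.sigmaCongrRight y (s.inv ((Equiv.Perm.sigmaCongrRight y).symm z)) := rfl

noncomputable instance [Finite ι] [∀ i, Finite (Y i)] : Fintype (ColouredMatching Y) :=
  haveI := Finite.of_injective (fun u : ColouredMatching Y => u.inv) fun _ _ h =>
    ColouredMatching.ext h
  Fintype.ofFinite _

noncomputable instance : DecidableEq (ColouredMatching Y) := Classical.decEq _

end ColouredMatching

section Assemble

variable {m : ℕ} [NeZero m] {n f : ℕ} {mu : MPartition m n} {lam : MPartition m f}
  {Y : ZMod m → Type}

/-- The numbering of the boxes of `λ` and the elements of the sets `Y i` obtained from bijections with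
the boxes of `μ`. -/
noncomputable def joinNumbering (b : ∀ i, Box (lam.part i) ⊕ Y i ≃ Box (mu.part i)) :
    Fin f ⊕ (Σ i, Y i) ≃ Fin n :=
  (Equiv.sumCongr lam.numbering.symm (Equiv.refl _)).trans ((Equiv.sigmaSumDistrib _ _).symm.trans
    ((Equiv.sigmaCongrRight b).trans mu.numbering))

theorem joinNumbering_inl (b : ∀ i, Box (lam.part i) ⊕ Y i ≃ Box (mu.part i)) (i : ZMod m)
    (p : Box (lam.part i)) :
    joinNumbering b (.inl (lam.numbering ⟨i, p⟩)) = mu.numbering ⟨i, b i (.inl p)⟩ := by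
  change mu.numbering (Equiv.sigmaCongrRight b ((Equiv.sigmaSumDistrib _ _).symm
    (.inl (lam.numbering.symm (lam.numbering ⟨i, p⟩))))) = _
  rw [Equiv.symm_apply_apply]
  rfl

theorem joinNumbering_inr (b : ∀ i, Box (lam.part i) ⊕ Y i ≃ Box (mu.part i)) (i : ZMod m)
    (q : Y i) : joinNumbering b (.inr ⟨i, q⟩) = mu.numbering ⟨i, b i (.inr q)⟩ := rfl

theorem colour_numbering (lam : MPartition m n) (z : Σ i, Box (lam.part i)) :
    lam.colour (lam.numbering z) = z.1 := by
  rw [MPartition.colour, Equiv.symm_apply_apply]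

theorem colour_joinNumbering_inl (b : ∀ i, Box (lam.part i) ⊕ Y i ≃ Box (mu.part i)) (y : Fin f) :
    mu.colour (joinNumbering b (.inl y)) = lam.colour y := by
  obtain ⟨⟨i, p⟩, rfl⟩ := lam.numbering.surjective y
  rw [joinNumbering_inl, colour_numbering, colour_numbering]

theorem colour_joinNumbering_inr (b : ∀ i, Box (lam.part i) ⊕ Y i ≃ Box (mu.part i))
    (z : Σ i, Y i) : mu.colour (joinNumbering b (.inr z)) = z.1 := by
  obtain ⟨i, q⟩ := z
  rw [joinNumbering_inr, colour_numbering]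

/-- Every node is the northern or the southern end of a through strand, or an end of an arc. -/
theorem node_cases (b : ∀ i, Box (lam.part i) ⊕ Y i ≃ Box (mu.part i)) {C : Fin n ⊕ Fin f → Prop}
    (h1 : ∀ y, C (.inl (joinNumbering b (.inl y)))) (h2 : ∀ z, C (.inl (joinNumbering b (.inr z))))
    (h3 : ∀ y, C (.inr y)) (z : Fin n ⊕ Fin f) : C z := by
  rcases z with x | y
  · obtain ⟨w | w, rfl⟩ := (joinNumbering b).surjective x
    exacts [h1 w, h2 w]
  · exact h3 y

/-- The other end of the strand at a node. -/
noncomputable def joinInv (b : ∀ i, Box (lam.part i) ⊕ Y i ≃ Box (mu.part i))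
    (s : ColouredMatching Y) : Fin n ⊕ Fin f → Fin n ⊕ Fin f :=
  Sum.elim (fun x => Sum.elim .inr (fun z => .inl (joinNumbering b (.inr (s.inv z))))
    ((joinNumbering b).symm x)) fun y => .inl (joinNumbering b (.inl y))

theorem joinInv_inl_inl (b : ∀ i, Box (lam.part i) ⊕ Y i ≃ Box (mu.part i))
    (s : ColouredMatching Y) (y : Fin f) : joinInv b s (.inl (joinNumbering b (.inl y))) = .inr y := by
  rw [joinInv, Sum.elim_inl, Equiv.symm_apply_apply, Sum.elim_inl]

theorem joinInv_inl_inr (b : ∀ i, Box (lam.part i) ⊕ Y i ≃ Box (mu.part i))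
    (s : ColouredMatching Y) (z : Σ i, Y i) : joinInv b s (.inl (joinNumbering b (.inr z))) =
      .inl (joinNumbering b (.inr (s.inv z))) := by
  rw [joinInv, Sum.elim_inl, Equiv.symm_apply_apply, Sum.elim_inr]

theorem joinInv_inr (b : ∀ i, Box (lam.part i) ⊕ Y i ≃ Box (mu.part i))
    (s : ColouredMatching Y) (y : Fin f) :
    joinInv b s (.inr y) = .inl (joinNumbering b (.inl y)) := rfl

variable (mu lam Y) in
/-- The data from which a matching of the nodes is assembled: for every colour a bijection that
attaches the through strands and leaves the set `Y i` for the ends of the arcs, and a matching of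
these ends. -/
abbrev JoinData : Type :=
  (∀ i, Box (lam.part i) ⊕ Y i ≃ Box (mu.part i)) × ColouredMatching Y

noncomputable instance [∀ i, Fintype (Y i)] [∀ i, DecidableEq (Y i)] : Fintype (JoinData mu lam Y) :=
  inferInstance

noncomputable instance [∀ i, Fintype (Y i)] [∀ i, DecidableEq (Y i)] :
    DecidableEq (JoinData mu lam Y) := inferInstance

/-- A matching of the nodes obtained from bijections and a matching of the sets `Y i`. -/
noncomputable def joinMatching (w : JoinData mu lam Y) : YoungMatching mu lam where
  inv := joinInv w.1 w.2
  inv_inv := node_cases w.1 (fun y => by rw [joinInv_inl_inl, joinInv_inr])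
    (fun z => by rw [joinInv_inl_inr, joinInv_inl_inr, w.2.inv_inv])
    (fun y => by rw [joinInv_inr, joinInv_inl_inl])
  inv_ne := node_cases w.1 (fun y => by rw [joinInv_inl_inl]; exact Sum.inr_ne_inl)
    (fun z h => by
      rw [joinInv_inl_inr] at h
      exact w.2.inv_ne z (Sum.inr_injective ((joinNumbering w.1).injective (Sum.inl_injective h))))
    (fun y => by rw [joinInv_inr]; exact Sum.inl_ne_inr)
  colour_inv := node_cases w.1
    (fun y => by
      rw [joinInv_inl_inl]
      change -lam.colour y = -mu.colour _
      rw [colour_joinNumbering_inl])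
    (fun z => by
      rw [joinInv_inl_inr]
      change mu.colour _ = -mu.colour _
      rw [colour_joinNumbering_inr, colour_joinNumbering_inr, w.2.fst_inv])
    (fun y => by
      rw [joinInv_inr]
      change mu.colour _ = - -lam.colour y
      rw [colour_joinNumbering_inl, neg_neg])
  isLeft y := rfl

theorem joinMatching_inv (w : JoinData mu lam Y) (z : Fin n ⊕ Fin f) :
    (joinMatching w).inv z = joinInv w.1 w.2 z := rfl

/-- Permutations of the sets `Y i` do not change the resulting matching of the nodes. -/
def relabel (y : ∀ i, Equiv.Perm (Y i)) (w : JoinData mu lam Y) : JoinData mu lam Y :=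
  (fun i => (Equiv.Perm.sumCongr 1 (y i)⁻¹).trans (w.1 i), y • w.2)

theorem relabel_injective (y y' : ∀ i, Equiv.Perm (Y i))
    (w : JoinData mu lam Y)
    (h : relabel y w = relabel y' w) : y = y' := by
  funext i
  rw [← inv_inj]
  ext q
  have h1 := congrArg (fun b => b i (.inr q)) (Prod.ext_iff.1 h).1
  exact Sum.inr_injective ((w.1 i).injective h1)

theorem joinNumbering_relabel_inl (y : ∀ i, Equiv.Perm (Y i))
    (w : JoinData mu lam Y) (t : Fin f) :
    joinNumbering (relabel y w).1 (.inl t) = joinNumbering w.1 (.inl t) := by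
  obtain ⟨⟨i, p⟩, rfl⟩ := lam.numbering.surjective t
  rw [joinNumbering_inl, joinNumbering_inl]
  rfl

theorem joinNumbering_relabel_inr (y : ∀ i, Equiv.Perm (Y i))
    (w : JoinData mu lam Y) (z : Σ i, Y i) :
    joinNumbering (relabel y w).1 (.inr z) =
      joinNumbering w.1 (.inr ((Equiv.Perm.sigmaCongrRight y).symm z)) := rfl

/-- The relabellings are the only ambiguity in the bijections and the coloured matching that give a
matching of the nodes. -/
theorem joinMatching_eq_iff
    [∀ i, Finite (Y i)] (w w' : JoinData mu lam Y) :
    joinMatching w = joinMatching w' ↔ ∃ y, w' = relabel y w := by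
  constructor
  · intro h
    have hinv : ∀ z, joinInv w.1 w.2 z = joinInv w'.1 w'.2 z := fun z =>
      congrFun (congrArg YoungMatching.inv h) z
    have hl : ∀ i p, w.1 i (.inl p) = w'.1 i (.inl p) := fun i p => by
      have h1 := Sum.inl_injective (hinv (.inr (lam.numbering ⟨i, p⟩)))
      rw [joinNumbering_inl, joinNumbering_inl] at h1
      exact eq_of_heq (Sigma.mk.inj (mu.numbering.injective h1)).2
    have hr : ∀ i q, ∃ q', w'.1 i (.inr q) = w.1 i (.inr q') := fun i q => by
      obtain ⟨p | q', hq'⟩ := (w.1 i).surjective (w'.1 i (.inr q))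
      · rw [hl] at hq'
        exact absurd ((w'.1 i).injective hq') Sum.inl_ne_inr
      · exact ⟨q', hq'.symm⟩
    choose F hF using hr
    have hinj : ∀ i, Function.Injective (F i) := fun i q q' hq => by
      have h1 := hF i q
      rw [hq, ← hF] at h1
      exact Sum.inr_injective ((w'.1 i).injective h1)
    let y : ∀ i, Equiv.Perm (Y i) := fun i =>
      (Equiv.ofBijective (F i) (Finite.injective_iff_bijective.1 (hinj i))).symm
    have hy : w'.1 = (relabel y w).1 := by
      refine funext fun i => Equiv.ext ?_
      rintro (p | q)
      · exact (hl i p).symm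
      · exact hF i q
    have hs : w'.2 = y • w.2 := by
      refine ColouredMatching.ext (funext fun z => ?_)
      have h1 := hinv (.inl (joinNumbering w'.1 (.inr z)))
      rw [joinInv_inl_inr, hy, joinNumbering_relabel_inr, joinInv_inl_inr,
        joinNumbering_relabel_inr] at h1
      have h2 := Sum.inr_injective ((joinNumbering w.1).injective (Sum.inl_injective h1))
      rw [ColouredMatching.smul_inv, h2, Equiv.apply_symm_apply]
    exact ⟨y, Prod.ext hy hs⟩
  · rintro ⟨y, rfl⟩
    refine YoungMatching.ext (funext (node_cases (relabel y w).1 (fun t => ?_) (fun z => ?_)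
      fun t => ?_))
    · rw [joinMatching_inv, joinMatching_inv, joinInv_inl_inl, joinNumbering_relabel_inl,
        joinInv_inl_inl]
    · rw [joinMatching_inv, joinMatching_inv, joinInv_inl_inr, joinNumbering_relabel_inr,
        joinInv_inl_inr, joinNumbering_relabel_inr]
      change _ = Sum.inl (joinNumbering w.1 (.inr ((Equiv.Perm.sigmaCongrRight y).symm
        (Equiv.Perm.sigmaCongrRight y (w.2.inv ((Equiv.Perm.sigmaCongrRight y).symm z))))))
      rw [Equiv.symm_apply_apply]
    · rw [joinMatching_inv, joinMatching_inv, joinInv_inr, joinInv_inr, joinNumbering_relabel_inl]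

/-- If `λ^i` has more boxes than `μ^i` for some `i`, both sides are empty; so it does not matter that the
subtraction is truncated. -/
theorem joinMatching_surjective [∀ i, Fintype (Y i)]
    (hY : ∀ i, Fintype.card (Y i) = (mu.part i).card - (lam.part i).card) :
    Function.Surjective (joinMatching (mu := mu) (lam := lam) (Y := Y)) := by
  intro u
  have h1 : ∀ i (p : Box (lam.part i)), ∃ p' : Box (mu.part i),
      u.inv (.inr (lam.numbering ⟨i, p⟩)) = .inl (mu.numbering ⟨i, p'⟩) := by
    intro i p
    obtain ⟨x, hx⟩ := Sum.isLeft_iff.1 (u.isLeft (lam.numbering ⟨i, p⟩))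
    obtain ⟨⟨j, p'⟩, rfl⟩ := mu.numbering.surjective x
    have h2 := u.colour_inv (.inr (lam.numbering ⟨i, p⟩))
    rw [hx] at h2
    change mu.colour _ = - -lam.colour _ at h2
    rw [colour_numbering, colour_numbering, neg_neg] at h2
    obtain rfl : j = i := h2
    exact ⟨p', hx⟩
  -- the strands between the two rows embed the boxes of `λ^i` into the boxes of `μ^i`
  choose F hF using h1
  have hinj : ∀ i, Function.Injective (F i) := fun i p p' hp => by
    have h2 := hF i p
    rw [hp, ← hF] at h2
    have h3 := congrArg u.inv h2
    rw [u.inv_inv, u.inv_inv] at h3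
    exact eq_of_heq (Sigma.mk.inj (lam.numbering.injective (Sum.inr_injective h3))).2
  have hb : ∀ i, ∃ b : Box (lam.part i) ⊕ Y i ≃ Box (mu.part i), ∀ p, b (.inl p) = F i p := by
    intro i
    refine exists_equiv_extending Function.Embedding.inl ⟨F i, hinj i⟩ ?_
    have h2 := Fintype.card_le_of_injective _ (hinj i)
    rw [card_box, card_box] at h2
    rw [Fintype.card_sum, card_box, card_box, hY]
    omega
  choose b hb using hb
  have hinl : ∀ t, u.inv (.inr t) = .inl (joinNumbering b (.inl t)) := by
    intro t
    obtain ⟨⟨i, p⟩, rfl⟩ := lam.numbering.surjective t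
    rw [joinNumbering_inl, hb, hF]
  have hinl' : ∀ t, u.inv (.inl (joinNumbering b (.inl t))) = .inr t := fun t => by
    rw [← hinl, u.inv_inv]
  -- the remaining nodes are matched among themselves
  have hs : ∀ z, ∃ z', u.inv (.inl (joinNumbering b (.inr z))) = .inl (joinNumbering b (.inr z')) := by
    intro z
    rcases hz : u.inv (.inl (joinNumbering b (.inr z))) with x | t
    · obtain ⟨t | z', rfl⟩ := (joinNumbering b).surjective x
      · rw [← hinl] at hz
        have h3 := congrArg u.inv hz
        rw [u.inv_inv, u.inv_inv] at h3
        exact absurd h3 Sum.inl_ne_inr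
      · exact ⟨z', rfl⟩
    · rw [← hinl'] at hz
      have h3 := congrArg u.inv hz
      rw [u.inv_inv, u.inv_inv] at h3
      exact absurd ((joinNumbering b).injective (Sum.inl_injective h3)) Sum.inr_ne_inl
  choose s hs using hs
  have hcancel : ∀ z z', (Sum.inl (joinNumbering b (.inr z)) : Fin n ⊕ Fin f) =
      .inl (joinNumbering b (.inr z')) → z = z' := fun z z' h =>
    Sum.inr_injective ((joinNumbering b).injective (Sum.inl_injective h))
  let σ : ColouredMatching Y :=
    { inv := s
      inv_inv := fun z => hcancel _ _ (by rw [← hs, ← hs, u.inv_inv])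
      inv_ne := fun z h => u.inv_ne _ ((hs z).trans (by rw [h]))
      fst_inv := fun z => by
        have h2 := u.colour_inv (.inl (joinNumbering b (.inr z)))
        rw [hs] at h2
        change mu.colour _ = -mu.colour _ at h2
        rwa [colour_joinNumbering_inr, colour_joinNumbering_inr] at h2 }
  refine ⟨(b, σ), YoungMatching.ext (funext (node_cases b (fun t => ?_) (fun z => ?_) fun t => ?_))⟩
  · rw [hinl']; exact joinInv_inl_inl b σ t
  · rw [hs]; exact joinInv_inl_inr b σ z
  · rw [hinl]; exact joinInv_inr b σ t

/-- The action of the Young subgroups in terms of bijections. -/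
def moveBoxes (g : mu.YoungGroup × lam.YoungGroup)
    (w : JoinData mu lam Y) : JoinData mu lam Y :=
  (fun i => (Equiv.Perm.sumCongr (g.2 i)⁻¹ 1).trans ((w.1 i).trans (g.1 i)), w.2)

theorem permYoung_numbering (lam : MPartition m n) (σ : lam.YoungGroup) (i : ZMod m)
    (p : Box (lam.part i)) : lam.permYoung σ (lam.numbering ⟨i, p⟩) = lam.numbering ⟨i, σ i p⟩ := by
  change lam.numbering (Equiv.Perm.sigmaCongrRight σ (lam.numbering.symm (lam.numbering ⟨i, p⟩))) = _
  rw [Equiv.symm_apply_apply]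
  rfl

theorem joinMatching_moveBoxes (g : mu.YoungGroup × lam.YoungGroup)
    (w : JoinData mu lam Y) :
    joinMatching (moveBoxes g w) = g • joinMatching w := by
  have hl : ∀ t, joinNumbering (moveBoxes g w).1 (.inl (lam.permYoung g.2 t)) =
      mu.permYoung g.1 (joinNumbering w.1 (.inl t)) := by
    intro t
    obtain ⟨⟨i, p⟩, rfl⟩ := lam.numbering.surjective t
    rw [permYoung_numbering, joinNumbering_inl, joinNumbering_inl, permYoung_numbering]
    change mu.numbering ⟨i, g.1 i (w.1 i (.inl ((g.2 i).symm (g.2 i p))))⟩ = _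
    rw [Equiv.symm_apply_apply]
  have hr : ∀ z, joinNumbering (moveBoxes g w).1 (.inr z) =
      mu.permYoung g.1 (joinNumbering w.1 (.inr z)) := by
    rintro ⟨i, q⟩
    rw [joinNumbering_inr, joinNumbering_inr, permYoung_numbering]
    rfl
  have key : ∀ z, (joinMatching (moveBoxes g w)).inv (nodePerm g z) =
      nodePerm g ((joinMatching w).inv z) := by
    refine node_cases w.1 (fun t => ?_) (fun z => ?_) fun t => ?_
    · rw [joinMatching_inv, joinMatching_inv, joinInv_inl_inl]
      change joinInv _ _ (.inl (mu.permYoung g.1 _)) = .inr (lam.permYoung g.2 t)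
      rw [← hl, joinInv_inl_inl]
    · rw [joinMatching_inv, joinMatching_inv, joinInv_inl_inr]
      change joinInv _ _ (.inl (mu.permYoung g.1 _)) = .inl (mu.permYoung g.1 _)
      rw [← hr, ← hr, joinInv_inl_inr]
      rfl
    · rw [joinMatching_inv, joinMatching_inv, joinInv_inr]
      change joinInv _ _ (.inr (lam.permYoung g.2 t)) = .inl (mu.permYoung g.1 _)
      rw [← hl, joinInv_inr]
  refine YoungMatching.ext (funext fun z => ?_)
  rw [YoungMatching.smul_inv, ← key, Equiv.apply_symm_apply]

theorem card_moveBoxes_eq_relabel [∀ i, Fintype (Y i)] [∀ i, DecidableEq (Y i)]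
    (g : mu.YoungGroup) (h : lam.YoungGroup) (y : ∀ i, Equiv.Perm (Y i)) :
    Fintype.card {w : JoinData mu lam Y //
      moveBoxes (g, h⁻¹) w = relabel y w} =
    (∏ i, Fintype.card {b : Box (lam.part i) ⊕ Y i ≃ Box (mu.part i) //
      ∀ q, g i (b q) = b ((Equiv.Perm.sumCongr (h i) (y i))⁻¹ q)}) *
      Fintype.card {s : ColouredMatching Y // y • s = s} := by
  have hiff : ∀ w : JoinData mu lam Y,
      moveBoxes (g, h⁻¹) w = relabel y w ↔ (∀ i, ∀ q, g i (w.1 i q) =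
        w.1 i ((Equiv.Perm.sumCongr (h i) (y i))⁻¹ q)) ∧ y • w.2 = w.2 := by
    intro w
    rw [Prod.ext_iff]
    refine and_congr ⟨fun hw i => ?_, fun hw => funext fun i => Equiv.ext ?_⟩ eq_comm
    · rintro (p | q)
      · have h1 := congrArg (fun b => b i (.inl ((h i)⁻¹ p))) hw
        change g i (w.1 i (.inl ((h i)⁻¹⁻¹ ((h i)⁻¹ p)))) = w.1 i (.inl ((h i)⁻¹ p)) at h1
        rw [inv_inv, show h i ((h i)⁻¹ p) = p from (h i).apply_symm_apply p] at h1
        exact h1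
      · exact congrArg (fun b => b i (.inr q)) hw
    · rintro (p | q)
      · have h1 := hw i (.inl (h i p))
        change g i (w.1 i (.inl (h i p))) = w.1 i (.inl ((h i).symm (h i p))) at h1
        rw [Equiv.symm_apply_apply] at h1
        exact h1
      · exact hw i (.inr q)
  rw [← Fintype.card_pi, ← Fintype.card_prod]
  exact Fintype.card_congr
    { toFun := fun w => (fun i => ⟨w.1.1 i, ((hiff w.1).1 w.2).1 i⟩, ⟨w.1.2, ((hiff w.1).1 w.2).2⟩)
      invFun := fun w => ⟨(fun i => (w.1 i).1, w.2.1), (hiff _).2 ⟨fun i => (w.1 i).2, w.2.2⟩⟩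
      left_inv := fun _ => rfl
      right_inv := fun _ => rfl }

theorem prod_sum_sum {ι R : Type*} [Fintype ι] [DecidableEq ι] [CommSemiring R] {α β : ι → Type*}
    [∀ i, Fintype (α i)] [∀ i, Fintype (β i)] (F : ∀ i, α i → β i → R) :
    ∏ i, ∑ a, ∑ b, F i a b = ∑ a : ∀ i, α i, ∑ b : ∀ i, β i, ∏ i, F i (a i) (b i) := by
  rw [Finset.prod_univ_sum, Fintype.piFinset_univ]
  refine Finset.sum_congr rfl fun a _ => ?_
  rw [Finset.prod_univ_sum, Fintype.piFinset_univ]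

variable {k : Type*} [Field k]

/-- The rank as an average over the permutations of the sets `Y i` of the ends of arcs. -/
theorem rank_mul_card [∀ i, Fintype (Y i)] [∀ i, DecidableEq (Y i)]
    (hY : ∀ i, Fintype.card (Y i) = (mu.part i).card - (lam.part i).card)
    (hmu : (∏ i, (hookProd (mu.part i) : k)) ≠ 0) (hlam : (∏ i, (hookProd (lam.part i) : k)) ≠ 0) :
    ((permMat k (YoungMatching mu lam) (prodElt (mu.symElt k) (invElt (lam.symElt k)))).rank : ℚ) *
      Fintype.card (∀ i, Equiv.Perm (Y i)) =
      ∑ y : ∀ i, Equiv.Perm (Y i), (Fintype.card {s : ColouredMatching Y // y • s = s} : ℚ) *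
        ∏ i, skewChar (lam.part i) (mu.part i) (Y i) (y i) := by
  have hcount : ∀ (g : mu.YoungGroup) (h : lam.YoungGroup),
      (Fintype.card {u : YoungMatching mu lam // (g, h⁻¹) • u = u} : ℚ) *
        Fintype.card (∀ i, Equiv.Perm (Y i)) = ∑ y : ∀ i, Equiv.Perm (Y i),
        (∏ i, (Fintype.card {b : Box (lam.part i) ⊕ Y i ≃ Box (mu.part i) //
          ∀ q, g i (b q) = b ((Equiv.Perm.sumCongr (h i) (y i))⁻¹ q)} : ℚ)) *
          Fintype.card {s : ColouredMatching Y // y • s = s} := fun g h => by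
    have h1 := card_fixed_mul_card relabel joinMatching (joinMatching_surjective hY)
      joinMatching_eq_iff relabel_injective (moveBoxes (g, h⁻¹))
      (fun u : YoungMatching mu lam => (g, h⁻¹) • u) (joinMatching_moveBoxes (g, h⁻¹))
    simp only [card_moveBoxes_eq_relabel] at h1
    exact_mod_cast h1
  have hA : (∏ i, (hookProd (mu.part i) : ℚ)) * ∏ i, (hookProd (lam.part i) : ℚ) ≠ 0 :=
    mul_ne_zero (Finset.prod_ne_zero_iff.2 fun i _ => hookProdQ_ne_zero _)
      (Finset.prod_ne_zero_iff.2 fun i _ => hookProdQ_ne_zero _)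
  apply mul_right_cancel₀ hA
  rw [mul_right_comm, rank_youngMatching mu lam hmu hlam, Finset.sum_mul, Finset.sum_mul]
  have h2 : ∀ y : ∀ i, Equiv.Perm (Y i),
      (Fintype.card {s : ColouredMatching Y // y • s = s} : ℚ) *
        (∏ i, skewChar (lam.part i) (mu.part i) (Y i) (y i)) *
        ((∏ i, (hookProd (mu.part i) : ℚ)) * ∏ i, (hookProd (lam.part i) : ℚ)) =
      ∑ g : mu.YoungGroup, ∑ h : lam.YoungGroup, (∏ i, (youngSym ℚ (mu.part i)).coeff (g i)) *
        (∏ i, (youngSym ℚ (lam.part i)).coeff (h i)) *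
        ((∏ i, (Fintype.card {b : Box (lam.part i) ⊕ Y i ≃ Box (mu.part i) //
          ∀ q, g i (b q) = b ((Equiv.Perm.sumCongr (h i) (y i))⁻¹ q)} : ℚ)) *
          Fintype.card {s : ColouredMatching Y // y • s = s}) := fun y => by
    have h3 := prod_sum_sum fun i (g : Equiv.Perm (Box (mu.part i)))
      (h : Equiv.Perm (Box (lam.part i))) => (youngSym ℚ (mu.part i)).coeff g *
        (youngSym ℚ (lam.part i)).coeff h *
        (Fintype.card {b : Box (lam.part i) ⊕ Y i ≃ Box (mu.part i) //
          ∀ q, g (b q) = b ((Equiv.Perm.sumCongr h (y i))⁻¹ q)} : ℚ)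
    simp only [sum_coeff_mul_coeff_mul_card_bij, Finset.prod_mul_distrib] at h3
    rw [mul_assoc, mul_comm (∏ i, skewChar _ _ _ _), h3, Finset.mul_sum]
    refine Finset.sum_congr rfl fun g _ => ?_
    rw [Finset.mul_sum]
    exact Finset.sum_congr rfl fun h _ => by ring
  rw [Finset.sum_congr rfl fun y _ => h2 y, Finset.sum_comm]
  refine Finset.sum_congr rfl fun g _ => ?_
  rw [Finset.sum_mul, Finset.sum_comm]
  refine Finset.sum_congr rfl fun h _ => ?_
  rw [mul_assoc, hcount, Finset.mul_sum]

end Assemble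

/-! ### Splitting into pairs of opposite components -/

section Split

variable {m : ℕ} [NeZero m]

variable (m) in
/-- Representatives of the pairs of distinct opposite elements of `ℤ/m`. -/
abbrev PosIndex : Type := {i : ZMod m // 0 < i.val ∧ 2 * i.val < m}

variable (m) in
/-- The elements of `ℤ/m` that are equal to their opposites. -/
abbrev SelfIndex : Type := {j : ZMod m // j = -j}

theorem eq_neg_iff_val (i : ZMod m) : i = -i ↔ i.val = 0 ∨ 2 * i.val = m := by
  have hlt := ZMod.val_lt i
  rw [← (ZMod.val_injective m).eq_iff, ZMod.neg_val]
  split_ifs with h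
  · simp [h]
  · have : i.val ≠ 0 := fun h0 => h ((ZMod.val_eq_zero i).1 h0)
    omega

theorem val_neg_of_val_ne_zero {i : ZMod m} (h : i.val ≠ 0) : (-i).val = m - i.val := by
  rw [ZMod.neg_val, if_neg fun h0 => h (by rw [h0, ZMod.val_zero])]

variable (m) in
/-- `ℤ/m` consists of representatives of pairs, their opposites, and the self-opposite elements. -/
noncomputable def splitIndex : (PosIndex m ⊕ PosIndex m) ⊕ SelfIndex m ≃ ZMod m :=
  Equiv.ofBijective (Sum.elim (Sum.elim (fun i => i.1) fun i => -i.1) fun j => j.1) (by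
    have hneg : ∀ i : PosIndex m, m < 2 * (-i.1).val := fun i => by
      rw [val_neg_of_val_ne_zero i.2.1.ne']
      have := i.2.2
      omega
    have hself : ∀ j : SelfIndex m, j.1.val = 0 ∨ 2 * j.1.val = m := fun j =>
      (eq_neg_iff_val j.1).1 j.2
    constructor
    · rintro ((i | i) | i) ((j | j) | j) h <;> dsimp only [Sum.elim_inl, Sum.elim_inr] at h
      · rw [Subtype.ext h]
      · have h1 := hneg j; have h2 := i.2; rw [h] at h2; omega
      · have h1 := hself j; have h2 := i.2; rw [h] at h2; omega
      · have h1 := hneg i; have h2 := j.2; rw [← h] at h2; omega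
      · rw [Subtype.ext (neg_injective h)]
      · have h1 := hself j; have h2 := hneg i; rw [h] at h2; have := NeZero.pos m; omega
      · have h1 := hself i; have h2 := j.2; rw [← h] at h2; omega
      · have h1 := hself i; have h2 := hneg j; rw [← h] at h2; have := NeZero.pos m; omega
      · rw [Subtype.ext h]
    · intro i
      by_cases hi : i = -i
      · exact ⟨.inr ⟨i, hi⟩, rfl⟩
      have h1 := mt (eq_neg_iff_val i).2 hi
      push Not at h1
      by_cases h2 : 2 * i.val < m
      · exact ⟨.inl (.inl ⟨i, Nat.pos_of_ne_zero h1.1, h2⟩), rfl⟩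
      · have h3 := val_neg_of_val_ne_zero h1.1
        have h4 := ZMod.val_lt i
        have h5 := h1.2
        exact ⟨.inl (.inr ⟨-i, by omega, by omega⟩), neg_neg i⟩)

theorem prod_splitIndex {M : Type*} [CommMonoid M] (F : ZMod m → M) :
    ∏ i, F i = (∏ i : PosIndex m, F i.1 * F (-i.1)) * ∏ j : SelfIndex m, F j.1 := by
  rw [← Equiv.prod_comp (splitIndex m), Fintype.prod_sum_type, Fintype.prod_sum_type,
    Finset.prod_mul_distrib]
  rfl

/-- Restriction of a family to the three kinds of indices. -/
noncomputable def splitPi (β : ZMod m → Type) : (∀ i, β i) ≃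
    ((∀ i : PosIndex m, β i.1) × (∀ i : PosIndex m, β (-i.1))) × ∀ j : SelfIndex m, β j.1 :=
  (Equiv.piCongrLeft β (splitIndex m)).symm.trans ((Equiv.sumPiEquivProdPi _).trans
    (Equiv.prodCongr (Equiv.sumPiEquivProdPi _) (Equiv.refl _)))

theorem sum_splitPi {R : Type*} [CommSemiring R] (β : ZMod m → Type) [∀ i, Fintype (β i)]
    (H : ∀ i : PosIndex m, β i.1 → β (-i.1) → R) (K : ∀ j : SelfIndex m, β j.1 → R) :
    ∑ y : ∀ i, β i, (∏ i : PosIndex m, H i (y i.1) (y (-i.1))) * ∏ j : SelfIndex m, K j (y j.1) =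
      (∏ i, ∑ a, ∑ b, H i a b) * ∏ j, ∑ c, K j c := by
  refine (Fintype.sum_equiv (splitPi β) _ (fun z => (∏ i : PosIndex m, H i (z.1.1 i) (z.1.2 i)) *
    ∏ j : SelfIndex m, K j (z.2 j)) fun y => rfl).trans ?_
  rw [Fintype.sum_prod_type, Fintype.sum_prod_type,
    prod_sum_sum, Finset.prod_univ_sum, Fintype.piFinset_univ, Finset.sum_mul]
  refine Finset.sum_congr rfl fun a _ => ?_
  rw [Finset.sum_mul]
  refine Finset.sum_congr rfl fun b _ => ?_
  rw [Finset.mul_sum]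

variable {Y : ZMod m → Type}

omit [NeZero m] in
theorem ColouredMatching.exists_comp (s : ColouredMatching Y) {i j : ZMod m} (h : j = -i)
    (q : Y i) : ∃ q' : Y j, s.inv ⟨i, q⟩ = ⟨j, q'⟩ := by
  have h1 := s.fst_inv ⟨i, q⟩
  rcases hz : s.inv ⟨i, q⟩ with ⟨j', q'⟩
  rw [hz] at h1
  obtain rfl : j' = j := h1.trans h.symm
  exact ⟨q', rfl⟩

/-- The element matched with a given element. -/
noncomputable def ColouredMatching.comp (s : ColouredMatching Y) {i j : ZMod m} (h : j = -i)
    (q : Y i) : Y j := (s.exists_comp h q).choose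

omit [NeZero m] in
theorem ColouredMatching.inv_mk (s : ColouredMatching Y) {i j : ZMod m} (h : j = -i) (q : Y i) :
    s.inv ⟨i, q⟩ = ⟨j, s.comp h q⟩ := (s.exists_comp h q).choose_spec

omit [NeZero m] in
theorem ColouredMatching.comp_comp (s : ColouredMatching Y) {i j : ZMod m} (h : j = -i)
    (h' : i = -j) (q : Y i) : s.comp h' (s.comp h q) = q := by
  have h1 := s.inv_inv ⟨i, q⟩
  rw [s.inv_mk h, s.inv_mk h'] at h1
  exact eq_of_heq (Sigma.mk.inj h1).2

/-- The bijection between sets of opposite colours given by a matching. -/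
noncomputable def ColouredMatching.pair (s : ColouredMatching Y) (i : ZMod m) : Y i ≃ Y (-i) where
  toFun := s.comp rfl
  invFun := s.comp (neg_neg i).symm
  left_inv := s.comp_comp _ _
  right_inv := s.comp_comp _ _

/-- The matching of a set of self-opposite colour. -/
noncomputable def ColouredMatching.self (s : ColouredMatching Y) (j : ZMod m) (h : j = -j) :
    PerfectMatching (Y j) :=
  ⟨⟨s.comp h, s.comp h, s.comp_comp h h, s.comp_comp h h⟩, s.comp_comp h h, fun q hq =>
    s.inv_ne ⟨j, q⟩ ((s.inv_mk h q).trans (congrArg (Sigma.mk j) hq))⟩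

omit [NeZero m] in
theorem ColouredMatching.inv_pair (s : ColouredMatching Y) (i : ZMod m) (q : Y i) :
    s.inv ⟨i, q⟩ = ⟨-i, s.pair i q⟩ := s.inv_mk rfl q

omit [NeZero m] in
theorem ColouredMatching.inv_pair_symm (s : ColouredMatching Y) (i : ZMod m) (q : Y (-i)) :
    s.inv ⟨-i, q⟩ = ⟨i, (s.pair i).symm q⟩ := s.inv_mk (neg_neg i).symm q

omit [NeZero m] in
theorem ColouredMatching.inv_self (s : ColouredMatching Y) (j : ZMod m) (h : j = -j) (q : Y j) :
    s.inv ⟨j, q⟩ = ⟨j, (s.self j h).1 q⟩ := s.inv_mk h q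

theorem sigma_cases {C : (Σ i, Y i) → Prop} (h1 : ∀ (i : PosIndex m) (q : Y i.1), C ⟨i.1, q⟩)
    (h2 : ∀ (i : PosIndex m) (q : Y (-i.1)), C ⟨-i.1, q⟩)
    (h3 : ∀ (j : SelfIndex m) (q : Y j.1), C ⟨j.1, q⟩) (z : Σ i, Y i) : C z := by
  obtain ⟨i, q⟩ := z
  obtain ⟨(x | x) | x, rfl⟩ := (splitIndex m).surjective i
  exacts [h1 x q, h2 x q, h3 x q]

/-- The splitting of a family of sets indexed by `ℤ/m`. -/
noncomputable def splitSigma (Y : ZMod m → Type) : ((Σ i : PosIndex m, Y i.1) ⊕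
    Σ i : PosIndex m, Y (-i.1)) ⊕ (Σ j : SelfIndex m, Y j.1) ≃ Σ i, Y i :=
  ((Equiv.sumCongr (Equiv.sumSigmaDistrib fun x => Y (splitIndex m (.inl x))).symm
    (Equiv.refl _)).trans (Equiv.sumSigmaDistrib fun x => Y (splitIndex m x)).symm).trans
      (Equiv.sigmaCongrLeft (splitIndex m))

/-- A coloured matching amounts to a bijection for every pair of opposite colours and a perfect
matching for every self-opposite colour. -/
noncomputable def splitMatching (Y : ZMod m → Type) : ColouredMatching Y ≃
    (∀ i : PosIndex m, Y i.1 ≃ Y (-i.1)) × ∀ j : SelfIndex m, PerfectMatching (Y j.1) :=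
  Equiv.ofBijective (fun s => (fun i => s.pair i.1, fun j => s.self j.1 j.2)) (by
    constructor
    · intro s s' h
      have h1 : ∀ i : PosIndex m, s.pair i.1 = s'.pair i.1 := congrFun (Prod.ext_iff.1 h).1
      have h2 : ∀ j : SelfIndex m, s.self j.1 j.2 = s'.self j.1 j.2 := congrFun (Prod.ext_iff.1 h).2
      refine ColouredMatching.ext (funext (sigma_cases (fun i q => ?_) (fun i q => ?_)
        fun j q => ?_))
      · rw [s.inv_pair, s'.inv_pair, h1]
      · rw [s.inv_pair_symm, s'.inv_pair_symm, h1]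
      · rw [s.inv_self _ j.2, s'.inv_self _ j.2, h2]
    · rintro ⟨e, t⟩
      let E := splitSigma Y
      let base : ((Σ i : PosIndex m, Y i.1) ⊕ Σ i : PosIndex m, Y (-i.1)) ⊕
          (Σ j : SelfIndex m, Y j.1) → ((Σ i : PosIndex m, Y i.1) ⊕ Σ i : PosIndex m, Y (-i.1)) ⊕
          (Σ j : SelfIndex m, Y j.1) :=
        Sum.elim (Sum.elim (fun z => .inl (.inr ⟨z.1, e z.1 z.2⟩))
          fun z => .inl (.inl ⟨z.1, (e z.1).symm z.2⟩)) fun z => .inr ⟨z.1, (t z.1).1 z.2⟩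
      have hE : ∀ z, E.symm (E z) = z := E.symm_apply_apply
      let s : ColouredMatching Y :=
        { inv := fun z => E (base (E.symm z))
          inv_inv := fun z => by
            obtain ⟨z, rfl⟩ := E.surjective z
            rw [hE, hE]
            congr 1
            rcases z with (z | z) | z
            · simp [base]
            · simp [base]
            · exact congrArg (fun q => Sum.inr (Sigma.mk z.1 q)) ((t z.1).2.1 z.2)
          inv_ne := fun z h => by
            obtain ⟨z, rfl⟩ := E.surjective z
            rw [hE, E.injective.eq_iff] at h
            rcases z with (z | z) | z
            · exact Sum.inr_ne_inl (Sum.inl_injective h)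
            · exact Sum.inl_ne_inr (Sum.inl_injective h)
            · exact (t z.1).2.2 z.2 (eq_of_heq (Sigma.ext_iff.1 (Sum.inr_injective h)).2)
          fst_inv := fun z => by
            obtain ⟨z, rfl⟩ := E.surjective z
            rw [hE]
            rcases z with (z | z) | z
            · rfl
            · exact (neg_neg z.1.1).symm
            · exact z.1.2 }
      have h1 : ∀ (i : PosIndex m) (q : Y i.1), s.inv ⟨i.1, q⟩ = ⟨-i.1, e i q⟩ := fun i q => by
        change E (base (E.symm (E (.inl (.inl ⟨i, q⟩))))) = _
        rw [hE]
        rfl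
      have h2 : ∀ (j : SelfIndex m) (q : Y j.1), s.inv ⟨j.1, q⟩ = ⟨j.1, (t j).1 q⟩ := fun j q => by
        change E (base (E.symm (E (.inr ⟨j, q⟩)))) = _
        rw [hE]
        rfl
      refine ⟨s, Prod.ext (funext fun i => Equiv.ext fun q => ?_) (funext fun j =>
        Subtype.ext (Equiv.ext fun q => ?_))⟩
      · have h3 := s.inv_pair i.1 q
        rw [h1] at h3
        exact (eq_of_heq (Sigma.mk.inj h3).2).symm
      · have h3 := s.inv_self j.1 j.2 q
        rw [h2] at h3
        exact (eq_of_heq (Sigma.mk.inj h3).2).symm)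

theorem card_smul_eq [∀ i, Fintype (Y i)] [∀ i, DecidableEq (Y i)] (y : ∀ i, Equiv.Perm (Y i)) :
    Fintype.card {s : ColouredMatching Y // y • s = s} =
      (∏ i : PosIndex m, Fintype.card {e : Y i.1 ≃ Y (-i.1) // ∀ q, y (-i.1) (e q) = e (y i.1 q)}) *
        ∏ j : SelfIndex m, Fintype.card {t : PerfectMatching (Y j.1) // y j.1 • t = t} := by
  have hiff : ∀ s : ColouredMatching Y, y • s = s ↔
      (∀ i : PosIndex m, ∀ q, y (-i.1) (s.pair i.1 q) = s.pair i.1 (y i.1 q)) ∧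
        ∀ j : SelfIndex m, y j.1 • s.self j.1 j.2 = s.self j.1 j.2 := by
    intro s
    have h0 : y • s = s ↔ ∀ z, Equiv.Perm.sigmaCongrRight y (s.inv z) =
        s.inv (Equiv.Perm.sigmaCongrRight y z) := by
      rw [ColouredMatching.ext_iff, funext_iff]
      constructor
      · intro h z
        have h1 := h (Equiv.Perm.sigmaCongrRight y z)
        rwa [ColouredMatching.smul_inv, Equiv.symm_apply_apply] at h1
      · intro h z
        rw [ColouredMatching.smul_inv, h, Equiv.apply_symm_apply]
    rw [h0]
    constructor
    · refine fun h => ⟨fun i q => ?_, fun j => (PerfectMatching.smul_eq_iff _ _).2 fun q => ?_⟩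
      · have h1 := h ⟨i.1, q⟩
        rw [s.inv_pair] at h1
        change (⟨-i.1, y (-i.1) (s.pair i.1 q)⟩ : Σ i, Y i) = s.inv ⟨i.1, y i.1 q⟩ at h1
        rw [s.inv_pair] at h1
        exact eq_of_heq (Sigma.mk.inj h1).2
      · have h1 := h ⟨j.1, q⟩
        rw [s.inv_self _ j.2] at h1
        change (⟨j.1, y j.1 ((s.self j.1 j.2).1 q)⟩ : Σ i, Y i) = s.inv ⟨j.1, y j.1 q⟩ at h1
        rw [s.inv_self _ j.2] at h1
        exact eq_of_heq (Sigma.mk.inj h1).2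
    · rintro ⟨h1, h2⟩
      refine sigma_cases (fun i q => ?_) (fun i q => ?_) fun j q => ?_
      · rw [s.inv_pair]
        change (⟨-i.1, y (-i.1) (s.pair i.1 q)⟩ : Σ i, Y i) = s.inv ⟨i.1, y i.1 q⟩
        rw [s.inv_pair, h1]
      · rw [s.inv_pair_symm]
        change (⟨i.1, y i.1 ((s.pair i.1).symm q)⟩ : Σ i, Y i) = s.inv ⟨-i.1, y (-i.1) q⟩
        rw [s.inv_pair_symm]
        congr 1
        rw [Equiv.eq_symm_apply, ← h1, Equiv.apply_symm_apply]
      · rw [s.inv_self _ j.2]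
        change (⟨j.1, y j.1 ((s.self j.1 j.2).1 q)⟩ : Σ i, Y i) = s.inv ⟨j.1, y j.1 q⟩
        rw [s.inv_self _ j.2, (PerfectMatching.smul_eq_iff _ _).1 (h2 j)]
  rw [← Fintype.card_pi, ← Fintype.card_pi, ← Fintype.card_prod]
  have e1 : {s : ColouredMatching Y // y • s = s} ≃
      {w : (∀ i : PosIndex m, Y i.1 ≃ Y (-i.1)) × ∀ j : SelfIndex m, PerfectMatching (Y j.1) //
        (∀ i : PosIndex m, ∀ q, y (-i.1) (w.1 i q) = w.1 i (y i.1 q)) ∧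
          ∀ j : SelfIndex m, y j.1 • w.2 j = w.2 j} :=
    (splitMatching Y).subtypeEquiv hiff
  exact Fintype.card_congr (e1.trans
    { toFun := fun w => (fun i => ⟨w.1.1 i, w.2.1 i⟩, fun j => ⟨w.1.2 j, w.2.2 j⟩)
      invFun := fun w => ⟨(fun i => (w.1 i).1, fun j => (w.2 j).1), fun i => (w.1 i).2,
        fun j => (w.2 j).2⟩
      left_inv := fun _ => rfl
      right_inv := fun _ => rfl })

end Split

section PairSum

/-- A bijection fixed by a pair of permutations identifies the two sets and the two permutations, so
that the sum over all pairs becomes an inner product. -/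
theorem sum_card_equiv_mul {lam nu lam' nu' : YoungDiagram} {X X' : Type} [Fintype X]
    [DecidableEq X] [Fintype X'] [DecidableEq X'] (h : Fintype.card X' = Fintype.card X) :
    ∑ a : Equiv.Perm X, ∑ b : Equiv.Perm X',
      (Fintype.card {e : X ≃ X' // ∀ q, b (e q) = e (a q)} : ℚ) *
        (skewChar lam nu X a * skewChar lam' nu' X' b) =
      (Fintype.card X).factorial * (Fintype.card X').factorial *
        charInner (skewChar lam nu X) (skewChar lam' nu' X) := by
  obtain ⟨e₀⟩ := Fintype.card_eq.1 h.symm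
  have h1 : ∀ (a : Equiv.Perm X) (b : Equiv.Perm X') (e : X ≃ X'),
      (∀ q, b (e q) = e (a q)) ↔ e.permCongr a = b := by
    intro a b e
    rw [eq_comm, Equiv.ext_iff]
    constructor
    · intro h c
      have := h (e.symm c)
      rwa [Equiv.apply_symm_apply] at this
    · intro h q
      rw [h, Equiv.permCongr_apply, Equiv.symm_apply_apply]
  have h2 : ∀ a b, (Fintype.card {e : X ≃ X' // ∀ q, b (e q) = e (a q)} : ℚ) =
      ∑ e : X ≃ X', if e.permCongr a = b then 1 else 0 := fun a b => by
    rw [Fintype.card_subtype, Finset.sum_boole]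
    simp only [h1]
  have h3 : ∀ a : Equiv.Perm X, ∑ b : Equiv.Perm X',
      (Fintype.card {e : X ≃ X' // ∀ q, b (e q) = e (a q)} : ℚ) *
        (skewChar lam nu X a * skewChar lam' nu' X' b) =
      (Fintype.card X).factorial * (skewChar lam nu X a * skewChar lam' nu' X a) := fun a => by
    simp only [h2, Finset.sum_mul]
    rw [Finset.sum_comm, Finset.sum_congr rfl (g := fun _ => skewChar lam nu X a *
      skewChar lam' nu' X a), Finset.sum_const, Finset.card_univ, Fintype.card_equiv e₀,
      nsmul_eq_mul]
    intro e _
    rw [Finset.sum_eq_single (e.permCongr a)]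
    · rw [if_pos rfl, one_mul, skewChar_permCongr]
    · intro b _ hb
      rw [if_neg (Ne.symm hb), zero_mul]
    · simp
  rw [Finset.sum_congr rfl fun a _ => h3 a, ← Finset.mul_sum, charInner, h, mul_assoc,
    mul_div_cancel₀]
  exact_mod_cast Nat.factorial_ne_zero _

theorem sum_matchChar_mul {lam nu : YoungDiagram} {X : Type} [Fintype X] [DecidableEq X] :
    ∑ c : Equiv.Perm X, (Fintype.card {t : PerfectMatching X // c • t = t} : ℚ) *
      skewChar lam nu X c =
      (Fintype.card X).factorial * charInner (skewChar lam nu X) matchChar := by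
  rw [charInner, mul_div_cancel₀]
  · exact Finset.sum_congr rfl fun c _ => mul_comm _ _
  · exact_mod_cast Nat.factorial_ne_zero _

theorem PerfectMatching.even_card {X : Type} [Fintype X] (s : PerfectMatching X) :
    2 ∣ Fintype.card X := by
  classical
  have h1 := Equiv.Perm.two_dvd_card_support (σ := s.1) (Equiv.ext fun x => by
    rw [pow_two]; exact s.2.1 x)
  rwa [show s.1.support = Finset.univ from Finset.eq_univ_iff_forall.2 fun x =>
    Equiv.Perm.mem_support.2 (s.2.2 x), Finset.card_univ] at h1

end PairSum

/-! ### The multiplicity formula -/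

section Formula

variable {m : ℕ} [NeZero m] {k : Type*} [Field k] {n f : ℕ} (mu : MPartition m n)
  (lam : MPartition m f)

/-- A set with as many elements as there are ends of arcs in a given component. -/
abbrev ArcEnds (i : ZMod m) : Type := Fin ((mu.part i).card - (lam.part i).card)

variable {mu lam}

/-- If there is a coloured matching of the ends of arcs, then the sizes of the components are
comparable. -/
theorem prec_of_colouredMatching (hle : ∀ i, lam.part i ≤ mu.part i)
    (s : ColouredMatching (ArcEnds mu lam)) : Prec lam.size mu.size := by
  have hsize : ∀ i, lam.size i ≤ mu.size i := fun i => Finset.card_le_card (hle i)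
  have hcard : ∀ i, Fintype.card (ArcEnds mu lam i) = mu.size i - lam.size i := fun i =>
    Fintype.card_fin _
  refine ⟨hsize, fun r _ => ?_, fun r hr => ?_⟩
  · have h1 := Fintype.card_congr (s.pair r)
    rw [hcard, hcard] at h1
    have := hsize r
    have := hsize (-r)
    omega
  · have h1 := (s.self r hr).even_card
    rw [hcard] at h1
    have := hsize r
    omega

/-- If there is an `i` with `λ^i` not contained in `μ^i`, a skew character vanishes; otherwise there is no
matching of opposite ends of arcs. -/
theorem rank_eq_zero (hmu : (∏ i, (hookProd (mu.part i) : k)) ≠ 0)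
    (hlam : (∏ i, (hookProd (lam.part i) : k)) ≠ 0) (h : ¬ lam.Le mu) :
    (permMat k (YoungMatching mu lam) (prodElt (mu.symElt k) (invElt (lam.symElt k)))).rank = 0 := by
  have key := rank_mul_card (Y := ArcEnds mu lam) (fun i => Fintype.card_fin _) hmu hlam
  rw [Finset.sum_eq_zero] at key
  · rcases mul_eq_zero.1 key with h1 | h1
    · exact_mod_cast h1
    · exact absurd h1 (by exact_mod_cast Fintype.card_ne_zero)
  intro y _
  by_cases hle : ∀ i, lam.part i ≤ mu.part i
  · have : IsEmpty {s : ColouredMatching (ArcEnds mu lam) // y • s = s} :=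
      ⟨fun s => h ⟨hle, prec_of_colouredMatching hle s.1⟩⟩
    rw [Fintype.card_eq_zero, Nat.cast_zero, zero_mul]
  · push Not at hle
    obtain ⟨i, hi⟩ := hle
    rw [Finset.prod_eq_zero (Finset.mem_univ i) (skewChar_eq_zero_of_not_le hi _), mul_zero]

/-- The average over the permutations of the ends of arcs splits into one factor for every pair of
opposite components and one for every self-opposite component. -/
theorem rank_eq_prod {Y : ZMod m → Type} [∀ i, Fintype (Y i)] [∀ i, DecidableEq (Y i)]
    (hY : ∀ i, Fintype.card (Y i) = (mu.part i).card - (lam.part i).card)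
    (hmu : (∏ i, (hookProd (mu.part i) : k)) ≠ 0)
    (hlam : (∏ i, (hookProd (lam.part i) : k)) ≠ 0)
    (hneg : ∀ i, Fintype.card (Y (-i)) = Fintype.card (Y i)) :
    (permMat k (YoungMatching mu lam) (prodElt (mu.symElt k) (invElt (lam.symElt k)))).rank =
      (∏ i : PosIndex m, ∑ τ ∈ partitionsOf (Fintype.card (Y i.1)),
        lrCoeff (lam.part i.1) τ (mu.part i.1) * lrCoeff (lam.part (-i.1)) τ (mu.part (-i.1))) *
      ∏ j : SelfIndex m, ∑ η ∈ evenPartitionsOf (Fintype.card (Y j.1)),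
        lrCoeff (lam.part j.1) η (mu.part j.1) := by
  have key := rank_mul_card hY hmu hlam
  have h1 : ∀ y : ∀ i, Equiv.Perm (Y i),
      (Fintype.card {s : ColouredMatching Y // y • s = s} : ℚ) *
        ∏ i, skewChar (lam.part i) (mu.part i) (Y i) (y i) =
      (∏ i : PosIndex m,
        (Fintype.card {e : Y i.1 ≃ Y (-i.1) // ∀ q, y (-i.1) (e q) = e (y i.1 q)} : ℚ) *
          (skewChar (lam.part i.1) (mu.part i.1) (Y i.1) (y i.1) *
            skewChar (lam.part (-i.1)) (mu.part (-i.1)) (Y (-i.1)) (y (-i.1)))) *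
      ∏ j : SelfIndex m, (Fintype.card {t : PerfectMatching (Y j.1) // y j.1 • t = t} : ℚ) *
        skewChar (lam.part j.1) (mu.part j.1) (Y j.1) (y j.1) := fun y => by
    rw [card_smul_eq, prod_splitIndex, Nat.cast_mul, Nat.cast_prod, Nat.cast_prod]
    simp only [Finset.prod_mul_distrib]
    ring
  have h2 : (Fintype.card (∀ i, Equiv.Perm (Y i)) : ℚ) =
      (∏ i : PosIndex m, ((Fintype.card (Y i.1)).factorial : ℚ) *
        (Fintype.card (Y (-i.1))).factorial) *
      ∏ j : SelfIndex m, ((Fintype.card (Y j.1)).factorial : ℚ) := by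
    rw [Fintype.card_pi, Nat.cast_prod, prod_splitIndex]
    simp only [Fintype.card_perm]
  have hP : (Fintype.card (∀ i, Equiv.Perm (Y i)) : ℚ) ≠ 0 := by
    exact_mod_cast Fintype.card_ne_zero
  rw [Finset.sum_congr rfl fun y _ => h1 y,
    sum_splitPi (fun i => Equiv.Perm (Y i)) (fun i a b =>
      (Fintype.card {e : Y i.1 ≃ Y (-i.1) // ∀ q, b (e q) = e (a q)} : ℚ) *
          (skewChar (lam.part i.1) (mu.part i.1) (Y i.1) a *
            skewChar (lam.part (-i.1)) (mu.part (-i.1)) (Y (-i.1)) b))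
      (fun j c => (Fintype.card {t : PerfectMatching (Y j.1) // c • t = t} : ℚ) *
        skewChar (lam.part j.1) (mu.part j.1) (Y j.1) c)] at key
  simp only [sum_card_equiv_mul (hneg _), sum_matchChar_mul, charInner_skewChar_skewChar,
    charInner_skewChar_matchChar] at key
  have h3 : ((permMat k (YoungMatching mu lam)
      (prodElt (mu.symElt k) (invElt (lam.symElt k)))).rank : ℚ) =
      (∏ i : PosIndex m, ((∑ τ ∈ partitionsOf (Fintype.card (Y i.1)),
        lrCoeff (lam.part i.1) τ (mu.part i.1) *
          lrCoeff (lam.part (-i.1)) τ (mu.part (-i.1)) : ℕ) : ℚ)) *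
      ∏ j : SelfIndex m, ((∑ η ∈ evenPartitionsOf (Fintype.card (Y j.1)),
        lrCoeff (lam.part j.1) η (mu.part j.1) : ℕ) : ℚ) := by
    apply mul_right_cancel₀ hP
    rw [key, h2]
    simp only [Finset.prod_mul_distrib]
    ring
  rw [← Nat.cast_prod, ← Nat.cast_prod, ← Nat.cast_mul] at h3
  exact_mod_cast h3

end Formula

end CyclotomicBrauer


theorem mainTheorem3 {k : Type*} [Field k] [IsAlgClosed k] (p : ℕ) [CharP k p]
    (m n f l : ℕ) [NeZero m] (hm : (m : k) ≠ 0) (hp : p = 0 ∨ n < p)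
    (ξ : k) (hξ : IsPrimitiveRoot ξ m) (δ : ZMod m → k) (hn : n = f + 2 * l)
    (lam : MPartition m f) (mu : MPartition m n) :
    (¬ lam.Le mu → repMult (standardRestriction hξ n δ lam) (wreathSpecht hξ mu) = 0) ∧
    (lam.Le mu → ∃ a : ZMod m → ℕ, PrecSum a lam.size mu.size ∧
      repMult (standardRestriction hξ n δ lam) (wreathSpecht hξ mu) =
        (∏ i : ZMod m with 0 < i.val ∧ 2 * i.val < m,
          ∑ τ ∈ partitionsOf (a i),
            lrCoeff (lam.part i) τ (mu.part i) * lrCoeff (lam.part (-i)) τ (mu.part (-i))) *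
        ∏ j : ZMod m with j = -j,
          ∑ η ∈ evenPartitionsOf (2 * a j), lrCoeff (lam.part j) η (mu.part j)) := by
  have hfac : ∀ d, d ≤ n → ((d.factorial : ℕ) : k) ≠ 0 := by
    intro d hd h0
    rw [CharP.cast_eq_zero_iff k p] at h0
    rcases hp with rfl | hp
    · exact Nat.factorial_ne_zero d (zero_dvd_iff.1 h0)
    · rcases CharP.char_is_prime_or_zero k p with hprime | rfl
      · exact absurd ((hprime.dvd_factorial).1 h0) (by omega)
      · omega
  have hmu := mu.prod_hookProd_ne_zero (k := k) (hfac n le_rfl)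
  have hlam := lam.prod_hookProd_ne_zero (k := k) (hfac f (by omega))
  rw [repMult_eq_rank hξ hm δ (hfac n le_rfl) (hfac f (by omega)), rank_throughMatching hξ mu lam hm]
  refine ⟨rank_eq_zero hmu hlam, fun hle => ?_⟩
  obtain ⟨hsize, hpair, hself⟩ := hle.2
  have hcard : ∀ i, Fintype.card (ArcEnds mu lam i) = mu.size i - lam.size i := fun i =>
    Fintype.card_fin _
  have hneg : ∀ i, Fintype.card (ArcEnds mu lam (-i)) = Fintype.card (ArcEnds mu lam i) := by
    intro i
    rw [hcard, hcard]
    by_cases hi : i = -i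
    · rw [← hi]
    · have := hpair i hi
      have := hsize i
      have := hsize (-i)
      omega
  classical
  let a : ZMod m → ℕ := fun i =>
    if i = -i then (mu.size i - lam.size i) / 2 else mu.size i - lam.size i
  have ha : ∀ i, i ≠ -i → a i = mu.size i - lam.size i := fun i hi => if_neg hi
  have ha' : ∀ i, i = -i → 2 * a i = mu.size i - lam.size i := fun i hi => by
    have h1 : a i = (mu.size i - lam.size i) / 2 := if_pos hi
    have := hself i hi
    have := hsize i
    omega
  refine ⟨a, ⟨hle.2, fun i hi => ?_, fun i hi => ?_⟩, ?_⟩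
  · have := ha i hi
    have := hsize i
    omega
  · have := ha' i hi
    have := hsize i
    omega
  rw [rank_eq_prod (fun i => Fintype.card_fin _) hmu hlam hneg,
    Finset.prod_subtype (p := fun i : ZMod m => 0 < i.val ∧ 2 * i.val < m) _
      (fun i => by rw [Finset.mem_filter, and_iff_right (Finset.mem_univ i)]),
    Finset.prod_subtype (p := fun j : ZMod m => j = -j) _
      (fun i => by rw [Finset.mem_filter, and_iff_right (Finset.mem_univ i)])]
  congr 1
  · refine Finset.prod_congr rfl fun i _ => ?_
    rw [hcard, ha i.1 fun h => ?_]
    have h1 := (eq_neg_iff_val i.1).1 h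
    have h2 := i.2
    omega
  · refine Finset.prod_congr rfl fun j _ => ?_
    rw [hcard, ha' j.1 j.2]
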